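/- **Setting.** Fix $K\ge 1$. A base station with $N$ antennas split into clusters of sizes $N_1,\dots,N_K$ ($N=\sum_k N_k$) receives $y=\Sigma x+n$, where $x=(x_0,\dots,x_M)\sim\mathcal{CN}(0,I_{M+1})$, $n\sim\mathcal{CN}(0,\sigma^2I_N)$ with $\sigma^2>0$, and $\Sigma=[h_0,\dots,h_M]$, $h_j=R_j^{1/2}z_j$, $z_j\sim\mathcal{CN}(0,I_N)$, with deterministic $R_j\succeq 0$. For an $N\times N$ matrix, $[\cdot]_{[k,l]}$ is the block with rows in cluster $k$ and columns in cluster $l$, and for a vector $h_j$ the part in cluster $k$ is $h_{jk}$. Cluster $k$ observes $\widetilde y_{jk}=h_{jk}+\widetilde n_{jk}$, $\widetilde n_{jk}\sim\mathcal{CN}(0,\widetilde\sigma^2I_{N_k})$ with $\widetilde\sigma^2\ge0$, and forms $\widehat h_{jk}=[R_j]_{[k,k]}([R_j]_{[k,k]}+\widetilde\sigma^2I)^{-1}\widetilde y_{jk}$; all $z_j$, $\widetilde n_{jk}$, $x$, $n$ are independent. Let $D_{R,j}$ be the block-diagonal part of $R_j$ and $$T_j=R_j(\widetilde\sigma^2I+R_j)^{-1},\quad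 D_{T,j}=D_{R,j}(\widetilde\sigma^2I+D_{R,j})^{-1},\quad \Phi_j=D_{T,j}(\widetilde\sigma^2I+R_j)D_{T,j},\quad V_j=T_jD_{T,j}^{-1},$$ $$W=\widetilde\sigma^2\sum_{j=0}^MT_j,\qquad D_W=\widetilde\sigma^2\sum_{j=0}^MD_{T,j},\qquad \widetilde h_j=V_j\widehat h_j,$$ $\widehat\Sigma=[\widehat h_0,\dots,\widehat h_M]$, $\widetilde\Sigma=[\widetilde h_0,\dots,\widetilde h_M]$, and let $\widehat\Sigma_k$ be the rows of $\widehat\Sigma$ in cluster $k$. With design parameters $\rho_k>0$ and $Z_k\succeq0$ the local receivers are $$r_k=(\widehat\Sigma_k\widehat\Sigma_k^H+N_kZ_k+N_k\rho_kI)^{-1}\widehat h_{0k},\qquad D_r=\mathrm{diag}(r_1,\dots,r_K)\in\mathbb C^{N\times K}.$$ For a row vector $\alpha=[\alpha_1,\dots,\alpha_K]$ of fusion coefficients, possibly depending on $\widehat\Sigma$, let $r_\alpha=D_r\alpha^H$; the SINR of user $0$ is $$\gamma(\alpha)=\frac{|\mathbb E[r_\alpha^Hh_0\mid\widehat\Sigma]|^2}{\mathbb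 E\big[|r_\alpha^H(\Sigma x-\widetilde h_0x_0+n)|^2\mid\widehat\Sigma\big]}.$$ Let $\gamma^{\mathrm{lfoc}}$ be $\gamma(\alpha)$ for $\alpha=c\,\widetilde h_0^HD_r\big(D_r^H(\widetilde\Sigma\widetilde\Sigma^H+W+\sigma^2I)D_r\big)^{-1}$ with a deterministic $c\in\mathbb C\setminus\{0\}$, let $\gamma^{\mathrm{lfsc}}$ be $\gamma(\alpha)$ for $\alpha=\widehat h_0^HD_r\big(D_r^H(\widehat\Sigma\widehat\Sigma^H+D_W+\sigma^2I)D_r\big)^{-1}$, and let $\gamma^{\mathrm{lfcc}}$ be $\gamma(\alpha)$ for a deterministic $\alpha\ne0$. **Asymptotic regime.** All quantities except $K$ may depend on an index $n\to\infty$ along which $N$ is strictly increasing (and $\widetilde\sigma^2$ is bounded). No relation between the random variables for different $n$ is assumed, except that they live on one probability space. Assume: * (A.1) $0<\liminf N_k/M\le\limsup N_k/M<\infty$ for each $k$; * (A.2) $\limsup\sup_j\lambda_{\max}(R_j)<\infty$ and $\liminf\inf_j\lambda_{\min}(R_j)>0$, over $0\le j\le M$; * (A.3) $\rho_k>0$,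 $Z_k$ Hermitian nonnegative, $\limsup\max_k\|Z_k\|<\infty$, $\limsup\max_k\rho_k<\infty$ and $\liminf\min_k\big(\rho_k+\lambda_{\min}(Z_k)\big)>0$ (the last two conditions hold automatically when the $\rho_k>0$ do not depend on $n$). **Deterministic quantities.** For $1\le j\le M$ put $A_j=\Phi_j^{1/2}$, $B_j=V_j\Phi_j^{1/2}$, $\Omega_j=A_jA_j^H$, and let $A_{jk},B_{jk}$ be the rows of $A_j,B_j$ in cluster $k$. Let $\delta_{jk}>0$ solve $$\delta_{jk}=\frac1{N_k}\mathrm{Tr}\,[\Omega_j]_{[k,k]}\Theta_k,\qquad \Theta_k=\Big(\rho_kI+Z_k+\frac1{N_k}\sum_{j=1}^M\frac{[\Omega_j]_{[k,k]}}{1+\delta_{jk}}\Big)^{-1}.$$ For $P,O\in\{A,B\}$ define $F_k=\mathrm{diag}_j\big((1+\delta_{jk})^{-1}\big)$, $\Xi_{kl}=(I_M-\Gamma_{kl}F_kF_l)^{-1}$ with $[\Gamma_{kl}]_{ij}=\frac{1}{N_kN_l}\mathrm{Tr}[\Omega_i]_{[l,k]}\Theta_k[\Omega_j]_{[k,l]}\Theta_l$,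 $[\Lambda_{P,O,kl}]_{ij}=\frac1{N_kN_l}\mathrm{Tr}[\Omega_i]_{[l,k]}\Theta_kP_{jk}O_{jl}^H\Theta_l$, $D_{P,O,k}=\frac1{N_k}\mathrm{diag}_j(\mathrm{Tr}\,P_{jk}O_{jk}^H\Theta_k)$; the row vectors $\mu_{P,O,kl}(\mathcal A)$ with entries $\frac{1}{\sqrt{N_kN_l}}\mathrm{Tr}\,\mathcal A\Theta_kP_{jk}O_{jl}^H\Theta_l$ and $\mu_{kl}=\mu_{A,A,kl}$; and the column vector $\lambda_{kl}(\mathcal B)$ with entries $\frac1{\sqrt{N_kN_l}}\mathrm{Tr}[\Omega_j]_{[l,k]}\Theta_k\mathcal B\Theta_l$. Let $$\Upsilon_{kl}(\mathcal A,\mathcal B)=\mathrm{Tr}\,\mathcal A\Theta_k\mathcal B\Theta_l+\mu_{kl}(\mathcal A)F_kF_l\Xi_{kl}\lambda_{kl}(\mathcal B),$$ $$\begin{aligned}\Pi_{B,kl}(\mathcal A)&=\big[\mu_{B,B,kl}(\mathcal A)-\mu_{B,A,kl}(\mathcal A)D_{A,B,l}F_l-\mu_{A,B,kl}(\mathcal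 A)D_{B,A,k}F_k\big]\mathbf 1_M\\&\quad+\mu_{kl}(\mathcal A)F_kF_l\Xi_{kl}\big[\Lambda_{B,B,kl}-\Lambda_{B,A,kl}D_{A,B,l}F_l-\Lambda_{A,B,kl}D_{B,A,k}F_k+D_{B,A,k}D_{A,B,l}\big]\mathbf 1_M,\end{aligned}$$ and let $\Pi_{kl}$ be the same expression with every $B_j$ replaced by $A_j$. Finally $[v]_k=\frac1{N_k}\mathrm{Tr}[\Phi_0]_{[k,k]}\Theta_k$, $J=(I_K+\mathrm{diag}(v))^{-1}$, $$[\Delta]_{kl}=\frac{\Upsilon_{kl}([\Phi_0]_{[l,k]},[W+\sigma^2I]_{[k,l]})}{N_kN_l}+\frac{\Pi_{B,kl}([\Phi_0]_{[l,k]})}{\sqrt{N_kN_l}},\qquad [\Delta_I]_{kl}=\frac{\Upsilon_{kl}([\Phi_0]_{[l,k]},[D_W+\sigma^2I]_{[k,l]})}{N_kN_l}+\frac{\Pi_{kl}([\Phi_0]_{[l,k]})}{\sqrt{N_kN_l}}.$$ **Theorem.** For all large $n$ the system for $(\delta_{jk})$ has exactly one positive solution, and with it, almost surely as $n\to\infty$,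 $$\gamma^{\mathrm{lfoc}}-v^H\Delta^{-1}v\to0,\qquad \gamma^{\mathrm{lfsc}}-\frac{(v^H\Delta_I^{-1}v)^2}{v^H\Delta_I^{-1}\Delta\Delta_I^{-1}v}\to0,\qquad \gamma^{\mathrm{lfcc}}-\frac{|\alpha Jv|^2}{\alpha J\Delta J\alpha^H}\to0.$$ -/

import Mathlib

open MeasureTheory ProbabilityTheory Filter Topology Matrix
open scoped ComplexOrder

noncomputable section

namespace DBP

/-! ### Block structure: `K` clusters, cluster `k` has `d k` antennas -/

/-- The antennas of the base station: antenna `i` of cluster `k` is the pair `⟨k, i⟩`. -/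
abbrev Ant {K : ℕ} (d : Fin K → ℕ) : Type := Σ k : Fin K, Fin (d k)

/-- The block `[A]_{[k,l]}` of an `N × N` matrix: rows of cluster `k`, columns of cluster `l`. -/
def blk {K : ℕ} {d : Fin K → ℕ} (A : Matrix (Ant d) (Ant d) ℂ) (k l : Fin K) :
    Matrix (Fin (d k)) (Fin (d l)) ℂ :=
  A.submatrix (fun i => ⟨k, i⟩) (fun i => ⟨l, i⟩)

/-- The rows of cluster `k`, all columns: `A[ς_k, :]`. -/
def rowsOf {K : ℕ} {d : Fin K → ℕ} (A : Matrix (Ant d) (Ant d) ℂ) (k : Fin K) :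
    Matrix (Fin (d k)) (Ant d) ℂ :=
  A.submatrix (fun i => ⟨k, i⟩) id

/-- The spectral norm of a square complex matrix. -/
def specNorm {n : Type} [Fintype n] [DecidableEq n] (A : Matrix n n ℂ) : ℝ :=
  ‖Matrix.toEuclideanCLM (n := n) (𝕜 := ℂ) A‖

/-- The nonnegative definite square root of a (nonnegative definite) matrix. -/
def psdSqrt {n : Type} [Fintype n] [DecidableEq n] (A : Matrix n n ℂ) : Matrix n n ℂ :=
  open scoped MatrixOrder Matrix.Norms.L2Operator in CFC.sqrt A

/-! ### Deterministic equivalents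

`N_k = d k`, there are `M` columns, `Sm k` is the Hermitian nonnegative matrix `S_k`, `z k` the
spectral parameter `z_k`, `A j` and `B j` the correlation matrices, and `δ j k` the solution of the
fundamental system. -/

section DetEq

variable {K : ℕ} {d : Fin K → ℕ} {M : ℕ}

/-- `Ω_j = A_j A_jᴴ`. -/
def Om (A : Fin M → Matrix (Ant d) (Ant d) ℂ) (j : Fin M) : Matrix (Ant d) (Ant d) ℂ :=
  A j * (A j)ᴴ

/-- `Θ_k = (-z_k I + S_k + N_k⁻¹ ∑_j [Ω_j]_{[k,k]} / (1 + δ_{jk}))⁻¹`. -/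
def Theta (Sm : (k : Fin K) → Matrix (Fin (d k)) (Fin (d k)) ℂ) (z : Fin K → ℝ)
    (A : Fin M → Matrix (Ant d) (Ant d) ℂ) (δ : Fin M → Fin K → ℝ) (k : Fin K) :
    Matrix (Fin (d k)) (Fin (d k)) ℂ :=
  ((-(z k : ℂ)) • (1 : Matrix (Fin (d k)) (Fin (d k)) ℂ) + Sm k
    + ((d k : ℂ))⁻¹ • ∑ j, (1 + (δ j k : ℂ))⁻¹ • blk (Om A j) k k)⁻¹

/-- `δ` is a positive solution of the system `δ_{jk} = N_k⁻¹ Tr([Ω_j]_{[k,k]} Θ_k)`. -/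
def IsPositiveSolution (Sm : (k : Fin K) → Matrix (Fin (d k)) (Fin (d k)) ℂ) (z : Fin K → ℝ)
    (A : Fin M → Matrix (Ant d) (Ant d) ℂ) (δ : Fin M → Fin K → ℝ) : Prop :=
  ∀ j k, 0 < δ j k ∧
    (δ j k : ℂ) = ((d k : ℂ))⁻¹ * (blk (Om A j) k k * Theta Sm z A δ k).trace

/-- `F̃_k = diag((1 + δ_{jk})⁻¹)`. -/
def Ft (δ : Fin M → Fin K → ℝ) (k : Fin K) : Matrix (Fin M) (Fin M) ℂ :=
  Matrix.diagonal fun j => (1 + (δ j k : ℂ))⁻¹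

/-- `1 / √(N_k N_l)`. -/
def isq (d : Fin K → ℕ) (k l : Fin K) : ℂ :=
  ((Real.sqrt ((d k : ℝ) * (d l : ℝ)) : ℝ) : ℂ)⁻¹

variable (Θ : (k : Fin K) → Matrix (Fin (d k)) (Fin (d k)) ℂ)

/-- `[Γ_{kl}]_{ij} = (N_k N_l)⁻¹ Tr([Ω_i]_{[l,k]} Θ_k [Ω_j]_{[k,l]} Θ_l)`. -/
def Gam (A : Fin M → Matrix (Ant d) (Ant d) ℂ) (k l : Fin K) : Matrix (Fin M) (Fin M) ℂ :=
  Matrix.of fun i j => ((d k : ℂ) * (d l : ℂ))⁻¹ *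
    (blk (Om A i) l k * Θ k * blk (Om A j) k l * Θ l).trace

/-- `Ξ_{kl} = (I - Γ_{kl} F̃_k F̃_l)⁻¹`. -/
def Xi (A : Fin M → Matrix (Ant d) (Ant d) ℂ) (δ : Fin M → Fin K → ℝ) (k l : Fin K) :
    Matrix (Fin M) (Fin M) ℂ :=
  (1 - Gam Θ A k l * Ft δ k * Ft δ l)⁻¹

/-- The row vector `λ̃_{P,O,kl}(𝒜)`, entries `Tr(𝒜 Θ_k P_{jk} O_{jl}ᴴ Θ_l) / √(N_k N_l)`. -/
def lamRow₂ (P O : Fin M → Matrix (Ant d) (Ant d) ℂ) (k l : Fin K)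
    (a : Matrix (Fin (d l)) (Fin (d k)) ℂ) : Fin M → ℂ :=
  fun j => isq d k l * (a * Θ k * (rowsOf (P j) k * (rowsOf (O j) l)ᴴ) * Θ l).trace

/-- The row vector `λ̃_{kl}(𝒜)`, entries `Tr(𝒜 Θ_k [Ω_j]_{[k,l]} Θ_l) / √(N_k N_l)`. -/
def lamRow (A : Fin M → Matrix (Ant d) (Ant d) ℂ) (k l : Fin K)
    (a : Matrix (Fin (d l)) (Fin (d k)) ℂ) : Fin M → ℂ :=
  fun j => isq d k l * (a * Θ k * blk (Om A j) k l * Θ l).trace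

/-- The column vector `λ_{kl}(ℬ)`, entries `Tr([Ω_j]_{[l,k]} Θ_k ℬ Θ_l) / √(N_k N_l)`. -/
def lamCol (A : Fin M → Matrix (Ant d) (Ant d) ℂ) (k l : Fin K)
    (b : Matrix (Fin (d k)) (Fin (d l)) ℂ) : Fin M → ℂ :=
  fun j => isq d k l * (blk (Om A j) l k * Θ k * b * Θ l).trace

/-- `[Λ_{P,O,kl}]_{ij} = (N_k N_l)⁻¹ Tr([Ω_i]_{[l,k]} Θ_k P_{jk} O_{jl}ᴴ Θ_l)`. -/
def Lam (A P O : Fin M → Matrix (Ant d) (Ant d) ℂ) (k l : Fin K) : Matrix (Fin M) (Fin M) ℂ :=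
  Matrix.of fun i j => ((d k : ℂ) * (d l : ℂ))⁻¹ *
    (blk (Om A i) l k * Θ k * (rowsOf (P j) k * (rowsOf (O j) l)ᴴ) * Θ l).trace

/-- `D_{P,O,k} = N_k⁻¹ diag(Tr(P_{jk} O_{jk}ᴴ Θ_k))`. -/
def DPO (P O : Fin M → Matrix (Ant d) (Ant d) ℂ) (k : Fin K) : Matrix (Fin M) (Fin M) ℂ :=
  Matrix.diagonal fun j => ((d k : ℂ))⁻¹ * (rowsOf (P j) k * (rowsOf (O j) k)ᴴ * Θ k).trace

/-- `ϝ̄_k(𝒜) = Tr(𝒜 Θ_k)`. -/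
def digBar (k : Fin K) (a : Matrix (Fin (d k)) (Fin (d k)) ℂ) : ℂ := (a * Θ k).trace

/-- `Ῡ_{kl}(𝒜, ℬ) = Tr(𝒜 Θ_k ℬ Θ_l) + λ̃_{kl}(𝒜) F̃_k F̃_l Ξ_{kl} λ_{kl}(ℬ)`. -/
def upsBar (A : Fin M → Matrix (Ant d) (Ant d) ℂ) (δ : Fin M → Fin K → ℝ) (k l : Fin K)
    (a : Matrix (Fin (d l)) (Fin (d k)) ℂ) (b : Matrix (Fin (d k)) (Fin (d l)) ℂ) : ℂ :=
  (a * Θ k * b * Θ l).trace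
    + lamRow Θ A k l a ⬝ᵥ ((Ft δ k * Ft δ l * Xi Θ A δ k l) *ᵥ lamCol Θ A k l b)

/-- `Π̄_{B,kl}(𝒜)`; taking `B = A` gives `Π̄_{kl}(𝒜)`. -/
def piBar (A B : Fin M → Matrix (Ant d) (Ant d) ℂ) (δ : Fin M → Fin K → ℝ) (k l : Fin K)
    (a : Matrix (Fin (d l)) (Fin (d k)) ℂ) : ℂ :=
  (lamRow₂ Θ B B k l a
      - lamRow₂ Θ B A k l a ᵥ* (DPO Θ A B l * Ft δ l)
      - lamRow₂ Θ A B k l a ᵥ* (DPO Θ B A k * Ft δ k)) ⬝ᵥ (fun _ => 1)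
    + lamRow Θ A k l a ⬝ᵥ ((Ft δ k * Ft δ l * Xi Θ A δ k l *
        (Lam Θ A B B k l
          - Lam Θ A B A k l * DPO Θ A B l * Ft δ l
          - Lam Θ A A B k l * DPO Θ B A k * Ft δ k
          + DPO Θ B A k * DPO Θ A B l)) *ᵥ (fun _ => 1))

end DetEq

/-! ### The decentralized uplink system -/

/-- The deterministic parameters of an uplink with `K` clusters and `M + 1` users. -/
structure System (K : ℕ) where
  /-- number of antennas `N_k` of cluster `k` -/
  d : Fin K → ℕ
  /-- number of interfering users -/
  M : ℕ
  /-- spatial correlation matrices `R_j` -/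
  R : Fin (M + 1) → Matrix (Ant d) (Ant d) ℂ
  R_psd : ∀ j, (R j).PosSemidef
  /-- variance `σ²` of the receiver noise -/
  sigSq : ℝ
  sigSq_pos : 0 < sigSq
  /-- variance `σ̃²` of the training noise -/
  tauSq : ℝ
  tauSq_nonneg : 0 ≤ tauSq
  /-- design matrices `Z_k` of the local receivers -/
  Z : (k : Fin K) → Matrix (Fin (d k)) (Fin (d k)) ℂ
  Z_psd : ∀ k, (Z k).PosSemidef
  /-- regularization parameters `ρ_k` -/
  rho : Fin K → ℝ
  rho_pos : ∀ k, 0 < rho k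

namespace System

variable {K : ℕ} (S : System K)

/-- Total number of antennas `N`. -/
def N : ℕ := ∑ k, S.d k

/-- `D_{R,j}`, the block diagonal part of `R_j`. -/
def DR (j : Fin (S.M + 1)) : Matrix (Ant S.d) (Ant S.d) ℂ :=
  Matrix.blockDiagonal' fun k => blk (S.R j) k k

/-- `D_{T,j} = D_{R,j} (σ̃² I + D_{R,j})⁻¹`. -/
def DT (j : Fin (S.M + 1)) : Matrix (Ant S.d) (Ant S.d) ℂ :=
  S.DR j * ((S.tauSq : ℂ) • (1 : Matrix (Ant S.d) (Ant S.d) ℂ) + S.DR j)⁻¹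

/-- `T_j = R_j (σ̃² I + R_j)⁻¹`. -/
def T (j : Fin (S.M + 1)) : Matrix (Ant S.d) (Ant S.d) ℂ :=
  S.R j * ((S.tauSq : ℂ) • (1 : Matrix (Ant S.d) (Ant S.d) ℂ) + S.R j)⁻¹

/-- `Φ_j = D_{T,j} (σ̃² I + R_j) D_{T,j}`, the covariance of the channel estimate. -/
def Phi (j : Fin (S.M + 1)) : Matrix (Ant S.d) (Ant S.d) ℂ :=
  S.DT j * ((S.tauSq : ℂ) • (1 : Matrix (Ant S.d) (Ant S.d) ℂ) + S.R j) * S.DT j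

/-- `V_j = T_j D_{T,j}⁻¹`. -/
def V (j : Fin (S.M + 1)) : Matrix (Ant S.d) (Ant S.d) ℂ := S.T j * (S.DT j)⁻¹

/-- `W = ∑_j W_j` with `W_j = σ̃² T_j`. -/
def W : Matrix (Ant S.d) (Ant S.d) ℂ := ∑ j, (S.tauSq : ℂ) • S.T j

/-- `D_W = σ̃² ∑_j D_{T,j}`. -/
def DW : Matrix (Ant S.d) (Ant S.d) ℂ := (S.tauSq : ℂ) • ∑ j, S.DT j

/-- `σ² I_N`. -/
def noiseCov : Matrix (Ant S.d) (Ant S.d) ℂ :=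
  (S.sigSq : ℂ) • (1 : Matrix (Ant S.d) (Ant S.d) ℂ)

end System

/-! ### Random channel, training and detection -/

/-- The circularly symmetric complex Gaussian law `𝒞𝒩(0, v)`: independent centred real Gaussian real
and imaginary parts of variance `v / 2`. -/
def complexGaussian (v : ℝ) : Measure ℂ :=
  ((gaussianReal 0 (v / 2).toNNReal).prod (gaussianReal 0 (v / 2).toNNReal)).map
    Complex.measurableEquivRealProd.symm

/-- The random variables of the system: the vectors `z_j ∼ 𝒞𝒩(0, I_N)` driving the channels, the
training noise `ñ_j` with `𝒞𝒩(0, σ̃²)` entries, the transmit signal `x ∼ 𝒞𝒩(0, I_{M+1})` and the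
receiver noise `n ∼ 𝒞𝒩(0, σ² I_N)`, all of them independent. -/
structure Randomness {K : ℕ} (S : System K) {Ω : Type*} [MeasurableSpace Ω] (P : Measure Ω) where
  z : Fin (S.M + 1) → Ant S.d → Ω → ℂ
  pilotNoise : Fin (S.M + 1) → Ant S.d → Ω → ℂ
  x : Fin (S.M + 1) → Ω → ℂ
  noise : Ant S.d → Ω → ℂ
  meas_z : ∀ j a, Measurable (z j a)
  meas_pilotNoise : ∀ j a, Measurable (pilotNoise j a)
  meas_x : ∀ j, Measurable (x j)
  meas_noise : ∀ a, Measurable (noise a)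
  law_z : ∀ j a, P.map (z j a) = complexGaussian 1
  law_pilotNoise : ∀ j a, P.map (pilotNoise j a) = complexGaussian S.tauSq
  law_x : ∀ j, P.map (x j) = complexGaussian 1
  law_noise : ∀ a, P.map (noise a) = complexGaussian S.sigSq
  indep : iIndepFun
    (Sum.elim (fun p : Fin (S.M + 1) × Ant S.d => z p.1 p.2)
      (Sum.elim (fun p : Fin (S.M + 1) × Ant S.d => pilotNoise p.1 p.2) (Sum.elim x noise))) P

namespace Randomness

variable {K : ℕ} {S : System K} {Ω : Type*} [MeasurableSpace Ω] {P : Measure Ω}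
  (X : Randomness S P)

/-- The channel of user `j`, `h_j = R_j^{1/2} z_j`. -/
def h (j : Fin (S.M + 1)) (ω : Ω) : Ant S.d → ℂ := psdSqrt (S.R j) *ᵥ fun a => X.z j a ω

/-- The channel matrix `Σ = [h_0, …, h_M]`. -/
def Sig (ω : Ω) : Matrix (Ant S.d) (Fin (S.M + 1)) ℂ := Matrix.of fun a j => X.h j ω a

/-- The training observation `ỹ_{jk} = h_{jk} + ñ_{jk}` of cluster `k`. -/
def obs (j : Fin (S.M + 1)) (k : Fin K) (ω : Ω) : Fin (S.d k) → ℂ :=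
  fun i => X.h j ω ⟨k, i⟩ + X.pilotNoise j ⟨k, i⟩ ω

/-- The local MMSE estimate `ĥ_{jk} = [R_j]_{[k,k]} ([R_j]_{[k,k]} + σ̃² I)⁻¹ ỹ_{jk}`. -/
def hHatLoc (j : Fin (S.M + 1)) (k : Fin K) (ω : Ω) : Fin (S.d k) → ℂ :=
  (blk (S.R j) k k * (blk (S.R j) k k +
    (S.tauSq : ℂ) • (1 : Matrix (Fin (S.d k)) (Fin (S.d k)) ℂ))⁻¹) *ᵥ X.obs j k ω

/-- The stacked estimate `ĥ_j`. -/
def hHat (j : Fin (S.M + 1)) (ω : Ω) : Ant S.d → ℂ := fun a => X.hHatLoc j a.1 ω a.2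

/-- `h̃_j = V_j ĥ_j`. -/
def hTil (j : Fin (S.M + 1)) (ω : Ω) : Ant S.d → ℂ := S.V j *ᵥ X.hHat j ω

/-- `Σ̂ = [ĥ_0, …, ĥ_M]`. -/
def SigHat (ω : Ω) : Matrix (Ant S.d) (Fin (S.M + 1)) ℂ := Matrix.of fun a j => X.hHat j ω a

/-- `Σ̃ = [h̃_0, …, h̃_M]`. -/
def SigTil (ω : Ω) : Matrix (Ant S.d) (Fin (S.M + 1)) ℂ := Matrix.of fun a j => X.hTil j ω a

/-- `Σ̂_k`, the rows of `Σ̂` that belong to cluster `k`. -/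
def SigHatLoc (k : Fin K) (ω : Ω) : Matrix (Fin (S.d k)) (Fin (S.M + 1)) ℂ :=
  (X.SigHat ω).submatrix (fun i => ⟨k, i⟩) id

/-- The σ-algebra generated by the channel estimates `Σ̂`. -/
abbrev estAlg : MeasurableSpace Ω :=
  MeasurableSpace.comap (fun ω (j : Fin (S.M + 1)) (a : Ant S.d) => X.hHat j ω a) inferInstance

/-- The local receiver `r_k = (Σ̂_k Σ̂_kᴴ + N_k Z_k + N_k ρ_k I)⁻¹ ĥ_{0k}`. -/
def r (k : Fin K) (ω : Ω) : Fin (S.d k) → ℂ :=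
  (X.SigHatLoc k ω * (X.SigHatLoc k ω)ᴴ + (S.d k : ℂ) • S.Z k
    + ((S.d k : ℂ) * (S.rho k : ℂ)) • (1 : Matrix (Fin (S.d k)) (Fin (S.d k)) ℂ))⁻¹
    *ᵥ X.hHatLoc 0 k ω

/-- `D_r = diag(r_1, …, r_K)`, an `N × K` matrix. -/
def Dr (ω : Ω) : Matrix (Ant S.d) (Fin K) ℂ :=
  Matrix.of fun a l => if a.1 = l then X.r a.1 ω a.2 else 0

/-- The fused receiver `r_α`, whose block `k` is `α_k^* r_k`. -/
def rAlpha (α : Ω → Fin K → ℂ) (ω : Ω) : Ant S.d → ℂ :=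
  fun a => star (α ω a.1) * X.r a.1 ω a.2

/-- The SINR of user `0` for the fusion coefficients `α` (which may depend on the estimates `Σ̂`):
`|E[r_αᴴ h_0 | Σ̂]|² / E[|r_αᴴ (Σ x - h̃_0 x_0 + n)|² | Σ̂]`. -/
def sinr (α : Ω → Fin K → ℂ) (ω : Ω) : ℝ :=
  ‖(P[fun ω' => star (X.rAlpha α ω') ⬝ᵥ X.h 0 ω' | X.estAlg]) ω‖ ^ 2 /
    (P[fun ω' => ‖star (X.rAlpha α ω') ⬝ᵥ
      (X.Sig ω' *ᵥ (fun j => X.x j ω') - X.x 0 ω' • X.hTil 0 ω' + fun a => X.noise a ω')‖ ^ 2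
      | X.estAlg]) ω

/-- The optimal coefficients
`c h̃_0ᴴ D_r (D_rᴴ (Σ̃ Σ̃ᴴ + W + σ² I) D_r)⁻¹`, with a free nonzero scalar `c`. -/
def alphaOpt (c : ℂ) (ω : Ω) : Fin K → ℂ :=
  c • (star (X.hTil 0 ω) ᵥ* (X.Dr ω *
    ((X.Dr ω)ᴴ * (X.SigTil ω * (X.SigTil ω)ᴴ + S.W + S.noiseCov) * X.Dr ω)⁻¹))

/-- The suboptimal coefficients `ĥ_0ᴴ D_r (D_rᴴ (Σ̂ Σ̂ᴴ + D_W + σ² I) D_r)⁻¹`. -/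
def alphaSub (ω : Ω) : Fin K → ℂ :=
  star (X.hHat 0 ω) ᵥ* (X.Dr ω *
    ((X.Dr ω)ᴴ * (X.SigHat ω * (X.SigHat ω)ᴴ + S.DW + S.noiseCov) * X.Dr ω)⁻¹)

/-- SINR of linear fusion with optimal coefficients. -/
def sinrLfoc (c : ℂ) (ω : Ω) : ℝ := X.sinr (X.alphaOpt c) ω

/-- SINR of linear fusion with suboptimal coefficients. -/
def sinrLfsc (ω : Ω) : ℝ := X.sinr X.alphaSub ω

/-- SINR of linear fusion with constant coefficients. -/
def sinrLfcc (α : Fin K → ℂ) (ω : Ω) : ℝ := X.sinr (fun _ => α) ω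

end Randomness

/-! ### The deterministic approximations of the SINRs -/

namespace System

variable {K : ℕ} (S : System K)

/-- `A_j = Φ_j^{1/2}` for the interfering users `j = 1, …, M`. -/
def Amat (j : Fin S.M) : Matrix (Ant S.d) (Ant S.d) ℂ := psdSqrt (S.Phi j.succ)

/-- `B_j = V_j Φ_j^{1/2}` for the interfering users `j = 1, …, M`. -/
def Bmat (j : Fin S.M) : Matrix (Ant S.d) (Ant S.d) ℂ := S.V j.succ * psdSqrt (S.Phi j.succ)

/-- `δ` is a positive solution of the fundamental system of the uplink (`z_k = -ρ_k`,
`S_k = Z_k`). -/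
def IsDelta (δ : Fin S.M → Fin K → ℝ) : Prop :=
  IsPositiveSolution S.Z (fun k => -S.rho k) S.Amat δ

variable (δ : Fin S.M → Fin K → ℝ)

/-- `Θ_k` for the uplink. -/
def Th (k : Fin K) : Matrix (Fin (S.d k)) (Fin (S.d k)) ℂ :=
  Theta S.Z (fun k => -S.rho k) S.Amat δ k

/-- `[v]_k = ϝ̄_k([Φ_0]_{[k,k]}) / N_k`. -/
def v (k : Fin K) : ℂ := digBar (S.Th δ) k (blk (S.Phi 0) k k) / (S.d k : ℂ)

/-- `J = (I_K + diag(v))⁻¹`. -/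
def J : Matrix (Fin K) (Fin K) ℂ := (1 + Matrix.diagonal (S.v δ))⁻¹

/-- `[Δ]_{kl}`. -/
def Del : Matrix (Fin K) (Fin K) ℂ := Matrix.of fun k l =>
  upsBar (S.Th δ) S.Amat δ k l (blk (S.Phi 0) l k) (blk (S.W + S.noiseCov) k l)
      / ((S.d k : ℂ) * (S.d l : ℂ))
    + isq S.d k l * piBar (S.Th δ) S.Amat S.Bmat δ k l (blk (S.Phi 0) l k)

/-- `[Δ_I]_{kl}`. -/
def DelI : Matrix (Fin K) (Fin K) ℂ := Matrix.of fun k l =>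
  upsBar (S.Th δ) S.Amat δ k l (blk (S.Phi 0) l k) (blk (S.DW + S.noiseCov) k l)
      / ((S.d k : ℂ) * (S.d l : ℂ))
    + isq S.d k l * piBar (S.Th δ) S.Amat S.Amat δ k l (blk (S.Phi 0) l k)

/-- `vᴴ Δ⁻¹ v`. -/
def barLfoc : ℂ := star (S.v δ) ⬝ᵥ ((S.Del δ)⁻¹ *ᵥ S.v δ)

/-- `(vᴴ Δ_I⁻¹ v)² / (vᴴ Δ_I⁻¹ Δ Δ_I⁻¹ v)`. -/
def barLfsc : ℂ :=
  (star (S.v δ) ⬝ᵥ ((S.DelI δ)⁻¹ *ᵥ S.v δ)) ^ 2 /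
    (star (S.v δ) ⬝ᵥ (((S.DelI δ)⁻¹ * S.Del δ * (S.DelI δ)⁻¹) *ᵥ S.v δ))

/-- `|α J v|² / (α J Δ J αᴴ)`. -/
def barLfcc (α : Fin K → ℂ) : ℂ :=
  ((‖α ⬝ᵥ (S.J δ *ᵥ S.v δ)‖ ^ 2 : ℝ) : ℂ) /
    (α ⬝ᵥ ((S.J δ * S.Del δ * S.J δ) *ᵥ star α))

end System

/-! ### The asymptotic regime -/

/-- The ratios `N_k / M` are eventually bounded away from `0` and `∞`. -/
def AssumptionA1 {K : ℕ} (S : ℕ → System K) : Prop :=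
  ∃ c C : ℝ, 0 < c ∧ ∀ᶠ n in atTop, ∀ k,
    c ≤ ((S n).d k : ℝ) / ((S n).M : ℝ) ∧ ((S n).d k : ℝ) / ((S n).M : ℝ) ≤ C

/-- The eigenvalues of the `R_j` are eventually bounded away from `0` and `∞`, uniformly in `j`. -/
def AssumptionA2 {K : ℕ} (S : ℕ → System K) : Prop :=
  ∃ c C : ℝ, 0 < c ∧ ∀ᶠ n in atTop, ∀ j i,
    c ≤ ((S n).R_psd j).isHermitian.eigenvalues i ∧
      ((S n).R_psd j).isHermitian.eigenvalues i ≤ C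

/-- The spectral norms of the `Z_k` are eventually bounded; the `ρ_k` are eventually bounded and
the eigenvalues of `Z_k + ρ_k I` eventually bounded away from `0`, which is automatic for positive
`ρ_k` that do not depend on `n`. -/
def AssumptionA3 {K : ℕ} (S : ℕ → System K) : Prop :=
  (∃ C : ℝ, ∀ᶠ n in atTop, ∀ k, specNorm ((S n).Z k) ≤ C) ∧
  (∃ C : ℝ, ∀ᶠ n in atTop, ∀ k, (S n).rho k ≤ C) ∧
  (∃ c : ℝ, 0 < c ∧ ∀ᶠ n in atTop, ∀ k i,
    c ≤ ((S n).Z_psd k).isHermitian.eigenvalues i + (S n).rho k)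

end DBP

end

noncomputable section

namespace DBP

open Finset (sum_congr sum_le_sum mem_univ single_le_sum sum_sub_distrib sum_nonneg sum_add_distrib sum_comm sum_ite_eq sum_eq_single)
open Fintype (card card_fin sum_sum_type sum_prod_type)
open Complex (norm_natCast norm_real ofReal_re star_def re_ofReal_mul ofReal_mul re_le_norm ofReal_natCast re_sum conj_ofReal I)
open Function (update)
open Nat (cast_nonneg)
open Real (exp sqrt norm_of_nonneg)

set_option linter.unusedSectionVars false

section

open scoped Matrix.Norms.L2Operator MatrixOrder

section LinearAlgebra

variable {m n p : Type} [Fintype m] [Fintype n] [Fintype p]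
  [DecidableEq m] [DecidableEq n] [DecidableEq p]

/-- Complex square matrices. -/
abbrev Sq (n : Type) : Type := Matrix n n ℂ

/-- The Euclidean norm of a complex vector. -/
def nrm (u : m → ℂ) : ℝ := ‖WithLp.toLp 2 u‖

/-- The sesquilinear form `uᴴ X v`. -/
def qf (u : m → ℂ) (X : Matrix m n ℂ) (v : n → ℂ) : ℂ := star u ⬝ᵥ (X *ᵥ v)

lemma nrm_nonneg (u : m → ℂ) : 0 ≤ nrm u := norm_nonneg _

lemma nrm_sq (u : m → ℂ) : nrm u ^ 2 = ∑ i, ‖u i‖ ^ 2 := by simp [nrm, EuclideanSpace.norm_sq_eq]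

lemma dot_self (u : m → ℂ) : star u ⬝ᵥ u = ((nrm u ^ 2 : ℝ) : ℂ) := by
  rw [nrm_sq]
  simp [dotProduct, Complex.conj_mul']

lemma norm_dot_le (u v : m → ℂ) : ‖star u ⬝ᵥ v‖ ≤ nrm u * nrm v := by
  have h := norm_inner_le_norm (𝕜 := ℂ) (WithLp.toLp 2 u) (WithLp.toLp 2 v)
  rw [EuclideanSpace.inner_eq_star_dotProduct] at h
  simpa [nrm, dotProduct_comm] using h

lemma nrm_mulVec_le (A : Matrix m n ℂ) (u : n → ℂ) : nrm (A *ᵥ u) ≤ ‖A‖ * nrm u :=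
  l2_opNorm_mulVec A (WithLp.toLp 2 u)

lemma nrm_smul (c : ℂ) (u : m → ℂ) : nrm (c • u) = ‖c‖ * nrm u := by simp [nrm, norm_smul]

lemma norm_apply_le_nrm (u : m → ℂ) (i : m) : ‖u i‖ ≤ nrm u := by
  simpa [nrm] using PiLp.norm_apply_le (WithLp.toLp 2 u) i

lemma norm_qf_le (u : m → ℂ) (X : Matrix m n ℂ) (v : n → ℂ) :
    ‖qf u X v‖ ≤ ‖X‖ * nrm u * nrm v := by
  calc ‖qf u X v‖ ≤ nrm u * nrm (X *ᵥ v) := norm_dot_le _ _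
    _ ≤ nrm u * (‖X‖ * nrm v) := by gcongr; exacts [nrm_nonneg _, nrm_mulVec_le _ _]
    _ = _ := by ring

lemma qf_add (u : m → ℂ) (X Y : Matrix m n ℂ) (v : n → ℂ) :
    qf u (X + Y) v = qf u X v + qf u Y v := by simp [qf, add_mulVec, dotProduct_add]

lemma qf_sub (u : m → ℂ) (X Y : Matrix m n ℂ) (v : n → ℂ) :
    qf u (X - Y) v = qf u X v - qf u Y v := by simp [qf, sub_mulVec, dotProduct_sub]

lemma qf_smul (c : ℂ) (u : m → ℂ) (X : Matrix m n ℂ) (v : n → ℂ) :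
    qf u (c • X) v = c * qf u X v := by simp [qf, smul_mulVec, dotProduct_smul]

lemma star_qf (u : m → ℂ) (X : Matrix m n ℂ) (v : n → ℂ) : star (qf u X v) = qf v Xᴴ u := by
  unfold qf
  rw [← star_dotProduct_star, star_star, star_mulVec, dotProduct_mulVec, dotProduct_comm]

lemma trace_mul_vecMulVec (X : Matrix m n ℂ) (u : n → ℂ) (v : m → ℂ) :
    (X * vecMulVec u (star v)).trace = qf v X u := by
  rw [mul_vecMulVec, trace_vecMulVec, dotProduct_comm, qf]

lemma norm_entry_le (A : Matrix m n ℂ) (i : m) (j : n) : ‖A i j‖ ≤ ‖A‖ := by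
  have h1 := norm_apply_le_nrm (A *ᵥ Pi.single j 1) i
  have h2 := nrm_mulVec_le A (Pi.single j 1)
  have h3 : nrm (Pi.single j (1 : ℂ)) = 1 := by simp [nrm]
  rw [h3, mul_one] at h2
  simpa using h1.trans h2

lemma norm_trace_le (A : Sq m) : ‖A.trace‖ ≤ card m * ‖A‖ := by
  calc ‖A.trace‖ ≤ ∑ i, ‖A i i‖ := norm_sum_le _ _
    _ ≤ ∑ _i : m, ‖A‖ := sum_le_sum fun i _ => norm_entry_le A i i
    _ = _ := by simp

/-- The Frobenius norm. -/
def fro (A : Matrix m n ℂ) : ℝ := sqrt (∑ i, ∑ j, ‖A i j‖ ^ 2)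

lemma fro_nonneg (A : Matrix m n ℂ) : 0 ≤ fro A := Real.sqrt_nonneg _

lemma fro_sq (A : Matrix m n ℂ) : fro A ^ 2 = ∑ i, ∑ j, ‖A i j‖ ^ 2 :=
  Real.sq_sqrt (by positivity)

lemma fro_sq_col (A : Matrix m n ℂ) : fro A ^ 2 = ∑ j, nrm (A.col j) ^ 2 := by
  simp only [fro_sq, nrm_sq, col_apply]
  exact sum_comm

lemma fro_conjTranspose (A : Matrix m n ℂ) : fro Aᴴ = fro A := by
  unfold fro
  rw [sum_comm]
  simp

lemma fro_sq_trace (A : Matrix m n ℂ) : (Aᴴ * A).trace = ((fro A ^ 2 : ℝ) : ℂ) := by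
  rw [fro_sq, sum_comm]
  simp [trace, mul_apply, Complex.conj_mul']

lemma fro_mul_le_left (A : Matrix m n ℂ) (B : Matrix n p ℂ) : fro (A * B) ≤ ‖A‖ * fro B := by
  refine abs_le_of_sq_le_sq' ?_ (mul_nonneg (norm_nonneg _) (fro_nonneg _)) |>.2
  rw [mul_pow, fro_sq_col, fro_sq_col, Finset.mul_sum]
  refine sum_le_sum fun j _ => ?_
  have h : (A * B).col j = A *ᵥ B.col j := by ext i; simp [mul_apply, mulVec, dotProduct]
  rw [h, ← mul_pow]
  exact pow_le_pow_left₀ (nrm_nonneg _) (nrm_mulVec_le _ _) 2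

lemma fro_mul_le_right (A : Matrix m n ℂ) (B : Matrix n p ℂ) : fro (A * B) ≤ fro A * ‖B‖ := by
  rw [← fro_conjTranspose, conjTranspose_mul]
  refine (fro_mul_le_left _ _).trans ?_
  rw [l2_opNorm_conjTranspose, fro_conjTranspose, mul_comm]

lemma fro_le (A : Matrix m n ℂ) : fro A ≤ sqrt (card n) * ‖A‖ := by
  have h : fro (1 : Sq n) = sqrt (card n) := by
    unfold fro
    congr 1
    simp [one_apply, apply_ite]
  calc fro A = fro (A * (1 : Sq n)) := by rw [Matrix.mul_one]
    _ ≤ ‖A‖ * fro (1 : Sq n) := fro_mul_le_left _ _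
    _ = _ := by rw [mul_comm, h]

lemma norm_trace_mul_le_fro (A : Matrix m n ℂ) (B : Matrix n m ℂ) :
    ‖(A * B).trace‖ ≤ fro A * fro B := by
  have h1 : ‖(A * B).trace‖ ≤ ∑ q : m × n, ‖A q.1 q.2‖ * ‖B q.2 q.1‖ := by
    rw [sum_prod_type]
    refine (norm_sum_le _ _).trans (sum_le_sum fun i _ => ?_)
    rw [diag_apply, mul_apply]
    exact (norm_sum_le _ _).trans (sum_le_sum fun j _ => (norm_mul _ _).le)
  refine h1.trans (abs_le_of_sq_le_sq' ?_ (mul_nonneg (fro_nonneg _) (fro_nonneg _)) |>.2)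
  refine (Finset.sum_mul_sq_le_sq_mul_sq _ _ _).trans (le_of_eq ?_)
  rw [mul_pow, fro_sq, ← fro_conjTranspose B, fro_sq, sum_prod_type, sum_prod_type]
  simp

lemma fro_vecMulVec (u : m → ℂ) (v : n → ℂ) : fro (vecMulVec u (star v)) = nrm u * nrm v := by
  refine (sq_eq_sq₀ (fro_nonneg _) (mul_nonneg (nrm_nonneg _) (nrm_nonneg _))).1 ?_
  rw [fro_sq, mul_pow, nrm_sq, nrm_sq, Finset.sum_mul_sum]
  simp [vecMulVec_apply, mul_pow]

lemma fro_add_le (A B : Matrix m n ℂ) : fro (A + B) ≤ fro A + fro B := by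
  let _ := Matrix.frobeniusNormedAddCommGroup (m := m) (n := n) (α := ℂ)
  have h : ∀ A : Matrix m n ℂ, fro A = ‖A‖ := fun A => by
    rw [frobenius_norm_def, fro, Real.sqrt_eq_rpow]
    simp
  simp only [h]
  exact norm_add_le A B

lemma fro_smul (c : ℂ) (A : Matrix m n ℂ) : fro (c • A) = ‖c‖ * fro A := by
  refine (sq_eq_sq₀ (fro_nonneg _) (mul_nonneg (norm_nonneg _) (fro_nonneg _))).1 ?_
  rw [fro_sq, mul_pow, fro_sq, Finset.mul_sum]
  simp [mul_pow, Finset.mul_sum]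

/-! ### Loewner order -/

lemma re_qf_le_of_le {A B : Sq m} (h : A ≤ B) (u : m → ℂ) :
    (qf u A u).re ≤ (qf u B u).re := by
  have h1 := (Matrix.le_iff.1 h).dotProduct_mulVec_nonneg u
  have h2 := (Complex.le_def.1 h1).1
  have h3 : qf u (B - A) u = _ := qf_sub u B A u
  rw [qf] at h3
  rw [h3] at h2
  simpa using h2

lemma qf_smul_one (c : ℂ) (u : m → ℂ) : qf u (c • 1) u = c * ((nrm u ^ 2 : ℝ) : ℂ) := by
  rw [qf_smul, qf, one_mulVec, dot_self]

lemma le_of_forall_re_qf {A B : Sq m} (hA : A.IsHermitian) (hB : B.IsHermitian)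
    (h : ∀ u, (qf u A u).re ≤ (qf u B u).re) : A ≤ B := by
  rw [Matrix.le_iff]
  refine PosSemidef.of_dotProduct_mulVec_nonneg (hB.sub hA) fun u => ?_
  have hs : star (qf u (B - A) u) = qf u (B - A) u := by rw [star_qf, (hB.sub hA)]
  have h2 := h u
  rw [Complex.le_def]
  constructor
  · change 0 ≤ (qf u (B - A) u).re
    rw [qf_sub]; simpa using h2
  · have := congrArg Complex.im hs
    change 0 = (qf u (B - A) u).im
    simp only [RCLike.star_def, Complex.conj_im] at this
    linarith

lemma norm_le_of_le_smul_one {A : Sq m} {c : ℝ} (hA : 0 ≤ A)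
    (h : A ≤ (c : ℂ) • 1) (hc : 0 ≤ c) : ‖A‖ ≤ c := by
  have h1 := CStarAlgebra.norm_le_norm_of_nonneg_of_le hA h
  refine h1.trans ?_
  rw [norm_smul]
  have : ‖(1 : Sq m)‖ ≤ 1 := by
    cases isEmpty_or_nonempty m
    · have : (1 : Sq m) = 0 := Subsingleton.elim _ _
      rw [this, norm_zero]; exact zero_le_one
    · exact CStarRing.norm_one.le
  calc _ ≤ ‖(c : ℂ)‖ * 1 := by gcongr
    _ = c := by simp [abs_of_nonneg hc]

lemma norm_one_le : ‖(1 : Sq m)‖ ≤ 1 := by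
  cases isEmpty_or_nonempty m
  · have : (1 : Sq m) = 0 := Subsingleton.elim _ _
    rw [this, norm_zero]; exact zero_le_one
  · exact CStarRing.norm_one.le

lemma le_norm_smul_one {A : Sq m} (hA : A.IsHermitian) : A ≤ (‖A‖ : ℂ) • 1 := by
  refine le_of_forall_re_qf hA (by simp [IsHermitian]) fun u => ?_
  rw [qf_smul_one]
  calc (qf u A u).re ≤ ‖qf u A u‖ := re_le_norm _
    _ ≤ ‖A‖ * nrm u * nrm u := norm_qf_le _ _ _
    _ = _ := by norm_cast; ring

lemma posDef_of_smul_one_le {A : Sq m} {c : ℝ} (hc : 0 < c) (h : (c : ℂ) • 1 ≤ A) :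
    A.PosDef := by
  have h1 : (A - (c : ℂ) • 1).PosSemidef := Matrix.le_iff.1 h
  have h2 : ((c : ℂ) • (1 : Sq m)).PosDef := PosDef.one.smul (by exact_mod_cast hc)
  simpa using h2.add_posSemidef h1

lemma inv_le_inv_of_le {A B : Sq m} (hA : A.PosDef) (h : A ≤ B) : B⁻¹ ≤ A⁻¹ := by
  have h1 := CStarAlgebra.antitoneOn_ringInverse (A := Sq m)
    (show A ∈ _ from isStrictlyPositive_iff_posDef.2 hA)
    (show B ∈ _ from IsStrictlyPositive.of_le (isStrictlyPositive_iff_posDef.2 hA) h) h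
  simpa [nonsing_inv_eq_ringInverse] using h1

lemma inv_smul_one (c : ℂ) : ((c • (1 : Sq m)))⁻¹ = c⁻¹ • 1 := by
  by_cases hc : c = 0
  · subst hc; simp
  · have := Matrix.inv_smul' (A := (1 : Sq m)) (Units.mk0 c hc) (by simp)
    simpa [Units.smul_def] using this

lemma inv_le_of_smul_one_le {A : Sq m} {c : ℝ} (hc : 0 < c) (h : (c : ℂ) • 1 ≤ A) :
    A⁻¹ ≤ ((c⁻¹ : ℝ) : ℂ) • 1 := by
  have h2 : ((c : ℂ) • (1 : Sq m)).PosDef := PosDef.one.smul (by exact_mod_cast hc)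
  have := inv_le_inv_of_le h2 h
  rw [inv_smul_one] at this
  simpa using this

lemma norm_inv_le {A : Sq m} {c : ℝ} (hc : 0 < c) (h : (c : ℂ) • 1 ≤ A) :
    ‖A⁻¹‖ ≤ c⁻¹ :=
  norm_le_of_le_smul_one (nonneg_iff_posSemidef.2 (posDef_of_smul_one_le hc h).inv.posSemidef)
    (inv_le_of_smul_one_le hc h) (by positivity)

lemma trace_mul_nonneg {A B : Sq m} (hA : A.PosSemidef) (hB : B.PosSemidef) :
    0 ≤ (A * B).trace := by
  obtain ⟨X, rfl⟩ := CStarAlgebra.nonneg_iff_eq_star_mul_self.1 (nonneg_iff_posSemidef.2 hA)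
  rw [Matrix.mul_assoc, trace_mul_comm]
  exact (hB.mul_mul_conjTranspose_same X).trace_nonneg

lemma trace_mul_le_trace_mul {A B B' : Sq m} (hA : A.PosSemidef) (h : B ≤ B') :
    (A * B).trace ≤ (A * B').trace := by
  have := trace_mul_nonneg hA (Matrix.le_iff.1 h)
  rw [Matrix.mul_sub, trace_sub] at this
  exact sub_nonneg.1 this

end LinearAlgebra

section FixedPoint

variable {m ι : Type} [Fintype m] [DecidableEq m] [Fintype ι] [DecidableEq ι]

lemma real_smul_le {A B : Sq m} {c : ℝ} (hc : 0 ≤ c) (h : A ≤ B) :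
    (c : ℂ) • A ≤ (c : ℂ) • B := by
  rw [Matrix.le_iff, ← smul_sub]
  exact (Matrix.le_iff.1 h).smul (by exact_mod_cast hc)

lemma real_smul_mono {A : Sq m} {c d : ℝ} (hA : 0 ≤ A) (h : c ≤ d) :
    (c : ℂ) • A ≤ (d : ℂ) • A := by
  rw [Matrix.le_iff, ← sub_smul]
  exact (nonneg_iff_posSemidef.1 hA).smul (by exact_mod_cast sub_nonneg.2 h)

/-- Uniform bounds on the data `Z`, `Ω_j` of one cluster. -/
structure Reg (C : ℝ) (Z : Sq m) (Om : ι → Sq m) : Prop where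
  one_le : 1 ≤ C
  card_pos : 0 < card m
  card_le : (card ι : ℝ) ≤ C * card m
  Z_ge : ((C⁻¹ : ℝ) : ℂ) • 1 ≤ Z
  Z_le : Z ≤ (C : ℂ) • 1
  Om_ge : ∀ i, ((C⁻¹ : ℝ) : ℂ) • 1 ≤ Om i
  Om_le : ∀ i, Om i ≤ (C : ℂ) • 1

/-- The matrix whose inverse is `Θ(δ)`. -/
def thetArg (Z : Sq m) (Om : ι → Sq m) (δ : ι → ℝ) : Sq m :=
  Z + (card m : ℂ)⁻¹ • ∑ j, (1 + (δ j : ℂ))⁻¹ • Om j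

/-- `Θ(δ) = (Z + N⁻¹ ∑_j Ω_j / (1 + δ_j))⁻¹`. -/
def thet (Z : Sq m) (Om : ι → Sq m) (δ : ι → ℝ) : Sq m :=
  (thetArg Z Om δ)⁻¹

/-- The map `δ ↦ (N⁻¹ Tr Ω_i Θ(δ))_i` of the fundamental system. -/
def fmap (Z : Sq m) (Om : ι → Sq m) (δ : ι → ℝ) (i : ι) : ℝ :=
  ((card m : ℂ)⁻¹ * (Om i * thet Z Om δ).trace).re

variable {C : ℝ} {Z : Sq m} {Om : ι → Sq m}

namespace Reg

lemma pos (h : Reg C Z Om) : 0 < C := zero_lt_one.trans_le h.one_le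

lemma cardR_pos (h : Reg C Z Om) : (0 : ℝ) < card m := by exact_mod_cast h.card_pos

lemma Om_nonneg (h : Reg C Z Om) (i : ι) : 0 ≤ Om i :=
  nonneg_iff_posSemidef.2 (posDef_of_smul_one_le (inv_pos.2 h.pos) (h.Om_ge i)).posSemidef

lemma Om_psd (h : Reg C Z Om) (i : ι) : (Om i).PosSemidef := nonneg_iff_posSemidef.1 (h.Om_nonneg i)

lemma Z_posDef (h : Reg C Z Om) : Z.PosDef := posDef_of_smul_one_le (inv_pos.2 h.pos) h.Z_ge

lemma Z_nonneg (h : Reg C Z Om) : 0 ≤ Z := nonneg_iff_posSemidef.2 h.Z_posDef.posSemidef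

lemma norm_Om (h : Reg C Z Om) (i : ι) : ‖Om i‖ ≤ C :=
  norm_le_of_le_smul_one (h.Om_nonneg i) (h.Om_le i) h.pos.le

end Reg

lemma thetArg_eq (Z : Sq m) (Om : ι → Sq m) (δ : ι → ℝ) :
    thetArg Z Om δ
      = Z + ∑ j, (((card m : ℝ)⁻¹ * (1 + δ j)⁻¹ : ℝ) : ℂ) • Om j := by
  simp [thetArg, Finset.smul_sum, smul_smul]

lemma thetArg_antitone (h : Reg C Z Om) {x y : ι → ℝ} (hx : 0 ≤ x) (hxy : x ≤ y) :
    thetArg Z Om y ≤ thetArg Z Om x := by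
  rw [thetArg_eq, thetArg_eq]
  refine add_le_add_right (sum_le_sum fun j _ => real_smul_mono (h.Om_nonneg j) ?_) _
  have := hx j
  have := hxy j
  have : 0 < 1 + x j := by simp at *; linarith
  gcongr

lemma Z_le_thetArg (h : Reg C Z Om) {x : ι → ℝ} (hx : 0 ≤ x) : Z ≤ thetArg Z Om x := by
  rw [thetArg_eq]
  refine le_add_of_nonneg_right (sum_nonneg fun j _ => ?_)
  have hj : 0 ≤ x j := hx j
  have := real_smul_mono (h.Om_nonneg j)
    (show (0 : ℝ) ≤ (card m : ℝ)⁻¹ * (1 + x j)⁻¹ by positivity)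
  simpa using this

lemma smul_one_le_thetArg (h : Reg C Z Om) {x : ι → ℝ} (hx : 0 ≤ x) :
    ((C⁻¹ : ℝ) : ℂ) • 1 ≤ thetArg Z Om x := h.Z_ge.trans (Z_le_thetArg h hx)

lemma thetArg_posDef (h : Reg C Z Om) {x : ι → ℝ} (hx : 0 ≤ x) : (thetArg Z Om x).PosDef :=
  posDef_of_smul_one_le (inv_pos.2 h.pos) (smul_one_le_thetArg h hx)

lemma thet_posDef (h : Reg C Z Om) {x : ι → ℝ} (hx : 0 ≤ x) : (thet Z Om x).PosDef :=
  (thetArg_posDef h hx).inv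

lemma thet_mono (h : Reg C Z Om) {x y : ι → ℝ} (hx : 0 ≤ x) (hxy : x ≤ y) :
    thet Z Om x ≤ thet Z Om y :=
  inv_le_inv_of_le (thetArg_posDef h (hx.trans hxy)) (thetArg_antitone h hx hxy)

lemma norm_thet_le (h : Reg C Z Om) {x : ι → ℝ} (hx : 0 ≤ x) : ‖thet Z Om x‖ ≤ C := by
  simpa [thet] using norm_inv_le (inv_pos.2 h.pos) (smul_one_le_thetArg h hx)

lemma thetArg_le (h : Reg C Z Om) {x : ι → ℝ} (hx : 0 ≤ x) :
    thetArg Z Om x ≤ ((C + C ^ 2 : ℝ) : ℂ) • 1 := by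
  have h1 : ∑ j, (((card m : ℝ)⁻¹ * (1 + x j)⁻¹ : ℝ) : ℂ) • Om j
      ≤ ∑ _j : ι, (((card m : ℝ)⁻¹ * C : ℝ) : ℂ) • (1 : Sq m) := by
    refine sum_le_sum fun j _ => ?_
    have hj : 0 ≤ x j := hx j
    refine (real_smul_mono (h.Om_nonneg j) (d := (card m : ℝ)⁻¹) ?_).trans ?_
    · exact mul_le_of_le_one_right (by positivity) (inv_le_one_of_one_le₀ (by linarith))
    · have := real_smul_le (c := (card m : ℝ)⁻¹) (by positivity) (h.Om_le j)
      rw [smul_smul] at this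
      simpa using this
  rw [Finset.sum_const, Finset.card_univ, ← Nat.cast_smul_eq_nsmul ℂ, smul_smul] at h1
  have h2 : (((card ι : ℂ) * (((card m : ℝ)⁻¹ * C : ℝ) : ℂ)) • (1 : Sq m))
      ≤ ((C ^ 2 : ℝ) : ℂ) • 1 := by
    have h3 : (card ι : ℝ) * ((card m : ℝ)⁻¹ * C) ≤ C ^ 2 := by
      have h4 := h.card_le
      have h5 := h.cardR_pos
      calc (card ι : ℝ) * ((card m : ℝ)⁻¹ * C)
          ≤ (C * card m) * ((card m : ℝ)⁻¹ * C) := by have := h.pos; gcongr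
        _ = C ^ 2 := by field_simp
    have := real_smul_mono (A := (1 : Sq m))
      (nonneg_iff_posSemidef.2 PosSemidef.one) h3
    push_cast at this ⊢
    exact this
  rw [thetArg_eq]
  calc _ ≤ (C : ℂ) • 1 + ((C ^ 2 : ℝ) : ℂ) • (1 : Sq m) :=
        add_le_add h.Z_le (h1.trans h2)
    _ = _ := by rw [← add_smul]; push_cast; rfl

lemma smul_one_le_thet (h : Reg C Z Om) {x : ι → ℝ} (hx : 0 ≤ x) :
    (((C + C ^ 2)⁻¹ : ℝ) : ℂ) • 1 ≤ thet Z Om x := by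
  have h1 := inv_le_inv_of_le (thetArg_posDef h hx) (thetArg_le h hx)
  rw [inv_smul_one] at h1
  push_cast at h1 ⊢
  exact h1

lemma fmap_eq (h : Reg C Z Om) {x : ι → ℝ} (hx : 0 ≤ x) (i : ι) :
    ((fmap Z Om x i : ℝ) : ℂ) = (card m : ℂ)⁻¹ * (Om i * thet Z Om x).trace := by
  have h1 : (0 : ℂ) ≤ (card m : ℂ)⁻¹ * (Om i * thet Z Om x).trace := by
    refine mul_nonneg ?_ (trace_mul_nonneg (h.Om_psd i) (thet_posDef h hx).posSemidef)
    rw [← ofReal_natCast, ← Complex.ofReal_inv]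
    exact_mod_cast (inv_nonneg.2 (cast_nonneg _))
  exact Complex.ext rfl (Complex.le_def.1 h1).2

lemma inv_card_mul_re (z : ℂ) :
    ((card m : ℂ)⁻¹ * z).re = (card m : ℝ)⁻¹ * z.re := by
  rw [← ofReal_natCast, ← Complex.ofReal_inv, re_ofReal_mul]

lemma fmap_le_mul (h : Reg C Z Om) {x y : ι → ℝ} {a : ℝ} (hxy : thet Z Om x ≤ (a : ℂ) • thet Z Om y)
    (i : ι) : fmap Z Om x i ≤ a * fmap Z Om y i := by
  have h1 := (Complex.le_def.1 (trace_mul_le_trace_mul (h.Om_psd i) hxy)).1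
  rw [mul_smul_comm, trace_smul, smul_eq_mul, re_ofReal_mul] at h1
  rw [fmap, fmap, inv_card_mul_re, inv_card_mul_re]
  calc _ ≤ (card m : ℝ)⁻¹ * (a * (Om i * thet Z Om y).trace.re) := by gcongr
    _ = _ := by ring

lemma fmap_mono (h : Reg C Z Om) {x y : ι → ℝ} (hx : 0 ≤ x) (hxy : x ≤ y) (i : ι) :
    fmap Z Om x i ≤ fmap Z Om y i := by
  simpa using fmap_le_mul (a := 1) h (by simpa using thet_mono h hx hxy) i

lemma norm_inv_card_trace_le (X : Sq m) :
    ‖(card m : ℂ)⁻¹ * X.trace‖ ≤ ‖X‖ := by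
  rcases Nat.eq_zero_or_pos (card m) with h0 | h0
  · simp [h0]
  have h1 : (0 : ℝ) < card m := by exact_mod_cast h0
  rw [norm_mul, norm_inv, norm_natCast]
  calc _ ≤ (card m : ℝ)⁻¹ * (card m * ‖X‖) := by gcongr; exact norm_trace_le X
    _ = _ := by field_simp

lemma fmap_le (h : Reg C Z Om) {x : ι → ℝ} (hx : 0 ≤ x) (i : ι) : fmap Z Om x i ≤ C ^ 2 := by
  refine (re_le_norm _).trans ((norm_inv_card_trace_le _).trans ?_)
  calc _ ≤ ‖Om i‖ * ‖thet Z Om x‖ := norm_mul_le _ _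
    _ ≤ C * C := by
      have := h.pos
      gcongr
      exacts [h.norm_Om i, norm_thet_le h hx]
    _ = _ := by ring

lemma le_fmap (h : Reg C Z Om) {x : ι → ℝ} (hx : 0 ≤ x) (i : ι) :
    C⁻¹ * (C + C ^ 2)⁻¹ ≤ fmap Z Om x i := by
  have hC := h.pos
  have h1 := trace_mul_le_trace_mul (h.Om_psd i) (smul_one_le_thet h hx)
  rw [mul_smul_comm, trace_smul, smul_eq_mul, Matrix.mul_one] at h1
  have h2 := (Complex.le_def.1 h1).1
  rw [re_ofReal_mul] at h2
  have h3 := trace_mul_le_trace_mul (PosSemidef.one (n := m) (R := ℂ)) (h.Om_ge i)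
  rw [Matrix.one_mul, Matrix.one_mul, trace_smul, trace_one] at h3
  have h4 := (Complex.le_def.1 h3).1
  rw [smul_eq_mul, re_ofReal_mul, Complex.natCast_re] at h4
  rw [fmap, inv_card_mul_re]
  have h5 := h.cardR_pos
  rw [inv_mul_eq_div, inv_mul_eq_div, le_div_iff₀ h5]
  calc (C + C ^ 2)⁻¹ / C * card m = (C + C ^ 2)⁻¹ * (C⁻¹ * card m) := by ring
    _ ≤ (C + C ^ 2)⁻¹ * (Om i).trace.re := by gcongr
    _ ≤ _ := h2

lemma thet_smul_le (h : Reg C Z Om) {y : ι → ℝ} {a Y : ℝ} (hy : 0 ≤ y) (hY : ∀ i, y i ≤ Y)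
    (hY0 : 0 ≤ Y) (ha : 1 ≤ a) :
    thet Z Om (a • y) ≤ ((a / (1 + (a - 1) / (1 + a * Y)) : ℝ) : ℂ) • thet Z Om y := by
  set t : ℝ := (1 + (a - 1) / (1 + a * Y)) / a with ht
  have ha0 : 0 < a := by linarith
  have hs : 0 ≤ (a - 1) / (1 + a * Y) := div_nonneg (by linarith) (by positivity)
  have ht0 : 0 < t := by positivity
  have ht1 : t ≤ 1 := by
    rw [ht, div_le_one ha0]
    have : (a - 1) / (1 + a * Y) ≤ a - 1 :=
      div_le_self (by linarith) (by nlinarith)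
    linarith
  have hay : 0 ≤ a • y := smul_nonneg ha0.le hy
  have h1 : (t : ℂ) • thetArg Z Om y ≤ thetArg Z Om (a • y) := by
    rw [thetArg_eq, thetArg_eq, smul_add, Finset.smul_sum]
    refine add_le_add ?_ (sum_le_sum fun j _ => ?_)
    · simpa using real_smul_mono h.Z_nonneg ht1
    · rw [smul_smul, ← ofReal_mul]
      refine real_smul_mono (h.Om_nonneg j) ?_
      have hj : 0 ≤ y j := hy j
      have hjY := hY j
      have hc := h.cardR_pos
      have h2 : t * (1 + y j)⁻¹ ≤ (1 + a * y j)⁻¹ := by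
        have h3 : (a - 1) / (1 + a * Y) ≤ (a - 1) / (1 + a * y j) := by
          have : 0 ≤ a - 1 := by linarith
          gcongr
        rw [← div_eq_mul_inv, div_le_iff₀ (by positivity), ht, div_le_iff₀ ha0]
        calc 1 + (a - 1) / (1 + a * Y) ≤ 1 + (a - 1) / (1 + a * y j) := by linarith
          _ = _ := by field_simp; ring
      calc t * ((card m : ℝ)⁻¹ * (1 + y j)⁻¹)
          = (card m : ℝ)⁻¹ * (t * (1 + y j)⁻¹) := by ring
        _ ≤ _ := by simp only [Pi.smul_apply, smul_eq_mul]; gcongr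
  have hpd : ((t : ℂ) • thetArg Z Om y).PosDef :=
    (thetArg_posDef h hy).smul (by exact_mod_cast ht0)
  have h2 := inv_le_inv_of_le hpd h1
  have h3 : ((t : ℂ) • thetArg Z Om y)⁻¹ = (t⁻¹ : ℂ) • (thetArg Z Om y)⁻¹ := by
    have hu : IsUnit (thetArg Z Om y).det :=
      (Matrix.isUnit_iff_isUnit_det _).1 (thetArg_posDef h hy).isUnit
    have := Matrix.inv_smul' (A := thetArg Z Om y) (Units.mk0 (t : ℂ) (by exact_mod_cast ht0.ne'))
      hu
    simpa [Units.smul_def] using this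
  rw [h3] at h2
  have h4 : a / (1 + (a - 1) / (1 + a * Y)) = t⁻¹ := by rw [ht, inv_div]
  rw [h4]
  push_cast
  exact h2

/-- Comparison of a sub- and a supersolution of the fundamental system. -/
lemma sub_le_super (h : Reg C Z Om) {x y : ι → ℝ} {p r Y : ℝ} (hx : ∀ i, 0 < x i)
    (hy : ∀ i, 0 < y i) (hY : ∀ i, y i ≤ Y) (hp : 0 < p)
    (hxf : ∀ i, x i ≤ p * fmap Z Om x i) (hyf : ∀ i, fmap Z Om y i ≤ r * y i) (hpr : 1 ≤ p * r)
    (i : ι) : x i * (1 - (p * r - 1) * Y) ≤ p * r * y i := by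
  have hne : (Finset.univ : Finset ι).Nonempty := ⟨i, mem_univ i⟩
  obtain ⟨k, -, hk⟩ := Finset.exists_max_image Finset.univ (fun i => x i / y i) hne
  set a := x k / y k with ha
  have hxa : ∀ i, x i ≤ a * y i := fun i => (div_le_iff₀ (hy i)).1 (hk i (mem_univ i))
  have hY0 : 0 < Y := (hy i).trans_le (hY i)
  have ha0 : 0 < a := div_pos (hx k) (hy k)
  have key : a * (1 - (p * r - 1) * Y) ≤ p * r := by
    by_cases ha1 : a ≤ 1
    · have h0 : 0 ≤ (p * r - 1) * Y := mul_nonneg (by linarith) hY0.le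
      nlinarith
    push Not at ha1
    have h1 := (fmap_mono h (fun i => (hx i).le) (y := a • y) hxa k).trans
      (fmap_le_mul h (thet_smul_le h (fun i => (hy i).le) hY hY0.le ha1.le) k)
    have hs : 0 ≤ (a - 1) / (1 + a * Y) := div_nonneg (by linarith) (by positivity)
    set w := 1 + (a - 1) / (1 + a * Y) with hw
    have hw0 : 0 < w := by positivity
    have h2 : a * y k ≤ p * (a / w * (r * y k)) := by
      calc a * y k = x k := by rw [ha, div_mul_cancel₀ _ (hy k).ne']
        _ ≤ p * fmap Z Om x k := hxf k
        _ ≤ p * (a / w * fmap Z Om y k) := by gcongr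
        _ ≤ _ := by gcongr; exact hyf k
    have h3 : w ≤ p * r := by
      have h4 : p * (a / w * (r * y k)) = (a * y k) * ((p * r) / w) := by ring
      rw [h4] at h2
      have h5 : 1 ≤ (p * r) / w := by
        by_contra hcon
        push Not at hcon
        have : 0 < a * y k := mul_pos ha0 (hy k)
        nlinarith
      rwa [one_le_div hw0] at h5
    have h6 : (a - 1) / (1 + a * Y) ≤ p * r - 1 := by linarith
    rw [div_le_iff₀ (by positivity)] at h6
    nlinarith
  by_cases hs : 0 ≤ 1 - (p * r - 1) * Y
  · calc x i * (1 - (p * r - 1) * Y) ≤ a * y i * (1 - (p * r - 1) * Y) := by gcongr; exact hxa i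
      _ = a * (1 - (p * r - 1) * Y) * y i := by ring
      _ ≤ _ := by gcongr; exact (hy i).le
  · push Not at hs
    have := hx i
    have := hy i
    have : 0 < p * r * y i := mul_pos (by linarith) (hy i)
    nlinarith

lemma fixed_unique (h : Reg C Z Om) {x y : ι → ℝ} (hx : ∀ i, 0 < x i) (hy : ∀ i, 0 < y i)
    (hxf : ∀ i, x i = fmap Z Om x i) (hyf : ∀ i, y i = fmap Z Om y i) : x = y := by
  have key : ∀ {x y : ι → ℝ}, (∀ i, 0 < x i) → (∀ i, 0 < y i) → (∀ i, x i = fmap Z Om x i) →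
      (∀ i, y i = fmap Z Om y i) → x ≤ y := fun {x y} hx hy hxf hyf i => by
    have := sub_le_super h (p := 1) (r := 1) (Y := C ^ 2) hx hy
      (fun i => (hyf i).le.trans (fmap_le h (fun i => (hy i).le) i)) one_pos
      (fun i => by simpa using (hxf i).le) (fun i => by simpa using (hyf i).ge) (by simp) i
    simpa using this
  exact le_antisymm (key hx hy hxf hyf) (key hy hx hyf hxf)

lemma fixed_exists (h : Reg C Z Om) : ∃ x : ι → ℝ, (∀ i, 0 < x i) ∧ ∀ i, x i = fmap Z Om x i := by
  have hle : (0 : ι → ℝ) ≤ fun _ => C ^ 2 := fun _ => sq_nonneg C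
  have _ : Fact ((0 : ι → ℝ) ≤ fun _ => C ^ 2) := ⟨hle⟩
  have hlow : 0 < C⁻¹ * (C + C ^ 2)⁻¹ := by have := h.pos; positivity
  let F : Set.Icc (0 : ι → ℝ) (fun _ => C ^ 2) →o Set.Icc (0 : ι → ℝ) (fun _ => C ^ 2) :=
    { toFun := fun x => ⟨fmap Z Om x.1, fun i => hlow.le.trans (le_fmap h x.2.1 i),
        fun i => fmap_le h x.2.1 i⟩
      monotone' := fun x y hxy i => fmap_mono h x.2.1 hxy i }
  have hF := F.map_lfp
  refine ⟨(OrderHom.lfp F).1, fun i => ?_, fun i => ?_⟩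
  · have h1 : fmap Z Om (OrderHom.lfp F).1 = (OrderHom.lfp F).1 := congrArg Subtype.val hF
    rw [← h1]
    exact hlow.trans_le (le_fmap h (OrderHom.lfp F).2.1 i)
  · exact (congrFun (congrArg Subtype.val hF) i).symm

/-- Stability of the fundamental system. -/
lemma fixed_stable {C : ℝ} (hC : 1 ≤ C) : ∃ C' : ℝ, 0 < C' ∧ ∀ {m ι : Type} [Fintype m] [DecidableEq m]
    [Fintype ι] [DecidableEq ι] {Z : Sq m} {Om : ι → Sq m}, Reg C Z Om →
    ∀ {x y : ι → ℝ} {η : ℝ}, (∀ i, 0 ≤ x i) → (∀ i, x i ≤ C ^ 2) → (∀ i, 0 < y i) →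
    (∀ i, y i = fmap Z Om y i) → (∀ i, |x i - fmap Z Om x i| ≤ η) →
    ∀ i, |x i - y i| ≤ C' * η := by
  have hC0 : 0 < C := by linarith
  set b := C⁻¹ * (C + C ^ 2)⁻¹ with hb
  have hb0 : 0 < b := by positivity
  refine ⟨16 * (1 + C ^ 2) * C ^ 2 / b, by positivity, ?_⟩
  intro m ι _ _ _ _ Z Om h x y η hx hxC hy hyf hxf i
  have hη : 0 ≤ η := (abs_nonneg _).trans (hxf i)
  have hyC : ∀ i, y i ≤ C ^ 2 := fun i => (hyf i).le.trans (fmap_le h (fun i => (hy i).le) i)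
  by_cases hbig : b < 4 * (1 + C ^ 2) * η
  · have h1 : |x i - y i| ≤ C ^ 2 := by
      rw [abs_le]; constructor <;> linarith [hx i, hxC i, (hy i).le, hyC i]
    refine h1.trans ?_
    rw [div_mul_eq_mul_div, le_div_iff₀ hb0]
    nlinarith [sq_nonneg C]
  push Not at hbig
  have hηb : η ≤ b / 2 := by nlinarith [sq_nonneg C]
  have hf : ∀ i, b ≤ fmap Z Om x i := fun i => le_fmap h hx i
  have hxb : ∀ i, b / 2 ≤ x i := fun i => by
    have := (abs_le.1 (hxf i)).1
    linarith [hf i]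
  have hx0 : ∀ i, 0 < x i := fun i => by linarith [hxb i]
  set e := 2 * η / b with he
  have he0 : 0 ≤ e := by positivity
  have heC : e * C ^ 2 ≤ 1 / 2 := by rw [he, div_mul_eq_mul_div, div_le_iff₀ hb0]; nlinarith
  have heb : e * b = 2 * η := by rw [he]; field_simp
  have h1 : ∀ i, x i ≤ (1 + e) * fmap Z Om x i := fun i => by
    have h2 := (abs_le.1 (hxf i)).2
    nlinarith [hf i]
  have h2 : ∀ i, fmap Z Om x i ≤ (1 + e) * x i := fun i => by
    have h2 := (abs_le.1 (hxf i)).1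
    nlinarith [hxb i]
  have h3 := sub_le_super h (p := 1 + e) (r := 1) hx0 hy hyC (by linarith) h1
    (fun i => by simpa using (hyf i).ge) (by linarith) i
  have h4 := sub_le_super h (p := 1) (r := 1 + e) hy hx0 hxC one_pos
    (fun i => by simpa using (hyf i).le) h2 (by linarith) i
  have hxi := hxC i
  have hyi := hyC i
  have h5 : 8 * (1 + C ^ 2) * C ^ 2 * e = 16 * (1 + C ^ 2) * C ^ 2 / b * η := by rw [he]; ring
  rw [← h5, abs_le]
  have e1 : e * x i ≤ e * C ^ 2 := by gcongr
  have e2 : e * y i ≤ e * C ^ 2 := by gcongr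
  have e3 : 0 ≤ e * C ^ 2 := by positivity
  have e4 : 0 ≤ e * C ^ 2 * C ^ 2 := by positivity
  have e5 : e * C ^ 2 * x i ≤ e * C ^ 2 * C ^ 2 := by gcongr
  have e6 : e * C ^ 2 * y i ≤ e * C ^ 2 * C ^ 2 := by gcongr
  constructor <;> nlinarith

end FixedPoint

section Resolvent

lemma nmul {m n p : Type} [Fintype m] [DecidableEq m] [Fintype n] [DecidableEq n] [Fintype p]
    [DecidableEq p] {A : Matrix m n ℂ} {B : Matrix n p ℂ} {a b : ℝ} (hA : ‖A‖ ≤ a) (hB : ‖B‖ ≤ b) :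
    ‖A * B‖ ≤ a * b :=
  (l2_opNorm_mul A B).trans
    (mul_le_mul hA hB (norm_nonneg _) ((norm_nonneg _).trans hA))

variable {m n ι : Type} [Fintype m] [DecidableEq m] [Fintype n] [DecidableEq n]
  [Fintype ι] [DecidableEq ι]

/-- `Z + N⁻¹ ∑_j y_j y_jᴴ`. -/
def resArg (Z : Sq m) (y : ι → m → ℂ) : Sq m :=
  Z + (card m : ℂ)⁻¹ • ∑ j, vecMulVec (y j) (star (y j))

/-- The resolvent `(Z + N⁻¹ ∑_j y_j y_jᴴ)⁻¹`. -/
def resolv (Z : Sq m) (y : ι → m → ℂ) : Sq m := (resArg Z y)⁻¹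

/-- The family with the `j`-th vector removed. -/
abbrev loo (y : ι → m → ℂ) (j : ι) : ι → m → ℂ := update y j 0

/-- `N⁻¹ y_jᴴ Q_j y_j` with the leave-one-out resolvent `Q_j`. -/
def qj (Z : Sq m) (y : ι → m → ℂ) (j : ι) : ℂ :=
  (card m : ℂ)⁻¹ * qf (y j) (resolv Z (loo y j)) (y j)

lemma resArg_eq_loo (Z : Sq m) (y : ι → m → ℂ) (j : ι) :
    resArg Z y = resArg Z (loo y j)
      + (card m : ℂ)⁻¹ • vecMulVec (y j) (star (y j)) := by
  unfold resArg
  rw [add_assoc, ← smul_add]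
  congr 2
  rw [← Finset.add_sum_erase _ _ (mem_univ j), add_comm]
  congr 1
  rw [← Finset.add_sum_erase _ _ (mem_univ j)]
  have h0 : vecMulVec (loo y j j) (star (loo y j j)) = 0 := by ext; simp [loo, vecMulVec_apply]
  rw [h0, zero_add]
  refine sum_congr rfl fun i hi => ?_
  rw [loo, Function.update_of_ne (Finset.ne_of_mem_erase hi)]

lemma vecMulVec_nonneg (u : m → ℂ) : 0 ≤ vecMulVec u (star u) :=
  nonneg_iff_posSemidef.2 (posSemidef_vecMulVec_self_star u)

lemma inv_card_nonneg : (0 : ℂ) ≤ (card m : ℂ)⁻¹ := by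
  rw [← ofReal_natCast, ← Complex.ofReal_inv]
  exact_mod_cast (inv_nonneg.2 (cast_nonneg _))

lemma Z_le_resArg (Z : Sq m) (y : ι → m → ℂ) : Z ≤ resArg Z y := by
  refine le_add_of_nonneg_right ?_
  refine nonneg_iff_posSemidef.2 (PosSemidef.smul (nonneg_iff_posSemidef.1
    (sum_nonneg fun j _ => vecMulVec_nonneg (y j))) inv_card_nonneg)

variable {C : ℝ} {Z : Sq m} {y : ι → m → ℂ}

lemma resArg_posDef (hC : 0 < C) (hZ : ((C⁻¹ : ℝ) : ℂ) • 1 ≤ Z) (y : ι → m → ℂ) :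
    (resArg Z y).PosDef :=
  posDef_of_smul_one_le (inv_pos.2 hC) (hZ.trans (Z_le_resArg Z y))

lemma resolv_posDef (hC : 0 < C) (hZ : ((C⁻¹ : ℝ) : ℂ) • 1 ≤ Z) (y : ι → m → ℂ) :
    (resolv Z y).PosDef := (resArg_posDef hC hZ y).inv

lemma norm_resolv_le (hC : 0 < C) (hZ : ((C⁻¹ : ℝ) : ℂ) • 1 ≤ Z) (y : ι → m → ℂ) :
    ‖resolv Z y‖ ≤ C := by
  simpa [resolv] using norm_inv_le (inv_pos.2 hC) (hZ.trans (Z_le_resArg Z y))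

lemma resArg_mul_resolv (hC : 0 < C) (hZ : ((C⁻¹ : ℝ) : ℂ) • 1 ≤ Z) (y : ι → m → ℂ) :
    resArg Z y * resolv Z y = 1 :=
  mul_nonsing_inv _ ((isUnit_iff_isUnit_det _).1 (resArg_posDef hC hZ y).isUnit)

lemma resolv_mul_resArg (hC : 0 < C) (hZ : ((C⁻¹ : ℝ) : ℂ) • 1 ≤ Z) (y : ι → m → ℂ) :
    resolv Z y * resArg Z y = 1 :=
  nonsing_inv_mul _ ((isUnit_iff_isUnit_det _).1 (resArg_posDef hC hZ y).isUnit)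

lemma resolv_herm (hC : 0 < C) (hZ : ((C⁻¹ : ℝ) : ℂ) • 1 ≤ Z) (y : ι → m → ℂ) :
    (resolv Z y)ᴴ = resolv Z y := (resolv_posDef hC hZ y).isHermitian

lemma qj_nonneg (hC : 0 < C) (hZ : ((C⁻¹ : ℝ) : ℂ) • 1 ≤ Z) (y : ι → m → ℂ) (j : ι) :
    0 ≤ qj Z y j :=
  mul_nonneg inv_card_nonneg ((resolv_posDef hC hZ _).posSemidef.dotProduct_mulVec_nonneg _)

lemma one_le_norm_one_add {z : ℂ} (hz : 0 ≤ z) : 1 ≤ ‖1 + z‖ := by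
  have h := Complex.le_def.1 hz
  calc (1 : ℝ) ≤ (1 + z).re := by simpa using h.1
    _ ≤ _ := re_le_norm _

lemma one_add_ne_zero {z : ℂ} (hz : 0 ≤ z) : 1 + z ≠ 0 := fun h => by
  have := one_le_norm_one_add hz
  rw [h, norm_zero] at this
  linarith

lemma norm_inv_one_add_le {z : ℂ} (hz : 0 ≤ z) : ‖(1 + z)⁻¹‖ ≤ 1 := by
  rw [norm_inv]; exact inv_le_one_of_one_le₀ (one_le_norm_one_add hz)

lemma star_of_nonneg {z : ℂ} (hz : 0 ≤ z) : star z = z := by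
  rw [RCLike.star_def, Complex.conj_eq_iff_im]
  exact (Complex.le_def.1 hz).2.symm

lemma norm_inv_sub_inv_le {z w : ℂ} (hz : 0 ≤ z) (hw : 0 ≤ w) :
    ‖(1 + z)⁻¹ - (1 + w)⁻¹‖ ≤ ‖z - w‖ := by
  have h1 := one_add_ne_zero hz
  have h2 := one_add_ne_zero hw
  have : (1 + z)⁻¹ - (1 + w)⁻¹ = (1 + z)⁻¹ * (1 + w)⁻¹ * (w - z) := by field_simp; ring
  rw [this, norm_mul, norm_mul, norm_sub_rev w z]
  calc _ ≤ 1 * 1 * ‖z - w‖ := by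
        gcongr
        exacts [norm_inv_one_add_le hz, norm_inv_one_add_le hw]
    _ = _ := by ring

/-- Sherman–Morrison, applied to the removed vector. -/
lemma resolv_mulVec (hC : 0 < C) (hZ : ((C⁻¹ : ℝ) : ℂ) • 1 ≤ Z) (y : ι → m → ℂ) (j : ι) :
    resolv Z y *ᵥ y j = (1 + qj Z y j)⁻¹ • (resolv Z (loo y j) *ᵥ y j) := by
  have h1 : resArg Z y *ᵥ (resolv Z (loo y j) *ᵥ y j) = (1 + qj Z y j) • y j := by
    rw [resArg_eq_loo Z y j, add_mulVec, mulVec_mulVec, resArg_mul_resolv hC hZ, one_mulVec,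
      smul_mulVec, vecMulVec_mulVec, add_smul, one_smul]
    congr 1
    ext i
    simp [qj, qf, mul_comm, mul_left_comm]
  have h2 := congrArg (fun v => resolv Z y *ᵥ v) h1
  simp only [mulVec_mulVec, mulVec_smul] at h2
  rw [← Matrix.mul_assoc, resolv_mul_resArg hC hZ, Matrix.one_mul] at h2
  rw [h2, smul_smul, inv_mul_cancel₀ (one_add_ne_zero (qj_nonneg hC hZ y j)), one_smul]

lemma qf_mul_right (u : n → ℂ) (X : Matrix n m ℂ) (Y : Sq m) (v : m → ℂ) :
    qf u (X * Y) v = qf u X (Y *ᵥ v) := by rw [qf, qf, mulVec_mulVec]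

lemma qf_smul_right (c : ℂ) (u : n → ℂ) (X : Matrix n m ℂ) (v : m → ℂ) :
    qf u X (c • v) = c * qf u X v := by simp [qf, mulVec_smul]

lemma qf_mul_resolv (hC : 0 < C) (hZ : ((C⁻¹ : ℝ) : ℂ) • 1 ≤ Z) (y : ι → m → ℂ) (j : ι)
    (u : n → ℂ) (X : Matrix n m ℂ) :
    qf u (X * resolv Z y) (y j) = (1 + qj Z y j)⁻¹ * qf u (X * resolv Z (loo y j)) (y j) := by
  rw [qf_mul_right, resolv_mulVec hC hZ, qf_smul_right, qf_mul_right]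

lemma qf_resolv_mul (hC : 0 < C) (hZ : ((C⁻¹ : ℝ) : ℂ) • 1 ≤ Z) (y : ι → m → ℂ) (j : ι)
    (X : Matrix m n ℂ) (v : n → ℂ) :
    qf (y j) (resolv Z y * X) v = (1 + qj Z y j)⁻¹ * qf (y j) (resolv Z (loo y j) * X) v := by
  have h := congrArg star (qf_mul_resolv hC hZ y j v Xᴴ)
  rw [star_qf, star_mul', star_qf, conjTranspose_mul, conjTranspose_mul, conjTranspose_conjTranspose,
    resolv_herm hC hZ, resolv_herm hC hZ] at h
  rw [h, star_inv₀, star_of_nonneg (add_nonneg zero_le_one (qj_nonneg hC hZ y j))]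

lemma resolv_eq_loo (hC : 0 < C) (hZ : ((C⁻¹ : ℝ) : ℂ) • 1 ≤ Z) (y : ι → m → ℂ) (j : ι) :
    resolv Z y = resolv Z (loo y j) - ((card m : ℂ)⁻¹ * (1 + qj Z y j)⁻¹) •
      (resolv Z (loo y j) * vecMulVec (y j) (star (y j)) * resolv Z (loo y j)) := by
  have h1 : resolv Z y * (resArg Z y - resArg Z (loo y j)) * resolv Z (loo y j)
      = resolv Z (loo y j) - resolv Z y := by
    rw [Matrix.mul_sub, resolv_mul_resArg hC hZ, Matrix.sub_mul, Matrix.one_mul, Matrix.mul_assoc,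
      resArg_mul_resolv hC hZ, Matrix.mul_one]
  rw [resArg_eq_loo Z y j, add_sub_cancel_left, mul_smul_comm, mul_vecMulVec,
    resolv_mulVec hC hZ, smul_vecMulVec, smul_smul, ← mul_vecMulVec, smul_mul_assoc] at h1
  rw [h1]; abel

lemma norm_trace_resolv_sub_le (hC : 0 < C) (hZ : ((C⁻¹ : ℝ) : ℂ) • 1 ≤ Z) (hcard : 0 < card m)
    (y : ι → m → ℂ) (j : ι) (hy : nrm (y j) ^ 2 ≤ C * card m) (X : Sq m) :
    ‖(X * resolv Z y).trace - (X * resolv Z (loo y j)).trace‖ ≤ C ^ 3 * ‖X‖ := by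
  have hcard' : (0 : ℝ) < card m := by exact_mod_cast hcard
  rw [resolv_eq_loo hC hZ y j, Matrix.mul_sub, trace_sub, sub_sub_cancel_left, norm_neg,
    mul_smul_comm, trace_smul, ← Matrix.mul_assoc, trace_mul_comm, ← Matrix.mul_assoc,
    ← Matrix.mul_assoc, trace_mul_vecMulVec, norm_smul, norm_mul]
  have h1 := norm_qf_le (y j) (resolv Z (loo y j) * X * resolv Z (loo y j)) (y j)
  have h2 : ‖resolv Z (loo y j) * X * resolv Z (loo y j)‖ ≤ C * ‖X‖ * C := by
    refine (norm_mul_le _ _).trans ?_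
    gcongr
    · refine (norm_mul_le _ _).trans ?_
      gcongr
      exact norm_resolv_le hC hZ _
    · exact norm_resolv_le hC hZ _
  have h3 := norm_inv_one_add_le (qj_nonneg hC hZ y j)
  calc _ ≤ ‖(card m : ℂ)⁻¹‖ * 1 * (C * ‖X‖ * C * (C * card m)) := by
        gcongr
        refine h1.trans ?_
        rw [mul_assoc, ← sq]
        gcongr
    _ = C ^ 3 * ‖X‖ := by rw [norm_inv, norm_natCast]; field_simp

/-- `N⁻¹ Re Tr Ω_i Q`. -/
def dhat (Z : Sq m) (Om : ι → Sq m) (y : ι → m → ℂ) (i : ι) : ℝ :=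
  ((card m : ℂ)⁻¹ * (Om i * resolv Z y).trace).re

variable {Om : ι → Sq m}

lemma dhat_nonneg' (h : Reg C Z Om) (y : ι → m → ℂ) (i : ι) :
    0 ≤ (card m : ℂ)⁻¹ * (Om i * resolv Z y).trace :=
  mul_nonneg inv_card_nonneg (trace_mul_nonneg (h.Om_psd i) (resolv_posDef h.pos h.Z_ge y).posSemidef)

lemma dhat_eq (h : Reg C Z Om) (y : ι → m → ℂ) (i : ι) :
    ((dhat Z Om y i : ℝ) : ℂ) = (card m : ℂ)⁻¹ * (Om i * resolv Z y).trace :=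
  Complex.ext rfl (Complex.le_def.1 (dhat_nonneg' h y i)).2

lemma dhat_nonneg (h : Reg C Z Om) (y : ι → m → ℂ) : 0 ≤ dhat Z Om y :=
  fun i => (Complex.le_def.1 (dhat_nonneg' h y i)).1

lemma dhat_le (h : Reg C Z Om) (y : ι → m → ℂ) (i : ι) : dhat Z Om y i ≤ C ^ 2 := by
  refine (re_le_norm _).trans ((norm_inv_card_trace_le _).trans ?_)
  calc _ ≤ ‖Om i‖ * ‖resolv Z y‖ := norm_mul_le _ _
    _ ≤ C * C := by
      have := h.pos
      gcongr
      exacts [h.norm_Om i, norm_resolv_le h.pos h.Z_ge y]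
    _ = _ := by ring

lemma ofReal_nonneg {x : ℝ} (hx : 0 ≤ x) : (0 : ℂ) ≤ (x : ℂ) := by exact_mod_cast hx

lemma norm_thet_sub_le (h : Reg C Z Om) {x z : ι → ℝ} (hx : 0 ≤ x) (hz : 0 ≤ z) {η : ℝ}
    (hη : 0 ≤ η) (hxz : ∀ i, |x i - z i| ≤ η) : ‖thet Z Om x - thet Z Om z‖ ≤ C ^ 4 * η := by
  have hCp := h.pos
  have hux : IsUnit (thetArg Z Om x).det := (isUnit_iff_isUnit_det _).1 (thetArg_posDef h hx).isUnit
  have huz : IsUnit (thetArg Z Om z).det := (isUnit_iff_isUnit_det _).1 (thetArg_posDef h hz).isUnit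
  have h1 : thet Z Om x * (thetArg Z Om z - thetArg Z Om x) * thet Z Om z
      = thet Z Om x - thet Z Om z := by
    rw [Matrix.mul_sub, Matrix.sub_mul, Matrix.mul_assoc, thet, thet, mul_nonsing_inv _ huz,
      nonsing_inv_mul _ hux, Matrix.mul_one, Matrix.one_mul]
  have h2 : ‖thetArg Z Om z - thetArg Z Om x‖ ≤ C ^ 2 * η := by
    have h3 : thetArg Z Om z - thetArg Z Om x = (card m : ℂ)⁻¹ •
        ∑ j, ((1 + (z j : ℂ))⁻¹ - (1 + (x j : ℂ))⁻¹) • Om j := by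
      simp only [thetArg, sub_smul, sum_sub_distrib, smul_sub]; abel
    rw [h3, norm_smul, norm_inv, norm_natCast]
    have h4 : ‖∑ j, ((1 + (z j : ℂ))⁻¹ - (1 + (x j : ℂ))⁻¹) • Om j‖
        ≤ ∑ _j : ι, η * C := by
      refine (norm_sum_le _ _).trans (sum_le_sum fun j _ => ?_)
      rw [norm_smul]
      gcongr
      · refine (norm_inv_sub_inv_le (ofReal_nonneg (hz j)) (ofReal_nonneg (hx j))).trans ?_
        rw [← Complex.ofReal_sub, norm_real, Real.norm_eq_abs, abs_sub_comm]
        exact hxz j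
      · exact h.norm_Om j
    rw [Finset.sum_const, Finset.card_univ, nsmul_eq_mul] at h4
    have h5 := h.cardR_pos
    calc _ ≤ (card m : ℝ)⁻¹ * ((C * card m) * (η * C)) := by
          gcongr
          refine h4.trans ?_
          have := h.card_le
          gcongr
      _ = _ := by field_simp
  rw [← h1]
  calc _ ≤ ‖thet Z Om x‖ * ‖thetArg Z Om z - thetArg Z Om x‖ * ‖thet Z Om z‖ :=
        (norm_mul_le _ _).trans (by gcongr; exact norm_mul_le _ _)
    _ ≤ C * (C ^ 2 * η) * C := by gcongr; exacts [norm_thet_le h hx, norm_thet_le h hz]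
    _ = _ := by ring

/-- Closeness of a quadratic form to its expected value. -/
def QuadNear (ε N : ℝ) (u : m → ℂ) (X : Matrix m n ℂ) (v : n → ℂ) (W : Matrix n m ℂ) : Prop :=
  ‖qf u X v - (X * W).trace‖ ≤ ε * N * ‖X‖

lemma QuadNear.div {ε N : ℝ} (hN : 0 < N) {u : m → ℂ} {X : Matrix m n ℂ} {v : n → ℂ}
    {W : Matrix n m ℂ} (h : QuadNear ε N u X v W) :
    ‖(N : ℂ)⁻¹ * qf u X v - (N : ℂ)⁻¹ * (X * W).trace‖ ≤ ε * ‖X‖ := by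
  rw [← mul_sub, norm_mul, norm_inv, norm_real, norm_of_nonneg hN.le]
  calc _ ≤ N⁻¹ * (ε * N * ‖X‖) := by gcongr; exact h
    _ = _ := by field_simp

lemma norm_qj_sub_dhat_le (h : Reg C Z Om) {ε : ℝ} (y : ι → m → ℂ) (j : ι)
    (hy : nrm (y j) ^ 2 ≤ C * card m) (hε : (card m : ℝ)⁻¹ ≤ ε)
    (hQ : QuadNear ε (card m) (y j) (resolv Z (loo y j)) (y j) (Om j)) :
    ‖qj Z y j - dhat Z Om y j‖ ≤ 2 * C ^ 4 * ε := by
  have hCp := h.pos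
  have hC1 := h.one_le
  have hN := h.cardR_pos
  have hε0 : 0 ≤ ε := (inv_nonneg.2 hN.le).trans hε
  have h1 := hQ.div hN
  have h2 := norm_trace_resolv_sub_le h.pos h.Z_ge h.card_pos y j hy (Om j)
  have h3 : ‖(card m : ℂ)⁻¹ * (resolv Z (loo y j) * Om j).trace - dhat Z Om y j‖
      ≤ C ^ 4 * ε := by
    rw [dhat_eq h, trace_mul_comm, ← mul_sub, norm_mul, norm_inv, norm_natCast,
      norm_sub_rev]
    calc _ ≤ ε * (C ^ 3 * C) := by
          gcongr
          exact h2.trans (by gcongr; exact h.norm_Om j)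
      _ = _ := by ring
  rw [ofReal_natCast] at h1
  have h4 : ε * ‖resolv Z (loo y j)‖ ≤ C ^ 4 * ε := by
    rw [mul_comm]
    gcongr
    exact (norm_resolv_le h.pos h.Z_ge _).trans (le_self_pow₀ hC1 (by norm_num))
  have h5 := norm_sub_le_norm_sub_add_norm_sub (qj Z y j)
    ((card m : ℂ)⁻¹ * (resolv Z (loo y j) * Om j).trace) (dhat Z Om y j)
  unfold qj at *
  linarith

lemma resolv_sub_thet (h : Reg C Z Om) {x : ι → ℝ} (hx : 0 ≤ x) (y : ι → m → ℂ) :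
    resolv Z y - thet Z Om x = thet Z Om x * ((card m : ℂ)⁻¹ • ∑ j,
      ((1 + (x j : ℂ))⁻¹ • Om j - vecMulVec (y j) (star (y j)))) * resolv Z y := by
  have hux : IsUnit (thetArg Z Om x).det := (isUnit_iff_isUnit_det _).1 (thetArg_posDef h hx).isUnit
  have h1 : thet Z Om x * (thetArg Z Om x - resArg Z y) * resolv Z y
      = resolv Z y - thet Z Om x := by
    rw [Matrix.mul_sub, Matrix.sub_mul, Matrix.mul_assoc (thet Z Om x) (resArg Z y),
      resArg_mul_resolv h.pos h.Z_ge, thet, nonsing_inv_mul _ hux, Matrix.mul_one, Matrix.one_mul]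
  rw [← h1, thetArg, resArg, add_sub_add_left_eq_sub, ← smul_sub, sum_sub_distrib]

lemma norm_inv_card_sum_le (h : Reg C Z Om) {f : ι → ℂ} {η : ℝ} (hη : 0 ≤ η)
    (hf : ∀ j, ‖f j‖ ≤ η) : ‖(card m : ℂ)⁻¹ * ∑ j, f j‖ ≤ C * η := by
  have hN := h.cardR_pos
  rw [norm_mul, norm_inv, norm_natCast]
  calc _ ≤ (card m : ℝ)⁻¹ * (card ι * η) := by
        gcongr
        refine (norm_sum_le _ _).trans ?_
        simpa using sum_le_sum (s := Finset.univ) fun j _ => hf j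
    _ ≤ (card m : ℝ)⁻¹ * ((C * card m) * η) := by gcongr; exact h.card_le
    _ = _ := by field_simp

lemma norm_inv_card_qf_le (hcard : 0 < card m) {y : m → ℂ}
    (hy : nrm y ^ 2 ≤ C * card m) (X : Sq m) :
    ‖(card m : ℂ)⁻¹ * qf y X y‖ ≤ C * ‖X‖ := by
  have hN : (0 : ℝ) < card m := by exact_mod_cast hcard
  rw [norm_mul, norm_inv, norm_natCast]
  calc _ ≤ (card m : ℝ)⁻¹ * (‖X‖ * (C * card m)) := by
        gcongr
        refine (norm_qf_le _ _ _).trans ?_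
        rw [mul_assoc, ← sq]
        gcongr
    _ = _ := by field_simp

/-- One step of the first order deterministic equivalent. -/
lemma first_order_step (h : Reg C Z Om) {ε η κ : ℝ} {x : ι → ℝ} (hx : 0 ≤ x) {y : ι → m → ℂ}
    (hy : ∀ j, nrm (y j) ^ 2 ≤ C * card m) (hε : (card m : ℝ)⁻¹ ≤ ε)
    (hQ : ∀ j, QuadNear ε (card m) (y j) (resolv Z (loo y j)) (y j) (Om j))
    (hd : ∀ j, |dhat Z Om y j - x j| ≤ η) (a : Sq m) (T : ι → Sq m)
    (hT : ∀ j, ‖T j‖ ≤ C) (hκ : 0 ≤ κ) (hη : 0 ≤ η)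
    (hTx : ∀ j, ‖T j - thet Z Om x‖ ≤ κ)
    (hA : ∀ j, QuadNear ε (card m) (y j) (resolv Z (loo y j) * a * T j) (y j) (Om j)) :
    ‖(card m : ℂ)⁻¹ * (a * resolv Z y).trace
      - (card m : ℂ)⁻¹ * (a * thet Z Om x).trace‖
      ≤ (6 * C ^ 8 * ε + C ^ 4 * η + 2 * C ^ 3 * κ) * ‖a‖ := by
  have hCp := h.pos
  have hC1 := h.one_le
  have hN := h.cardR_pos
  have hε0 : 0 ≤ ε := (inv_nonneg.2 hN.le).trans hε
  set Θ := thet Z Om x with hΘ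
  have hΘn : ‖Θ‖ ≤ C := norm_thet_le h hx
  set c : ℂ := (card m : ℂ)⁻¹ with hc
  have hcn : ‖c‖ = (card m : ℝ)⁻¹ := by rw [hc, norm_inv, norm_natCast]
  have key : c * (a * resolv Z y).trace - c * (a * Θ).trace = c * ∑ j,
      ((1 + (x j : ℂ))⁻¹ * (c * (a * Θ * Om j * resolv Z y).trace)
        - c * qf (y j) (resolv Z y * (a * Θ)) (y j)) := by
    rw [← mul_sub, ← trace_sub, ← Matrix.mul_sub, resolv_sub_thet h hx]
    congr 1
    rw [mul_smul_comm, Matrix.mul_sum, smul_mul_assoc, Matrix.sum_mul, mul_smul_comm,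
      Matrix.mul_sum, trace_smul, trace_sum, smul_eq_mul, Finset.mul_sum]
    refine sum_congr rfl fun j _ => ?_
    have e1 : a * (Θ * ((1 + (x j : ℂ))⁻¹ • Om j - vecMulVec (y j) (star (y j))) * resolv Z y)
        = (1 + (x j : ℂ))⁻¹ • (a * Θ * Om j * resolv Z y)
          - a * Θ * vecMulVec (y j) (star (y j)) * resolv Z y := by
      simp only [Matrix.mul_sub, Matrix.sub_mul, mul_smul_comm, smul_mul_assoc, Matrix.mul_assoc]
    rw [e1, trace_sub, trace_smul, smul_eq_mul, trace_mul_comm (a * Θ * vecMulVec _ _),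
      ← Matrix.mul_assoc, trace_mul_vecMulVec]
    ring
  rw [key]
  have hbound : ∀ j, ‖(1 + (x j : ℂ))⁻¹ * (c * (a * Θ * Om j * resolv Z y).trace)
        - c * qf (y j) (resolv Z y * (a * Θ)) (y j)‖
        ≤ (4 * C ^ 7 * ε + C ^ 3 * η + 2 * C ^ 2 * κ) * ‖a‖ := by
    intro j
    set Q := resolv Z (loo y j) with hQdef
    have hQn : ‖Q‖ ≤ C := norm_resolv_le h.pos h.Z_ge _
    set t := c * (a * Θ * Om j * resolv Z y).trace with ht
    set u := c * qf (y j) (Q * (a * Θ)) (y j) with hu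
    have e0 : c * qf (y j) (resolv Z y * (a * Θ)) (y j) = (1 + qj Z y j)⁻¹ * u := by
      rw [qf_resolv_mul h.pos h.Z_ge, hu]; ring
    have b1 : ‖u - c * qf (y j) (Q * a * T j) (y j)‖ ≤ C * (C * ‖a‖ * κ) := by
      rw [hu, ← mul_sub, ← qf_sub, ← Matrix.mul_assoc, ← Matrix.mul_sub]
      refine (norm_inv_card_qf_le h.card_pos (hy j) _).trans ?_
      gcongr
      refine nmul (nmul hQn le_rfl) ?_
      rw [norm_sub_rev]; exact hTx j
    have b2 : ‖c * qf (y j) (Q * a * T j) (y j) - c * (Q * a * T j * Om j).trace‖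
        ≤ ε * (C * ‖a‖ * C) := by
      have := (hA j).div hN
      rw [ofReal_natCast] at this
      refine this.trans ?_
      gcongr
      exact nmul (nmul hQn le_rfl) (hT j)
    have b3 : ‖c * (Q * a * T j * Om j).trace - c * (Q * a * Θ * Om j).trace‖
        ≤ C * ‖a‖ * κ * C := by
      rw [← mul_sub, ← trace_sub, ← Matrix.sub_mul, ← Matrix.mul_sub]
      exact (norm_inv_card_trace_le _).trans (nmul (nmul (nmul hQn le_rfl) (hTx j)) (h.norm_Om j))
    have b4 : ‖t - c * (Q * a * Θ * Om j).trace‖ ≤ ε * (C ^ 3 * (‖a‖ * C * C)) := by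
      have e1 : (Q * a * Θ * Om j).trace = (a * Θ * Om j * Q).trace := by
        rw [Matrix.mul_assoc, Matrix.mul_assoc, trace_mul_comm]
        simp only [Matrix.mul_assoc]
      rw [ht, e1, ← mul_sub, norm_mul, hcn]
      have := norm_trace_resolv_sub_le h.pos h.Z_ge h.card_pos y j (hy j) (a * Θ * Om j)
      gcongr
      refine this.trans ?_
      gcongr
      exact nmul (nmul le_rfl hΘn) (h.norm_Om j)
    have b5 : ‖u‖ ≤ C * (C * (‖a‖ * C)) :=
      (norm_inv_card_qf_le h.card_pos (hy j) _).trans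
        (by gcongr; exact nmul hQn (nmul le_rfl hΘn))
    have b6 : ‖(1 + (x j : ℂ))⁻¹ - (1 + qj Z y j)⁻¹‖ ≤ η + 2 * C ^ 4 * ε := by
      refine (norm_inv_sub_inv_le (ofReal_nonneg (hx j)) (qj_nonneg h.pos h.Z_ge y j)).trans ?_
      have h1 := norm_qj_sub_dhat_le h y j (hy j) hε (hQ j)
      have h2 : ‖(x j : ℂ) - dhat Z Om y j‖ ≤ η := by
        rw [← Complex.ofReal_sub, norm_real, Real.norm_eq_abs, abs_sub_comm]; exact hd j
      have h3 := norm_sub_le_norm_sub_add_norm_sub (x j : ℂ) (dhat Z Om y j) (qj Z y j)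
      rw [norm_sub_rev (dhat Z Om y j : ℂ)] at h3
      linarith
    have b7 : ‖t - u‖ ≤ (2 * C ^ 5 * ε + 2 * C ^ 2 * κ) * ‖a‖ := by
      have e1 : t - u = (t - c * (Q * a * Θ * Om j).trace)
          - (c * (Q * a * T j * Om j).trace - c * (Q * a * Θ * Om j).trace)
          - (c * qf (y j) (Q * a * T j) (y j) - c * (Q * a * T j * Om j).trace)
          - (u - c * qf (y j) (Q * a * T j) (y j)) := by ring
      have e2 : C ^ 2 * (ε * ‖a‖) ≤ C ^ 5 * (ε * ‖a‖) := by
        gcongr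
        · norm_num
      rw [e1]
      refine (norm_sub_le _ _).trans ((add_le_add_left ((norm_sub_le _ _).trans
        (add_le_add_left (norm_sub_le _ _) _)) _).trans ?_)
      nlinarith
    have e1 : (1 + (x j : ℂ))⁻¹ * t - (1 + qj Z y j)⁻¹ * u
        = (1 + (x j : ℂ))⁻¹ * (t - u) + ((1 + (x j : ℂ))⁻¹ - (1 + qj Z y j)⁻¹) * u := by ring
    rw [e0, e1]
    calc _ ≤ 1 * ((2 * C ^ 5 * ε + 2 * C ^ 2 * κ) * ‖a‖)
          + (η + 2 * C ^ 4 * ε) * (C * (C * (‖a‖ * C))) := by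
          refine (norm_add_le _ _).trans (add_le_add ?_ ?_)
          · rw [norm_mul]
            gcongr
            exact norm_inv_one_add_le (ofReal_nonneg (hx j))
          · rw [norm_mul]; gcongr
      _ ≤ _ := by
          have e2 : C ^ 5 * (ε * ‖a‖) ≤ C ^ 7 * (ε * ‖a‖) := by
            gcongr
            · norm_num
          nlinarith
  refine (norm_inv_card_sum_le h (by positivity) hbound).trans ?_
  have e2 : 0 ≤ C ^ 8 * (ε * ‖a‖) := by positivity
  nlinarith

lemma abs_dhat_sub_loo_le (h : Reg C Z Om) {ε : ℝ} (y : ι → m → ℂ) (j : ι)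
    (hy : nrm (y j) ^ 2 ≤ C * card m) (hε : (card m : ℝ)⁻¹ ≤ ε) (i : ι) :
    |dhat Z Om y i - dhat Z Om (loo y j) i| ≤ C ^ 4 * ε := by
  have hCp := h.pos
  have hN := h.cardR_pos
  rw [← Real.norm_eq_abs, ← norm_real, Complex.ofReal_sub, dhat_eq h, dhat_eq h, ← mul_sub,
    norm_mul, norm_inv, norm_natCast]
  have h2 := norm_trace_resolv_sub_le h.pos h.Z_ge h.card_pos y j hy (Om i)
  have hε0 : 0 ≤ ε := (inv_nonneg.2 hN.le).trans hε
  calc _ ≤ ε * (C ^ 3 * C) := by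
        gcongr
        exact h2.trans (by gcongr; exact h.norm_Om i)
    _ = _ := by ring

/-- The normalized traces `N⁻¹ Tr Ω_i Q` are close to the solution of the fundamental system. -/
lemma dhat_near {C : ℝ} (hC : 1 ≤ C) : ∃ C' : ℝ, 0 < C' ∧ ∀ {m ι : Type} [Fintype m]
    [DecidableEq m] [Fintype ι] [DecidableEq ι] {Z : Sq m} {Om : ι → Sq m},
    Reg C Z Om → ∀ {ε : ℝ} {y : ι → m → ℂ} {δ : ι → ℝ},
    (∀ j, nrm (y j) ^ 2 ≤ C * card m) → (card m : ℝ)⁻¹ ≤ ε →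
    (∀ j, QuadNear ε (card m) (y j) (resolv Z (loo y j)) (y j) (Om j)) →
    (∀ i j, QuadNear ε (card m) (y j)
      (resolv Z (loo y j) * Om i * thet Z Om (dhat Z Om (loo y j))) (y j) (Om j)) →
    (∀ i, 0 < δ i) → (∀ i, δ i = fmap Z Om δ i) → ∀ i, |dhat Z Om y i - δ i| ≤ C' * ε := by
  obtain ⟨C₁, hC₁, hstab⟩ := fixed_stable hC
  have hC0 : 0 < C := by linarith
  refine ⟨C₁ * ((6 * C ^ 8 + 2 * C ^ 3 * (C ^ 4 * C ^ 4)) * C), by positivity, ?_⟩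
  intro m ι _ _ _ _ Z Om h ε y δ hy hε hQ hA hδ hδf i
  have hN := h.cardR_pos
  have hε0 : 0 ≤ ε := (inv_nonneg.2 hN.le).trans hε
  have key : ∀ i, |dhat Z Om y i - fmap Z Om (dhat Z Om y) i|
      ≤ (6 * C ^ 8 + 2 * C ^ 3 * (C ^ 4 * C ^ 4)) * C * ε := by
    intro i
    have h1 := first_order_step h (η := 0) (κ := C ^ 4 * (C ^ 4 * ε)) (dhat_nonneg h y) hy hε hQ
      (fun j => by simp) (Om i) (fun j => thet Z Om (dhat Z Om (loo y j)))
      (fun j => norm_thet_le h (dhat_nonneg h _)) (by positivity) le_rfl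
      (fun j => norm_thet_sub_le h (dhat_nonneg h _) (dhat_nonneg h _) (by positivity) fun i => by
        rw [abs_sub_comm]; exact abs_dhat_sub_loo_le h y j (hy j) hε i) (hA i)
    rw [← dhat_eq h, ← fmap_eq h (dhat_nonneg h y), ← Complex.ofReal_sub, norm_real,
      Real.norm_eq_abs] at h1
    refine h1.trans ?_
    calc _ ≤ (6 * C ^ 8 * ε + C ^ 4 * 0 + 2 * C ^ 3 * (C ^ 4 * (C ^ 4 * ε))) * C := by
          gcongr; exact h.norm_Om i
      _ = _ := by ring
  have := hstab h (dhat_nonneg h y) (dhat_le h y) hδ hδf key i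
  rwa [← mul_assoc] at this

/-- First order deterministic equivalent. -/
lemma first_order (h : Reg C Z Om) {ε η : ℝ} {δ : ι → ℝ} (hδ : 0 ≤ δ) {y : ι → m → ℂ}
    (hy : ∀ j, nrm (y j) ^ 2 ≤ C * card m) (hε : (card m : ℝ)⁻¹ ≤ ε)
    (hQ : ∀ j, QuadNear ε (card m) (y j) (resolv Z (loo y j)) (y j) (Om j))
    (hη : 0 ≤ η) (hd : ∀ j, |dhat Z Om y j - δ j| ≤ η) (a : Sq m)
    (hA : ∀ j, QuadNear ε (card m) (y j) (resolv Z (loo y j) * a * thet Z Om δ) (y j)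
      (Om j)) :
    ‖(card m : ℂ)⁻¹ * (a * resolv Z y).trace
      - (card m : ℂ)⁻¹ * (a * thet Z Om δ).trace‖
      ≤ (6 * C ^ 8 * ε + C ^ 4 * η) * ‖a‖ := by
  simpa using first_order_step h (κ := 0) hδ hy hε hQ hd a (fun _ => thet Z Om δ)
    (fun _ => norm_thet_le h hδ) le_rfl hη (fun j => by simp) hA

end Resolvent

section SecondOrder

variable {m m' s ι : Type} [Fintype m] [DecidableEq m] [Fintype m'] [DecidableEq m']
  [Fintype s] [DecidableEq s] [Fintype ι] [DecidableEq ι]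

/-- Two clusters whose vectors have the factors `G_j`, `G'_j` and the cross-covariances
`Ω_j^× = G_j G'_jᴴ`. -/
structure PairReg (C : ℝ) (Z : Sq m) (Om : ι → Sq m) (Z' : Sq m')
    (Om' : ι → Sq m') (Ox : ι → Matrix m m' ℂ) (G : ι → Matrix m s ℂ)
    (G' : ι → Matrix m' s ℂ) : Prop where
  reg : Reg C Z Om
  reg' : Reg C Z' Om'
  card_le : (card m : ℝ) ≤ C * card m'
  card_le' : (card m' : ℝ) ≤ C * card m
  norm_Ox : ∀ j, ‖Ox j‖ ≤ C
  Om_eq : ∀ j, Om j = G j * (G j)ᴴ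
  Om_eq' : ∀ j, Om' j = G' j * (G' j)ᴴ
  Ox_eq : ∀ j, Ox j = G j * (G' j)ᴴ

/-- Concentration events at one pair `(a, b)` for the second order equivalent. -/
structure PairEvent (ε : ℝ) (Z : Sq m) (Om : ι → Sq m) (Z' : Sq m')
    (Om' : ι → Sq m') (Ox : ι → Matrix m m' ℂ) (y : ι → m → ℂ) (y' : ι → m' → ℂ)
    (δ δ' : ι → ℝ) (a : Matrix m' m ℂ) (b : Matrix m m' ℂ) : Prop where
  quad : ∀ j, QuadNear ε (card m) (y j)
    (resolv Z (loo y j) * b * resolv Z' (loo y' j) * a * thet Z Om δ) (y j) (Om j)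
  quad₁ : ∀ j, QuadNear ε (card m) (y j)
    (resolv Z (loo y j) * b * resolv Z' (loo y' j)) (y' j) (Ox j)ᴴ
  quad₂ : ∀ j, QuadNear ε (card m) (y' j)
    (resolv Z' (loo y' j) * a * thet Z Om δ) (y j) (Ox j)
  first : ‖(card m' : ℂ)⁻¹ * (a * thet Z Om δ * b * resolv Z' y').trace
    - (card m' : ℂ)⁻¹ * (a * thet Z Om δ * b * thet Z' Om' δ').trace‖ ≤ ε
  first₁ : ∀ j, ‖(card m' : ℂ)⁻¹ * (a * thet Z Om δ * Ox j * resolv Z' y').trace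
    - (card m' : ℂ)⁻¹ * (a * thet Z Om δ * Ox j * thet Z' Om' δ').trace‖ ≤ ε

/-- Concentration events that do not depend on test matrices. -/
structure BaseEvent (C ε : ℝ) (Z : Sq m) (y : ι → m → ℂ) (δ : ι → ℝ) : Prop where
  nrm_le : ∀ j, nrm (y j) ^ 2 ≤ C * card m
  eps : (card m : ℝ)⁻¹ ≤ ε
  pos : 0 ≤ δ
  qj_near : ∀ j, ‖qj Z y j - δ j‖ ≤ ε

lemma norm_trace_resolv_sub_le' {C : ℝ} {Z : Sq m} (hC : 0 < C)
    (hZ : ((C⁻¹ : ℝ) : ℂ) • 1 ≤ Z) (hcard : 0 < card m) (y : ι → m → ℂ) (j : ι)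
    (hy : nrm (y j) ^ 2 ≤ C * card m) (X : Matrix m' m ℂ) (Y : Matrix m m' ℂ) :
    ‖(X * resolv Z y * Y).trace - (X * resolv Z (loo y j) * Y).trace‖ ≤ C ^ 3 * (‖Y‖ * ‖X‖) := by
  rw [trace_mul_comm, trace_mul_comm _ Y, ← Matrix.mul_assoc, ← Matrix.mul_assoc]
  refine (norm_trace_resolv_sub_le hC hZ hcard y j hy _).trans ?_
  gcongr
  exact nmul le_rfl le_rfl

variable {C : ℝ} {Z : Sq m} {Om : ι → Sq m} {Z' : Sq m'}
    {Om' : ι → Sq m'} {Ox : ι → Matrix m m' ℂ} {G : ι → Matrix m s ℂ}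
    {G' : ι → Matrix m' s ℂ} {ε : ℝ} {y : ι → m → ℂ} {y' : ι → m' → ℂ} {δ δ' : ι → ℝ}

lemma norm_trace_two_sub_le (h : PairReg C Z Om Z' Om' Ox G G') (B : BaseEvent C ε Z y δ)
    (B' : BaseEvent C ε Z' y' δ') (j : ι) (X : Matrix m' m ℂ) (b : Matrix m m' ℂ) :
    ‖(X * resolv Z y * b * resolv Z' y').trace
      - (X * resolv Z (loo y j) * b * resolv Z' (loo y' j)).trace‖
      ≤ 2 * C ^ 4 * ‖X‖ * ‖b‖ := by
  have hCp := h.reg.pos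
  have h1 := norm_trace_resolv_sub_le' hCp h.reg.Z_ge h.reg.card_pos y j (B.nrm_le j) X
    (b * resolv Z' y')
  have h2 := norm_trace_resolv_sub_le hCp h.reg'.Z_ge h.reg'.card_pos y' j (B'.nrm_le j)
    (X * resolv Z (loo y j) * b)
  have h3 : ‖b * resolv Z' y'‖ ≤ ‖b‖ * C := nmul le_rfl (norm_resolv_le hCp h.reg'.Z_ge _)
  have h4 : ‖X * resolv Z (loo y j) * b‖ ≤ ‖X‖ * C * ‖b‖ :=
    nmul (nmul le_rfl (norm_resolv_le hCp h.reg.Z_ge _)) le_rfl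
  simp only [← Matrix.mul_assoc] at h1
  have h5 := norm_sub_le_norm_sub_add_norm_sub (X * resolv Z y * b * resolv Z' y').trace
    (X * resolv Z (loo y j) * b * resolv Z' y').trace
    (X * resolv Z (loo y j) * b * resolv Z' (loo y' j)).trace
  calc _ ≤ _ := h5
    _ ≤ C ^ 3 * (‖b‖ * C * ‖X‖) + C ^ 3 * (‖X‖ * C * ‖b‖) := by
        refine add_le_add (h1.trans ?_) (h2.trans ?_) <;> gcongr
    _ = _ := by ring

lemma qf_mul_vecMulVec_mul {n p : Type} [Fintype n] [Fintype p] (u : n → ℂ) (X : Matrix n m ℂ)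
    (v : m → ℂ) (w : m' → ℂ) (Y : Matrix m' p ℂ) (t : p → ℂ) :
    qf u (X * vecMulVec v (star w) * Y) t = qf u X v * qf w Y t := by
  simp only [qf, mul_vecMulVec, vecMulVec_mul, vecMulVec_mulVec, dotProduct_smul]
  rw [dotProduct_mulVec (star w)]
  simp

lemma nrm_mul_nrm_le (h : PairReg C Z Om Z' Om' Ox G G') (B : BaseEvent C ε Z y δ)
    (B' : BaseEvent C ε Z' y' δ') (j : ι) :
    nrm (y j) * nrm (y' j) ≤ C ^ 2 * card m := by
  have h1 := B.nrm_le j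
  have h2 := B'.nrm_le j
  have h3 := h.card_le'
  have hC := h.reg.one_le
  have hCp := h.reg.pos
  have hN := h.reg.cardR_pos
  have h4 : C * (card m' : ℝ) ≤ C * (C * card m) := by gcongr
  have h5 : C * (card m : ℝ) ≤ C * (C * card m) := by gcongr; nlinarith
  nlinarith [sq_nonneg (nrm (y j) - nrm (y' j))]

lemma second_order_term (h : PairReg C Z Om Z' Om' Ox G G') (B : BaseEvent C ε Z y δ)
    (B' : BaseEvent C ε Z' y' δ') {a : Matrix m' m ℂ} {b : Matrix m m' ℂ} (ha : ‖a‖ ≤ C)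
    (hb : ‖b‖ ≤ C) (E : PairEvent ε Z Om Z' Om' Ox y y' δ δ' a b) (j : ι) :
    ‖(1 + (δ j : ℂ))⁻¹ * ((card m : ℂ)⁻¹ *
        (a * thet Z Om δ * Om j * resolv Z y * b * resolv Z' y').trace)
      - (card m : ℂ)⁻¹ * qf (y j) (resolv Z y * b * resolv Z' y' * a * thet Z Om δ) (y j)
      - (1 + (δ j : ℂ))⁻¹ * (1 + (δ' j : ℂ))⁻¹ *
        (((card m' : ℂ)⁻¹ * ((Ox j)ᴴ * resolv Z y * b * resolv Z' y').trace) *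
          ((card m : ℂ)⁻¹ * (a * thet Z Om δ * Ox j * thet Z' Om' δ').trace))‖
      ≤ 20 * C ^ 12 * ε := by
  have hCp := h.reg.pos
  have hC1 := h.reg.one_le
  have hN := h.reg.cardR_pos
  have hN' := h.reg'.cardR_pos
  have hε0 : 0 ≤ ε := (inv_nonneg.2 hN.le).trans B.eps
  set Θ := thet Z Om δ with hΘ
  set Θ' := thet Z' Om' δ' with hΘ'
  set Q := resolv Z y with hQ
  set Q' := resolv Z' y' with hQ'
  set Qj := resolv Z (loo y j) with hQj
  set Qj' := resolv Z' (loo y' j) with hQj'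
  have nΘ : ‖Θ‖ ≤ C := norm_thet_le h.reg B.pos
  have nΘ' : ‖Θ'‖ ≤ C := norm_thet_le h.reg' B'.pos
  have nQ : ‖Q‖ ≤ C := norm_resolv_le hCp h.reg.Z_ge _
  have nQ' : ‖Q'‖ ≤ C := norm_resolv_le hCp h.reg'.Z_ge _
  have nQj : ‖Qj‖ ≤ C := norm_resolv_le hCp h.reg.Z_ge _
  have nQj' : ‖Qj'‖ ≤ C := norm_resolv_le hCp h.reg'.Z_ge _
  have nOm := h.reg.norm_Om j
  have nOx := h.norm_Ox j
  have nOxH : ‖(Ox j)ᴴ‖ ≤ C := by rw [l2_opNorm_conjTranspose]; exact nOx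
  set c : ℂ := (card m : ℂ)⁻¹ with hc
  set c' : ℂ := (card m' : ℂ)⁻¹ with hc'
  have nc : ‖c‖ = (card m : ℝ)⁻¹ := by rw [hc, norm_inv, norm_natCast]
  have nc' : ‖c'‖ = (card m' : ℝ)⁻¹ := by rw [hc', norm_inv, norm_natCast]
  have ncε : ‖c‖ ≤ ε := nc.le.trans B.eps
  have ncε' : ‖c'‖ ≤ ε := nc'.le.trans B'.eps
  have ncm : ‖c'‖ * card m ≤ C := by rw [nc', inv_mul_le_iff₀ hN', mul_comm]; exact h.card_le
  have ncm' : ‖c‖ * card m' ≤ C := by rw [nc, inv_mul_le_iff₀ hN, mul_comm]; exact h.card_le'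
  set f := (1 + (δ j : ℂ))⁻¹ with hf
  set f' := (1 + (δ' j : ℂ))⁻¹ with hf'
  set g := (1 + qj Z y j)⁻¹ with hg
  set g' := (1 + qj Z' y' j)⁻¹ with hg'
  have nf : ‖f‖ ≤ 1 := norm_inv_one_add_le (ofReal_nonneg (B.pos j))
  have nf' : ‖f'‖ ≤ 1 := norm_inv_one_add_le (ofReal_nonneg (B'.pos j))
  have ng : ‖g‖ ≤ 1 := norm_inv_one_add_le (qj_nonneg hCp h.reg.Z_ge y j)
  have ng' : ‖g'‖ ≤ 1 := norm_inv_one_add_le (qj_nonneg hCp h.reg'.Z_ge y' j)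
  have nfg : ‖g - f‖ ≤ ε := (norm_inv_sub_inv_le (qj_nonneg hCp h.reg.Z_ge y j)
    (ofReal_nonneg (B.pos j))).trans (B.qj_near j)
  have nfg' : ‖g' - f'‖ ≤ ε := (norm_inv_sub_inv_le (qj_nonneg hCp h.reg'.Z_ge y' j)
    (ofReal_nonneg (B'.pos j))).trans (B'.qj_near j)
  set D₁ := c * (a * Θ * Om j * Q * b * Q').trace with hD₁
  set D₂ := c * qf (y j) (Qj * b * Qj' * a * Θ) (y j) with hD₂
  set P₁ := c' * qf (y j) (Qj * b * Qj') (y' j) with hP₁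
  set P₃ := c' * ((Ox j)ᴴ * Q * b * Q').trace with hP₃
  set R₁ := c * qf (y' j) (Qj' * a * Θ) (y j) with hR₁
  set R₄ := c * (a * Θ * Ox j * Θ').trace with hR₄
  have expand : c * qf (y j) (Q * b * Q' * a * Θ) (y j) = g * D₂ - g * g' * (P₁ * R₁) := by
    have e1 : Q * b * Q' * a * Θ = Q * (b * Q' * a * Θ) := by simp only [Matrix.mul_assoc]
    rw [e1, qf_resolv_mul hCp h.reg.Z_ge, hQ', resolv_eq_loo hCp h.reg'.Z_ge y' j, ← hQj, ← hQj',
      ← hg, ← hc']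
    have e2 : Qj * (b * (Qj' - (c' * (1 + qj Z' y' j)⁻¹) •
        (Qj' * vecMulVec (y' j) (star (y' j)) * Qj')) * a * Θ)
        = Qj * b * Qj' * a * Θ - (c' * g') •
          (Qj * b * Qj' * vecMulVec (y' j) (star (y' j)) * (Qj' * a * Θ)) := by
      simp only [Matrix.mul_sub, Matrix.sub_mul, Matrix.mul_smul, Matrix.smul_mul, Matrix.mul_assoc,
        hg']
    rw [e2, qf_sub, qf_smul, qf_mul_vecMulVec_mul, hD₂, hP₁, hR₁]
    ring
  have bD₁ : ‖D₁ - c * (Qj * b * Qj' * a * Θ * Om j).trace‖ ≤ 2 * C ^ 8 * ε := by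
    have e1 : (Qj * b * Qj' * a * Θ * Om j).trace = (a * Θ * Om j * Qj * b * Qj').trace := by
      have : Qj * b * Qj' * a * Θ * Om j = (Qj * b * Qj') * (a * Θ * Om j) := by
        simp only [Matrix.mul_assoc]
      rw [this, trace_mul_comm]
      simp only [Matrix.mul_assoc]
    rw [hD₁, e1, ← mul_sub, norm_mul]
    have h1 := norm_trace_two_sub_le h B B' j (a * Θ * Om j) b
    have h2 : ‖a * Θ * Om j‖ ≤ C * C * C := nmul (nmul ha nΘ) nOm
    calc _ ≤ ε * (2 * C ^ 4 * (C * C * C) * C) := by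
          gcongr
          exact h1.trans (by gcongr)
      _ = _ := by ring
  have bD₂ : ‖D₂ - c * (Qj * b * Qj' * a * Θ * Om j).trace‖ ≤ C ^ 5 * ε := by
    have := (E.quad j).div hN
    rw [ofReal_natCast] at this
    refine this.trans ?_
    have h2 : ‖Qj * b * Qj' * a * Θ‖ ≤ C * C * C * C * C :=
      nmul (nmul (nmul (nmul nQj hb) nQj') ha) nΘ
    calc _ ≤ ε * (C * C * C * C * C) := by gcongr
      _ = _ := by ring
  have nD₂ : ‖D₂‖ ≤ C ^ 6 := by
    refine (norm_inv_card_qf_le h.reg.card_pos (B.nrm_le j) _).trans ?_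
    calc _ ≤ C * (C * C * C * C * C) := by
          gcongr
          exact nmul (nmul (nmul (nmul nQj hb) nQj') ha) nΘ
      _ = _ := by ring
  have bP : ‖P₁ - P₃‖ ≤ 3 * C ^ 7 * ε := by
    have h1 : ‖P₁ - c' * (Qj * b * Qj' * (Ox j)ᴴ).trace‖ ≤ C ^ 4 * ε := by
      rw [hP₁, ← mul_sub, norm_mul]
      have h2 : ‖Qj * b * Qj'‖ ≤ C * C * C := nmul (nmul nQj hb) nQj'
      calc _ ≤ ‖c'‖ * (ε * card m * (C * C * C)) := by
            gcongr
            exact (E.quad₁ j).trans (by gcongr)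
        _ = (‖c'‖ * card m) * (ε * (C * C * C)) := by ring
        _ ≤ C * (ε * (C * C * C)) := by gcongr
        _ = _ := by ring
    have h2 : ‖P₃ - c' * (Qj * b * Qj' * (Ox j)ᴴ).trace‖ ≤ 2 * C ^ 6 * ε := by
      rw [hP₃, trace_mul_comm (Qj * b * Qj'), ← mul_sub, norm_mul]
      have h1 := norm_trace_two_sub_le h B B' j (Ox j)ᴴ b
      simp only [← Matrix.mul_assoc] at h1 ⊢
      calc _ ≤ ε * (2 * C ^ 4 * C * C) := by
            gcongr
            exact h1.trans (by gcongr)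
        _ = _ := by ring
    have h3 : C ^ 4 * ε ≤ C ^ 7 * ε := by gcongr; norm_num
    have h4 : C ^ 6 * ε ≤ C ^ 7 * ε := by gcongr; norm_num
    have h5 := norm_sub_le_norm_sub_add_norm_sub P₁ (c' * (Qj * b * Qj' * (Ox j)ᴴ).trace) P₃
    rw [norm_sub_rev (c' * (Qj * b * Qj' * (Ox j)ᴴ).trace) P₃] at h5
    linarith
  have bR : ‖R₁ - R₄‖ ≤ 3 * C ^ 6 * ε := by
    have h1 : ‖R₁ - c * (Qj' * a * Θ * Ox j).trace‖ ≤ C ^ 3 * ε := by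
      have := (E.quad₂ j).div hN
      rw [ofReal_natCast] at this
      refine this.trans ?_
      have h2 : ‖Qj' * a * Θ‖ ≤ C * C * C := nmul (nmul nQj' ha) nΘ
      calc _ ≤ ε * (C * C * C) := by gcongr
        _ = _ := by ring
    have h2 : ‖c * (a * Θ * Ox j * Q').trace - c * (Qj' * a * Θ * Ox j).trace‖ ≤ C ^ 6 * ε := by
      have e1 : (Qj' * a * Θ * Ox j).trace = (a * Θ * Ox j * Qj').trace := by
        rw [trace_mul_comm (a * Θ * Ox j)]
        simp only [Matrix.mul_assoc]
      rw [e1, ← mul_sub, norm_mul]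
      have h1 := norm_trace_resolv_sub_le hCp h.reg'.Z_ge h.reg'.card_pos y' j (B'.nrm_le j)
        (a * Θ * Ox j)
      have h2 : ‖a * Θ * Ox j‖ ≤ C * C * C := nmul (nmul ha nΘ) nOx
      calc _ ≤ ε * (C ^ 3 * (C * C * C)) := by
            gcongr
            exact h1.trans (by gcongr)
        _ = _ := by ring
    have h3 : ‖c * (a * Θ * Ox j * Q').trace - R₄‖ ≤ C * ε := by
      have h4 := E.first₁ j
      rw [← mul_sub, norm_mul, ← hc', ← hΘ, ← hΘ', ← hQ'] at h4
      rw [hR₄, ← mul_sub, norm_mul]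
      have h5 : ‖(a * Θ * Ox j * Q').trace - (a * Θ * Ox j * Θ').trace‖
          ≤ card m' * ε := by
        rw [nc', inv_mul_le_iff₀ hN'] at h4
        exact h4
      calc _ ≤ ‖c‖ * (card m' * ε) := by gcongr
        _ = (‖c‖ * card m') * ε := by ring
        _ ≤ _ := by gcongr
    have h4 : C ^ 3 * ε ≤ C ^ 6 * ε := by gcongr; norm_num
    have h5 : C * ε ≤ C ^ 6 * ε := by gcongr; exact le_self_pow₀ hC1 (by norm_num)
    have h6 := norm_sub_le_norm_sub_add_norm_sub R₁ (c * (Qj' * a * Θ * Ox j).trace) R₄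
    have h7 := norm_sub_le_norm_sub_add_norm_sub (c * (Qj' * a * Θ * Ox j).trace)
      (c * (a * Θ * Ox j * Q').trace) R₄
    rw [norm_sub_rev _ (c * (a * Θ * Ox j * Q').trace)] at h7
    linarith
  have nP₃ : ‖P₃‖ ≤ C ^ 4 := by
    refine (norm_inv_card_trace_le _).trans ?_
    calc _ ≤ C * C * C * C := nmul (nmul (nmul nOxH nQ) hb) nQ'
      _ = _ := by ring
  have nR₁ : ‖R₁‖ ≤ C ^ 5 := by
    rw [hR₁, norm_mul]
    have h1 := norm_qf_le (y' j) (Qj' * a * Θ) (y j)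
    have h2 : ‖Qj' * a * Θ‖ ≤ C * C * C := nmul (nmul nQj' ha) nΘ
    have h3 := nrm_mul_nrm_le h B B' j
    calc _ ≤ ‖c‖ * ((C * C * C) * (C ^ 2 * card m)) := by
          gcongr
          refine h1.trans ?_
          rw [mul_assoc, mul_comm (nrm (y' j))]
          gcongr
          exact mul_nonneg (nrm_nonneg _) (nrm_nonneg _)
      _ = _ := by rw [nc]; field_simp
  have nR₄ : ‖R₄‖ ≤ C ^ 5 := by
    rw [hR₄, norm_mul]
    have h1 := norm_trace_le (a * Θ * Ox j * Θ')
    have h2 : ‖a * Θ * Ox j * Θ'‖ ≤ C * C * C * C := nmul (nmul (nmul ha nΘ) nOx) nΘ'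
    calc _ ≤ ‖c‖ * (card m' * (C * C * C * C)) := by
          gcongr
          exact h1.trans (by gcongr)
      _ = (‖c‖ * card m') * (C * C * C * C) := by ring
      _ ≤ C * (C * C * C * C) := by gcongr
      _ = _ := by ring
  rw [expand]
  have e1 : f * D₁ - (g * D₂ - g * g' * (P₁ * R₁)) - f * f' * (P₃ * R₄)
      = f * (D₁ - c * (Qj * b * Qj' * a * Θ * Om j).trace)
        - f * (D₂ - c * (Qj * b * Qj' * a * Θ * Om j).trace)
        - (g - f) * D₂ + g * g' * ((P₁ - P₃) * R₁) + g * g' * (P₃ * (R₁ - R₄))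
        + ((g - f) * g' + f * (g' - f')) * (P₃ * R₄) := by ring
  rw [e1]
  have s1 : ‖f * (D₁ - c * (Qj * b * Qj' * a * Θ * Om j).trace)‖ ≤ 1 * (2 * C ^ 8 * ε) := by
    rw [norm_mul]; gcongr
  have s2 : ‖f * (D₂ - c * (Qj * b * Qj' * a * Θ * Om j).trace)‖ ≤ 1 * (C ^ 5 * ε) := by
    rw [norm_mul]; gcongr
  have s3 : ‖(g - f) * D₂‖ ≤ ε * C ^ 6 := by rw [norm_mul]; gcongr
  have s4 : ‖g * g' * ((P₁ - P₃) * R₁)‖ ≤ 1 * 1 * ((3 * C ^ 7 * ε) * C ^ 5) := by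
    rw [norm_mul, norm_mul, norm_mul]; gcongr
  have s5 : ‖g * g' * (P₃ * (R₁ - R₄))‖ ≤ 1 * 1 * (C ^ 4 * (3 * C ^ 6 * ε)) := by
    rw [norm_mul, norm_mul, norm_mul]; gcongr
  have s6 : ‖((g - f) * g' + f * (g' - f')) * (P₃ * R₄)‖ ≤ (ε * 1 + 1 * ε) * (C ^ 4 * C ^ 5) := by
    rw [norm_mul, norm_mul]
    gcongr
    refine (norm_add_le _ _).trans ?_
    rw [norm_mul, norm_mul]
    gcongr
  have p5 : C ^ 5 * ε ≤ C ^ 12 * ε := by gcongr; norm_num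
  have p6 : C ^ 6 * ε ≤ C ^ 12 * ε := by gcongr; norm_num
  have p8 : C ^ 8 * ε ≤ C ^ 12 * ε := by gcongr; norm_num
  have p9 : C ^ 9 * ε ≤ C ^ 12 * ε := by gcongr; norm_num
  have p10 : C ^ 10 * ε ≤ C ^ 12 * ε := by gcongr; norm_num
  have p12 : 0 ≤ C ^ 12 * ε := by positivity
  refine (norm_add_le _ _).trans ((add_le_add_left ((norm_add_le _ _).trans (add_le_add_left
    ((norm_add_le _ _).trans (add_le_add_left ((norm_sub_le _ _).trans
    (add_le_add_left (norm_sub_le _ _) _)) _)) _)) _).trans ?_)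
  ring_nf at s1 s2 s3 s4 s5 s6 p5 p6 p8 p9 p10 p12 ⊢
  linarith

/-- One step of the second order deterministic equivalent. -/
lemma second_order_step (h : PairReg C Z Om Z' Om' Ox G G') (B : BaseEvent C ε Z y δ)
    (B' : BaseEvent C ε Z' y' δ') {a : Matrix m' m ℂ} {b : Matrix m m' ℂ} (ha : ‖a‖ ≤ C)
    (hb : ‖b‖ ≤ C) (E : PairEvent ε Z Om Z' Om' Ox y y' δ δ' a b) :
    ‖(card m : ℂ)⁻¹ * (a * resolv Z y * b * resolv Z' y').trace
      - (card m : ℂ)⁻¹ * (a * thet Z Om δ * b * thet Z' Om' δ').trace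
      - (card m : ℂ)⁻¹ * ∑ j, (1 + (δ j : ℂ))⁻¹ * (1 + (δ' j : ℂ))⁻¹ *
        (((card m' : ℂ)⁻¹ * ((Ox j)ᴴ * resolv Z y * b * resolv Z' y').trace) *
          ((card m : ℂ)⁻¹ * (a * thet Z Om δ * Ox j * thet Z' Om' δ').trace))‖
      ≤ 21 * C ^ 13 * ε := by
  have hCp := h.reg.pos
  have hC1 := h.reg.one_le
  have hN := h.reg.cardR_pos
  have hN' := h.reg'.cardR_pos
  have hε0 : 0 ≤ ε := (inv_nonneg.2 hN.le).trans B.eps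
  have hterm := fun j => second_order_term h B B' ha hb E j
  have h1 := norm_inv_card_sum_le h.reg (by positivity) hterm
  have h2 : ‖(card m : ℂ)⁻¹ * (a * thet Z Om δ * b * resolv Z' y').trace
      - (card m : ℂ)⁻¹ * (a * thet Z Om δ * b * thet Z' Om' δ').trace‖ ≤ C * ε := by
    have h4 := E.first
    rw [← mul_sub, norm_mul, norm_inv, norm_natCast, inv_mul_le_iff₀ hN'] at h4
    rw [← mul_sub, norm_mul, norm_inv, norm_natCast, inv_mul_le_iff₀ hN]
    refine h4.trans ?_
    calc _ ≤ (C * card m) * ε := by gcongr; exact h.card_le'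
      _ = _ := by ring
  have key : (a * resolv Z y * b * resolv Z' y').trace - (a * thet Z Om δ * b * resolv Z' y').trace
      = ∑ j, ((1 + (δ j : ℂ))⁻¹ * ((card m : ℂ)⁻¹ *
        (a * thet Z Om δ * Om j * resolv Z y * b * resolv Z' y').trace)
      - (card m : ℂ)⁻¹ *
        qf (y j) (resolv Z y * b * resolv Z' y' * a * thet Z Om δ) (y j)) := by
    rw [← trace_sub, ← Matrix.sub_mul, ← Matrix.sub_mul, ← Matrix.mul_sub,
      resolv_sub_thet h.reg B.pos]
    simp only [Matrix.mul_smul, Matrix.smul_mul, Matrix.mul_sum, Matrix.sum_mul, trace_smul,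
      trace_sum, smul_eq_mul, Finset.mul_sum]
    refine sum_congr rfl fun j _ => ?_
    set Θ := thet Z Om δ
    set Q := resolv Z y
    set Q' := resolv Z' y'
    have e1 : a * (Θ * ((1 + (δ j : ℂ))⁻¹ • Om j - vecMulVec (y j) (star (y j))) * Q) * b * Q'
        = (1 + (δ j : ℂ))⁻¹ • (a * Θ * Om j * Q * b * Q')
          - (a * Θ) * vecMulVec (y j) (star (y j)) * (Q * b * Q') := by
      simp only [Matrix.mul_sub, Matrix.sub_mul, Matrix.mul_smul, Matrix.smul_mul, Matrix.mul_assoc]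
    rw [e1, trace_sub, trace_smul, smul_eq_mul, trace_mul_comm ((a * Θ) * vecMulVec _ _),
      ← Matrix.mul_assoc, trace_mul_vecMulVec]
    have e2 : Q * b * Q' * (a * Θ) = Q * b * Q' * a * Θ := by simp only [Matrix.mul_assoc]
    rw [e2]
    ring
  have e3 : (card m : ℂ)⁻¹ * (a * resolv Z y * b * resolv Z' y').trace
      - (card m : ℂ)⁻¹ * (a * thet Z Om δ * b * thet Z' Om' δ').trace
      = (card m : ℂ)⁻¹ * ((a * resolv Z y * b * resolv Z' y').trace
        - (a * thet Z Om δ * b * resolv Z' y').trace)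
      + ((card m : ℂ)⁻¹ * (a * thet Z Om δ * b * resolv Z' y').trace
      - (card m : ℂ)⁻¹ * (a * thet Z Om δ * b * thet Z' Om' δ').trace) := by ring
  rw [e3, key, add_sub_right_comm, ← mul_sub, ← sum_sub_distrib]
  refine (norm_add_le _ _).trans ((add_le_add h1 h2).trans ?_)
  have p1 : C * ε ≤ C ^ 13 * ε := by gcongr; exact le_self_pow₀ hC1 (by norm_num)
  ring_nf at p1 ⊢
  linarith

/-! ### Stability of the linear system -/

/-- The matrix `Γ`. -/
def gamMat (Z : Sq m) (Om : ι → Sq m) (Z' : Sq m')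
    (Om' : ι → Sq m') (Ox : ι → Matrix m m' ℂ) (δ δ' : ι → ℝ) : Sq ι :=
  of fun i j => ((card m : ℂ) * (card m' : ℂ))⁻¹ *
    ((Ox i)ᴴ * thet Z Om δ * Ox j * thet Z' Om' δ').trace

/-- The diagonal matrix with entries `(1 + δ_j)⁻¹`. -/
def fMat (δ : ι → ℝ) : Sq ι := Matrix.diagonal fun j => (1 + (δ j : ℂ))⁻¹

lemma trace_four (A B T : Sq m) {P : Matrix m s ℂ} {R : Matrix m s ℂ} (hT : Tᴴ = T)
    (hA : A = P * Pᴴ) (hB : B = R * Rᴴ) :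
    (A * T * B * T).trace = ((fro (Pᴴ * T * R) ^ 2 : ℝ) : ℂ) := by
  rw [← fro_sq_trace, hA, hB]
  simp only [conjTranspose_mul, conjTranspose_conjTranspose, hT]
  have e1 : P * Pᴴ * T * (R * Rᴴ) * T = (P * Pᴴ * T * R) * (Rᴴ * T) := by
    simp only [Matrix.mul_assoc]
  rw [e1, trace_mul_comm]
  simp only [Matrix.mul_assoc]

/-- Contraction of the diagonal blocks of `Γ`. -/
lemma gam_diag_contract (h : Reg C Z Om) (hG : ∀ j, Om j = G j * (G j)ᴴ) (hδ : ∀ i, 0 < δ i)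
    (hδf : ∀ i, δ i = fmap Z Om δ i) (i : ι) :
    ∑ j, ((card m : ℝ)⁻¹ * fro ((G i)ᴴ * thet Z Om δ * G j) * (1 + δ j)⁻¹) ^ 2 * δ j
      ≤ (1 - C⁻¹ ^ 4 * (C + C ^ 2)⁻¹ ^ 2) * δ i := by
  have hδ0 : 0 ≤ δ := fun i => (hδ i).le
  have hCp := h.pos
  have hN := h.cardR_pos
  have hu : IsUnit (thetArg Z Om δ).det :=
    (isUnit_iff_isUnit_det _).1 (thetArg_posDef h hδ0).isUnit
  set Θ := thet Z Om δ with hΘ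
  have hΘp : Θ.PosDef := thet_posDef h hδ0
  have hΘH : Θᴴ = Θ := hΘp.isHermitian
  have e1 : Om i * Θ = Om i * Θ * thetArg Z Om δ * Θ := by
    rw [Matrix.mul_assoc _ (thetArg Z Om δ), hΘ, thet, mul_nonsing_inv _ hu, Matrix.mul_one]
  have e2 : (Om i * Θ * thetArg Z Om δ * Θ).trace = (Om i * (Θ * Z * Θ)).trace
      + (card m : ℂ)⁻¹ * ∑ j, (1 + (δ j : ℂ))⁻¹ * (Om i * Θ * Om j * Θ).trace := by
    rw [thetArg, Matrix.mul_add, Matrix.add_mul, trace_add]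
    simp only [Matrix.mul_smul, Matrix.smul_mul, Matrix.mul_sum, Matrix.sum_mul, trace_smul,
      trace_sum, smul_eq_mul, Matrix.mul_assoc]
  have e3 : δ i = (card m : ℝ)⁻¹ * (Om i * (Θ * Z * Θ)).trace.re
      + ∑ j, (card m : ℝ)⁻¹ ^ 2 * (1 + δ j)⁻¹ * fro ((G i)ᴴ * Θ * G j) ^ 2 := by
    rw [hδf i, fmap, inv_card_mul_re, ← hΘ, e1, e2, Complex.add_re, mul_add, inv_card_mul_re,
      re_sum, Finset.mul_sum, Finset.mul_sum]
    congr 1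
    refine sum_congr rfl fun j _ => ?_
    rw [trace_four (Om i) (Om j) Θ hΘH (hG i) (hG j)]
    have : (1 + (δ j : ℂ))⁻¹ = (((1 + δ j)⁻¹ : ℝ) : ℂ) := by push_cast; rfl
    rw [this, ← ofReal_mul, ofReal_re]
    ring
  have u0 : C⁻¹ ^ 2 * (C + C ^ 2)⁻¹ ^ 2 ≤ (card m : ℝ)⁻¹ * (Om i * (Θ * Z * Θ)).trace.re := by
    set t := (C + C ^ 2)⁻¹ with ht
    have ht0 : 0 < t := by positivity
    have l1 : ((t ^ 2 * C⁻¹ : ℝ) : ℂ) • 1 ≤ Θ * Z * Θ := by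
      have a1 : ((C⁻¹ : ℝ) : ℂ) • (Θ * Θ) ≤ Θ * Z * Θ := by
        have := (Matrix.le_iff.1 h.Z_ge).mul_mul_conjTranspose_same Θ
        rw [hΘH, Matrix.mul_sub, Matrix.sub_mul, mul_smul_comm, smul_mul_assoc, Matrix.mul_one]
          at this
        exact Matrix.le_iff.2 this
      have a2 : ((t : ℝ) : ℂ) • 1 ≤ Θ := smul_one_le_thet h hδ0
      have a3 : ((t ^ 2 : ℝ) : ℂ) • 1 ≤ Θ * Θ := by
        refine le_of_forall_re_qf (by simp [IsHermitian]) (by simp [IsHermitian, hΘH]) fun u => ?_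
        rw [qf_smul_one]
        have b1 := re_qf_le_of_le a2 u
        rw [qf_smul_one, ← ofReal_mul, ofReal_re] at b1
        have b2 : qf u (Θ * Θ) u = ((nrm (Θ *ᵥ u) ^ 2 : ℝ) : ℂ) := by
          rw [← dot_self, star_mulVec, hΘH, ← dotProduct_mulVec, mulVec_mulVec, qf]
        rw [b2, ← ofReal_mul, ofReal_re, ofReal_re]
        have b3 : (qf u Θ u).re ≤ nrm u * nrm (Θ *ᵥ u) :=
          (re_le_norm _).trans (norm_dot_le _ _)
        have b4 := nrm_nonneg u
        have b5 := nrm_nonneg (Θ *ᵥ u)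
        rcases b4.eq_or_lt with b6 | b6
        · rw [← b6]; simp; positivity
        · have b7 : t * nrm u ≤ nrm (Θ *ᵥ u) := by
            have : nrm u * (t * nrm u) ≤ nrm u * nrm (Θ *ᵥ u) := by nlinarith
            exact le_of_mul_le_mul_left this b6
          nlinarith
      have a4 := real_smul_le (c := C⁻¹) (by positivity) a3
      rw [smul_smul, ← ofReal_mul, mul_comm] at a4
      exact a4.trans a1
    have l2 := trace_mul_le_trace_mul (h.Om_psd i) l1
    rw [mul_smul_comm, trace_smul, smul_eq_mul, Matrix.mul_one] at l2
    have l3 := trace_mul_le_trace_mul (PosSemidef.one (n := m) (R := ℂ)) (h.Om_ge i)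
    rw [Matrix.one_mul, Matrix.one_mul, trace_smul, trace_one] at l3
    have l4 := (Complex.le_def.1 l3).1
    have l5 := (Complex.le_def.1 l2).1
    rw [smul_eq_mul, re_ofReal_mul, Complex.natCast_re] at l4
    rw [re_ofReal_mul] at l5
    rw [inv_mul_eq_div, le_div_iff₀ hN]
    calc _ = (t ^ 2 * C⁻¹) * (C⁻¹ * card m) := by ring
      _ ≤ (t ^ 2 * C⁻¹) * (Om i).trace.re := by gcongr
      _ ≤ _ := l5
  have hδC : δ i ≤ C ^ 2 := (hδf i).le.trans (fmap_le h hδ0 i)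
  have s1 : ∑ j, ((card m : ℝ)⁻¹ * fro ((G i)ᴴ * Θ * G j) * (1 + δ j)⁻¹) ^ 2 * δ j
      ≤ ∑ j, (card m : ℝ)⁻¹ ^ 2 * (1 + δ j)⁻¹ * fro ((G i)ᴴ * Θ * G j) ^ 2 := by
    refine sum_le_sum fun j _ => ?_
    have hj := hδ j
    have : (1 + δ j)⁻¹ * δ j ≤ 1 := by rw [inv_mul_le_iff₀ (by linarith)]; linarith
    calc _ = ((card m : ℝ)⁻¹ ^ 2 * (1 + δ j)⁻¹ * fro ((G i)ᴴ * Θ * G j) ^ 2)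
          * ((1 + δ j)⁻¹ * δ j) := by ring
      _ ≤ _ := mul_le_of_le_one_right (by positivity) this
  have s2 : C⁻¹ ^ 4 * (C + C ^ 2)⁻¹ ^ 2 * δ i ≤ C⁻¹ ^ 2 * (C + C ^ 2)⁻¹ ^ 2 := by
    calc _ ≤ C⁻¹ ^ 4 * (C + C ^ 2)⁻¹ ^ 2 * C ^ 2 := by gcongr
      _ = _ := by field_simp
  linarith

end SecondOrder

section SecondOrderEquivalent

/-- Stability of a linear system whose matrix contracts a weighted sup norm. -/
lemma lin_stable {ι : Type} [Fintype ι] {c : ι → ι → ℂ} {w : ι → ℝ} {lo hi κ η : ℝ}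
    (hlo : 0 < lo) (hw : ∀ i, lo ≤ w i) (hw' : ∀ i, w i ≤ hi) (hκ : 0 < κ)
    (hc : ∀ i, ∑ j, ‖c i j‖ * w j ≤ (1 - κ) * w i) {τ e : ι → ℂ}
    (hτ : ∀ i, τ i = e i + ∑ j, c i j * τ j) (he : ∀ i, ‖e i‖ ≤ η) (i : ι) :
    ‖τ i‖ ≤ hi / (κ * lo) * η := by
  obtain ⟨k, -, hk⟩ := Finset.exists_max_image Finset.univ (fun i => ‖τ i‖ / w i)
    ⟨i, mem_univ i⟩
  have hw0 : ∀ i, 0 < w i := fun i => hlo.trans_le (hw i)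
  set A := ‖τ k‖ / w k with hA
  have hA0 : 0 ≤ A := div_nonneg (norm_nonneg _) (hw0 k).le
  have hτA : ∀ i, ‖τ i‖ ≤ A * w i := fun i =>
    (div_le_iff₀ (hw0 i)).1 (hk i (mem_univ i))
  have h1 : A * w k ≤ η + A * ((1 - κ) * w k) := by
    calc A * w k = ‖τ k‖ := by rw [hA, div_mul_cancel₀ _ (hw0 k).ne']
      _ ≤ ‖e k‖ + ∑ j, ‖c k j‖ * ‖τ j‖ := by
        rw [hτ k]
        refine (norm_add_le _ _).trans (add_le_add_right ((norm_sum_le _ _).trans ?_) _)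
        exact sum_le_sum fun j _ => (norm_mul _ _).le
      _ ≤ η + ∑ j, ‖c k j‖ * (A * w j) :=
        add_le_add (he k) (sum_le_sum fun j _ => by gcongr; exact hτA j)
      _ = η + A * ∑ j, ‖c k j‖ * w j := by
        rw [Finset.mul_sum]; congr 1; exact sum_congr rfl fun j _ => by ring
      _ ≤ _ := by gcongr; exact hc k
  have hη : 0 ≤ η := (norm_nonneg _).trans (he k)
  have h2 : A * (κ * lo) ≤ η := by
    have : A * (κ * lo) ≤ A * (κ * w k) := by gcongr; exact hw k
    nlinarith
  have hhi : 0 < hi := (hw0 i).trans_le (hw' i)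
  have h3 : A ≤ η / (κ * lo) := by rwa [le_div_iff₀ (by positivity)]
  calc _ ≤ A * w i := hτA i
    _ ≤ η / (κ * lo) * hi := by
      have := hw' i
      have := hw0 i
      gcongr
    _ = _ := by ring

variable {m m' s ι : Type} [Fintype m] [DecidableEq m] [Fintype m'] [DecidableEq m']
  [Fintype s] [DecidableEq s] [Fintype ι] [DecidableEq ι]

/-- The matrix `Γ F F'` of the linear system. -/
def linMat (Z : Sq m) (Om : ι → Sq m) (Z' : Sq m')
    (Om' : ι → Sq m') (Ox : ι → Matrix m m' ℂ) (δ δ' : ι → ℝ) : Sq ι :=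
  gamMat Z Om Z' Om' Ox δ δ' * fMat δ * fMat δ'

/-- The second order deterministic equivalent of `Tr a Q b Q'`. -/
def ups (Z : Sq m) (Om : ι → Sq m) (Z' : Sq m')
    (Om' : ι → Sq m') (Ox : ι → Matrix m m' ℂ) (δ δ' : ι → ℝ) (a : Matrix m' m ℂ)
    (b : Matrix m m' ℂ) : ℂ :=
  (a * thet Z Om δ * b * thet Z' Om' δ').trace +
    ((card m : ℂ) * (card m' : ℂ))⁻¹ *
      ((fun j => (a * thet Z Om δ * Ox j * thet Z' Om' δ').trace) ⬝ᵥ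
        ((fMat δ * fMat δ' * (1 - linMat Z Om Z' Om' Ox δ δ')⁻¹) *ᵥ
          fun i => ((Ox i)ᴴ * thet Z Om δ * b * thet Z' Om' δ').trace))

variable {C : ℝ} {Z : Sq m} {Om : ι → Sq m} {Z' : Sq m'}
    {Om' : ι → Sq m'} {Ox : ι → Matrix m m' ℂ} {G : ι → Matrix m s ℂ}
    {G' : ι → Matrix m' s ℂ} {ε : ℝ} {y : ι → m → ℂ} {y' : ι → m' → ℂ} {δ δ' : ι → ℝ}

/-- A positive solution of the fundamental system of one cluster. -/
def IsFixed (Z : Sq m) (Om : ι → Sq m) (δ : ι → ℝ) : Prop :=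
  (∀ i, 0 < δ i) ∧ ∀ i, δ i = fmap Z Om δ i

lemma IsFixed.nonneg (h : IsFixed Z Om δ) : 0 ≤ δ := fun i => (h.1 i).le

lemma IsFixed.le (h : IsFixed Z Om δ) (r : Reg C Z Om) (i : ι) : δ i ≤ C ^ 2 :=
  (h.2 i).le.trans (fmap_le r h.nonneg i)

lemma IsFixed.ge (h : IsFixed Z Om δ) (r : Reg C Z Om) (i : ι) : C⁻¹ * (C + C ^ 2)⁻¹ ≤ δ i :=
  (le_fmap r h.nonneg i).trans (h.2 i).ge

lemma linMat_apply (i j : ι) : linMat Z Om Z' Om' Ox δ δ' i j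
    = ((card m : ℂ) * (card m' : ℂ))⁻¹ *
      ((Ox i)ᴴ * thet Z Om δ * Ox j * thet Z' Om' δ').trace
      * (1 + (δ j : ℂ))⁻¹ * (1 + (δ' j : ℂ))⁻¹ := by simp [linMat, gamMat, fMat, mul_diagonal]

lemma linMat_contract (h : PairReg C Z Om Z' Om' Ox G G') (hδ : IsFixed Z Om δ)
    (hδ' : IsFixed Z' Om' δ') (i : ι) :
    ∑ j, ‖linMat Z Om Z' Om' Ox δ δ' i j‖ * sqrt (δ j * δ' j)
      ≤ (1 - C⁻¹ ^ 4 * (C + C ^ 2)⁻¹ ^ 2) * sqrt (δ i * δ' i) := by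
  have h1 := gam_diag_contract h.reg h.Om_eq hδ.1 hδ.2 i
  have h2 := gam_diag_contract h.reg' h.Om_eq' hδ'.1 hδ'.2 i
  set κ := C⁻¹ ^ 4 * (C + C ^ 2)⁻¹ ^ 2
  set p : ι → ℝ := fun j =>
    (card m : ℝ)⁻¹ * fro ((G i)ᴴ * thet Z Om δ * G j) * (1 + δ j)⁻¹ with hp
  set p' : ι → ℝ := fun j =>
    (card m' : ℝ)⁻¹ * fro ((G' i)ᴴ * thet Z' Om' δ' * G' j) * (1 + δ' j)⁻¹ with hp'
  have hp0 : ∀ j, 0 ≤ p j := fun j => by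
    have := (hδ.1 j).le
    exact mul_nonneg (mul_nonneg (by positivity) (fro_nonneg _)) (by positivity)
  have hp0' : ∀ j, 0 ≤ p' j := fun j => by
    have := (hδ'.1 j).le
    exact mul_nonneg (mul_nonneg (by positivity) (fro_nonneg _)) (by positivity)
  have hle : ∀ j, ‖linMat Z Om Z' Om' Ox δ δ' i j‖ ≤ p j * p' j := by
    intro j
    have hΘH : (thet Z' Om' δ')ᴴ = thet Z' Om' δ' := (thet_posDef h.reg' hδ'.nonneg).isHermitian
    have e1 : ((Ox i)ᴴ * thet Z Om δ * Ox j * thet Z' Om' δ').trace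
        = (((G i)ᴴ * thet Z Om δ * G j) * ((G' i)ᴴ * thet Z' Om' δ' * G' j)ᴴ).trace := by
      rw [h.Ox_eq, h.Ox_eq]
      simp only [conjTranspose_mul, conjTranspose_conjTranspose, hΘH]
      have : G' i * (G i)ᴴ * thet Z Om δ * (G j * (G' j)ᴴ) * thet Z' Om' δ'
        = G' i * ((G i)ᴴ * thet Z Om δ * (G j * (G' j)ᴴ) * thet Z' Om' δ') := by
        simp only [Matrix.mul_assoc]
      rw [this, trace_mul_comm]
      simp only [Matrix.mul_assoc]
    have e2 := norm_trace_mul_le_fro ((G i)ᴴ * thet Z Om δ * G j)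
      ((G' i)ᴴ * thet Z' Om' δ' * G' j)ᴴ
    rw [fro_conjTranspose, ← e1] at e2
    have f1 : ‖(1 + (δ j : ℂ))⁻¹‖ = (1 + δ j)⁻¹ := by
      rw [norm_inv, ← Complex.ofReal_one, ← Complex.ofReal_add, norm_real,
        norm_of_nonneg (by have := hδ.1 j; linarith)]
    have f2 : ‖(1 + (δ' j : ℂ))⁻¹‖ = (1 + δ' j)⁻¹ := by
      rw [norm_inv, ← Complex.ofReal_one, ← Complex.ofReal_add, norm_real,
        norm_of_nonneg (by have := hδ'.1 j; linarith)]
    rw [linMat_apply, norm_mul, norm_mul, norm_mul, f1, f2, norm_inv, norm_mul,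
      norm_natCast, norm_natCast, mul_inv]
    have g1 := hδ.1 j
    have g2 := hδ'.1 j
    calc _ ≤ (card m : ℝ)⁻¹ * (card m' : ℝ)⁻¹ *
          (fro ((G i)ᴴ * thet Z Om δ * G j) * fro ((G' i)ᴴ * thet Z' Om' δ' * G' j))
          * (1 + δ j)⁻¹ * (1 + δ' j)⁻¹ := by gcongr
      _ = p j * p' j := by simp only [hp, hp']; ring
  have hA : 0 ≤ ∑ j, p j ^ 2 * δ j :=
    sum_nonneg fun j _ => mul_nonneg (sq_nonneg _) (hδ.1 j).le
  have hκ1 : 0 ≤ 1 - κ := by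
    have := hA.trans h1
    exact nonneg_of_mul_nonneg_left this (hδ.1 i)
  calc _ ≤ ∑ j, (p j * sqrt (δ j)) * (p' j * sqrt (δ' j)) := by
        refine sum_le_sum fun j _ => ?_
        rw [Real.sqrt_mul (hδ.1 j).le]
        calc _ ≤ p j * p' j * (sqrt (δ j) * sqrt (δ' j)) := by gcongr; exact hle j
          _ = _ := by ring
    _ ≤ sqrt (((1 - κ) * δ i) * ((1 - κ) * δ' i)) := by
        refine Real.le_sqrt_of_sq_le ((Finset.sum_mul_sq_le_sq_mul_sq _ _ _).trans ?_)
        simp only [mul_pow, Real.sq_sqrt (hδ.1 _).le, Real.sq_sqrt (hδ'.1 _).le]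
        exact mul_le_mul h1 h2 (sum_nonneg fun j _ => mul_nonneg (sq_nonneg _) (hδ'.1 j).le)
          (hA.trans h1)
    _ = _ := by
        rw [show (1 - κ) * δ i * ((1 - κ) * δ' i) = (1 - κ) ^ 2 * (δ i * δ' i) by ring,
          Real.sqrt_mul (sq_nonneg _), Real.sqrt_sq hκ1]

/-- The stability constant of the linear system. -/
def linConst (C : ℝ) : ℝ :=
  C ^ 2 / (C⁻¹ ^ 4 * (C + C ^ 2)⁻¹ ^ 2 * (C⁻¹ * (C + C ^ 2)⁻¹))

lemma linConst_nonneg (hC : 0 < C) : 0 ≤ linConst C := by unfold linConst; positivity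

lemma linMat_stable (h : PairReg C Z Om Z' Om' Ox G G') (hδ : IsFixed Z Om δ)
    (hδ' : IsFixed Z' Om' δ') {τ e : ι → ℂ} {η : ℝ}
    (hτ : ∀ i, τ i = e i + ∑ j, linMat Z Om Z' Om' Ox δ δ' i j * τ j) (he : ∀ i, ‖e i‖ ≤ η)
    (i : ι) : ‖τ i‖ ≤ linConst C * η := by
  have hCp := h.reg.pos
  have hb : 0 < C⁻¹ * (C + C ^ 2)⁻¹ := by positivity
  refine lin_stable (w := fun j => sqrt (δ j * δ' j)) hb (fun j => ?_) (fun j => ?_)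
    (by positivity) (linMat_contract h hδ hδ') hτ he i
  · refine Real.le_sqrt_of_sq_le ?_
    rw [sq]
    exact mul_le_mul (hδ.ge h.reg j) (hδ'.ge h.reg' j) hb.le (hδ.1 j).le
  · refine Real.sqrt_le_iff.2 ⟨sq_nonneg C, ?_⟩
    rw [sq]
    exact mul_le_mul (hδ.le h.reg j) (hδ'.le h.reg' j) (hδ'.1 j).le (sq_nonneg C)

lemma isUnit_linMat (h : PairReg C Z Om Z' Om' Ox G G') (hδ : IsFixed Z Om δ)
    (hδ' : IsFixed Z' Om' δ') : IsUnit (1 - linMat Z Om Z' Om' Ox δ δ').det := by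
  rw [isUnit_iff_ne_zero]
  intro h0
  obtain ⟨v, hv, hv0⟩ := exists_mulVec_eq_zero_iff.2 h0
  refine hv (funext fun i => ?_)
  have := linMat_stable h hδ hδ' (τ := v) (e := 0) (η := 0) (fun i => by
    have := congrFun hv0 i
    rw [sub_mulVec, one_mulVec, Pi.sub_apply, Pi.zero_apply, sub_eq_zero] at this
    rw [this, Pi.zero_apply, zero_add]
    rfl) (by simp) i
  simpa using this

/-- Second order deterministic equivalent. -/
lemma second_order {C : ℝ} (hC : 1 ≤ C) : ∃ C' : ℝ, 0 < C' ∧ ∀ {m m' s ι : Type} [Fintype m]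
    [DecidableEq m] [Fintype m'] [DecidableEq m'] [Fintype s] [DecidableEq s] [Fintype ι]
    [DecidableEq ι] {Z : Sq m} {Om : ι → Sq m} {Z' : Sq m'}
    {Om' : ι → Sq m'} {Ox : ι → Matrix m m' ℂ} {G : ι → Matrix m s ℂ}
    {G' : ι → Matrix m' s ℂ} {ε : ℝ} {y : ι → m → ℂ} {y' : ι → m' → ℂ} {δ δ' : ι → ℝ},
    PairReg C Z Om Z' Om' Ox G G' → IsFixed Z Om δ → IsFixed Z' Om' δ' →
    BaseEvent C ε Z y δ → BaseEvent C ε Z' y' δ' → ∀ {a : Matrix m' m ℂ} {b : Matrix m m' ℂ},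
    ‖a‖ ≤ C → ‖b‖ ≤ C → PairEvent ε Z Om Z' Om' Ox y y' δ δ' a b →
    (∀ i, PairEvent ε Z Om Z' Om' Ox y y' δ δ' (Ox i)ᴴ b) →
    ‖(card m : ℂ)⁻¹ * (a * resolv Z y * b * resolv Z' y').trace
      - (card m : ℂ)⁻¹ * ups Z Om Z' Om' Ox δ δ' a b‖ ≤ C' * ε := by
  have hCp : 0 < C := by linarith
  have hL := linConst_nonneg hCp
  refine ⟨21 * C ^ 13 + C * (C ^ 5 * (linConst C * (C * (21 * C ^ 13)))), by positivity, ?_⟩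
  intro m m' s ι _ _ _ _ _ _ _ _ Z Om Z' Om' Ox G G' ε y y' δ δ' h hδ hδ' B B' a b ha hb E Ei
  have hN := h.reg.cardR_pos
  have hN' := h.reg'.cardR_pos
  have hNc : (card m : ℂ) ≠ 0 := by exact_mod_cast hN.ne'
  have hNc' : (card m' : ℂ) ≠ 0 := by exact_mod_cast hN'.ne'
  have hε0 : 0 ≤ ε := (inv_nonneg.2 hN.le).trans B.eps
  set Θ := thet Z Om δ with hΘ
  set Θ' := thet Z' Om' δ' with hΘ'
  set Q := resolv Z y
  set Q' := resolv Z' y'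
  set L := linMat Z Om Z' Om' Ox δ δ' with hLdef
  set τ : ι → ℂ := fun i => (card m' : ℂ)⁻¹ * ((Ox i)ᴴ * Q * b * Q').trace with hτ
  set lam : ι → ℂ := fun i => (card m' : ℂ)⁻¹ * ((Ox i)ᴴ * Θ * b * Θ').trace with hlam
  set x : ι → ℂ := (1 - L)⁻¹ *ᵥ lam with hx
  have hu := isUnit_linMat h hδ hδ'
  have hxeq : ∀ i, x i = lam i + ∑ j, L i j * x j := by
    intro i
    have : (1 - L) *ᵥ x = lam := by rw [hx, mulVec_mulVec, mul_nonsing_inv _ hu, one_mulVec]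
    have := congrFun this i
    rw [sub_mulVec, one_mulVec, Pi.sub_apply, sub_eq_iff_eq_add] at this
    exact this
  have hstep : ∀ i, ‖τ i - lam i - ∑ j, L i j * τ j‖ ≤ C * (21 * C ^ 13) * ε := by
    intro i
    have h1 := second_order_step h B B' (by rw [l2_opNorm_conjTranspose]; exact h.norm_Ox i) hb (Ei i)
    have e1 : τ i - lam i - ∑ j, L i j * τ j = ((card m : ℂ) * (card m' : ℂ)⁻¹) *
        ((card m : ℂ)⁻¹ * ((Ox i)ᴴ * Q * b * Q').trace
      - (card m : ℂ)⁻¹ * ((Ox i)ᴴ * Θ * b * Θ').trace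
      - (card m : ℂ)⁻¹ * ∑ j, (1 + (δ j : ℂ))⁻¹ * (1 + (δ' j : ℂ))⁻¹ *
        (((card m' : ℂ)⁻¹ * ((Ox j)ᴴ * Q * b * Q').trace) *
          ((card m : ℂ)⁻¹ * ((Ox i)ᴴ * Θ * Ox j * Θ').trace))) := by
      have e2 : ∑ j, L i j * τ j = (card m' : ℂ)⁻¹ *
          ∑ j, (1 + (δ j : ℂ))⁻¹ * (1 + (δ' j : ℂ))⁻¹ *
        (((card m' : ℂ)⁻¹ * ((Ox j)ᴴ * Q * b * Q').trace) *
          ((card m : ℂ)⁻¹ * ((Ox i)ᴴ * Θ * Ox j * Θ').trace)) := by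
        rw [Finset.mul_sum]
        refine sum_congr rfl fun j _ => ?_
        rw [hLdef, linMat_apply, hτ, mul_inv]
        ring
      have e4 : ∀ A B S : ℂ, (card m' : ℂ)⁻¹ * A - (card m' : ℂ)⁻¹ * B
          - (card m' : ℂ)⁻¹ * S = ((card m : ℂ) * (card m' : ℂ)⁻¹) *
          ((card m : ℂ)⁻¹ * A - (card m : ℂ)⁻¹ * B
            - (card m : ℂ)⁻¹ * S) := by intros; field_simp
      rw [e2]
      exact e4 _ _ _
    rw [e1, norm_mul, norm_mul, norm_inv, norm_natCast, norm_natCast]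
    calc _ ≤ C * (21 * C ^ 13 * ε) := by
          gcongr
          rw [← div_eq_mul_inv, div_le_iff₀ hN']
          exact h.card_le
      _ = _ := by ring
  have hdiff : ∀ i, ‖τ i - x i‖ ≤ linConst C * (C * (21 * C ^ 13) * ε) := by
    refine linMat_stable h hδ hδ' (τ := fun i => τ i - x i)
      (e := fun i => τ i - lam i - ∑ j, L i j * τ j) (fun i => ?_) hstep
    simp only [mul_sub, sum_sub_distrib]
    have := hxeq i
    linear_combination -this
  have hU : (card m : ℂ)⁻¹ * ups Z Om Z' Om' Ox δ δ' a b
      = (card m : ℂ)⁻¹ * (a * Θ * b * Θ').trace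
        + (card m : ℂ)⁻¹ * ∑ j, (1 + (δ j : ℂ))⁻¹ * (1 + (δ' j : ℂ))⁻¹ *
          (x j * ((card m : ℂ)⁻¹ * (a * Θ * Ox j * Θ').trace)) := by
    have e1 : ∀ j, ((fMat δ * fMat δ' * (1 - L)⁻¹) *ᵥ
        fun i => ((Ox i)ᴴ * Θ * b * Θ').trace) j
        = (1 + (δ j : ℂ))⁻¹ * (1 + (δ' j : ℂ))⁻¹ * ((card m' : ℂ) * x j) := by
      intro j
      have e2 : (fun i => ((Ox i)ᴴ * Θ * b * Θ').trace) = (card m' : ℂ) • lam := by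
        funext i
        simp only [hlam, Pi.smul_apply, smul_eq_mul]
        field_simp
      rw [e2, mulVec_smul, ← mulVec_mulVec, ← hx, fMat, fMat, diagonal_mul_diagonal,
        Pi.smul_apply, mulVec_diagonal, smul_eq_mul]
      ring
    rw [ups, mul_add, dotProduct]
    congr 1
    simp only [Finset.mul_sum]
    refine sum_congr rfl fun j _ => ?_
    rw [e1, mul_inv]
    linear_combination ((card m : ℂ)⁻¹ * (card m : ℂ)⁻¹ *
      (a * Θ * Ox j * Θ').trace * (1 + (δ j : ℂ))⁻¹ * (1 + (δ' j : ℂ))⁻¹ * x j) *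
      inv_mul_cancel₀ hNc'
  have h1 := second_order_step h B B' ha hb E
  have h2 : ‖(card m : ℂ)⁻¹ * ∑ j, (1 + (δ j : ℂ))⁻¹ * (1 + (δ' j : ℂ))⁻¹ *
          ((τ j - x j) * ((card m : ℂ)⁻¹ * (a * Θ * Ox j * Θ').trace))‖
      ≤ C * (linConst C * (C * (21 * C ^ 13) * ε) * C ^ 5) := by
    refine norm_inv_card_sum_le h.reg (by positivity) fun j => ?_
    have n1 : ‖(card m : ℂ)⁻¹ * (a * Θ * Ox j * Θ').trace‖ ≤ C ^ 5 := by
      rw [norm_mul, norm_inv, norm_natCast]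
      have h2 : ‖a * Θ * Ox j * Θ'‖ ≤ C * C * C * C :=
        nmul (nmul (nmul ha (norm_thet_le h.reg hδ.nonneg)) (h.norm_Ox j))
          (norm_thet_le h.reg' hδ'.nonneg)
      have h3 := h.card_le'
      calc _ ≤ (card m : ℝ)⁻¹ * ((C * card m) * (C * C * C * C)) := by
            gcongr
            exact (norm_trace_le _).trans (by gcongr)
        _ = _ := by field_simp
    rw [norm_mul, norm_mul, norm_mul]
    calc _ ≤ 1 * 1 * (linConst C * (C * (21 * C ^ 13) * ε) * C ^ 5) := by
          gcongr
          · exact norm_inv_one_add_le (ofReal_nonneg (hδ.nonneg j))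
          · exact norm_inv_one_add_le (ofReal_nonneg (hδ'.nonneg j))
          · exact hdiff j
      _ = _ := by ring
  rw [hU]
  have e3 : (card m : ℂ)⁻¹ * (a * Q * b * Q').trace
      - ((card m : ℂ)⁻¹ * (a * Θ * b * Θ').trace
        + (card m : ℂ)⁻¹ * ∑ j, (1 + (δ j : ℂ))⁻¹ * (1 + (δ' j : ℂ))⁻¹ *
          (x j * ((card m : ℂ)⁻¹ * (a * Θ * Ox j * Θ').trace)))
      = ((card m : ℂ)⁻¹ * (a * Q * b * Q').trace
      - (card m : ℂ)⁻¹ * (a * Θ * b * Θ').trace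
      - (card m : ℂ)⁻¹ * ∑ j, (1 + (δ j : ℂ))⁻¹ * (1 + (δ' j : ℂ))⁻¹ *
        (τ j * ((card m : ℂ)⁻¹ * (a * Θ * Ox j * Θ').trace)))
      + (card m : ℂ)⁻¹ * ∑ j, (1 + (δ j : ℂ))⁻¹ * (1 + (δ' j : ℂ))⁻¹ *
          ((τ j - x j) * ((card m : ℂ)⁻¹ * (a * Θ * Ox j * Θ').trace)) := by
    simp only [sub_mul, mul_sub, sum_sub_distrib]
    ring
  rw [e3]
  refine (norm_add_le _ _).trans ((add_le_add h1 h2).trans (le_of_eq ?_))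
  ring

end SecondOrderEquivalent

section ThirdOrder

variable {m m' s ι : Type} [Fintype m] [DecidableEq m] [Fintype m'] [DecidableEq m']
  [Fintype s] [DecidableEq s] [Fintype ι] [DecidableEq ι]

variable {C : ℝ} {Z : Sq m} {Om : ι → Sq m} {Z' : Sq m'}
    {Om' : ι → Sq m'} {Ox : ι → Matrix m m' ℂ} {G : ι → Matrix m s ℂ}
    {G' : ι → Matrix m' s ℂ} {ε : ℝ} {y : ι → m → ℂ} {y' : ι → m' → ℂ} {δ δ' : ι → ℝ}

/-- The second order equivalent holds at `(a, b)` up to `ε`. -/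
def UpsNear (ε : ℝ) (Z : Sq m) (Om : ι → Sq m) (Z' : Sq m')
    (Om' : ι → Sq m') (Ox : ι → Matrix m m' ℂ) (y : ι → m → ℂ) (y' : ι → m' → ℂ)
    (δ δ' : ι → ℝ) (a : Matrix m' m ℂ) (b : Matrix m m' ℂ) : Prop :=
  ‖(card m : ℂ)⁻¹ * (a * resolv Z y * b * resolv Z' y').trace
      - (card m : ℂ)⁻¹ * ups Z Om Z' Om' Ox δ δ' a b‖ ≤ ε

lemma norm_ups_le (h : PairReg C Z Om Z' Om' Ox G G') (hε : ε ≤ 1) {a : Matrix m' m ℂ}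
    {b : Matrix m m' ℂ} (ha : ‖a‖ ≤ C) (hb : ‖b‖ ≤ C)
    (hu : UpsNear ε Z Om Z' Om' Ox y y' δ δ' a b) :
    ‖(card m' : ℂ)⁻¹ * ups Z Om Z' Om' Ox δ δ' a b‖ ≤ 2 * C ^ 6 := by
  have hCp := h.reg.pos
  have hC1 := h.reg.one_le
  have hN := h.reg.cardR_pos
  have hN' := h.reg'.cardR_pos
  have h2 : ‖(card m : ℂ)⁻¹ * (a * resolv Z y * b * resolv Z' y').trace‖ ≤ C ^ 5 := by
    rw [norm_mul, norm_inv, norm_natCast]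
    have h2 : ‖a * resolv Z y * b * resolv Z' y'‖ ≤ C * C * C * C :=
      nmul (nmul (nmul ha (norm_resolv_le hCp h.reg.Z_ge _)) hb) (norm_resolv_le hCp h.reg'.Z_ge _)
    have h3 := h.card_le'
    calc _ ≤ (card m : ℝ)⁻¹ * ((C * card m) * (C * C * C * C)) := by
          gcongr
          exact (norm_trace_le _).trans (by gcongr)
      _ = _ := by field_simp
  unfold UpsNear at hu
  rw [norm_sub_rev] at hu
  have h3 : ‖(card m : ℂ)⁻¹ * ups Z Om Z' Om' Ox δ δ' a b‖ ≤ C ^ 5 + 1 := by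
    have := norm_le_norm_add_norm_sub' ((card m : ℂ)⁻¹ * ups Z Om Z' Om' Ox δ δ' a b)
      ((card m : ℂ)⁻¹ * (a * resolv Z y * b * resolv Z' y').trace)
    linarith
  rw [norm_mul, norm_inv, norm_natCast, inv_mul_le_iff₀ hN] at h3
  rw [norm_mul, norm_inv, norm_natCast, inv_mul_le_iff₀ hN']
  have h4 := h.card_le
  have h5 : 1 ≤ C ^ 5 := one_le_pow₀ hC1
  calc _ ≤ _ := h3
    _ ≤ (C * card m') * (2 * C ^ 5) := by gcongr; linarith
    _ = _ := by ring

/-- Quadratic forms in two leave-one-out resolvents. -/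
lemma qf_near_ups (h : PairReg C Z Om Z' Om' Ox G G') (B : BaseEvent C ε Z y δ)
    (B' : BaseEvent C ε Z' y' δ') {a : Matrix m' m ℂ} {b : Matrix m m' ℂ} (ha : ‖a‖ ≤ C)
    (hb : ‖b‖ ≤ C) (hu : UpsNear ε Z Om Z' Om' Ox y y' δ δ' a b) (j : ι) {u : m → ℂ} {u' : m' → ℂ}
    (hq : QuadNear ε (card m) u' (resolv Z' (loo y' j) * a * resolv Z (loo y j)) u b) :
    ‖(card m' : ℂ)⁻¹ * qf u' (resolv Z' (loo y' j) * a * resolv Z (loo y j)) u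
      - (card m' : ℂ)⁻¹ * ups Z Om Z' Om' Ox δ δ' a b‖ ≤ 4 * C ^ 6 * ε := by
  have hCp := h.reg.pos
  have hC1 := h.reg.one_le
  have hN := h.reg.cardR_pos
  have hN' := h.reg'.cardR_pos
  have hε0 : 0 ≤ ε := (inv_nonneg.2 hN.le).trans B.eps
  set Qj := resolv Z (loo y j)
  set Qj' := resolv Z' (loo y' j)
  set c' : ℂ := (card m' : ℂ)⁻¹ with hc'
  have nc' : ‖c'‖ = (card m' : ℝ)⁻¹ := by rw [hc', norm_inv, norm_natCast]
  have ncm : ‖c'‖ * card m ≤ C := by rw [nc', inv_mul_le_iff₀ hN', mul_comm]; exact h.card_le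
  have h1 : ‖c' * qf u' (Qj' * a * Qj) u - c' * (Qj' * a * Qj * b).trace‖ ≤ C ^ 4 * ε := by
    rw [← mul_sub, norm_mul]
    have h2 : ‖Qj' * a * Qj‖ ≤ C * C * C :=
      nmul (nmul (norm_resolv_le hCp h.reg'.Z_ge _) ha) (norm_resolv_le hCp h.reg.Z_ge _)
    calc _ ≤ ‖c'‖ * (ε * card m * (C * C * C)) := by
          gcongr
          exact hq.trans (by gcongr)
      _ = (‖c'‖ * card m) * (ε * (C * C * C)) := by ring
      _ ≤ C * (ε * (C * C * C)) := by gcongr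
      _ = _ := by ring
  have h2 : ‖c' * (a * resolv Z y * b * resolv Z' y').trace - c' * (Qj' * a * Qj * b).trace‖
      ≤ 2 * C ^ 6 * ε := by
    have e1 : (Qj' * a * Qj * b).trace = (a * Qj * b * Qj').trace := by
      rw [trace_mul_comm _ Qj']; simp only [Matrix.mul_assoc]
    rw [e1, ← mul_sub, norm_mul]
    have h1 := norm_trace_two_sub_le h B B' j a b
    calc _ ≤ ε * (2 * C ^ 4 * C * C) := by
          gcongr
          · exact nc'.le.trans B'.eps
          · exact h1.trans (by gcongr)
      _ = _ := by ring
  have h3 : ‖c' * (a * resolv Z y * b * resolv Z' y').trace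
      - c' * ups Z Om Z' Om' Ox δ δ' a b‖ ≤ C * ε := by
    unfold UpsNear at hu
    rw [← mul_sub, norm_mul, norm_inv, norm_natCast, inv_mul_le_iff₀ hN] at hu
    rw [← mul_sub, norm_mul]
    calc _ ≤ ‖c'‖ * (card m * ε) := by gcongr
      _ = (‖c'‖ * card m) * ε := by ring
      _ ≤ _ := by gcongr
  have p1 : C ^ 4 * ε ≤ C ^ 6 * ε := by gcongr; norm_num
  have p2 : C * ε ≤ C ^ 6 * ε := by gcongr; exact le_self_pow₀ hC1 (by norm_num)
  have e1 : c' * qf u' (Qj' * a * Qj) u - c' * ups Z Om Z' Om' Ox δ δ' a b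
      = (c' * qf u' (Qj' * a * Qj) u - c' * (Qj' * a * Qj * b).trace)
        - (c' * (a * resolv Z y * b * resolv Z' y').trace - c' * (Qj' * a * Qj * b).trace)
        + (c' * (a * resolv Z y * b * resolv Z' y').trace
          - c' * ups Z Om Z' Om' Ox δ δ' a b) := by ring
  rw [e1]
  refine (norm_add_le _ _).trans ((add_le_add (norm_sub_le _ _) le_rfl).trans ?_)
  linarith

/-- The coefficient of the removed vector in `Q t_j`. -/
lemma beta_near (h : Reg C Z Om) (B : BaseEvent C ε Z y δ) (j : ι) {u v : m → ℂ}
    {U : Sq m} (hU : ‖U‖ ≤ C)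
    (hq : QuadNear ε (card m) u (resolv Z (loo y j)) v U)
    (hf : ‖(card m : ℂ)⁻¹ * (U * resolv Z y).trace
      - (card m : ℂ)⁻¹ * (U * thet Z Om δ).trace‖ ≤ ε) :
    ‖(1 + qj Z y j)⁻¹ * ((card m : ℂ)⁻¹ * qf u (resolv Z (loo y j)) v)
      - (1 + (δ j : ℂ))⁻¹ * ((card m : ℂ)⁻¹ * (U * thet Z Om δ).trace)‖ ≤ 4 * C ^ 4 * ε ∧
    ‖(1 + (δ j : ℂ))⁻¹ * ((card m : ℂ)⁻¹ * (U * thet Z Om δ).trace)‖ ≤ C ^ 2 := by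
  have hCp := h.pos
  have hC1 := h.one_le
  have hN := h.cardR_pos
  have hε0 : 0 ≤ ε := (inv_nonneg.2 hN.le).trans B.eps
  set Qj := resolv Z (loo y j)
  set c : ℂ := (card m : ℂ)⁻¹ with hc
  set d := c * (U * thet Z Om δ).trace
  have nd : ‖d‖ ≤ C ^ 2 := by
    refine (norm_inv_card_trace_le _).trans ((nmul hU (norm_thet_le h B.pos)).trans (le_of_eq ?_))
    ring
  have h1 : ‖c * qf u Qj v - c * (Qj * U).trace‖ ≤ C * ε := by
    have := hq.div hN
    rw [ofReal_natCast] at this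
    refine this.trans ?_
    rw [mul_comm]
    gcongr
    exact norm_resolv_le hCp h.Z_ge _
  have h2 : ‖c * (U * resolv Z y).trace - c * (Qj * U).trace‖ ≤ C ^ 4 * ε := by
    rw [trace_mul_comm Qj U, ← mul_sub, norm_mul]
    have := norm_trace_resolv_sub_le hCp h.Z_ge h.card_pos y j (B.nrm_le j) U
    calc _ ≤ ε * (C ^ 3 * C) := by
          gcongr
          · rw [hc, norm_inv, norm_natCast]; exact B.eps
          · exact this.trans (by gcongr)
      _ = _ := by ring
  have p1 : C * ε ≤ C ^ 4 * ε := by gcongr; exact le_self_pow₀ hC1 (by norm_num)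
  have p0 : ε ≤ C ^ 4 * ε := le_mul_of_one_le_left hε0 (one_le_pow₀ hC1)
  have p2 : C ^ 2 * ε ≤ C ^ 4 * ε := by gcongr; norm_num
  have h3 : ‖c * qf u Qj v - d‖ ≤ 3 * C ^ 4 * ε := by
    have e1 : c * qf u Qj v - d = (c * qf u Qj v - c * (Qj * U).trace)
      - (c * (U * resolv Z y).trace - c * (Qj * U).trace) + (c * (U * resolv Z y).trace - d) := by
      ring
    rw [e1]
    refine (norm_add_le _ _).trans ((add_le_add (norm_sub_le _ _) hf).trans ?_)
    linarith
  constructor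
  · have e1 : (1 + qj Z y j)⁻¹ * (c * qf u Qj v) - (1 + (δ j : ℂ))⁻¹ * d
        = (1 + qj Z y j)⁻¹ * (c * qf u Qj v - d)
          + ((1 + qj Z y j)⁻¹ - (1 + (δ j : ℂ))⁻¹) * d := by ring
    rw [e1]
    calc _ ≤ 1 * (3 * C ^ 4 * ε) + ε * C ^ 2 := by
          refine (norm_add_le _ _).trans ?_
          rw [norm_mul, norm_mul]
          gcongr
          · exact norm_inv_one_add_le (qj_nonneg hCp h.Z_ge y j)
          · exact (norm_inv_sub_inv_le (qj_nonneg hCp h.Z_ge y j)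
              (ofReal_nonneg (B.pos j))).trans (B.qj_near j)
      _ ≤ _ := by linarith
  · rw [norm_mul]
    calc _ ≤ 1 * C ^ 2 := by
          gcongr
          exact norm_inv_one_add_le (ofReal_nonneg (B.pos j))
      _ = _ := one_mul _

/-- The limit of `∑_j t'_jᴴ Q' a Q t_j`. -/
def thirdSum (Z : Sq m) (Om : ι → Sq m) (Z' : Sq m')
    (Om' : ι → Sq m') (Ox : ι → Matrix m m' ℂ) (δ δ' : ι → ℝ) (U : ι → Sq m)
    (U' : ι → Sq m') (Wtt Wyt Wty : ι → Matrix m m' ℂ) (a : Matrix m' m ℂ) (j : ι) : ℂ :=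
  ups Z Om Z' Om' Ox δ δ' a (Wtt j)
    - (1 + (δ j : ℂ))⁻¹ * ((card m : ℂ)⁻¹ * (U j * thet Z Om δ).trace) *
      ups Z Om Z' Om' Ox δ δ' a (Wyt j)
    - (1 + (δ' j : ℂ))⁻¹ * ((card m' : ℂ)⁻¹ * (U' j * thet Z' Om' δ').trace) *
      ups Z Om Z' Om' Ox δ δ' a (Wty j)
    + (1 + (δ j : ℂ))⁻¹ * ((card m : ℂ)⁻¹ * (U j * thet Z Om δ).trace) *
      ((1 + (δ' j : ℂ))⁻¹ * ((card m' : ℂ)⁻¹ * (U' j * thet Z' Om' δ').trace)) *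
      ups Z Om Z' Om' Ox δ δ' a (Ox j)

/-- Events for the third order equivalent; `t_j`, `t'_j` are further vectors with
`𝔼 t yᴴ = U`, `𝔼 y' t'ᴴ = U'`, `𝔼 t t'ᴴ = Wtt`, `𝔼 y t'ᴴ = Wyt`, `𝔼 t y'ᴴ = Wty`. -/
structure ThirdEvent (C ε : ℝ) (Z : Sq m) (Om : ι → Sq m) (Z' : Sq m')
    (Om' : ι → Sq m') (Ox : ι → Matrix m m' ℂ) (y : ι → m → ℂ) (y' : ι → m' → ℂ)
    (δ δ' : ι → ℝ) (t : ι → m → ℂ) (t' : ι → m' → ℂ) (U : ι → Sq m)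
    (U' : ι → Sq m') (Wtt Wyt Wty : ι → Matrix m m' ℂ) (a : Matrix m' m ℂ) : Prop where
  norm_U : ∀ j, ‖U j‖ ≤ C
  norm_U' : ∀ j, ‖U' j‖ ≤ C
  norm_tt : ∀ j, ‖Wtt j‖ ≤ C
  norm_yt : ∀ j, ‖Wyt j‖ ≤ C
  norm_ty : ∀ j, ‖Wty j‖ ≤ C
  qU : ∀ j, QuadNear ε (card m) (y j) (resolv Z (loo y j)) (t j) (U j)
  qU' : ∀ j, QuadNear ε (card m') (t' j) (resolv Z' (loo y' j)) (y' j) (U' j)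
  fU : ∀ j, ‖(card m : ℂ)⁻¹ * (U j * resolv Z y).trace
      - (card m : ℂ)⁻¹ * (U j * thet Z Om δ).trace‖ ≤ ε
  fU' : ∀ j, ‖(card m' : ℂ)⁻¹ * (U' j * resolv Z' y').trace
      - (card m' : ℂ)⁻¹ * (U' j * thet Z' Om' δ').trace‖ ≤ ε
  qtt : ∀ j, QuadNear ε (card m) (t' j)
    (resolv Z' (loo y' j) * a * resolv Z (loo y j)) (t j) (Wtt j)
  qyt : ∀ j, QuadNear ε (card m) (t' j)
    (resolv Z' (loo y' j) * a * resolv Z (loo y j)) (y j) (Wyt j)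
  qty : ∀ j, QuadNear ε (card m) (y' j)
    (resolv Z' (loo y' j) * a * resolv Z (loo y j)) (t j) (Wty j)
  qyy : ∀ j, QuadNear ε (card m) (y' j)
    (resolv Z' (loo y' j) * a * resolv Z (loo y j)) (y j) (Ox j)
  utt : ∀ j, UpsNear ε Z Om Z' Om' Ox y y' δ δ' a (Wtt j)
  uyt : ∀ j, UpsNear ε Z Om Z' Om' Ox y y' δ δ' a (Wyt j)
  uty : ∀ j, UpsNear ε Z Om Z' Om' Ox y y' δ δ' a (Wty j)
  uyy : ∀ j, UpsNear ε Z Om Z' Om' Ox y y' δ δ' a (Ox j)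

/-- Third order deterministic equivalent. -/
lemma third_order (h : PairReg C Z Om Z' Om' Ox G G') (B : BaseEvent C ε Z y δ)
    (B' : BaseEvent C ε Z' y' δ') (hε : ε ≤ 1) {a : Matrix m' m ℂ} (ha : ‖a‖ ≤ C)
    {t : ι → m → ℂ} {t' : ι → m' → ℂ} {U : ι → Sq m}
    {U' : ι → Sq m'} {Wtt Wyt Wty : ι → Matrix m m' ℂ}
    (E : ThirdEvent C ε Z Om Z' Om' Ox y y' δ δ' t t' U U' Wtt Wyt Wty a) :
    ‖(card m : ℂ)⁻¹ * ∑ j, (card m' : ℂ)⁻¹ *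
        qf (t' j) (resolv Z' y' * a * resolv Z y) (t j)
      - (card m : ℂ)⁻¹ * ∑ j, (card m' : ℂ)⁻¹ *
        thirdSum Z Om Z' Om' Ox δ δ' U U' Wtt Wyt Wty a j‖ ≤ 300 * C ^ 15 * ε := by
  have hCp := h.reg.pos
  have hC1 := h.reg.one_le
  have hN := h.reg.cardR_pos
  have hN' := h.reg'.cardR_pos
  have hε0 : 0 ≤ ε := (inv_nonneg.2 hN.le).trans B.eps
  rw [← mul_sub, ← sum_sub_distrib]
  refine (norm_inv_card_sum_le h.reg (η := 300 * C ^ 14 * ε) (by positivity) fun j => ?_).trans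
    (le_of_eq (by ring))
  obtain ⟨hb, nb⟩ := beta_near h.reg B j (E.norm_U j) (E.qU j) (E.fU j)
  obtain ⟨hb', nb'⟩ := beta_near h.reg' B' j (E.norm_U' j) (E.qU' j) (E.fU' j)
  have hA1 := qf_near_ups h B B' ha (E.norm_tt j) (E.utt j) j (E.qtt j)
  have hA2 := qf_near_ups h B B' ha (E.norm_yt j) (E.uyt j) j (E.qyt j)
  have hA3 := qf_near_ups h B B' ha (E.norm_ty j) (E.uty j) j (E.qty j)
  have hA4 := qf_near_ups h B B' ha (h.norm_Ox j) (E.uyy j) j (E.qyy j)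
  have nA2 := norm_ups_le h hε ha (E.norm_yt j) (E.uyt j)
  have nA3 := norm_ups_le h hε ha (E.norm_ty j) (E.uty j)
  have nA4 := norm_ups_le h hε ha (h.norm_Ox j) (E.uyy j)
  unfold thirdSum
  set Qj := resolv Z (loo y j) with hQj
  set Qj' := resolv Z' (loo y' j) with hQj'
  set c : ℂ := (card m : ℂ)⁻¹ with hc
  set c' : ℂ := (card m' : ℂ)⁻¹ with hc'
  set β := (1 + qj Z y j)⁻¹ * (c * qf (y j) Qj (t j)) with hβ
  set β' := (1 + qj Z' y' j)⁻¹ * (c' * qf (t' j) Qj' (y' j)) with hβ'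
  set b := (1 + (δ j : ℂ))⁻¹ * (c * (U j * thet Z Om δ).trace)
  set b' := (1 + (δ' j : ℂ))⁻¹ * (c' * (U' j * thet Z' Om' δ').trace)
  have expand : qf (t' j) (resolv Z' y' * a * resolv Z y) (t j)
      = qf (t' j) (Qj' * a * Qj) (t j) - β * qf (t' j) (Qj' * a * Qj) (y j)
        - β' * qf (y' j) (Qj' * a * Qj) (t j) + β * β' * qf (y' j) (Qj' * a * Qj) (y j) := by
    rw [resolv_eq_loo hCp h.reg.Z_ge y j, resolv_eq_loo hCp h.reg'.Z_ge y' j, ← hQj, ← hQj',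
      ← hc, ← hc']
    have e2 : (Qj' - (c' * (1 + qj Z' y' j)⁻¹) • (Qj' * vecMulVec (y' j) (star (y' j)) * Qj')) * a *
        (Qj - (c * (1 + qj Z y j)⁻¹) • (Qj * vecMulVec (y j) (star (y j)) * Qj))
        = Qj' * a * Qj - (c * (1 + qj Z y j)⁻¹) •
          ((Qj' * a * Qj) * vecMulVec (y j) (star (y j)) * Qj)
        - (c' * (1 + qj Z' y' j)⁻¹) • (Qj' * vecMulVec (y' j) (star (y' j)) * (Qj' * a * Qj))
        + (c' * (1 + qj Z' y' j)⁻¹ * (c * (1 + qj Z y j)⁻¹)) •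
          (Qj' * vecMulVec (y' j) (star (y' j)) *
            ((Qj' * a * Qj) * vecMulVec (y j) (star (y j)) * Qj)) := by
      simp only [Matrix.mul_sub, Matrix.sub_mul, Matrix.mul_smul, Matrix.smul_mul,
        Matrix.mul_assoc, smul_sub, smul_smul]
      rw [mul_comm (c * _) (c' * _)]
      abel
    rw [e2, qf_add, qf_sub, qf_sub, qf_smul, qf_smul, qf_smul, qf_mul_vecMulVec_mul,
      qf_mul_vecMulVec_mul, qf_mul_vecMulVec_mul, qf_mul_vecMulVec_mul, hβ, hβ']
    ring
  rw [expand]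
  set q1 := c' * qf (t' j) (Qj' * a * Qj) (t j)
  set q2 := c' * qf (t' j) (Qj' * a * Qj) (y j)
  set q3 := c' * qf (y' j) (Qj' * a * Qj) (t j)
  set q4 := c' * qf (y' j) (Qj' * a * Qj) (y j)
  set u1 := c' * ups Z Om Z' Om' Ox δ δ' a (Wtt j)
  set u2 := c' * ups Z Om Z' Om' Ox δ δ' a (Wyt j)
  set u3 := c' * ups Z Om Z' Om' Ox δ δ' a (Wty j)
  set u4 := c' * ups Z Om Z' Om' Ox δ δ' a (Ox j)
  have e3 : c' * (qf (t' j) (Qj' * a * Qj) (t j) - β * qf (t' j) (Qj' * a * Qj) (y j)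
        - β' * qf (y' j) (Qj' * a * Qj) (t j) + β * β' * qf (y' j) (Qj' * a * Qj) (y j))
      - c' * (ups Z Om Z' Om' Ox δ δ' a (Wtt j) - b * ups Z Om Z' Om' Ox δ δ' a (Wyt j)
        - b' * ups Z Om Z' Om' Ox δ δ' a (Wty j) + b * b' * ups Z Om Z' Om' Ox δ δ' a (Ox j))
      = (q1 - u1) - (β * (q2 - u2) + (β - b) * u2) - (β' * (q3 - u3) + (β' - b') * u3)
        + (β * β' * (q4 - u4) + ((β - b) * β' + b * (β' - b')) * u4) := by ring
  rw [e3]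
  have nβ : ‖β‖ ≤ 5 * C ^ 4 := by
    have := norm_le_norm_add_norm_sub' β b
    have p1 : C ^ 2 ≤ C ^ 4 := pow_le_pow_right₀ hC1 (by norm_num)
    have p2 : 4 * C ^ 4 * ε ≤ 4 * C ^ 4 := mul_le_of_le_one_right (by positivity) hε
    linarith
  have nβ' : ‖β'‖ ≤ 5 * C ^ 4 := by
    have := norm_le_norm_add_norm_sub' β' b'
    have p1 : C ^ 2 ≤ C ^ 4 := pow_le_pow_right₀ hC1 (by norm_num)
    have p2 : 4 * C ^ 4 * ε ≤ 4 * C ^ 4 := mul_le_of_le_one_right (by positivity) hε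
    linarith
  have s2 : ‖β * (q2 - u2) + (β - b) * u2‖ ≤ 5 * C ^ 4 * (4 * C ^ 6 * ε)
      + 4 * C ^ 4 * ε * (2 * C ^ 6) := by
    exact (norm_add_le _ _).trans (add_le_add (norm_mul_le_of_le nβ hA2) (norm_mul_le_of_le hb nA2))
  have s3 : ‖β' * (q3 - u3) + (β' - b') * u3‖ ≤ 5 * C ^ 4 * (4 * C ^ 6 * ε)
      + 4 * C ^ 4 * ε * (2 * C ^ 6) := by
    exact (norm_add_le _ _).trans
      (add_le_add (norm_mul_le_of_le nβ' hA3) (norm_mul_le_of_le hb' nA3))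
  have s4 : ‖β * β' * (q4 - u4) + ((β - b) * β' + b * (β' - b')) * u4‖
      ≤ 5 * C ^ 4 * (5 * C ^ 4) * (4 * C ^ 6 * ε)
        + (4 * C ^ 4 * ε * (5 * C ^ 4) + C ^ 2 * (4 * C ^ 4 * ε)) * (2 * C ^ 6) := by
    exact (norm_add_le _ _).trans (add_le_add
      (norm_mul_le_of_le (norm_mul_le_of_le nβ nβ') hA4)
      (norm_mul_le_of_le ((norm_add_le _ _).trans (add_le_add (norm_mul_le_of_le hb nβ')
        (norm_mul_le_of_le nb hb'))) nA4))
  have p6 : C ^ 6 * ε ≤ C ^ 14 * ε := by gcongr; norm_num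
  have p10 : C ^ 10 * ε ≤ C ^ 14 * ε := by gcongr; norm_num
  have p12 : C ^ 12 * ε ≤ C ^ 14 * ε := by gcongr; norm_num
  have p14 : 0 ≤ C ^ 14 * ε := by positivity
  refine (norm_add_le _ _).trans ((add_le_add ((norm_sub_le _ _).trans
    (add_le_add ((norm_sub_le _ _).trans (add_le_add hA1 s2)) s3)) s4).trans ?_)
  ring_nf at p6 p10 p12 p14 ⊢
  linarith

end ThirdOrder

section Blocks

variable {K : ℕ} {d : Fin K → ℕ} {M : ℕ}

lemma blk_mul_conjTranspose (P O : Sq (Ant d)) (k l : Fin K) :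
    blk (P * Oᴴ) k l = rowsOf P k * (rowsOf O l)ᴴ := by
  ext i j
  simp [blk, rowsOf, mul_apply]

lemma blk_conjTranspose (P : Sq (Ant d)) (k l : Fin K) :
    (blk P k l)ᴴ = blk Pᴴ l k := by
  ext i j
  simp [blk]

lemma conjTranspose_blk_Om (A : Fin M → Sq (Ant d)) (j : Fin M) (k l : Fin K) :
    (blk (Om A j) k l)ᴴ = blk (Om A j) l k := by rw [blk_conjTranspose]; simp [Om]

variable (Sm : (k : Fin K) → Sq (Fin (d k))) (z : Fin K → ℝ)
    (A B : Fin M → Sq (Ant d)) (δ : Fin M → Fin K → ℝ)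

/-- The regularization `-z_k I + S_k` of cluster `k`. -/
def regMat (k : Fin K) : Sq (Fin (d k)) :=
  (-(z k : ℂ)) • (1 : Sq (Fin (d k))) + Sm k

lemma Theta_eq_thet (k : Fin K) :
    Theta Sm z A δ k = thet (regMat Sm z k) (fun j => blk (Om A j) k k) fun j => δ j k := by
  simp [Theta, thet, thetArg, regMat]

lemma isPositiveSolution_iff {C : ℝ} (h : ∀ k, Reg C (regMat Sm z k) fun j => blk (Om A j) k k) :
    IsPositiveSolution Sm z A δ ↔
      ∀ k, IsFixed (regMat Sm z k) (fun j => blk (Om A j) k k) fun j => δ j k := by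
  constructor
  · intro hs k
    have hp : ∀ j, 0 < δ j k := fun j => (hs j k).1
    refine ⟨hp, fun j => ?_⟩
    have h1 := (hs j k).2
    rw [Theta_eq_thet] at h1
    have h2 := fmap_eq (h k) (x := fun j => δ j k) (fun j => (hp j).le) j
    simp only [card_fin] at h2
    rw [← Complex.ofReal_inj, h1, h2]
  · intro hs j k
    refine ⟨(hs k).1 j, ?_⟩
    rw [Theta_eq_thet]
    have h2 := fmap_eq (h k) (x := fun j => δ j k) (hs k).nonneg j
    simp only [card_fin] at h2
    rw [← h2]
    exact congrArg _ ((hs k).2 j)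

lemma isq_mul_self (k l : Fin K) : isq d k l * isq d k l = ((d k : ℂ) * (d l : ℂ))⁻¹ := by
  rw [isq, ← mul_inv, ← ofReal_mul, Real.mul_self_sqrt (by positivity)]
  push_cast; rfl

lemma Gam_eq (k l : Fin K) : Gam (Theta Sm z A δ) A k l
    = gamMat (regMat Sm z k) (fun j => blk (Om A j) k k) (regMat Sm z l)
      (fun j => blk (Om A j) l l) (fun j => blk (Om A j) k l) (fun j => δ j k)
      fun j => δ j l := by
  ext i j
  simp only [Gam, gamMat, of_apply, Theta_eq_thet, conjTranspose_blk_Om, card_fin]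

lemma Xi_eq (k l : Fin K) : Xi (Theta Sm z A δ) A δ k l
    = (1 - linMat (regMat Sm z k) (fun j => blk (Om A j) k k) (regMat Sm z l)
      (fun j => blk (Om A j) l l) (fun j => blk (Om A j) k l) (fun j => δ j k)
      fun j => δ j l)⁻¹ := by rw [Xi, Gam_eq]; rfl

/-- The second order equivalent for two clusters. -/
abbrev upsK (k l : Fin K) (a : Matrix (Fin (d l)) (Fin (d k)) ℂ)
    (b : Matrix (Fin (d k)) (Fin (d l)) ℂ) : ℂ :=
  ups (regMat Sm z k) (fun j => blk (Om A j) k k) (regMat Sm z l)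
    (fun j => blk (Om A j) l l) (fun j => blk (Om A j) k l) (fun j => δ j k)
    (fun j => δ j l) a b

lemma upsBar_eq (k l : Fin K) (a : Matrix (Fin (d l)) (Fin (d k)) ℂ)
    (b : Matrix (Fin (d k)) (Fin (d l)) ℂ) :
    upsBar (Theta Sm z A δ) A δ k l a b = upsK Sm z A δ k l a b := by
  rw [upsBar, upsK, ups, Xi_eq]
  have e1 : lamRow (Theta Sm z A δ) A k l a = isq d k l • fun j =>
      (a * thet (regMat Sm z k) (fun j => blk (Om A j) k k) (fun j => δ j k) * blk (Om A j) k l *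
        thet (regMat Sm z l) (fun j => blk (Om A j) l l) (fun j => δ j l)).trace := by
    funext j; simp [lamRow, Theta_eq_thet]
  have e2 : lamCol (Theta Sm z A δ) A k l b = isq d k l • fun i =>
      ((blk (Om A i) k l)ᴴ * thet (regMat Sm z k) (fun j => blk (Om A j) k k) (fun j => δ j k) * b *
        thet (regMat Sm z l) (fun j => blk (Om A j) l l) (fun j => δ j l)).trace := by
    funext j; simp [lamCol, Theta_eq_thet, conjTranspose_blk_Om]
  rw [e1, e2, smul_dotProduct, mulVec_smul, dotProduct_smul, smul_smul, isq_mul_self,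
    Theta_eq_thet, Theta_eq_thet, card_fin, card_fin, smul_eq_mul]
  rfl

/-- Weighted sums of second order equivalents. -/
lemma sum_mul_upsK (k l : Fin K) (a : Matrix (Fin (d l)) (Fin (d k)) ℂ)
    (W : Fin M → Matrix (Fin (d k)) (Fin (d l)) ℂ) (w : Fin M → ℂ) :
    ((d k : ℂ) * (d l : ℂ))⁻¹ * ∑ j, w j * upsK Sm z A δ k l a (W j)
    = isq d k l * ((fun j => isq d k l * (a * Theta Sm z A δ k * W j * Theta Sm z A δ l).trace) ⬝ᵥ w
      + lamRow (Theta Sm z A δ) A k l a ⬝ᵥ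
        ((Ft δ k * Ft δ l * Xi (Theta Sm z A δ) A δ k l) *ᵥ
          ((of fun i j => ((d k : ℂ) * (d l : ℂ))⁻¹ *
            (blk (Om A i) l k * Theta Sm z A δ k * W j * Theta Sm z A δ l).trace) *ᵥ w))) := by
  simp only [← upsBar_eq]
  set Θ := Theta Sm z A δ
  set Y := Ft δ k * Ft δ l * Xi Θ A δ k l
  have e1 : (of fun i j => ((d k : ℂ) * (d l : ℂ))⁻¹ *
      (blk (Om A i) l k * Θ k * W j * Θ l).trace) *ᵥ w
      = isq d k l • ∑ j, w j • lamCol Θ A k l (W j) := by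
    funext i
    simp only [mulVec, dotProduct, of_apply, ← isq_mul_self, lamCol, Pi.smul_apply,
      Finset.sum_apply, smul_eq_mul, Finset.mul_sum]
    exact sum_congr rfl fun j _ => by ring
  rw [e1, mulVec_smul, dotProduct_smul, mulVec_sum, dotProduct_sum]
  simp only [mulVec_smul, dotProduct_smul, smul_eq_mul, ← isq_mul_self, upsBar]
  rw [dotProduct, mul_add, Finset.mul_sum, Finset.mul_sum, Finset.mul_sum, Finset.mul_sum,
    ← sum_add_distrib]
  exact sum_congr rfl fun j _ => by ring

/-- The third order equivalent of a pair of clusters. -/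
abbrev thirdK (k l : Fin K) (a : Matrix (Fin (d l)) (Fin (d k)) ℂ) (j : Fin M) : ℂ :=
  thirdSum (regMat Sm z k) (fun j => blk (Om A j) k k) (regMat Sm z l)
    (fun j => blk (Om A j) l l) (fun j => blk (Om A j) k l) (fun j => δ j k)
    (fun j => δ j l) (fun j => blk (B j * (A j)ᴴ) k k) (fun j => blk (A j * (B j)ᴴ) l l)
    (fun j => blk (B j * (B j)ᴴ) k l) (fun j => blk (A j * (B j)ᴴ) k l)
    (fun j => blk (B j * (A j)ᴴ) k l) a j

lemma isq_mul_piBar {k l : Fin K}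
    (hu : IsUnit (1 - linMat (regMat Sm z k) (fun j => blk (Om A j) k k) (regMat Sm z l)
      (fun j => blk (Om A j) l l) (fun j => blk (Om A j) k l) (fun j => δ j k)
      fun j => δ j l).det) (a : Matrix (Fin (d l)) (Fin (d k)) ℂ) :
    isq d k l * piBar (Theta Sm z A δ) A B δ k l a
      = ((d k : ℂ) * (d l : ℂ))⁻¹ * ∑ j, thirdK Sm z A B δ k l a j := by
  set Θ := Theta Sm z A δ with hΘ
  set Ξ := Xi Θ A δ k l with hΞ
  set F := Ft δ k with hF
  set F' := Ft δ l with hF'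
  set D := DPO Θ B A k with hD
  set D' := DPO Θ A B l with hD'
  set one : Fin M → ℂ := fun _ => 1 with hone
  set Y := F * F' * Ξ with hY
  have hcomm : F * F' = F' * F := by rw [hF, hF', Ft, Ft, diagonal_mul_diagonal, diagonal_mul_diagonal]; simp only [mul_comm]
  have hcommD : ∀ f g : Fin M → ℂ, diagonal f * diagonal g = diagonal g * diagonal f := by
    intro f g; rw [diagonal_mul_diagonal, diagonal_mul_diagonal]; simp only [mul_comm]
  have hXi : Ξ = 1 + Ξ * (Gam Θ A k l * F * F') := by
    have h1 : Ξ * (1 - Gam Θ A k l * F * F') = 1 := by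
      rw [hΞ, Xi]
      refine nonsing_inv_mul _ ?_
      rw [hΘ, Gam_eq]
      exact hu
    rw [Matrix.mul_sub, Matrix.mul_one, sub_eq_iff_eq_add] at h1
    exact h1
  have key : ((d k : ℂ) * (d l : ℂ))⁻¹ * ∑ j, thirdK Sm z A B δ k l a j
    = ((d k : ℂ) * (d l : ℂ))⁻¹ * ∑ j, one j * upsK Sm z A δ k l a (rowsOf (B j) k * (rowsOf (B j) l)ᴴ)
    - ((d k : ℂ) * (d l : ℂ))⁻¹ * ∑ j, ((D * F) *ᵥ one) j * upsK Sm z A δ k l a (rowsOf (A j) k * (rowsOf (B j) l)ᴴ)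
    - ((d k : ℂ) * (d l : ℂ))⁻¹ * ∑ j, ((D' * F') *ᵥ one) j * upsK Sm z A δ k l a (rowsOf (B j) k * (rowsOf (A j) l)ᴴ)
    + ((d k : ℂ) * (d l : ℂ))⁻¹ * ∑ j, ((F * F' * (D * D')) *ᵥ one) j * upsK Sm z A δ k l a (blk (Om A j) k l) := by
    rw [← mul_sub, ← mul_sub, ← mul_add, ← sum_sub_distrib, ← sum_sub_distrib,
      ← sum_add_distrib]
    congr 1
    refine sum_congr rfl fun j _ => ?_
    simp only [thirdK, thirdSum, blk_mul_conjTranspose, hD, hD', hF, hF', DPO, Ft,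
      diagonal_mul_diagonal, mulVec_diagonal, hone, hΘ, Theta_eq_thet, card_fin]
    ring
  rw [key, sum_mul_upsK, sum_mul_upsK, sum_mul_upsK, sum_mul_upsK, piBar, ← hΘ]
  have g1 : (of fun i j => ((d k : ℂ) * (d l : ℂ))⁻¹ *
            (blk (Om A i) l k * Θ k * blk (Om A j) k l * Θ l).trace) = Gam Θ A k l := rfl
  have g2 : ∀ P O : Fin M → Sq (Ant d),
      (of fun i j => ((d k : ℂ) * (d l : ℂ))⁻¹ *
        (blk (Om A i) l k * Θ k * (rowsOf (P j) k * (rowsOf (O j) l)ᴴ) * Θ l).trace)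
        = Lam Θ A P O k l := fun _ _ => rfl
  have g3 : ∀ P O : Fin M → Sq (Ant d),
      (fun j => isq d k l * (a * Θ k * (rowsOf (P j) k * (rowsOf (O j) l)ᴴ) * Θ l).trace)
        = lamRow₂ Θ P O k l a := fun _ _ => rfl
  have g4 : (fun j => isq d k l * (a * Θ k * blk (Om A j) k l * Θ l).trace)
        = lamRow Θ A k l a := rfl
  rw [g1, g2, g2, g2, g3, g3, g3, g4, ← hΞ, ← hF, ← hF', ← hY, ← hD, ← hD', ← hone]
  have hlast : (F * F' * (D * D')) *ᵥ one + Y *ᵥ (Gam Θ A k l *ᵥ ((F * F' * (D * D')) *ᵥ one))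
      = Y *ᵥ ((D * D') *ᵥ one) := by
    simp only [mulVec_mulVec]
    rw [← add_mulVec]
    congr 1
    have : Y = F * F' + Y * (Gam Θ A k l * F * F') := by
      conv_lhs => rw [hY, hXi]
      rw [hY, Matrix.mul_add, Matrix.mul_one]
      simp only [Matrix.mul_assoc]
    conv_rhs => rw [this]
    simp only [Matrix.add_mul, Matrix.mul_assoc]
  have e1 : Lam Θ A B A k l * D' * F' = Lam Θ A B A k l * (D' * F') := Matrix.mul_assoc _ _ _
  have e2 : Lam Θ A A B k l * D * F = Lam Θ A A B k l * (D * F) := Matrix.mul_assoc _ _ _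
  have e3 : ∀ x y z w : ℂ, isq d k l * x - isq d k l * y - isq d k l * z + isq d k l * w
    = isq d k l * (x - y - z + w) := by intros; ring
  rw [e3]
  congr 1
  rw [e1, e2, ← mulVec_mulVec, add_mulVec, sub_mulVec, sub_mulVec, mulVec_add, mulVec_sub,
    mulVec_sub, ← hlast, sub_dotProduct, sub_dotProduct, ← dotProduct_mulVec, ← dotProduct_mulVec,
    dotProduct_add, dotProduct_add, dotProduct_sub, dotProduct_sub]
  simp only [mulVec_mulVec, Matrix.mul_assoc]
  ring

end Blocks

section Embeddings

variable {K : ℕ} {d : Fin K → ℕ}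

/-- The part of a vector that belongs to cluster `k`. -/
def restr (u : Ant d → ℂ) (k : Fin K) : Fin (d k) → ℂ := fun i => u ⟨k, i⟩

/-- The matrix that selects the entries of cluster `k`. -/
def sel (d : Fin K → ℕ) (k : Fin K) : Matrix (Fin (d k)) (Ant d) ℂ :=
  of fun i a => if (⟨k, i⟩ : Ant d) = a then 1 else 0

/-- A matrix placed at the block `(k, l)`. -/
def em (k l : Fin K) (X : Matrix (Fin (d k)) (Fin (d l)) ℂ) : Sq (Ant d) :=
  (sel d k)ᴴ * X * sel d l

lemma sel_mulVec (k : Fin K) (u : Ant d → ℂ) : sel d k *ᵥ u = restr u k := by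
  ext i
  simp [sel, restr, mulVec, dotProduct]

lemma blk_eq (B : Sq (Ant d)) (k l : Fin K) :
    blk B k l = sel d k * B * (sel d l)ᴴ := by
  ext i j
  simp [blk, sel, mul_apply]

lemma sel_mul (k : Fin K) : sel d k * (sel d k)ᴴ = 1 := by
  have := blk_eq (1 : Sq (Ant d)) k k
  rw [Matrix.mul_one] at this
  rw [← this]
  ext i j
  simp [blk, one_apply]

lemma norm_sel_le (k : Fin K) : ‖sel d k‖ ≤ 1 := by
  have h1 := l2_opNorm_conjTranspose_mul_self (sel d k)ᴴ
  rw [conjTranspose_conjTranspose, sel_mul, l2_opNorm_conjTranspose] at h1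
  have h2 := norm_one_le (m := Fin (d k))
  nlinarith [norm_nonneg (sel d k)]

lemma norm_blk_le (B : Sq (Ant d)) (k l : Fin K) : ‖blk B k l‖ ≤ ‖B‖ := by
  rw [blk_eq]
  have h := nmul (nmul (norm_sel_le k) (le_refl ‖B‖))
    ((l2_opNorm_conjTranspose _).trans_le (norm_sel_le l))
  simpa using h

lemma norm_em_le (k l : Fin K) (X : Matrix (Fin (d k)) (Fin (d l)) ℂ) : ‖em k l X‖ ≤ ‖X‖ := by
  have h := nmul (nmul ((l2_opNorm_conjTranspose _).trans_le (norm_sel_le k))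
    (le_refl ‖X‖)) (norm_sel_le l)
  simpa [em] using h

lemma blk_smul_one (c : ℂ) (k : Fin K) :
    blk (c • (1 : Sq (Ant d))) k k = c • 1 := by
  rw [blk_eq, Matrix.mul_smul, Matrix.mul_one, Matrix.smul_mul, sel_mul]

lemma blk_le_blk {A B : Sq (Ant d)} (h : A ≤ B) (k : Fin K) :
    blk A k k ≤ blk B k k := by
  rw [Matrix.le_iff] at h ⊢
  exact h.submatrix fun i => ⟨k, i⟩

lemma em_mul_em (k l n : Fin K) (X : Matrix (Fin (d k)) (Fin (d l)) ℂ)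
    (Y : Matrix (Fin (d l)) (Fin (d n)) ℂ) : em k l X * em l n Y = em k n (X * Y) := by
  unfold em
  calc _ = (sel d k)ᴴ * X * (sel d l * (sel d l)ᴴ) * Y *
        sel d n := by simp only [Matrix.mul_assoc]
    _ = _ := by rw [sel_mul]; simp only [Matrix.mul_assoc, Matrix.one_mul]

lemma em_mul_mul_em (k l m n : Fin K) (X : Matrix (Fin (d k)) (Fin (d l)) ℂ)
    (B : Sq (Ant d)) (Y : Matrix (Fin (d m)) (Fin (d n)) ℂ) :
    em k l X * B * em m n Y = em k n (X * blk B l m * Y) := by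
  rw [blk_eq]
  simp only [em, Matrix.mul_assoc]

lemma qf_conjTranspose_mul_mul {m n p q : Type} [Fintype m] [DecidableEq m] [Fintype n]
    [DecidableEq n] [Fintype p] [DecidableEq p] [Fintype q] [DecidableEq q] (P : Matrix m p ℂ)
    (X : Matrix m n ℂ) (O : Matrix n q ℂ) (u : p → ℂ) (v : q → ℂ) :
    qf u (Pᴴ * X * O) v = qf (P *ᵥ u) X (O *ᵥ v) := by
  rw [qf, qf, star_mulVec, ← dotProduct_mulVec, mulVec_mulVec, mulVec_mulVec, Matrix.mul_assoc]

lemma qf_em (k l : Fin K) (P O : Sq (Ant d)) (X : Matrix (Fin (d k)) (Fin (d l)) ℂ)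
    (u v : Ant d → ℂ) : qf u (Pᴴ * em k l X * O) v = qf (restr (P *ᵥ u) k) X (restr (O *ᵥ v) l) := by
  rw [qf_conjTranspose_mul_mul, em, qf_conjTranspose_mul_mul, sel_mulVec, sel_mulVec]

lemma trace_em (k l : Fin K) (P O Φ : Sq (Ant d))
    (X : Matrix (Fin (d k)) (Fin (d l)) ℂ) :
    (Pᴴ * em k l X * O * Φ).trace = (X * blk (O * Φ * Pᴴ) l k).trace := by
  rw [blk_eq, em]
  have e1 : Pᴴ * ((sel d k)ᴴ * X * sel d l) * O * Φ
    = (Pᴴ * (sel d k)ᴴ) * (X * (sel d l * O * Φ)) := by simp only [Matrix.mul_assoc]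
  rw [e1, trace_mul_comm]
  simp only [Matrix.mul_assoc]

lemma psdSqrt_mul_self {n : Type} [Fintype n] [DecidableEq n] {A : Sq n}
    (h : A.PosSemidef) : psdSqrt A * psdSqrt A = A :=
  CFC.sqrt_mul_sqrt_self A (nonneg_iff_posSemidef.2 h)

lemma psdSqrt_herm {n : Type} [Fintype n] [DecidableEq n] (A : Sq n) :
    (psdSqrt A)ᴴ = psdSqrt A :=
  (nonneg_iff_posSemidef.1 (CFC.sqrt_nonneg A)).isHermitian

lemma psdSqrt_mul_conjTranspose {n : Type} [Fintype n] [DecidableEq n] {A : Sq n}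
    (h : A.PosSemidef) : psdSqrt A * (psdSqrt A)ᴴ = A := by rw [psdSqrt_herm, psdSqrt_mul_self h]

end Embeddings

/-- The deterministic data of a network of `K` clusters: regularizations `Zr`, covariances `Phi` of
the estimates, transformations `V` of the estimates, the normalised noise covariance `Wn`, the
weight `g` of the estimates relative to it, and the parameters `δ`. -/
structure Net (K : ℕ) where
  d : Fin K → ℕ
  M : ℕ
  Zr : (k : Fin K) → Sq (Fin (d k))
  Phi : Fin (M + 1) → Sq (Ant d)
  V : Fin (M + 1) → Sq (Ant d)
  Wn : Sq (Ant d)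
  g : ℝ
  δ : Fin M → Fin K → ℝ

namespace Net

variable {K : ℕ} (T : Net K)

/-- The number of antennas. -/
def N : ℝ := card (Ant T.d)

/-- Families of vectors, one for each user. -/
abbrev Est : Type := Fin (T.M + 1) → Ant T.d → ℂ

/-- Square matrices indexed by the antennas. -/
abbrev Mat : Type := Sq (Ant T.d)

/-- The covariances of the interferers, cluster `k`. -/
abbrev om (k : Fin K) : Fin T.M → Sq (Fin (T.d k)) :=
  fun i => blk (T.Phi i.succ) k k

/-- The cross covariances of the interferers. -/
abbrev ox (k l : Fin K) : Fin T.M → Matrix (Fin (T.d k)) (Fin (T.d l)) ℂ :=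
  fun i => blk (T.Phi i.succ) k l

/-- The parameters `δ` of cluster `k`. -/
abbrev dl (k : Fin K) : Fin T.M → ℝ := fun j => T.δ j k

/-- The interferers in cluster `k`. -/
abbrev cl (y : T.Est) (k : Fin K) : Fin T.M → Fin (T.d k) → ℂ :=
  fun j => restr (y j.succ) k

abbrev res (y : T.Est) (k : Fin K) : Sq (Fin (T.d k)) :=
  resolv (T.Zr k) (T.cl y k)

abbrev th (k : Fin K) : Sq (Fin (T.d k)) := thet (T.Zr k) (T.om k) (T.dl k)

abbrev thHat (y : T.Est) (k : Fin K) :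
    Sq (Fin (T.d k)) :=
  thet (T.Zr k) (T.om k) (dhat (T.Zr k) (T.om k) (T.cl y k))

/-- `∑_j (V_j y_j) (V_j y_j)ᴴ` over the interferers. -/
def gram (y : T.Est) : T.Mat :=
  ∑ j : Fin T.M, vecMulVec (T.V j.succ *ᵥ y j.succ) (star (T.V j.succ *ᵥ y j.succ))

/-- The index set of the matrices whose products are the test matrices of quadratic forms. -/
abbrev Letter : Type := Fin 9 × Fin K × Fin (T.M + 1)

/-- The matrices whose products are the test matrices of quadratic forms. -/
def letter (y : T.Est) (c : T.Letter) : T.Mat :=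
  (![em c.2.1 c.2.1 (T.res y c.2.1), em c.2.1 c.2.1 (T.th c.2.1), em c.2.1 c.2.1 (T.thHat y c.2.1),
    vecMulVec (y c.2.2) (star (y c.2.2)), T.gram y, T.V c.2.2, (T.V c.2.2)ᴴ, T.Phi c.2.2, T.Wn] :
    Fin 9 → T.Mat) c.1

/-- Products of letters. -/
def word (y : T.Est) (L : List T.Letter) : T.Mat :=
  (L.map (T.letter y)).prod

/-- All quadratic forms with leave-one-out test matrices concentrate. -/
def Conc (η : ℝ) (y : T.Est) : Prop :=
  ∀ (j : Fin (T.M + 1)) (L : List T.Letter), L.length ≤ 12 →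
    ‖qf (y j) (T.word (update y j 0) L) (y j)
      - (T.word (update y j 0) L * T.Phi j).trace‖
      ≤ η * fro (T.word (update y j 0) L)

/-- Deterministic test matrices that are short products of letters. -/
def Test (n : ℕ) (B : T.Mat) : Prop :=
  ∃ L : List T.Letter, L.length ≤ n ∧ ∀ y, T.word y L = B

/-- Uniform bounds on the data of a network. -/
structure NetReg (C : ℝ) : Prop where
  one_le : 1 ≤ C
  d_pos : ∀ k, 0 < T.d k
  M_le : ∀ k, (T.M : ℝ) ≤ C * T.d k
  le_M : ∀ k, (T.d k : ℝ) ≤ C * T.M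
  tr_le : ∀ j k, ‖(T.Phi j).trace‖ + T.N ≤ C * T.d k
  Z_ge : ∀ k, ((C⁻¹ : ℝ) : ℂ) • 1 ≤ T.Zr k
  Z_le : ∀ k, T.Zr k ≤ (C : ℂ) • 1
  Phi_ge : ∀ j, ((C⁻¹ : ℝ) : ℂ) • 1 ≤ T.Phi j
  Phi_le : ∀ j, T.Phi j ≤ (C : ℂ) • 1
  norm_V : ∀ j, ‖T.V j‖ ≤ C
  norm_VP : ∀ j, ‖T.V j * T.Phi j‖ ≤ C
  norm_PV : ∀ j, ‖T.Phi j * (T.V j)ᴴ‖ ≤ C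
  norm_VPV : ∀ j, ‖T.V j * T.Phi j * (T.V j)ᴴ‖ ≤ C
  V_blk : ∀ j k, blk (T.V j * T.Phi j) k k = blk (T.Phi j) k k
  g_nonneg : 0 ≤ T.g
  g_le : T.g ≤ 1
  Wn_ge : ((1 - T.g : ℝ) : ℂ) • 1 ≤ T.Wn
  norm_Wn : ‖T.Wn‖ ≤ C
  fixed : ∀ k, IsFixed (T.Zr k) (T.om k) (T.dl k)

variable {T} {C η ε : ℝ} {y : T.Est}

lemma word_append (L L' : List T.Letter) : T.word y (L ++ L') = T.word y L * T.word y L' := by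
  simp [word]

lemma word_cons (c : T.Letter) (L : List T.Letter) :
    T.word y (c :: L) = T.letter y c * T.word y L := by simp [word]

lemma word_nil : T.word y [] = 1 := rfl

lemma NetReg.pos (h : T.NetReg C) : 0 < C := zero_lt_one.trans_le h.one_le

lemma NetReg.N_le (h : T.NetReg C) (k : Fin K) : T.N ≤ C * T.d k := by
  have := h.tr_le 0 k
  have := norm_nonneg (T.Phi 0).trace
  linarith

lemma N_nonneg : 0 ≤ T.N := cast_nonneg _

lemma N_eq : T.N = ∑ k, (T.d k : ℝ) := by simp [N]

lemma d_le_N (k : Fin K) : (T.d k : ℝ) ≤ T.N := by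
  rw [N_eq]
  exact single_le_sum (f := fun k => (T.d k : ℝ)) (fun _ _ => cast_nonneg _)
    (mem_univ k)

lemma NetReg.dR_pos (h : T.NetReg C) (k : Fin K) : (0 : ℝ) < T.d k := by exact_mod_cast h.d_pos k

lemma NetReg.N_pos (h : T.NetReg C) (k : Fin K) : 0 < T.N := (h.dR_pos k).trans_le (d_le_N k)

lemma NetReg.reg (h : T.NetReg C) (k : Fin K) : Reg C (T.Zr k) (T.om k) where
  one_le := h.one_le
  card_pos := by simpa using h.d_pos k
  card_le := by simpa using h.M_le k
  Z_ge := h.Z_ge k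
  Z_le := h.Z_le k
  Om_ge i := (blk_smul_one _ k).symm.trans_le (blk_le_blk (h.Phi_ge i.succ) k)
  Om_le i := (blk_le_blk (h.Phi_le i.succ) k).trans_eq (blk_smul_one _ k)

lemma NetReg.Phi_psd (h : T.NetReg C) (j : Fin (T.M + 1)) : (T.Phi j).PosSemidef :=
  (posDef_of_smul_one_le (inv_pos.2 h.pos) (h.Phi_ge j)).posSemidef

lemma NetReg.norm_Phi (h : T.NetReg C) (j : Fin (T.M + 1)) : ‖T.Phi j‖ ≤ C :=
  norm_le_of_le_smul_one (nonneg_iff_posSemidef.2 (h.Phi_psd j)) (h.Phi_le j) h.pos.le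

lemma NetReg.pairReg (h : T.NetReg C) (k l : Fin K) :
    PairReg C (T.Zr k) (T.om k) (T.Zr l) (T.om l) (T.ox k l)
      (fun j => rowsOf (psdSqrt (T.Phi j.succ)) k)
      (fun j => rowsOf (psdSqrt (T.Phi j.succ)) l) where
  reg := h.reg k
  reg' := h.reg l
  card_le := by simpa using (d_le_N k).trans (h.N_le l)
  card_le' := by simpa using (d_le_N l).trans (h.N_le k)
  norm_Ox j := (norm_blk_le _ _ _).trans (h.norm_Phi _)
  Om_eq j := by rw [← blk_mul_conjTranspose, psdSqrt_mul_conjTranspose (h.Phi_psd _)]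
  Om_eq' j := by rw [← blk_mul_conjTranspose, psdSqrt_mul_conjTranspose (h.Phi_psd _)]
  Ox_eq j := by rw [← blk_mul_conjTranspose, psdSqrt_mul_conjTranspose (h.Phi_psd _)]

lemma Conc.quad (E : T.Conc η y) (h : T.NetReg C) (hη : η ≤ ε * sqrt T.N) (hη0 : 0 ≤ η)
    {P O : T.Mat} (hP : ‖P‖ ≤ C) (hO : ‖O‖ ≤ C) {k l : Fin K}
    {X : Matrix (Fin (T.d k)) (Fin (T.d l)) ℂ} {j : Fin (T.M + 1)} (L : List T.Letter)
    (hL : L.length ≤ 12) (hw : T.word (update y j 0) L = Pᴴ * em k l X * O) (a : Fin K) :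
    QuadNear (C ^ 3 * ε) (card (Fin (T.d a))) (restr (P *ᵥ y j) k) X (restr (O *ᵥ y j) l)
      (blk (O * T.Phi j * Pᴴ) l k) := by
  have hCp := h.pos
  have h1 := E j L hL
  rw [hw, qf_em, trace_em] at h1
  have hN : 0 < T.N := h.N_pos a
  have hs : 0 < sqrt T.N := Real.sqrt_pos.2 hN
  have hε : 0 ≤ ε := by
    by_contra hlt
    have := mul_neg_of_neg_of_pos (not_le.1 hlt) hs
    linarith
  refine h1.trans ?_
  have h2 : fro (Pᴴ * em k l X * O) ≤ C * (sqrt T.N * ‖X‖) * C := by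
    refine (fro_mul_le_right _ _).trans ?_
    have h3 := fro_mul_le_left Pᴴ (em k l X)
    have h4 : fro (em k l X) ≤ sqrt T.N * ‖X‖ := (fro_le _).trans (by
      unfold N; gcongr; exact norm_em_le _ _ _)
    rw [l2_opNorm_conjTranspose] at h3
    have h5 : fro (Pᴴ * em k l X) ≤ C * (sqrt T.N * ‖X‖) :=
      h3.trans (mul_le_mul hP h4 (fro_nonneg _) hCp.le)
    exact mul_le_mul h5 hO (norm_nonneg _) (by positivity)
  have h6 := h.N_le a
  rw [card_fin]
  calc _ ≤ (ε * sqrt T.N) * (C * (sqrt T.N * ‖X‖) * C) :=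
        mul_le_mul hη h2 (fro_nonneg _) (by positivity)
    _ = C ^ 2 * ε * (sqrt T.N * sqrt T.N) * ‖X‖ := by ring
    _ = C ^ 2 * ε * T.N * ‖X‖ := by rw [Real.mul_self_sqrt hN.le]
    _ ≤ C ^ 2 * ε * (C * T.d a) * ‖X‖ := by gcongr
    _ = _ := by ring

lemma cl_update (j : Fin T.M) (k : Fin K) :
    T.cl (update y j.succ 0) k = loo (T.cl y k) j := by
  funext i
  by_cases hij : i = j
  · subst hij; simp [cl]; rfl
  · have : i.succ ≠ j.succ := fun h => hij (Fin.succ_injective _ h)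
    simp [cl, hij]

lemma cl_update_zero (k : Fin K) : T.cl (update y 0 0) k = T.cl y k := by
  funext i
  simp [cl]

lemma gram_update_zero : T.gram (update y 0 0) = T.gram y := by simp [gram]

section Letters

variable (T y)

lemma word_res (k : Fin K) : T.word y [(0, k, 0)] = em k k (T.res y k) := by simp [word, letter]

lemma word_th (k : Fin K) : T.word y [(1, k, 0)] = em k k (T.th k) := by simp [word, letter]

lemma word_thHat (k : Fin K) : T.word y [(2, k, 0)] = em k k (T.thHat y k) := by simp [word, letter]

lemma word_gram (k : Fin K) : T.word y [(4, k, 0)] = T.gram y := by simp [word, letter]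

lemma word_V (k : Fin K) (i : Fin (T.M + 1)) : T.word y [(5, k, i)] = T.V i := by
  simp [word, letter]

lemma word_VH (k : Fin K) (i : Fin (T.M + 1)) : T.word y [(6, k, i)] = (T.V i)ᴴ := by
  simp [word, letter]

end Letters

section Tests

variable (T)

lemma test_Phi (k : Fin K) (i : Fin (T.M + 1)) : T.Test 3 (T.Phi i) :=
  ⟨[(7, k, i)], by simp, fun y => by simp [word, letter]⟩

lemma test_Wn (k : Fin K) : T.Test 3 T.Wn := ⟨[(8, k, 0)], by simp, fun y => by simp [word, letter]⟩

lemma Test.mid {A B : T.Mat} (hA : T.Test 3 A) (hB : T.Test 3 B)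
    (k : Fin K) : T.Test 7 (A * em k k (T.th k) * B) := by
  obtain ⟨L, hL, hA⟩ := hA
  obtain ⟨L', hL', hB⟩ := hB
  refine ⟨L ++ ((1, k, 0) :: L'), by simp; omega, fun y => ?_⟩
  rw [word_append, hA, word_cons, hB, Matrix.mul_assoc]
  simp [letter]

lemma Test.mono {A : T.Mat} {n n' : ℕ} (hA : T.Test n A) (h : n ≤ n') :
    T.Test n' A := by
  obtain ⟨L, hL, hA⟩ := hA
  exact ⟨L, hL.trans h, hA⟩

lemma test_VP (k : Fin K) (i : Fin (T.M + 1)) : T.Test 3 (T.V i * T.Phi i) :=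
  ⟨[(5, k, i), (7, k, i)], by simp, fun y => by simp [word, letter]⟩

lemma test_PV (k : Fin K) (i : Fin (T.M + 1)) : T.Test 3 (T.Phi i * (T.V i)ᴴ) :=
  ⟨[(7, k, i), (6, k, i)], by simp, fun y => by simp [word, letter]⟩

lemma test_VPV (k : Fin K) (i : Fin (T.M + 1)) : T.Test 3 (T.V i * T.Phi i * (T.V i)ᴴ) :=
  ⟨[(5, k, i), (7, k, i), (6, k, i)], by simp, fun y => by simp [word, letter, Matrix.mul_assoc]⟩

end Tests

end Net

lemma QuadNear.mono {m n : Type} [Fintype m] [DecidableEq m] [Fintype n] [DecidableEq n]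
    {ε ε' N : ℝ} {u : m → ℂ} {X : Matrix m n ℂ} {v : n → ℂ} {W : Matrix n m ℂ}
    (h : QuadNear ε N u X v W) (hε : ε ≤ ε') (hN : 0 ≤ N) : QuadNear ε' N u X v W :=
  h.trans (by gcongr)

namespace Net

variable {K : ℕ} {T : Net K} {C η ε : ℝ} {y : T.Est}

/-- A regular network together with estimates for which quadratic forms concentrate. -/
structure Good (T : Net K) (C η ε : ℝ) (y : T.Est) : Prop where
  reg : T.NetReg C
  conc : T.Conc η y
  one_le : 1 ≤ η
  le : η ^ 3 ≤ ε ^ 2 * T.N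
  pos : 0 < ε
  le_one : ε ≤ 1

lemma Good.eta_le (H : T.Good C η ε y) : η ≤ ε * sqrt T.N := by
  have h1 : η ^ 2 ≤ ε ^ 2 * T.N := by
    refine le_trans ?_ H.le
    have := H.one_le
    exact pow_le_pow_right₀ H.one_le (by norm_num)
  have h2 := Real.sqrt_le_sqrt h1
  rwa [Real.sqrt_sq (by linarith [H.one_le]), Real.sqrt_mul (sq_nonneg _),
    Real.sqrt_sq H.pos.le] at h2

lemma Good.eta_nonneg (H : T.Good C η ε y) : 0 ≤ η := by linarith [H.one_le]

lemma Good.inv_N_le (H : T.Good C η ε y) : T.N⁻¹ ≤ ε := by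
  have h1 := H.eta_le
  have h2 := H.one_le
  have hN : 0 < sqrt T.N := by
    by_contra hlt
    have : sqrt T.N = 0 := le_antisymm (not_lt.1 hlt) (Real.sqrt_nonneg _)
    rw [this] at h1; linarith
  have h3 : 1 ≤ sqrt T.N := by
    have := H.le_one
    nlinarith
  have h4 : sqrt T.N * sqrt T.N = T.N := Real.mul_self_sqrt N_nonneg
  rw [inv_le_iff_one_le_mul₀ (by rw [← h4]; positivity), ← h4]
  have := H.pos
  nlinarith [mul_nonneg H.pos.le hN.le]

lemma Good.inv_card_le (H : T.Good C η ε y) (k : Fin K) :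
    (card (Fin (T.d k)) : ℝ)⁻¹ ≤ C ^ 3 * ε := by
  have hC := H.reg.one_le
  have hN := H.reg.N_pos k
  have hd := H.reg.dR_pos k
  rw [card_fin]
  calc (T.d k : ℝ)⁻¹ ≤ C * T.N⁻¹ := by
        rw [← div_eq_mul_inv, le_div_iff₀ hN, inv_mul_le_iff₀ hd, mul_comm]
        exact H.reg.N_le k
    _ ≤ C ^ 3 * ε := mul_le_mul (le_self_pow₀ hC (by norm_num)) H.inv_N_le (inv_nonneg.2 hN.le)
        (by positivity)

lemma nrm_restr_le (u : Ant T.d → ℂ) (k : Fin K) : nrm (restr u k) ≤ nrm u := by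
  have h := nrm_mulVec_le (sel T.d k) u
  rw [sel_mulVec] at h
  refine h.trans ?_
  have := norm_sel_le (d := T.d) k
  have := nrm_nonneg u
  nlinarith

lemma Good.nrm_sq_le (H : T.Good C η ε y) (j : Fin (T.M + 1)) (k : Fin K) :
    nrm (y j) ^ 2 ≤ C * T.d k := by
  have h1 := H.conc j [] (by simp)
  rw [word_nil, Matrix.one_mul, qf, one_mulVec, dot_self] at h1
  have h2 : fro (1 : T.Mat) ≤ sqrt T.N := by
    have := fro_le (1 : T.Mat)
    have h3 := norm_one_le (m := Ant T.d)
    unfold N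
    nlinarith [Real.sqrt_nonneg (card (Ant T.d) : ℝ)]
  have h3 : η * fro (1 : T.Mat) ≤ T.N := by
    have hN := N_nonneg (T := T)
    calc _ ≤ (ε * sqrt T.N) * sqrt T.N :=
          mul_le_mul H.eta_le h2 (fro_nonneg _) (mul_nonneg H.pos.le (Real.sqrt_nonneg _))
      _ = ε * T.N := by rw [mul_assoc, Real.mul_self_sqrt hN]
      _ ≤ 1 * T.N := by gcongr; exact H.le_one
      _ = _ := one_mul _
  have h4 := norm_le_norm_add_norm_sub' ((nrm (y j) ^ 2 : ℝ) : ℂ) (T.Phi j).trace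
  rw [norm_real, norm_of_nonneg (sq_nonneg _)] at h4
  have h5 := H.reg.tr_le j k
  linarith

lemma Good.nrm_restr_sq_le (H : T.Good C η ε y) (j : Fin (T.M + 1)) (k a : Fin K) :
    nrm (restr (y j) k) ^ 2 ≤ C * card (Fin (T.d a)) := by
  rw [card_fin]
  refine le_trans ?_ (H.nrm_sq_le j a)
  exact pow_le_pow_left₀ (nrm_nonneg _) (nrm_restr_le _ _) 2

/-- Quadratic forms in transformed estimates. -/
lemma Good.quad (H : T.Good C η ε y) {P O : T.Mat} (hP : ‖P‖ ≤ C)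
    (hO : ‖O‖ ≤ C) {k l : Fin K} {X : Matrix (Fin (T.d k)) (Fin (T.d l)) ℂ} {j : Fin (T.M + 1)}
    (L : List T.Letter) (hL : L.length ≤ 12)
    (hw : T.word (update y j 0) L = Pᴴ * em k l X * O) (a : Fin K) :
    QuadNear (C ^ 3 * ε) (card (Fin (T.d a))) (restr (P *ᵥ y j) k) X (restr (O *ᵥ y j) l)
      (blk (O * T.Phi j * Pᴴ) l k) :=
  H.conc.quad H.reg H.eta_le H.eta_nonneg hP hO L hL hw a

lemma Good.norm_one (H : T.Good C η ε y) : ‖(1 : T.Mat)‖ ≤ C :=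
  norm_one_le.trans H.reg.one_le

/-- Quadratic forms in the estimates. -/
lemma Good.quad_one (H : T.Good C η ε y) {k l : Fin K} {X : Matrix (Fin (T.d k)) (Fin (T.d l)) ℂ}
    {j : Fin (T.M + 1)} (L : List T.Letter) (hL : L.length ≤ 12)
    (hw : T.word (update y j 0) L = em k l X) (a : Fin K) :
    QuadNear (C ^ 3 * ε) (card (Fin (T.d a))) (restr (y j) k) X (restr (y j) l)
      (blk (T.Phi j) l k) := by
  have h := H.quad H.norm_one H.norm_one (k := k) (l := l) (X := X) (j := j) L hL
    (by rw [hw]; simp) a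
  simpa using h

lemma word_res_loo (j : Fin T.M) (k : Fin K) :
    T.word (update y j.succ 0) [(0, k, 0)]
      = em k k (resolv (T.Zr k) (loo (T.cl y k) j)) := by rw [word_res, res, cl_update]

lemma Good.quad_res (H : T.Good C η ε y) (j : Fin T.M) (k a : Fin K) :
    QuadNear (C ^ 3 * ε) (card (Fin (T.d a))) (T.cl y k j)
      (resolv (T.Zr k) (loo (T.cl y k) j)) (T.cl y k j) (T.om k j) :=
  H.quad_one _ (by simp) (word_res_loo j k) a

/-- The random parameters are close to the deterministic ones. -/
lemma dhat_sub_le (K : ℕ) {C : ℝ} (hC : 1 ≤ C) : ∃ C' : ℝ, 0 < C' ∧ ∀ {T : Net K} {η ε : ℝ}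
    {y : T.Est}, T.Good C η ε y → ∀ k i,
    |dhat (T.Zr k) (T.om k) (T.cl y k) i - T.dl k i| ≤ C' * ε := by
  obtain ⟨C', hC', h⟩ := dhat_near hC
  refine ⟨C' * C ^ 3, by positivity, fun {T η ε y} H k i => ?_⟩
  rw [mul_assoc]
  refine h (H.reg.reg k) (fun j => H.nrm_restr_sq_le _ _ _) (H.inv_card_le k)
    (fun j => H.quad_res j k k) (fun i j => ?_) (H.reg.fixed k).1 (H.reg.fixed k).2 i
  obtain ⟨L, hL, hB⟩ := test_Phi T k i.succ
  refine H.quad_one ([(0, k, 0)] ++ L ++ [(2, k, 0)]) (by simp; omega) ?_ k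
  rw [word_append, word_append, word_res_loo, hB, word_thHat, em_mul_mul_em, thHat, cl_update]

lemma baseEvent (K : ℕ) {C : ℝ} (hC : 1 ≤ C) : ∃ C' : ℝ, 0 < C' ∧ ∀ {T : Net K} {η ε : ℝ}
    {y : T.Est}, T.Good C η ε y → ∀ k,
    BaseEvent C (C' * ε) (T.Zr k) (T.cl y k) (T.dl k) := by
  obtain ⟨C', hC', h⟩ := dhat_sub_le K hC
  refine ⟨2 * C ^ 7 + C' + C ^ 3, by positivity, fun {T η ε y} H k => ?_⟩
  have hε := H.pos
  have h7 : 0 ≤ 2 * C ^ 7 * ε := by positivity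
  have h3 : 0 ≤ C ^ 3 * ε := by positivity
  have h1 : 0 ≤ C' * ε := by positivity
  refine ⟨fun j => H.nrm_restr_sq_le _ _ _, (H.inv_card_le k).trans (by linarith),
    (H.reg.fixed k).nonneg, fun j => ?_⟩
  have e1 := norm_qj_sub_dhat_le (H.reg.reg k) (T.cl y k) j (H.nrm_restr_sq_le _ _ _)
    (H.inv_card_le k) (H.quad_res j k k)
  have e2 := h H k j
  rw [← Real.norm_eq_abs, ← norm_real, Complex.ofReal_sub] at e2
  have e3 := norm_sub_le_norm_sub_add_norm_sub (qj (T.Zr k) (T.cl y k) j)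
    (dhat (T.Zr k) (T.om k) (T.cl y k) j : ℂ) (T.dl k j : ℂ)
  have e4 : 2 * C ^ 4 * (C ^ 3 * ε) = 2 * C ^ 7 * ε := by ring
  linarith

/-- First order equivalent for short products. -/
lemma first (K : ℕ) {C : ℝ} (hC : 1 ≤ C) : ∃ C' : ℝ, 0 < C' ∧ ∀ {T : Net K} {η ε : ℝ}
    {y : T.Est}, T.Good C η ε y → ∀ k {B : T.Mat},
    T.Test 7 B → ‖blk B k k‖ ≤ C ^ 3 →
    ‖(card (Fin (T.d k)) : ℂ)⁻¹ * (blk B k k * T.res y k).trace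
      - (card (Fin (T.d k)) : ℂ)⁻¹ * (blk B k k * T.th k).trace‖ ≤ C' * ε := by
  obtain ⟨C', hC', h⟩ := dhat_sub_le K hC
  refine ⟨(6 * C ^ 11 + C ^ 4 * C') * C ^ 3, by positivity, fun {T η ε y} H k B hB hBn => ?_⟩
  have hε := H.pos
  have h1 := first_order (H.reg.reg k) (H.reg.fixed k).nonneg (y := T.cl y k)
    (fun j => H.nrm_restr_sq_le _ _ _) (H.inv_card_le k) (fun j => H.quad_res j k k)
    (η := C' * ε) (by positivity) (h H k) (blk B k k) (fun j => by
      obtain ⟨L, hL, hB⟩ := hB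
      refine H.quad_one ([(0, k, 0)] ++ L ++ [(1, k, 0)]) (by simp; omega) ?_ k
      rw [word_append, word_append, word_res_loo, hB, word_th, em_mul_mul_em])
  refine h1.trans ?_
  calc _ ≤ (6 * C ^ 8 * (C ^ 3 * ε) + C ^ 4 * (C' * ε)) * C ^ 3 := by gcongr
    _ = _ := by ring

lemma NetReg.norm_th (h : T.NetReg C) (k : Fin K) : ‖T.th k‖ ≤ C :=
  norm_thet_le (h.reg k) (h.fixed k).nonneg

lemma pairEvent (K : ℕ) {C : ℝ} (hC : 1 ≤ C) : ∃ C' : ℝ, 0 < C' ∧ ∀ {T : Net K} {η ε : ℝ}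
    {y : T.Est}, T.Good C η ε y → ∀ (k l : Fin K)
    {A B : T.Mat}, T.Test 3 A → T.Test 3 B → ‖A‖ ≤ C → ‖B‖ ≤ C →
    PairEvent (C' * ε) (T.Zr k) (T.om k) (T.Zr l) (T.om l) (T.ox k l) (T.cl y k) (T.cl y l)
      (T.dl k) (T.dl l) (blk A l k) (blk B k l) := by
  obtain ⟨C', hC', h⟩ := first K hC
  refine ⟨C' + C ^ 3, by positivity, fun {T η ε y} H k l A B hA hB hAn hBn => ?_⟩
  have hε := H.pos
  have p1 : C' * ε ≤ (C' + C ^ 3) * ε := by gcongr; have := pow_pos H.reg.pos 3; linarith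
  have p2 : C ^ 3 * ε ≤ (C' + C ^ 3) * ε := by gcongr; linarith
  have key : ∀ {B : T.Mat}, T.Test 3 B → ‖B‖ ≤ C →
      ‖(card (Fin (T.d l)) : ℂ)⁻¹ * (blk A l k * T.th k * blk B k l * T.res y l).trace
      - (card (Fin (T.d l)) : ℂ)⁻¹ * (blk A l k * T.th k * blk B k l * T.th l).trace‖
      ≤ (C' + C ^ 3) * ε := by
    intro B hB hBn
    have e1 : blk (A * em k k (T.th k) * B) l l = blk A l k * T.th k * blk B k l := by
      simp only [blk_eq, em, Matrix.mul_assoc]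
    have e2 : ‖blk A l k * T.th k * blk B k l‖ ≤ C ^ 3 :=
      (nmul (nmul ((norm_blk_le _ _ _).trans hAn) (H.reg.norm_th k))
        ((norm_blk_le _ _ _).trans hBn)).trans (le_of_eq (by ring))
    have := h H l (hA.mid T hB k) (by rw [e1]; exact e2)
    rw [e1] at this
    exact this.trans p1
  refine ⟨fun j => ?_, fun j => ?_, fun j => ?_, key hB hBn,
    fun j => key (test_Phi T k j.succ) (H.reg.norm_Phi _)⟩
  · obtain ⟨L, hL, hA⟩ := hA
    obtain ⟨L', hL', hB⟩ := hB
    refine (H.quad_one ([(0, k, 0)] ++ L' ++ [(0, l, 0)] ++ L ++ [(1, k, 0)]) (by simp; omega) ?_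
      k).mono p2 (cast_nonneg _)
    rw [word_append, word_append, word_append, word_append, word_res_loo, word_res_loo, hA, hB,
      word_th, em_mul_mul_em, em_mul_mul_em]
  · obtain ⟨L', hL', hB⟩ := hB
    have := (H.quad_one (X := resolv (T.Zr k) (loo (T.cl y k) j) * blk B k l *
      resolv (T.Zr l) (loo (T.cl y l) j)) ([(0, k, 0)] ++ L' ++ [(0, l, 0)]) (by simp; omega) (by
        rw [word_append, word_append, word_res_loo, word_res_loo, hB, em_mul_mul_em])
      k).mono p2 (cast_nonneg _)
    rw [ox, blk_conjTranspose, (H.reg.Phi_psd _).isHermitian]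
    exact this
  · obtain ⟨L, hL, hA⟩ := hA
    refine (H.quad_one ([(0, l, 0)] ++ L ++ [(1, k, 0)]) (by simp; omega) ?_
      k).mono p2 (cast_nonneg _)
    rw [word_append, word_append, word_res_loo, hA, word_th, em_mul_mul_em]

/-- Second order equivalent for short products. -/
lemma second (K : ℕ) {C : ℝ} (hC : 1 ≤ C) : ∃ C' : ℝ, 0 < C' ∧ ∀ {T : Net K} {η ε : ℝ}
    {y : T.Est}, T.Good C η ε y → ∀ (k l : Fin K)
    {A B : T.Mat}, T.Test 3 A → T.Test 3 B → ‖A‖ ≤ C → ‖B‖ ≤ C →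
    UpsNear (C' * ε) (T.Zr k) (T.om k) (T.Zr l) (T.om l) (T.ox k l) (T.cl y k) (T.cl y l)
      (T.dl k) (T.dl l) (blk A l k) (blk B k l) := by
  obtain ⟨C₁, hC₁, h₁⟩ := baseEvent K hC
  obtain ⟨C₂, hC₂, h₂⟩ := pairEvent K hC
  obtain ⟨C₃, hC₃, h₃⟩ := second_order hC
  refine ⟨C₃ * (C₁ + C₂), by positivity, fun {T η ε y} H k l A B hA hB hAn hBn => ?_⟩
  have hε := H.pos
  have p1 : C₁ * ε ≤ (C₁ + C₂) * ε := by gcongr; linarith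
  have p2 : C₂ * ε ≤ (C₁ + C₂) * ε := by gcongr; linarith
  have bm : ∀ k, BaseEvent C ((C₁ + C₂) * ε) (T.Zr k) (T.cl y k) (T.dl k) := fun k =>
    ⟨(h₁ H k).nrm_le, (h₁ H k).eps.trans p1, (h₁ H k).pos, fun j => ((h₁ H k).qj_near j).trans p1⟩
  have pm : ∀ {A : T.Mat}, T.Test 3 A → ‖A‖ ≤ C →
      PairEvent ((C₁ + C₂) * ε) (T.Zr k) (T.om k) (T.Zr l) (T.om l) (T.ox k l) (T.cl y k) (T.cl y l)
      (T.dl k) (T.dl l) (blk A l k) (blk B k l) := fun hA hAn => by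
    have e := h₂ H k l hA hB hAn hBn
    exact ⟨fun j => (e.quad j).mono p2 (cast_nonneg _),
      fun j => (e.quad₁ j).mono p2 (cast_nonneg _),
      fun j => (e.quad₂ j).mono p2 (cast_nonneg _), e.first.trans p2,
      fun j => (e.first₁ j).trans p2⟩
  unfold UpsNear
  rw [mul_assoc]
  refine h₃ (H.reg.pairReg k l) (H.reg.fixed k) (H.reg.fixed l) (bm k) (bm l)
    ((norm_blk_le _ _ _).trans hAn) ((norm_blk_le _ _ _).trans hBn) (pm hA hAn) fun i => ?_
  have := pm (test_Phi T k i.succ) (H.reg.norm_Phi _)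
  rw [ox, blk_conjTranspose, (H.reg.Phi_psd _).isHermitian]
  exact this

/-- The transformed estimates in cluster `k`. -/
abbrev tl (T : Net K) (y : T.Est) (k : Fin K) :
    Fin T.M → Fin (T.d k) → ℂ :=
  fun j => restr (T.V j.succ *ᵥ y j.succ) k

/-- The third order equivalent of a network. -/
abbrev third (T : Net K) (k l : Fin K) (a : Matrix (Fin (T.d l)) (Fin (T.d k)) ℂ) (j : Fin T.M) : ℂ :=
  thirdSum (T.Zr k) (T.om k) (T.Zr l) (T.om l) (T.ox k l) (T.dl k) (T.dl l)
    (fun j => blk (T.V j.succ * T.Phi j.succ) k k) (fun j => blk (T.Phi j.succ * (T.V j.succ)ᴴ) l l)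
    (fun j => blk (T.V j.succ * T.Phi j.succ * (T.V j.succ)ᴴ) k l)
    (fun j => blk (T.Phi j.succ * (T.V j.succ)ᴴ) k l)
    (fun j => blk (T.V j.succ * T.Phi j.succ) k l) a j

lemma third_near (K : ℕ) {C : ℝ} (hC : 1 ≤ C) : ∃ C' : ℝ, 0 < C' ∧ ∀ {T : Net K} {η ε : ℝ}
    {y : T.Est}, T.Good C η ε y → C' * ε ≤ 1 → ∀ (k l : Fin K)
    {A : T.Mat}, T.Test 3 A → ‖A‖ ≤ C →
    ‖(card (Fin (T.d k)) : ℂ)⁻¹ * ∑ j, (card (Fin (T.d l)) : ℂ)⁻¹ *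
        qf (T.tl y l j) (T.res y l * blk A l k * T.res y k) (T.tl y k j)
      - (card (Fin (T.d k)) : ℂ)⁻¹ * ∑ j, (card (Fin (T.d l)) : ℂ)⁻¹ *
        T.third k l (blk A l k) j‖ ≤ C' * ε := by
  obtain ⟨C₁, hC₁, h₁⟩ := baseEvent K hC
  obtain ⟨C₂, hC₂, h₂⟩ := first K hC
  obtain ⟨C₃, hC₃, h₃⟩ := second K hC
  set D := C₁ + C₂ + C₃ + C ^ 3 with hD
  refine ⟨300 * C ^ 15 * D, by positivity, fun {T η ε y} H hsmall k l A hA hAn => ?_⟩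
  have hε := H.pos
  have hC3 : 0 < C ^ 3 := by positivity
  have hCp : 0 < C := by linarith
  have p1 : C₁ * ε ≤ D * ε := by gcongr; linarith
  have p2 : C₂ * ε ≤ D * ε := by gcongr; linarith
  have p3 : C₃ * ε ≤ D * ε := by gcongr; linarith
  have p4 : C ^ 3 * ε ≤ D * ε := by gcongr; linarith
  have hCC : C ≤ C ^ 3 := le_self_pow₀ hC (by norm_num)
  have hDε : D * ε ≤ 1 := by
    refine le_trans ?_ hsmall
    have : (1 : ℝ) ≤ 300 * C ^ 15 := by have := one_le_pow₀ hC (n := 15); linarith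
    have hD0 : 0 ≤ D * ε := by positivity
    nlinarith
  have bm : ∀ k, BaseEvent C (D * ε) (T.Zr k) (T.cl y k) (T.dl k) := fun k =>
    ⟨(h₁ H k).nrm_le, (h₁ H k).eps.trans p1, (h₁ H k).pos, fun j => ((h₁ H k).qj_near j).trans p1⟩
  have um : ∀ {B : T.Mat}, T.Test 3 B → ‖B‖ ≤ C →
      UpsNear (D * ε) (T.Zr k) (T.om k) (T.Zr l) (T.om l) (T.ox k l) (T.cl y k) (T.cl y l)
        (T.dl k) (T.dl l) (blk A l k) (blk B k l) := fun hB hBn =>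
    (h₃ H k l hA hB hAn hBn).trans p3
  have hnV : ∀ j, ‖T.V j‖ ≤ C := H.reg.norm_V
  obtain ⟨L, hL, hLA⟩ := hA
  have hmid : ∀ j : Fin T.M, T.word (update y j.succ 0) ([(0, l, 0)] ++ L ++ [(0, k, 0)])
      = em l k (resolv (T.Zr l) (loo (T.cl y l) j) * blk A l k *
        resolv (T.Zr k) (loo (T.cl y k) j)) := fun j => by
    rw [word_append, word_append, word_res_loo, word_res_loo, hLA, em_mul_mul_em]
  rw [mul_assoc]
  refine third_order (H.reg.pairReg k l) (bm k) (bm l) hDε ((norm_blk_le _ _ _).trans hAn)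
    ⟨fun j => (norm_blk_le _ _ _).trans (H.reg.norm_VP _),
      fun j => (norm_blk_le _ _ _).trans (H.reg.norm_PV _),
      fun j => (norm_blk_le _ _ _).trans (H.reg.norm_VPV _),
      fun j => (norm_blk_le _ _ _).trans (H.reg.norm_PV _),
      fun j => (norm_blk_le _ _ _).trans (H.reg.norm_VP _), fun j => ?_, fun j => ?_,
      fun j => (h₂ H k ((test_VP T k j.succ).mono T (by norm_num))
        (((norm_blk_le _ _ _).trans (H.reg.norm_VP _)).trans hCC)).trans p2,
      fun j => (h₂ H l ((test_PV T k j.succ).mono T (by norm_num))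
        (((norm_blk_le _ _ _).trans (H.reg.norm_PV _)).trans hCC)).trans p2,
      fun j => ?_, fun j => ?_, fun j => ?_, fun j => ?_,
      fun j => um (test_VPV T k j.succ) (H.reg.norm_VPV _),
      fun j => um (test_PV T k j.succ) (H.reg.norm_PV _),
      fun j => um (test_VP T k j.succ) (H.reg.norm_VP _),
      fun j => um (test_Phi T k j.succ) (H.reg.norm_Phi _)⟩
  · have := (H.quad H.norm_one (hnV j.succ) (j := j.succ) (k := k) (l := k)
      (X := resolv (T.Zr k) (loo (T.cl y k) j)) ([(0, k, 0)] ++ [(5, k, j.succ)]) (by simp) (by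
        rw [word_append, word_res_loo, word_V]; simp) k).mono p4 (cast_nonneg _)
    simpa using this
  · have := (H.quad (hnV j.succ) H.norm_one (j := j.succ) (k := l) (l := l)
      (X := resolv (T.Zr l) (loo (T.cl y l) j)) ([(6, k, j.succ)] ++ [(0, l, 0)]) (by simp) (by
        rw [word_append, word_res_loo, word_VH]; simp) l).mono p4 (cast_nonneg _)
    simpa using this
  · exact (H.quad (hnV j.succ) (hnV j.succ)
      ([(6, k, j.succ)] ++ ([(0, l, 0)] ++ L ++ [(0, k, 0)]) ++ [(5, k, j.succ)])
      (by simp; omega) (by rw [word_append, word_append, hmid, word_V, word_VH]) k).mono p4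
        (cast_nonneg _)
  · have := (H.quad (hnV j.succ) H.norm_one (j := j.succ)
      ([(6, k, j.succ)] ++ ([(0, l, 0)] ++ L ++ [(0, k, 0)]))
      (by simp; omega) (by rw [word_append, hmid, word_VH, Matrix.mul_one]) k).mono p4
        (cast_nonneg _)
    simpa using this
  · have := (H.quad H.norm_one (hnV j.succ) (j := j.succ)
      (([(0, l, 0)] ++ L ++ [(0, k, 0)]) ++ [(5, k, j.succ)])
      (by simp; omega) (by rw [word_append, hmid, word_V, conjTranspose_one, Matrix.one_mul])
        k).mono p4 (cast_nonneg _)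
    simpa using this
  · exact (H.quad_one _ (by simp; omega) (hmid j) k).mono p4 (cast_nonneg _)

end Net

section GramMatrices

variable {m n : Type} [Fintype m] [DecidableEq m] [Fintype n] [DecidableEq n]

lemma mul_vecMulVec_mul_conjTranspose (A : Matrix m n ℂ) (u : n → ℂ) :
    A * vecMulVec u (star u) * Aᴴ = vecMulVec (A *ᵥ u) (star (A *ᵥ u)) := by
  rw [mul_vecMulVec, vecMulVec_mul, star_mulVec]

lemma trace_vecMulVec_mul (u : m → ℂ) (X : Sq m) :
    (vecMulVec u (star u) * X).trace = qf u X u := by rw [trace_mul_comm, trace_mul_vecMulVec]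

lemma fro_mul_conjTranspose_self (B : Matrix m n ℂ) : fro (B * Bᴴ) = fro (Bᴴ * B) := by
  have h1 := fro_sq_trace (B * Bᴴ)
  have h2 := fro_sq_trace (Bᴴ * B)
  simp only [conjTranspose_mul, conjTranspose_conjTranspose] at h1 h2
  have h3 : (B * Bᴴ * (B * Bᴴ)).trace = (Bᴴ * B * (Bᴴ * B)).trace := by
    rw [Matrix.mul_assoc, trace_mul_comm]
    simp only [Matrix.mul_assoc]
  rw [h1, h2] at h3
  exact (sq_eq_sq₀ (fro_nonneg _) (fro_nonneg _)).1 (by exact_mod_cast h3)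

lemma sum_vecMulVec (t : n → m → ℂ) :
    ∑ j, vecMulVec (t j) (star (t j)) = (of fun a j => t j a) * (of fun a j => t j a)ᴴ := by
  ext a b
  simp [Matrix.sum_apply, mul_apply, vecMulVec_apply]

lemma fro_sum_vecMulVec_sq (t : n → m → ℂ) :
    fro (∑ j, vecMulVec (t j) (star (t j))) ^ 2 = ∑ i, ∑ j, ‖star (t i) ⬝ᵥ t j‖ ^ 2 := by
  rw [sum_vecMulVec, fro_mul_conjTranspose_self, fro_sq]
  simp [mul_apply, dotProduct]

lemma norm_qf_sq (u v : m → ℂ) :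
    ((‖star u ⬝ᵥ v‖ ^ 2 : ℝ) : ℂ) = qf u (vecMulVec v (star v)) u := by
  rw [qf, vecMulVec_mulVec]
  have h : star v ⬝ᵥ u = star (star u ⬝ᵥ v) := by rw [← star_dotProduct_star, star_star]
  rw [h]
  simp [Complex.conj_mul']

lemma qf_eq_sum (u : m → ℂ) (X : Matrix m n ℂ) (v : n → ℂ) :
    qf u X v = ∑ i, ∑ j, star (u i) * X i j * v j := by
  simp only [qf, dotProduct, mulVec, Pi.star_apply, Finset.mul_sum, mul_assoc]

lemma norm_qf_sub_le {X Y : Sq m} {η : ℝ} (h : ∀ i j, ‖(X - Y) i j‖ ≤ η) (hη : 0 ≤ η)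
    (u : m → ℂ) : ‖qf u X u - qf u Y u‖ ≤ card m * η * nrm u ^ 2 := by
  rw [← qf_sub, qf_eq_sum]
  calc _ ≤ ∑ i, ∑ j, ‖u i‖ * η * ‖u j‖ := by
        refine (norm_sum_le _ _).trans (sum_le_sum fun i _ =>
          (norm_sum_le _ _).trans (sum_le_sum fun j _ => ?_))
        rw [norm_mul, norm_mul, norm_star]
        gcongr
        exact h i j
    _ = η * (∑ i, ‖u i‖) ^ 2 := by
        rw [sq, Finset.sum_mul_sum, Finset.mul_sum]
        refine sum_congr rfl fun i _ => ?_
        rw [Finset.mul_sum]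
        exact sum_congr rfl fun j _ => by ring
    _ ≤ η * (card m * ∑ i, ‖u i‖ ^ 2) := by
        gcongr
        exact sq_sum_le_card_mul_sum_sq
    _ = _ := by rw [nrm_sq]; ring

end GramMatrices

namespace Net

variable {K : ℕ} {T : Net K} {C η ε : ℝ} {y : T.Est}

/-- The normalised matrix `G = g / N ∑_j (V_j y_j) (V_j y_j)ᴴ + W`. -/
def gm (T : Net K) (y : T.Est) : T.Mat :=
  ((T.g / T.N : ℝ) : ℂ) • T.gram y + T.Wn

/-- The deterministic equivalent of `N_k⁻¹ y_{0k}ᴴ Q_k y_{0k}`. -/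
def vv (T : Net K) (k : Fin K) : ℂ :=
  (card (Fin (T.d k)) : ℂ)⁻¹ * (blk (T.Phi 0) k k * T.th k).trace

/-- The quadratic forms `N (N_k N_l)⁻¹ y_{0k}ᴴ Q_k G_{kl} Q_l y_{0l}`. -/
def gq (T : Net K) (y : T.Est) : Sq (Fin K) :=
  of fun k l => ((T.N / (T.d k * T.d l) : ℝ) : ℂ) *
    qf (restr (y 0) k) (T.res y k * blk (T.gm y) k l * T.res y l) (restr (y 0) l)

/-- The traces `N (N_k N_l)⁻¹ Tr Q_k G_{kl} Q_l [Φ_0]_{lk}`. -/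
def dh (T : Net K) (y : T.Est) : Sq (Fin K) :=
  of fun k l => ((T.N / (T.d k * T.d l) : ℝ) : ℂ) *
    (T.res y k * blk (T.gm y) k l * T.res y l * blk (T.Phi 0) l k).trace

/-- The deterministic equivalent of `gq`. -/
def dlt (T : Net K) : Sq (Fin K) :=
  of fun k l => ((T.N / (T.d k * T.d l) : ℝ) : ℂ) *
      ups (T.Zr k) (T.om k) (T.Zr l) (T.om l) (T.ox k l) (T.dl k) (T.dl l) (blk (T.Phi 0) l k)
        (blk T.Wn k l)
    + ((T.g / (T.d k * T.d l) : ℝ) : ℂ) * ∑ j, T.third k l (blk (T.Phi 0) l k) j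

lemma NetReg.norm_res (h : T.NetReg C) (k : Fin K) : ‖T.res y k‖ ≤ C :=
  norm_resolv_le h.pos (h.Z_ge k) _

lemma vv_near (K : ℕ) {C : ℝ} (hC : 1 ≤ C) : ∃ C' : ℝ, 0 < C' ∧ ∀ {T : Net K} {η ε : ℝ}
    {y : T.Est}, T.Good C η ε y → ∀ (k : Fin K)
    {O : T.Mat}, T.Test 1 O → ‖O‖ ≤ C →
    blk (O * T.Phi 0) k k = blk (T.Phi 0) k k →
    ‖(T.d k : ℂ)⁻¹ * qf (restr (y 0) k) (T.res y k) (restr (O *ᵥ y 0) k) - T.vv k‖ ≤ C' * ε := by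
  obtain ⟨C', hC', h⟩ := first K hC
  refine ⟨C ^ 4 + C', by positivity, fun {T η ε y} H k O hO hOn hb => ?_⟩
  have hCp := H.reg.pos
  obtain ⟨L, hL, hO⟩ := hO
  have h1 := (H.quad H.norm_one hOn (j := 0) (k := k) (l := k) (X := T.res y k)
    ([(0, k, 0)] ++ L) (by simp; omega) (by
      rw [word_append, word_res, hO, res, cl_update_zero]; simp) k)
  rw [conjTranspose_one, Matrix.mul_one, one_mulVec, hb] at h1
  have h2 := h1.div (H.reg.reg k).cardR_pos
  have h3 := h H k ((test_Phi T k 0).mono T (by norm_num))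
    (((norm_blk_le _ _ _).trans (H.reg.norm_Phi _)).trans (le_self_pow₀ hC (by norm_num)))
  rw [trace_mul_comm (blk (T.Phi 0) k k) (T.res y k)] at h3
  rw [ofReal_natCast] at h2
  have h4 : C ^ 3 * ε * ‖T.res y k‖ ≤ C ^ 4 * ε := by
    have := H.pos
    calc _ ≤ C ^ 3 * ε * C := by gcongr; exact H.reg.norm_res k
      _ = _ := by ring
  have h5 := norm_sub_le_norm_sub_add_norm_sub
    ((card (Fin (T.d k)) : ℂ)⁻¹ * qf (restr (y 0) k) (T.res y k) (restr (O *ᵥ y 0) k))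
    ((card (Fin (T.d k)) : ℂ)⁻¹ * (T.res y k * blk (T.Phi 0) k k).trace) (T.vv k)
  rw [card_fin] at h5 h2 h3
  unfold vv at h5 ⊢
  rw [card_fin] at h5 ⊢
  linarith

/-- The Frobenius norm of the Gram matrix. -/
lemma Good.fro_gram_sq_le (H : T.Good C η ε y) (a : Fin K) :
    fro (T.gram y) ^ 2 ≤ 3 * C ^ 8 * T.N ^ 3 * η := by
  have hC := H.reg.one_le
  have hCp := H.reg.pos
  have hN := H.reg.N_pos a
  have hη := H.one_le
  have hη0 := H.eta_nonneg
  have hM : (T.M : ℝ) ≤ C * T.N := (H.reg.M_le a).trans (by gcongr; exact d_le_N a)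
  have hy : ∀ j, nrm (y j) ^ 2 ≤ C * T.N := fun j =>
    (H.nrm_sq_le j a).trans (by gcongr; exact d_le_N a)
  have pair : ∀ i j : Fin T.M, i ≠ j →
      ‖star (T.V i.succ *ᵥ y i.succ) ⬝ᵥ (T.V j.succ *ᵥ y j.succ)‖ ^ 2
        ≤ (C + η) * C ^ 5 * T.N := by
    intro i j hij
    have hij' : j.succ ≠ i.succ := fun h => hij (Fin.succ_injective _ h).symm
    set B := (T.V i.succ)ᴴ * T.V j.succ with hB
    have hBn : ‖B‖ ≤ C * C :=
      nmul ((l2_opNorm_conjTranspose _).trans_le (H.reg.norm_V _)) (H.reg.norm_V _)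
    have hBB : nrm (B *ᵥ y j.succ) ^ 2 ≤ C ^ 5 * T.N := by
      calc _ ≤ (C * C * nrm (y j.succ)) ^ 2 := by
            refine pow_le_pow_left₀ (nrm_nonneg _) ((nrm_mulVec_le _ _).trans ?_) 2
            have := nrm_nonneg (y j.succ)
            gcongr
        _ = C ^ 4 * nrm (y j.succ) ^ 2 := by ring
        _ ≤ C ^ 4 * (C * T.N) := by gcongr; exact hy _
        _ = _ := by ring
    have hw : T.word (update y i.succ 0)
        [(6, a, i.succ), (5, a, j.succ), (3, a, j.succ), (6, a, j.succ), (5, a, i.succ)]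
        = vecMulVec (B *ᵥ y j.succ) (star (B *ᵥ y j.succ)) := by
      rw [← mul_vecMulVec_mul_conjTranspose, hB]
      simp [word, letter, hij', Matrix.mul_assoc]
    have h1 := H.conc i.succ
      [(6, a, i.succ), (5, a, j.succ), (3, a, j.succ), (6, a, j.succ), (5, a, i.succ)] (by simp)
    rw [hw, fro_vecMulVec, trace_vecMulVec_mul, ← norm_qf_sq] at h1
    have h2 := norm_qf_le (B *ᵥ y j.succ) (T.Phi i.succ) (B *ᵥ y j.succ)
    have h3 := norm_le_norm_add_norm_sub'
      ((‖star (y i.succ) ⬝ᵥ (B *ᵥ y j.succ)‖ ^ 2 : ℝ) : ℂ)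
      (qf (B *ᵥ y j.succ) (T.Phi i.succ) (B *ᵥ y j.succ))
    rw [norm_real, norm_of_nonneg (sq_nonneg _)] at h3
    have h4 : star (T.V i.succ *ᵥ y i.succ) ⬝ᵥ (T.V j.succ *ᵥ y j.succ)
        = star (y i.succ) ⬝ᵥ (B *ᵥ y j.succ) := by
      rw [star_mulVec, ← dotProduct_mulVec, mulVec_mulVec]
    rw [h4]
    calc _ ≤ ‖T.Phi i.succ‖ * nrm (B *ᵥ y j.succ) * nrm (B *ᵥ y j.succ)
          + η * (nrm (B *ᵥ y j.succ) * nrm (B *ᵥ y j.succ)) := by linarith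
      _ = (‖T.Phi i.succ‖ + η) * nrm (B *ᵥ y j.succ) ^ 2 := by ring
      _ ≤ (C + η) * (C ^ 5 * T.N) := by gcongr; exact H.reg.norm_Phi _
      _ = _ := by ring
  have diag : ∀ i : Fin T.M, ‖star (T.V i.succ *ᵥ y i.succ) ⬝ᵥ (T.V i.succ *ᵥ y i.succ)‖ ^ 2
        ≤ C ^ 6 * T.N ^ 2 := by
    intro i
    rw [dot_self, norm_real, norm_of_nonneg (sq_nonneg _)]
    have h1 : nrm (T.V i.succ *ᵥ y i.succ) ^ 2 ≤ C ^ 3 * T.N := by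
      calc _ ≤ (C * nrm (y i.succ)) ^ 2 := by
            refine pow_le_pow_left₀ (nrm_nonneg _) ((nrm_mulVec_le _ _).trans ?_) 2
            have := nrm_nonneg (y i.succ)
            gcongr
            exact H.reg.norm_V _
        _ = C ^ 2 * nrm (y i.succ) ^ 2 := by ring
        _ ≤ C ^ 2 * (C * T.N) := by gcongr; exact hy _
        _ = _ := by ring
    calc _ ≤ (C ^ 3 * T.N) ^ 2 := pow_le_pow_left₀ (sq_nonneg _) h1 2
      _ = _ := by ring
  have hrow : ∀ i : Fin T.M, ∑ j : Fin T.M,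
      ‖star (T.V i.succ *ᵥ y i.succ) ⬝ᵥ (T.V j.succ *ᵥ y j.succ)‖ ^ 2
        ≤ C ^ 6 * T.N ^ 2 + C * T.N * ((C + η) * C ^ 5 * T.N) := by
    intro i
    rw [← Finset.add_sum_erase _ _ (mem_univ i)]
    refine add_le_add (diag i) ?_
    calc _ ≤ ∑ _j ∈ Finset.univ.erase i, (C + η) * C ^ 5 * T.N :=
          sum_le_sum fun j hj => pair i j (Finset.ne_of_mem_erase hj).symm
      _ ≤ ∑ _j : Fin T.M, (C + η) * C ^ 5 * T.N :=
          Finset.sum_le_sum_of_subset_of_nonneg (Finset.erase_subset _ _)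
            fun _ _ _ => by positivity
      _ = T.M * ((C + η) * C ^ 5 * T.N) := by simp
      _ ≤ _ := by gcongr
  rw [gram, fro_sum_vecMulVec_sq]
  have p7 : C ^ 7 ≤ C ^ 8 := pow_le_pow_right₀ hC (by norm_num)
  calc _ ≤ ∑ _i : Fin T.M, (C ^ 6 * T.N ^ 2 + C * T.N * ((C + η) * C ^ 5 * T.N)) :=
        sum_le_sum fun i _ => hrow i
    _ = T.M * (C ^ 6 * T.N ^ 2 + C * T.N * ((C + η) * C ^ 5 * T.N)) := by simp; ring
    _ ≤ (C * T.N) * (C ^ 6 * T.N ^ 2 + C * T.N * ((C + η) * C ^ 5 * T.N)) := by gcongr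
    _ = T.N ^ 3 * (C ^ 7 * 1 + C ^ 8 * 1 + C ^ 7 * η) := by ring
    _ ≤ T.N ^ 3 * (C ^ 8 * η + C ^ 8 * η + C ^ 8 * η) := by gcongr
    _ = _ := by ring

lemma Good.eta_mul_fro_gram_le (H : T.Good C η ε y) (a : Fin K) :
    η * fro (T.gram y) ≤ 2 * C ^ 4 * T.N ^ 2 * ε := by
  have hη0 := H.eta_nonneg
  have hN := H.reg.N_pos a
  have hCp := H.reg.pos
  have hε := H.pos
  refine abs_le_of_sq_le_sq' ?_ (by positivity) |>.2
  calc (η * fro (T.gram y)) ^ 2 = η ^ 2 * fro (T.gram y) ^ 2 := by ring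
    _ ≤ η ^ 2 * (3 * C ^ 8 * T.N ^ 3 * η) := by gcongr; exact H.fro_gram_sq_le a
    _ = 3 * C ^ 8 * T.N ^ 3 * η ^ 3 := by ring
    _ ≤ 3 * C ^ 8 * T.N ^ 3 * (ε ^ 2 * T.N) := by gcongr; exact H.le
    _ ≤ 4 * C ^ 8 * T.N ^ 3 * (ε ^ 2 * T.N) := by gcongr; norm_num
    _ = _ := by ring

lemma blk_add (A B : Sq (Ant T.d)) (k l : Fin K) :
    blk (A + B) k l = blk A k l + blk B k l := rfl

lemma blk_smul (c : ℂ) (A : Sq (Ant T.d)) (k l : Fin K) :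
    blk (c • A) k l = c • blk A k l := rfl

lemma blk_gram (y : T.Est) (k l : Fin K) :
    blk (T.gram y) k l = ∑ j, vecMulVec (T.tl y k j) (star (T.tl y l j)) := by
  ext i i'
  simp [blk, gram, Matrix.sum_apply, vecMulVec_apply, restr]

lemma NetReg.div_le (h : T.NetReg C) (k l : Fin K) :
    T.N / (T.d k * T.d l) * T.d k ≤ C := by
  have h1 := h.dR_pos k
  have h2 := h.dR_pos l
  have : T.N / (T.d k * T.d l) * T.d k = T.N / T.d l := by field_simp
  rw [this, div_le_iff₀ h2]
  exact h.N_le l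

lemma NetReg.div_mul_le (h : T.NetReg C) (k l : Fin K) :
    T.N / (T.d k * T.d l) * T.N ≤ C ^ 2 := by
  have h1 := h.dR_pos k
  have h2 := h.dR_pos l
  have hN := h.N_pos k
  have hC := h.pos
  rw [div_mul_eq_mul_div, div_le_iff₀ (by positivity)]
  calc T.N * T.N ≤ (C * T.d k) * (C * T.d l) :=
        mul_le_mul (h.N_le k) (h.N_le l) hN.le (by positivity)
    _ = _ := by ring

lemma norm_gq_sub_dh_le (K : ℕ) {C : ℝ} (hC : 1 ≤ C) : ∃ C' : ℝ, 0 < C' ∧ ∀ {T : Net K} {η ε : ℝ}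
    {y : T.Est}, T.Good C η ε y → ∀ k l,
    ‖(T.gq y - T.dh y) k l‖ ≤ C' * ε := by
  refine ⟨2 * C ^ 8 + C ^ 7, by positivity, fun {T η ε y} H k l => ?_⟩
  have hCp := H.reg.pos
  have hN := H.reg.N_pos k
  have h1 := H.reg.dR_pos k
  have h2 := H.reg.dR_pos l
  have hε := H.pos
  have hg0 := H.reg.g_nonneg
  have hg1 := H.reg.g_le
  set Q := T.res y k
  set Q' := T.res y l
  set a := blk (T.Phi 0) l k
  set u := restr (y 0) k
  set u' := restr (y 0) l
  have hE : T.word (update y 0 0) ([(0, k, 0)] ++ [(4, k, 0)] ++ [(0, l, 0)])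
      = em k k Q * T.gram y * em l l Q' := by
    rw [word_append, word_append, word_res, word_gram, word_res, res, res, cl_update_zero,
      cl_update_zero, gram_update_zero]
  have e1 : ‖qf u (Q * blk (T.gram y) k l * Q') u' - (Q * blk (T.gram y) k l * Q' * a).trace‖
      ≤ C ^ 2 * (2 * C ^ 4 * T.N ^ 2 * ε) := by
    have hc := H.conc 0 ([(0, k, 0)] ++ [(4, k, 0)] ++ [(0, l, 0)]) (by simp)
    rw [hE, em_mul_mul_em] at hc
    have q1 := qf_em k l 1 1 (Q * blk (T.gram y) k l * Q') (y 0) (y 0)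
    have q2 := trace_em k l 1 1 (T.Phi 0) (Q * blk (T.gram y) k l * Q')
    rw [one_mulVec, conjTranspose_one, Matrix.one_mul, Matrix.mul_one] at q1
    rw [conjTranspose_one, Matrix.one_mul, Matrix.mul_one, Matrix.one_mul, Matrix.mul_one] at q2
    rw [q1, q2, ← em_mul_mul_em] at hc
    refine hc.trans ?_
    have f1 : fro (em k k Q * T.gram y * em l l Q') ≤ C * fro (T.gram y) * C := by
      refine (fro_mul_le_right _ _).trans ?_
      refine mul_le_mul ((fro_mul_le_left _ _).trans ?_)
        ((norm_em_le _ _ _).trans (H.reg.norm_res l)) (norm_nonneg _)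
        (mul_nonneg hCp.le (fro_nonneg _))
      exact mul_le_mul_of_nonneg_right ((norm_em_le _ _ _).trans (H.reg.norm_res k)) (fro_nonneg _)
    calc _ ≤ η * (C * fro (T.gram y) * C) := by
          have := H.eta_nonneg
          gcongr
      _ = C ^ 2 * (η * fro (T.gram y)) := by ring
      _ ≤ _ := mul_le_mul_of_nonneg_left (H.eta_mul_fro_gram_le k) (by positivity)
  have e2 : ‖qf u (Q * blk T.Wn k l * Q') u' - (Q * blk T.Wn k l * Q' * a).trace‖
      ≤ C ^ 3 * ε * T.d k * C ^ 3 := by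
    obtain ⟨L, hL, hW⟩ := test_Wn T k
    have hq := H.quad_one (j := 0) (X := Q * blk T.Wn k l * Q') ([(0, k, 0)] ++ L ++ [(0, l, 0)])
      (by simp; omega) (by
        rw [word_append, word_append, word_res, word_res, hW, res, res, cl_update_zero,
          cl_update_zero, em_mul_mul_em]) k
    rw [card_fin] at hq
    refine hq.trans ?_
    gcongr
    exact (nmul (nmul (H.reg.norm_res k) ((norm_blk_le _ _ _).trans H.reg.norm_Wn))
      (H.reg.norm_res l)).trans (le_of_eq (by ring))
  set s := T.N / (T.d k * T.d l) with hs
  have hs0 : 0 ≤ s := by positivity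
  have e3 : (T.gq y - T.dh y) k l = (s : ℂ) * (((T.g / T.N : ℝ) : ℂ) *
      (qf u (Q * blk (T.gram y) k l * Q') u' - (Q * blk (T.gram y) k l * Q' * a).trace)
      + (qf u (Q * blk T.Wn k l * Q') u' - (Q * blk T.Wn k l * Q' * a).trace)) := by
    simp only [Matrix.sub_apply, gq, dh, of_apply, gm, blk_add, blk_smul, Matrix.mul_add,
      Matrix.add_mul, Matrix.mul_smul, Matrix.smul_mul, qf_add, qf_smul, trace_add, trace_smul,
      smul_eq_mul]
    ring
  rw [e3, norm_mul, norm_real, norm_of_nonneg hs0]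
  have e4 := H.reg.div_mul_le k l
  have e5 := H.reg.div_le k l
  calc _ ≤ s * (1 / T.N * (C ^ 2 * (2 * C ^ 4 * T.N ^ 2 * ε)) + C ^ 3 * ε * T.d k * C ^ 3) := by
        gcongr
        refine (norm_add_le _ _).trans (add_le_add ?_ e2)
        rw [norm_mul, norm_real, norm_of_nonneg (by positivity)]
        gcongr
    _ = (s * T.N) * (C ^ 2 * (2 * C ^ 4 * ε)) + (s * T.d k) * (C ^ 3 * ε * C ^ 3) := by field_simp
    _ ≤ C ^ 2 * (C ^ 2 * (2 * C ^ 4 * ε)) + C * (C ^ 3 * ε * C ^ 3) := by gcongr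
    _ = _ := by ring

lemma dh_apply (y : T.Est) (k l : Fin K) (hN : T.N ≠ 0) :
    T.dh y k l = (T.g : ℂ) * ((T.d k : ℂ)⁻¹ * ∑ j, (T.d l : ℂ)⁻¹ *
        qf (T.tl y l j) (T.res y l * blk (T.Phi 0) l k * T.res y k) (T.tl y k j))
      + ((T.N / T.d l : ℝ) : ℂ) * ((T.d k : ℂ)⁻¹ *
        (blk (T.Phi 0) l k * T.res y k * blk T.Wn k l * T.res y l).trace) := by
  have e1 : (T.res y k * blk (T.gram y) k l * T.res y l * blk (T.Phi 0) l k).trace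
      = ∑ j, qf (T.tl y l j) (T.res y l * blk (T.Phi 0) l k * T.res y k) (T.tl y k j) := by
    rw [blk_gram, Matrix.mul_sum, Matrix.sum_mul, Matrix.sum_mul, trace_sum]
    refine sum_congr rfl fun j _ => ?_
    rw [← trace_mul_vecMulVec, Matrix.mul_assoc, Matrix.mul_assoc, trace_mul_comm]
    rw [trace_mul_comm, ← Matrix.mul_assoc, trace_mul_comm]
    simp only [Matrix.mul_assoc]
  have e2 : (T.res y k * blk T.Wn k l * T.res y l * blk (T.Phi 0) l k).trace
      = (blk (T.Phi 0) l k * T.res y k * blk T.Wn k l * T.res y l).trace := by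
    rw [trace_mul_comm]; simp only [Matrix.mul_assoc]
  simp only [dh, of_apply, gm, blk_add, blk_smul, Matrix.mul_add,
      Matrix.add_mul, Matrix.mul_smul, Matrix.smul_mul, trace_add, trace_smul, smul_eq_mul, e1, e2,
      ← Finset.mul_sum]
  have hN' : (T.N : ℂ) ≠ 0 := by exact_mod_cast hN
  push_cast
  field_simp

lemma norm_dh_sub_dlt_le (K : ℕ) {C : ℝ} (hC : 1 ≤ C) : ∃ C' : ℝ, 0 < C' ∧
    ∀ {T : Net K} {η ε : ℝ} {y : T.Est}, T.Good C η ε y → C' * ε ≤ 1 →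
    ∀ k l, ‖(T.dh y - T.dlt) k l‖ ≤ C' * ε := by
  obtain ⟨C₁, hC₁, h₁⟩ := second K hC
  obtain ⟨C₂, hC₂, h₂⟩ := third_near K hC
  refine ⟨C₂ + C * C₁, by positivity, fun {T η ε y} H hs k l => ?_⟩
  have hCp := H.reg.pos
  have hN := H.reg.N_pos k
  have hε := H.pos
  have hg0 := H.reg.g_nonneg
  have hdl := H.reg.dR_pos l
  have e1 := h₁ H k l (test_Phi T k 0) (test_Wn T k) (H.reg.norm_Phi 0) H.reg.norm_Wn
  have e2 := h₂ H (by nlinarith [mul_nonneg hCp.le (mul_nonneg hC₁.le hε.le)]) k l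
    (test_Phi T k 0) (H.reg.norm_Phi 0)
  unfold UpsNear at e1
  simp only [card_fin] at e1 e2
  have e3 : (T.dh y - T.dlt) k l = (T.g : ℂ) *
      ((T.d k : ℂ)⁻¹ * ∑ j, (T.d l : ℂ)⁻¹ *
        qf (T.tl y l j) (T.res y l * blk (T.Phi 0) l k * T.res y k) (T.tl y k j)
      - (T.d k : ℂ)⁻¹ * ∑ j, (T.d l : ℂ)⁻¹ * T.third k l (blk (T.Phi 0) l k) j)
      + ((T.N / T.d l : ℝ) : ℂ) * ((T.d k : ℂ)⁻¹ *
        (blk (T.Phi 0) l k * T.res y k * blk T.Wn k l * T.res y l).trace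
      - (T.d k : ℂ)⁻¹ * ups (T.Zr k) (T.om k) (T.Zr l) (T.om l) (T.ox k l) (T.dl k) (T.dl l)
        (blk (T.Phi 0) l k) (blk T.Wn k l)) := by
    rw [Matrix.sub_apply, dh_apply y k l hN.ne', dlt, of_apply, ← Finset.mul_sum,
      ← Finset.mul_sum]
    push_cast
    field_simp
    ring
  rw [e3]
  refine (norm_add_le _ _).trans ?_
  rw [norm_mul, norm_mul, norm_real, norm_real, norm_of_nonneg hg0,
    norm_of_nonneg (by positivity)]
  calc _ ≤ 1 * (C₂ * ε) + C * (C₁ * ε) := by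
        gcongr
        · exact H.reg.g_le
        · rw [div_le_iff₀ hdl]; exact H.reg.N_le l
    _ = _ := by ring

lemma norm_dh_le (K : ℕ) {C : ℝ} (hC : 1 ≤ C) : ∃ C' : ℝ, 0 < C' ∧
    ∀ {T : Net K} {η ε : ℝ} {y : T.Est}, T.Good C η ε y →
    ∀ k l, ‖T.dh y k l‖ ≤ C' := by
  refine ⟨C * (C ^ 2 * (C ^ 3 * C ^ 2 * C)) + C * (C * C ^ 4), by positivity,
    fun {T η ε y} H k l => ?_⟩
  have hCp := H.reg.pos
  have hN := H.reg.N_pos k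
  have hε := H.pos
  have hg0 := H.reg.g_nonneg
  have hdl := H.reg.dR_pos l
  have hdk := H.reg.dR_pos k
  have ht : ∀ (k : Fin K) j, nrm (T.tl y k j) ^ 2 ≤ C ^ 2 * (C * T.d l) := fun k j => by
    have h1 : nrm (T.tl y k j) ≤ C * nrm (y j.succ) :=
      (nrm_restr_le _ _).trans ((nrm_mulVec_le _ _).trans (by
        have := nrm_nonneg (y j.succ)
        gcongr
        exact H.reg.norm_V _))
    calc _ ≤ (C * nrm (y j.succ)) ^ 2 := pow_le_pow_left₀ (nrm_nonneg _) h1 2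
      _ = C ^ 2 * nrm (y j.succ) ^ 2 := by ring
      _ ≤ _ := by gcongr; exact H.nrm_sq_le _ _
  have hq : ∀ j, ‖(T.d l : ℂ)⁻¹ *
        qf (T.tl y l j) (T.res y l * blk (T.Phi 0) l k * T.res y k) (T.tl y k j)‖
        ≤ C ^ 3 * C ^ 2 * C := by
    intro j
    rw [norm_mul, norm_inv, norm_natCast, inv_mul_le_iff₀ hdl]
    have h1 : ‖T.res y l * blk (T.Phi 0) l k * T.res y k‖ ≤ C ^ 3 :=
      (nmul (nmul (H.reg.norm_res l) ((norm_blk_le _ _ _).trans (H.reg.norm_Phi _)))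
        (H.reg.norm_res k)).trans (le_of_eq (by ring))
    have h2 := ht k j
    have h3 := ht l j
    have h4 : nrm (T.tl y l j) * nrm (T.tl y k j) ≤ C ^ 2 * (C * T.d l) := by
      nlinarith [sq_nonneg (nrm (T.tl y l j) - nrm (T.tl y k j))]
    calc _ ≤ ‖T.res y l * blk (T.Phi 0) l k * T.res y k‖ * nrm (T.tl y l j) * nrm (T.tl y k j) :=
          norm_qf_le _ _ _
      _ = ‖T.res y l * blk (T.Phi 0) l k * T.res y k‖ * (nrm (T.tl y l j) * nrm (T.tl y k j)) := by
          ring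
      _ ≤ C ^ 3 * (C ^ 2 * (C * T.d l)) := by
          refine mul_le_mul h1 h4 ?_ (by positivity)
          exact mul_nonneg (nrm_nonneg _) (nrm_nonneg _)
      _ = _ := by ring
  have h1 := norm_inv_card_sum_le (H.reg.reg k) (by positivity) hq
  rw [card_fin] at h1
  rw [dh_apply y k l hN.ne']
  refine (norm_add_le _ _).trans ?_
  rw [norm_mul (T.g : ℂ), norm_mul ((T.N / T.d l : ℝ) : ℂ), norm_real, norm_real, norm_of_nonneg hg0,
    norm_of_nonneg (by positivity)]
  have h2 : ‖(T.d k : ℂ)⁻¹ * (blk (T.Phi 0) l k * T.res y k * blk T.Wn k l * T.res y l).trace‖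
      ≤ C * C ^ 4 := by
    rw [norm_mul, norm_inv, norm_natCast, inv_mul_le_iff₀ hdk]
    have h2 : ‖blk (T.Phi 0) l k * T.res y k * blk T.Wn k l * T.res y l‖ ≤ C ^ 4 :=
      (nmul (nmul (nmul ((norm_blk_le _ _ _).trans (H.reg.norm_Phi _)) (H.reg.norm_res k))
        ((norm_blk_le _ _ _).trans H.reg.norm_Wn)) (H.reg.norm_res l)).trans (le_of_eq (by ring))
    refine (norm_trace_le _).trans ?_
    rw [card_fin]
    calc _ ≤ (C * T.d k) * C ^ 4 := by
          gcongr
          exact (d_le_N l).trans (H.reg.N_le k)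
      _ = _ := by ring
  have h3 : T.N / T.d l ≤ C := by rw [div_le_iff₀ hdl]; exact H.reg.N_le l
  calc _ ≤ 1 * (C * (C ^ 3 * C ^ 2 * C)) + C * (C * C ^ 4) := by
        gcongr
        exact H.reg.g_le
    _ ≤ _ := by
        have : 1 * (C * (C ^ 3 * C ^ 2 * C)) ≤ C * (C ^ 2 * (C ^ 3 * C ^ 2 * C)) := by
          rw [one_mul]
          exact mul_le_mul_of_nonneg_left
            (le_mul_of_one_le_left (by positivity) (one_le_pow₀ hC)) hCp.le
        linarith

end Net

namespace Net

variable {K : ℕ} {T : Net K} {C η ε : ℝ} {y : T.Est}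

/-- The lower bound for the solutions of the fundamental system. -/
def low (C : ℝ) : ℝ := C⁻¹ * (C + C ^ 2)⁻¹

lemma low_pos (hC : 1 ≤ C) : 0 < low C := by unfold low; positivity

lemma low_le_one (hC : 1 ≤ C) : low C ≤ 1 := by
  unfold low
  have h1 : C⁻¹ ≤ 1 := inv_le_one_of_one_le₀ hC
  have h2 : (C + C ^ 2)⁻¹ ≤ 1 := inv_le_one_of_one_le₀ (by nlinarith)
  exact mul_le_one₀ h1 (by positivity) h2

lemma dl_eq (h : T.NetReg C) (k : Fin K) (j : Fin T.M) :
    ((T.dl k j : ℝ) : ℂ) = (T.d k : ℂ)⁻¹ * (T.om k j * T.th k).trace := by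
  have h2 := fmap_eq (h.reg k) (x := T.dl k) (h.fixed k).nonneg j
  rw [card_fin] at h2
  rw [← h2]
  exact congrArg _ ((h.fixed k).2 j)

/-- Transformed estimates do not degenerate under the resolvent. -/
lemma nrm_res_tl_ge (K : ℕ) {C : ℝ} (hC : 1 ≤ C) : ∃ C' : ℝ, 0 < C' ∧
    ∀ {T : Net K} {η ε : ℝ} {y : T.Est}, T.Good C η ε y → C' * ε ≤ low C →
    ∀ (k : Fin K) (j : Fin T.M),
      low C ^ 2 / (16 * C) * T.d k ≤ nrm (T.res y k *ᵥ T.tl y k j) ^ 2 := by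
  obtain ⟨C₁, hC₁, h₁⟩ := baseEvent K hC
  obtain ⟨C₂, hC₂, h₂⟩ := first K hC
  set D := C₁ + C₂ + C ^ 3 with hD
  have hC3 : 0 < C ^ 3 := by positivity
  refine ⟨16 * C ^ 4 * D, by positivity, fun {T η ε y} H hs k j => ?_⟩
  have hCp := H.reg.pos
  have hε := H.pos
  have hd := H.reg.dR_pos k
  have hl := low_pos hC
  have hl1 := low_le_one hC
  have p1 : C₁ * ε ≤ D * ε := by gcongr; linarith
  have p2 : C₂ * ε ≤ D * ε := by gcongr; linarith
  have p4 : C ^ 3 * ε ≤ D * ε := by gcongr; linarith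
  have bm : BaseEvent C (D * ε) (T.Zr k) (T.cl y k) (T.dl k) :=
    ⟨(h₁ H k).nrm_le, (h₁ H k).eps.trans p1, (h₁ H k).pos, fun j => ((h₁ H k).qj_near j).trans p1⟩
  have hb := (beta_near (H.reg.reg k) bm j (u := T.cl y k j) (v := T.tl y k j)
    (U := blk (T.V j.succ * T.Phi j.succ) k k)
    ((norm_blk_le _ _ _).trans (H.reg.norm_VP _)) (by
      have := (H.quad H.norm_one (H.reg.norm_V j.succ) (j := j.succ) (k := k) (l := k)
        (X := resolv (T.Zr k) (loo (T.cl y k) j)) ([(0, k, 0)] ++ [(5, k, j.succ)]) (by simp) (by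
        rw [word_append, word_res_loo, word_V]; simp) k).mono p4 (cast_nonneg _)
      simpa using this)
    ((h₂ H k ((test_VP T k j.succ).mono T (by norm_num))
        (((norm_blk_le _ _ _).trans (H.reg.norm_VP _)).trans
          (le_self_pow₀ hC (by norm_num)))).trans p2)).1
  have e1 := qf_resolv_mul hCp (H.reg.Z_ge k) (T.cl y k) j 1 (T.tl y k j)
  rw [Matrix.mul_one, Matrix.mul_one] at e1
  rw [H.reg.V_blk, ← mul_assoc, mul_comm (1 + _)⁻¹, mul_assoc, ← e1, card_fin,
    ← dl_eq H.reg] at hb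
  have hδ := (H.reg.fixed k).ge (H.reg.reg k) j
  change low C ≤ T.dl k j at hδ
  have e2 : (1 + (T.dl k j : ℂ))⁻¹ * (T.dl k j : ℂ)
      = (((1 + T.dl k j)⁻¹ * T.dl k j : ℝ) : ℂ) := by push_cast; ring
  have hδ0 : 0 < T.dl k j := hl.trans_le hδ
  have e3 : low C / 2 ≤ (1 + T.dl k j)⁻¹ * T.dl k j := by
    rw [inv_mul_eq_div, le_div_iff₀ (by linarith)]
    nlinarith
  rw [e2] at hb
  have e4 : low C / 4 ≤ ‖(T.d k : ℂ)⁻¹ * qf (T.cl y k j) (T.res y k) (T.tl y k j)‖ := by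
    have f1 := norm_le_norm_add_norm_sub ((T.d k : ℂ)⁻¹ * qf (T.cl y k j) (T.res y k) (T.tl y k j))
      (((1 + T.dl k j)⁻¹ * T.dl k j : ℝ) : ℂ)
    rw [norm_real, norm_of_nonneg (by positivity)] at f1
    have f2 : 4 * C ^ 4 * (D * ε) ≤ low C / 4 := by linarith
    linarith
  rw [norm_mul, norm_inv, norm_natCast, le_inv_mul_iff₀ hd] at e4
  have e5 : ‖qf (T.cl y k j) (T.res y k) (T.tl y k j)‖
      ≤ nrm (T.cl y k j) * nrm (T.res y k *ᵥ T.tl y k j) := norm_dot_le _ _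
  have e6 := H.nrm_restr_sq_le j.succ k k
  rw [card_fin] at e6
  have e7 : (T.d k * (low C / 4)) ^ 2
      ≤ C * T.d k * nrm (T.res y k *ᵥ T.tl y k j) ^ 2 := by
    calc _ ≤ (nrm (T.cl y k j) * nrm (T.res y k *ᵥ T.tl y k j)) ^ 2 :=
          pow_le_pow_left₀ (by positivity) (e4.trans e5) 2
      _ = nrm (T.cl y k j) ^ 2 * nrm (T.res y k *ᵥ T.tl y k j) ^ 2 := by ring
      _ ≤ _ := by gcongr
  have e8 : C * T.d k * (low C ^ 2 / (16 * C) * T.d k) = (T.d k * (low C / 4)) ^ 2 := by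
    field_simp; ring
  rw [← e8] at e7
  exact le_of_mul_le_mul_left e7 (by positivity)

lemma fro_res_ge (K : ℕ) {C : ℝ} (hC : 1 ≤ C) : ∃ C' : ℝ, 0 < C' ∧
    ∀ {T : Net K} {η ε : ℝ} {y : T.Est}, T.Good C η ε y → C' * ε ≤ low C →
    ∀ (k : Fin K), low C ^ 2 / (4 * C ^ 2) * T.d k ≤ fro (T.res y k) ^ 2 := by
  obtain ⟨C₁, hC₁, h₁⟩ := dhat_sub_le K hC
  refine ⟨2 * C₁, by positivity, fun {T η ε y} H hs k => ?_⟩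
  have hCp := H.reg.pos
  have hε := H.pos
  have hd := H.reg.dR_pos k
  have hl := low_pos hC
  have hM : 0 < T.M := by
    have h1 : 0 < C * T.M := hd.trans_le (H.reg.le_M k)
    exact_mod_cast pos_of_mul_pos_right h1 hCp.le
  set j : Fin T.M := ⟨0, hM⟩
  have hδ := (H.reg.fixed k).ge (H.reg.reg k) j
  change low C ≤ T.dl k j at hδ
  have h2 := (abs_le.1 (h₁ H k j)).1
  have h3 : low C / 2 ≤ dhat (T.Zr k) (T.om k) (T.cl y k) j := by linarith
  have h4 : dhat (T.Zr k) (T.om k) (T.cl y k) j ≤ (T.d k : ℝ)⁻¹ * (fro (T.om k j) * fro (T.res y k)) := by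
    refine (re_le_norm _).trans ?_
    rw [norm_mul, norm_inv, norm_natCast, card_fin]
    gcongr
    exact norm_trace_mul_le_fro _ _
  have h5 : fro (T.om k j) ≤ sqrt (T.d k) * C := by
    refine (fro_le _).trans ?_
    rw [card_fin]
    gcongr
    exact (norm_blk_le _ _ _).trans (H.reg.norm_Phi _)
  have h6 : T.d k * (low C / 2) ≤ sqrt (T.d k) * C * fro (T.res y k) := by
    have h7 := h3.trans h4
    rw [le_inv_mul_iff₀ hd] at h7
    refine h7.trans ?_
    gcongr
    exact fro_nonneg _
  have h7 : (T.d k * (low C / 2)) ^ 2 ≤ T.d k * C ^ 2 * fro (T.res y k) ^ 2 := by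
    calc _ ≤ (sqrt (T.d k) * C * fro (T.res y k)) ^ 2 :=
          pow_le_pow_left₀ (by positivity) h6 2
      _ = sqrt (T.d k) ^ 2 * C ^ 2 * fro (T.res y k) ^ 2 := by ring
      _ = _ := by rw [Real.sq_sqrt hd.le]
  have e8 : T.d k * C ^ 2 * (low C ^ 2 / (4 * C ^ 2) * T.d k) = (T.d k * (low C / 2)) ^ 2 := by
    field_simp; ring
  rw [← e8] at h7
  exact le_of_mul_le_mul_left h7 (by positivity)

/-- The block diagonal combination of the resolvents. -/
def comb (T : Net K) (y : T.Est) (u : Fin K → ℂ) :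
    T.Mat :=
  ∑ k, (u k * (T.d k : ℂ)⁻¹) • em k k (T.res y k)

lemma em_conjTranspose (k : Fin K) (X : Sq (Fin (T.d k))) :
    (em k k X)ᴴ = em k k Xᴴ := by simp [em, Matrix.mul_assoc]

lemma NetReg.comb_conjTranspose (h : T.NetReg C) (u : Fin K → ℂ) :
    (T.comb y u)ᴴ = T.comb y (star u) := by
  simp only [comb, conjTranspose_sum, conjTranspose_smul, em_conjTranspose,
    resolv_herm h.pos (h.Z_ge _)]
  simp

lemma restr_comb_mulVec (u : Fin K → ℂ) (x : Ant T.d → ℂ) (k : Fin K) :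
    restr (T.comb y u *ᵥ x) k = (u k * (T.d k : ℂ)⁻¹) • (T.res y k *ᵥ restr x k) := by
  have h1 : ∀ l, sel T.d k * em l l (T.res y l) = if k = l then T.res y k * sel T.d k else 0 := by
    intro l
    split_ifs with h
    · subst h
      rw [em, ← Matrix.mul_assoc, ← Matrix.mul_assoc, sel_mul, Matrix.one_mul]
    · rw [em, ← Matrix.mul_assoc, ← Matrix.mul_assoc]
      have : sel T.d k * (sel T.d l)ᴴ = 0 := by
        ext i j
        simp [sel, mul_apply]
        intro h'
        exact absurd h' h
      rw [this, Matrix.zero_mul, Matrix.zero_mul]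
  rw [← sel_mulVec, mulVec_mulVec, comb, Matrix.mul_sum]
  simp only [Matrix.mul_smul, h1, smul_ite, smul_zero, sum_ite_eq, mem_univ, if_true]
  rw [smul_mulVec, ← mulVec_mulVec, sel_mulVec]

lemma nrm_sq_eq_sum_restr (x : Ant T.d → ℂ) : nrm x ^ 2 = ∑ k, nrm (restr x k) ^ 2 := by
  simp only [nrm_sq, restr]
  rw [Fintype.sum_sigma]

lemma qf_dh (h : T.NetReg C) (u : Fin K → ℂ) :
    qf u (T.dh y) u = (T.N : ℂ) *
      (((T.comb y u)ᴴ * T.gm y * T.comb y u) * T.Phi 0).trace := by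
  have h1 : T.N * ((T.comb y u)ᴴ * T.gm y * T.comb y u * T.Phi 0).trace
      = ∑ k, ∑ l, T.N * ((star (u k) * (T.d k : ℂ)⁻¹) * (u l * (T.d l : ℂ)⁻¹) *
        (em k k (T.res y k) * T.gm y * em l l (T.res y l) * T.Phi 0).trace) := by
    rw [h.comb_conjTranspose, comb, comb, Matrix.sum_mul, Matrix.sum_mul, Matrix.sum_mul, trace_sum,
      Finset.mul_sum]
    refine sum_congr rfl fun k _ => ?_
    rw [Matrix.mul_sum, Matrix.sum_mul, trace_sum, Finset.mul_sum]
    refine sum_congr rfl fun l _ => ?_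
    simp only [Matrix.smul_mul, Matrix.mul_smul, trace_smul, smul_eq_mul, Pi.star_apply]
    ring
  rw [h1, qf_eq_sum]
  refine sum_congr rfl fun k _ => sum_congr rfl fun l _ => ?_
  have q2 := trace_em k l 1 1 (T.Phi 0) (T.res y k * blk (T.gm y) k l * T.res y l)
  rw [conjTranspose_one, Matrix.one_mul, Matrix.mul_one, Matrix.one_mul, Matrix.mul_one] at q2
  rw [em_mul_mul_em, q2, dh, of_apply]
  push_cast
  rw [div_eq_mul_inv, mul_inv]
  ring

lemma NetReg.gm_ge (h : T.NetReg C) :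
    ((T.g / T.N : ℝ) : ℂ) • T.gram y + ((1 - T.g : ℝ) : ℂ) • 1 ≤ T.gm y :=
  add_le_add_right h.Wn_ge _

lemma gm_psd (h : T.NetReg C) : (T.gm y).PosSemidef := by
  have h1 : (0 : ℂ) ≤ ((T.g / T.N : ℝ) : ℂ) :=
    ofReal_nonneg (div_nonneg h.g_nonneg N_nonneg)
  have h2 : (0 : ℂ) ≤ ((1 - T.g : ℝ) : ℂ) := ofReal_nonneg (by linarith [h.g_le])
  have h3 : (T.gram y).PosSemidef :=
    nonneg_iff_posSemidef.1 (sum_nonneg fun j _ => vecMulVec_nonneg _)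
  have h4 : T.Wn.PosSemidef := nonneg_iff_posSemidef.1
    ((nonneg_iff_posSemidef.2 (PosSemidef.one.smul h2)).trans h.Wn_ge)
  exact (h3.smul h1).add h4

lemma trace_comb_ge (K : ℕ) {C : ℝ} (hC : 1 ≤ C) : ∃ C' c : ℝ, 0 < C' ∧ 0 < c ∧
    ∀ {T : Net K} {η ε : ℝ} {y : T.Est}, T.Good C η ε y → C' * ε ≤ low C →
    ∀ u : Fin K → ℂ, c * nrm u ^ 2 ≤ (qf u (T.dh y) u).re := by
  obtain ⟨C₁, hC₁, h₁⟩ := nrm_res_tl_ge K hC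
  obtain ⟨C₂, hC₂, h₂⟩ := fro_res_ge K hC
  have hl := low_pos hC
  set c₀ := low C ^ 2 / (16 * C ^ 4) with hc₀
  have hCp : 0 < C := by linarith
  refine ⟨C₁ + C₂, C⁻¹ * c₀, by positivity, by positivity, fun {T η ε y} H hs u => ?_⟩
  have hε := H.pos
  have hg0 := H.reg.g_nonneg
  have hg1 := H.reg.g_le
  have s1 : C₁ * ε ≤ low C := by nlinarith [mul_pos hC₂ hε]
  have s2 : C₂ * ε ≤ low C := by nlinarith [mul_pos hC₁ hε]
  set 𝒟 := T.comb y u with h𝒟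
  have hpsd : (𝒟ᴴ * T.gm y * 𝒟).PosSemidef := (gm_psd H.reg).conjTranspose_mul_mul_same _
  have t1 : ((C⁻¹ : ℝ) : ℂ) * (𝒟ᴴ * T.gm y * 𝒟).trace ≤ (𝒟ᴴ * T.gm y * 𝒟 * T.Phi 0).trace := by
    have := trace_mul_le_trace_mul hpsd (H.reg.Phi_ge 0)
    rwa [Matrix.mul_smul, Matrix.mul_one, trace_smul, smul_eq_mul] at this
  have hpsd2 : (𝒟 * 𝒟ᴴ).PosSemidef := posSemidef_self_mul_conjTranspose _
  have t2 : (((T.g / T.N : ℝ) : ℂ) * ((𝒟 * 𝒟ᴴ) * T.gram y).trace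
      + ((1 - T.g : ℝ) : ℂ) * (𝒟 * 𝒟ᴴ).trace) ≤ (𝒟ᴴ * T.gm y * 𝒟).trace := by
    have := trace_mul_le_trace_mul hpsd2 (H.reg.gm_ge (y := y))
    rw [Matrix.mul_add, Matrix.mul_smul, Matrix.mul_smul, Matrix.mul_one, trace_add, trace_smul,
      trace_smul, smul_eq_mul, smul_eq_mul] at this
    refine this.trans_eq ?_
    rw [Matrix.mul_assoc, trace_mul_comm]
  have t3 : ((𝒟 * 𝒟ᴴ) * T.gram y).trace
      = ((∑ j : Fin T.M, nrm (𝒟ᴴ *ᵥ (T.V j.succ *ᵥ y j.succ)) ^ 2 : ℝ) : ℂ) := by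
    rw [gram, Matrix.mul_sum, trace_sum]
    push_cast
    refine sum_congr rfl fun j _ => ?_
    rw [trace_mul_vecMulVec, qf, ← mulVec_mulVec, dotProduct_mulVec]
    rw [← conjTranspose_conjTranspose 𝒟, ← star_mulVec, conjTranspose_conjTranspose, dot_self]
    push_cast; rfl
  have t4 : (𝒟 * 𝒟ᴴ).trace = ((fro 𝒟 ^ 2 : ℝ) : ℂ) := by rw [trace_mul_comm, fro_sq_trace]
  have b1 : ∀ j : Fin T.M, ∑ k, ‖u k‖ ^ 2 * (low C ^ 2 / (16 * C) * (T.d k : ℝ)⁻¹)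
      ≤ nrm (𝒟ᴴ *ᵥ (T.V j.succ *ᵥ y j.succ)) ^ 2 := by
    intro j
    rw [nrm_sq_eq_sum_restr]
    refine sum_le_sum fun k _ => ?_
    have hd := H.reg.dR_pos k
    rw [h𝒟, H.reg.comb_conjTranspose, restr_comb_mulVec, nrm_smul, mul_pow, norm_mul, norm_inv,
      norm_natCast, Pi.star_apply, norm_star]
    calc _ = (‖u k‖ * (T.d k : ℝ)⁻¹) ^ 2 * (low C ^ 2 / (16 * C) * T.d k) := by field_simp
      _ ≤ _ := by gcongr; exact h₁ H s1 k j
  have b2 : ∑ k, ‖u k‖ ^ 2 * (low C ^ 2 / (4 * C ^ 2) * (T.d k : ℝ)⁻¹) ≤ fro 𝒟 ^ 2 := by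
    have e1 : ((fro 𝒟 ^ 2 : ℝ) : ℂ)
        = ((∑ k, (‖u k‖ * (T.d k : ℝ)⁻¹) ^ 2 * fro (T.res y k) ^ 2 : ℝ) : ℂ) := by
      rw [← t4]
      have e2 : ∀ k, (em k k (T.res y k) * 𝒟ᴴ).trace
          = (star (u k) * (T.d k : ℂ)⁻¹) * ((fro (T.res y k) ^ 2 : ℝ) : ℂ) := by
        intro k
        rw [h𝒟, H.reg.comb_conjTranspose, comb, Matrix.mul_sum, trace_sum,
          Finset.sum_eq_single_of_mem k (mem_univ k)]
        · rw [Matrix.mul_smul, em_mul_em, trace_smul, smul_eq_mul, Pi.star_apply, em,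
            trace_mul_comm, ← Matrix.mul_assoc, sel_mul, Matrix.one_mul]
          congr 1
          rw [← fro_sq_trace, resolv_herm H.reg.pos (H.reg.Z_ge _)]
        · intro l _ hl
          have : sel T.d k * (sel T.d l)ᴴ = 0 := by
            ext i j
            simp [sel, mul_apply]
            intro h'
            exact absurd h' hl.symm
          rw [Matrix.mul_smul, trace_smul]
          have e3 : em k k (T.res y k) * em l l (T.res y l)
            = (sel T.d k)ᴴ * T.res y k * (sel T.d k * (sel T.d l)ᴴ) * T.res y l * sel T.d l := by
            simp only [em, Matrix.mul_assoc]
          rw [e3, this]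
          simp
      rw [h𝒟, comb, Matrix.sum_mul, trace_sum]
      push_cast
      refine sum_congr rfl fun k _ => ?_
      rw [Matrix.smul_mul, trace_smul, ← comb, ← h𝒟, e2, smul_eq_mul, mul_pow]
      have : (‖u k‖ : ℂ) ^ 2 = star (u k) * u k := by rw [RCLike.star_def, Complex.conj_mul']
      rw [this]
      push_cast
      ring
    rw [Complex.ofReal_inj.1 e1]
    refine sum_le_sum fun k _ => ?_
    have hd := H.reg.dR_pos k
    calc _ = (‖u k‖ * (T.d k : ℝ)⁻¹) ^ 2 * (low C ^ 2 / (4 * C ^ 2) * T.d k) := by field_simp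
      _ ≤ _ := by gcongr; exact h₂ H s2 k
  have b3 : c₀ * nrm u ^ 2 ≤ T.N * (T.g / T.N *
      (∑ j : Fin T.M, nrm (𝒟ᴴ *ᵥ (T.V j.succ *ᵥ y j.succ)) ^ 2) + (1 - T.g) * fro 𝒟 ^ 2) := by
    rcases isEmpty_or_nonempty (Fin K) with hK | ⟨⟨a⟩⟩
    · have : nrm u = 0 := by
        have := nrm_sq u
        simpa using this
      rw [this]
      have := N_nonneg (T := T)
      have h1 : 0 ≤ ∑ j : Fin T.M, nrm (𝒟ᴴ *ᵥ (T.V j.succ *ᵥ y j.succ)) ^ 2 := by positivity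
      have h3 : 0 ≤ 1 - T.g := by linarith
      have : (0 : ℝ) ^ 2 = 0 := by norm_num
      rw [this, mul_zero]
      positivity
    have hN := H.reg.N_pos a
    have hN2 : T.N ≤ C ^ 2 * T.M := by
      have h1 := H.reg.N_le a
      have h2 := H.reg.le_M a
      nlinarith
    have hsum : (T.M : ℝ) * ∑ k, ‖u k‖ ^ 2 * (low C ^ 2 / (16 * C) * (T.d k : ℝ)⁻¹)
        ≤ ∑ j : Fin T.M, nrm (𝒟ᴴ *ᵥ (T.V j.succ *ᵥ y j.succ)) ^ 2 := by
      calc _ = ∑ _j : Fin T.M, ∑ k, ‖u k‖ ^ 2 * (low C ^ 2 / (16 * C) * (T.d k : ℝ)⁻¹) := by simp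
        _ ≤ _ := sum_le_sum fun j _ => b1 j
    have hk : ∀ k, T.N⁻¹ ≤ (T.d k : ℝ)⁻¹ := fun k =>
      inv_anti₀ (H.reg.dR_pos k) (d_le_N k)
    have g1 : c₀ * nrm u ^ 2 ≤ ∑ j : Fin T.M, nrm (𝒟ᴴ *ᵥ (T.V j.succ *ᵥ y j.succ)) ^ 2 := by
      refine le_trans ?_ hsum
      rw [nrm_sq, Finset.mul_sum, Finset.mul_sum]
      refine sum_le_sum fun k _ => ?_
      calc c₀ * ‖u k‖ ^ 2 = (C ^ 2)⁻¹ * (‖u k‖ ^ 2 * (low C ^ 2 / (16 * C ^ 2))) := by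
            rw [hc₀]; field_simp
        _ ≤ (T.M * T.N⁻¹) * (‖u k‖ ^ 2 * (low C ^ 2 / (16 * C))) := by
            gcongr
            · rw [← div_eq_mul_inv, le_div_iff₀ hN, inv_mul_le_iff₀ (by positivity)]
              exact hN2
            · exact le_self_pow₀ hC (by norm_num)
        _ ≤ (T.M * (T.d k : ℝ)⁻¹) * (‖u k‖ ^ 2 * (low C ^ 2 / (16 * C))) := by
            gcongr
            · exact H.reg.dR_pos k
            · exact d_le_N k
        _ = _ := by ring
    have g2 : c₀ * nrm u ^ 2 ≤ T.N * fro 𝒟 ^ 2 := by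
      refine le_trans ?_ (mul_le_mul_of_nonneg_left b2 hN.le)
      rw [nrm_sq, Finset.mul_sum, Finset.mul_sum]
      refine sum_le_sum fun k _ => ?_
      have hd := H.reg.dR_pos k
      have : (1 : ℝ) ≤ T.N * (T.d k : ℝ)⁻¹ := by
        rw [← div_eq_mul_inv, le_div_iff₀ hd, one_mul]; exact d_le_N k
      calc c₀ * ‖u k‖ ^ 2 = 1 * (‖u k‖ ^ 2 * (low C ^ 2 / (16 * C ^ 4))) := by
            rw [hc₀]; field_simp
        _ ≤ (T.N * (T.d k : ℝ)⁻¹) * (‖u k‖ ^ 2 * (low C ^ 2 / (4 * C ^ 2))) := by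
            gcongr
            · norm_num
            · norm_num
        _ = _ := by ring
    have : T.N * (T.g / T.N *
      (∑ j : Fin T.M, nrm (𝒟ᴴ *ᵥ (T.V j.succ *ᵥ y j.succ)) ^ 2) + (1 - T.g) * fro 𝒟 ^ 2)
      = T.g * (∑ j : Fin T.M, nrm (𝒟ᴴ *ᵥ (T.V j.succ *ᵥ y j.succ)) ^ 2)
        + (1 - T.g) * (T.N * fro 𝒟 ^ 2) := by field_simp
    rw [this]
    calc c₀ * nrm u ^ 2 = T.g * (c₀ * nrm u ^ 2) + (1 - T.g) * (c₀ * nrm u ^ 2) := by ring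
      _ ≤ _ := by
        have : 0 ≤ 1 - T.g := by linarith
        gcongr
  rw [qf_dh H.reg, ← h𝒟, re_ofReal_mul]
  have t1' := (Complex.le_def.1 t1).1
  have t2' := (Complex.le_def.1 t2).1
  rw [t3, t4] at t2'
  rw [re_ofReal_mul] at t1'
  rw [Complex.add_re, ← ofReal_mul, ← ofReal_mul, ofReal_re,
    ofReal_re] at t2'
  have hN0 := N_nonneg (T := T)
  calc C⁻¹ * c₀ * nrm u ^ 2 = C⁻¹ * (c₀ * nrm u ^ 2) := by ring
    _ ≤ C⁻¹ * (T.N * (𝒟ᴴ * T.gm y * 𝒟).trace.re) := by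
        refine mul_le_mul_of_nonneg_left (b3.trans ?_) (by positivity)
        exact mul_le_mul_of_nonneg_left t2' hN0
    _ = T.N * (C⁻¹ * (𝒟ᴴ * T.gm y * 𝒟).trace.re) := by ring
    _ ≤ _ := mul_le_mul_of_nonneg_left t1' hN0

/-- The deterministic matrix `Δ` is bounded, bounded below, and close to the quadratic forms. -/
lemma dlt_near (K : ℕ) {C : ℝ} (hC : 1 ≤ C) : ∃ C' c : ℝ, 0 < C' ∧ 0 < c ∧
    ∀ {T : Net K} {η ε : ℝ} {y : T.Est}, T.Good C η ε y → C' * ε ≤ c →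
    (∀ k l, ‖(T.gq y - T.dlt) k l‖ ≤ C' * ε) ∧ (∀ k l, ‖T.dlt k l‖ ≤ C') ∧
    ∀ u : Fin K → ℂ, c * nrm u ^ 2 ≤ (qf u T.dlt u).re := by
  obtain ⟨C₁, hC₁, h₁⟩ := norm_gq_sub_dh_le K hC
  obtain ⟨C₂, hC₂, h₂⟩ := norm_dh_sub_dlt_le K hC
  obtain ⟨C₃, hC₃, h₃⟩ := norm_dh_le K hC
  obtain ⟨C₄, c, hC₄, hc, h₄⟩ := trace_comb_ge K hC
  have hl := low_pos hC
  set e := min (min 1 (low C)) (c / 2) with he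
  have he0 : 0 < e := by positivity
  set D := C₁ + C₂ + C₃ + C₄ + K * C₂ + 1 with hD
  have hD0 : 0 < D := by positivity
  refine ⟨D, e, hD0, he0, fun {T η ε y} H hs => ?_⟩
  have hε := H.pos
  have e1 : e ≤ 1 := (min_le_left _ _).trans (min_le_left _ _)
  have e2 : e ≤ low C := (min_le_left _ _).trans (min_le_right _ _)
  have e3 : e ≤ c / 2 := min_le_right _ _
  have hKC : 0 ≤ K * C₂ := by positivity
  have s2 : C₂ * ε ≤ D * ε := by gcongr; linarith
  have s12 : C₁ * ε + C₂ * ε ≤ D * ε := by rw [← add_mul]; gcongr; linarith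
  have s4 : C₄ * ε ≤ D * ε := by gcongr; linarith
  have sK : K * C₂ * ε ≤ D * ε := by gcongr; linarith
  have g2 := h₂ H ((s2.trans hs).trans e1)
  refine ⟨fun k l => ?_, fun k l => ?_, fun u => ?_⟩
  · have : (T.gq y - T.dlt) k l = (T.gq y - T.dh y) k l + (T.dh y - T.dlt) k l := by
      simp
    rw [this]
    exact (norm_add_le _ _).trans ((add_le_add (h₁ H k l) (g2 k l)).trans s12)
  · have f1 := norm_le_norm_add_norm_sub (T.dh y k l) (T.dlt k l)
    have f2 := h₃ H k l
    have f3 := g2 k l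
    rw [Matrix.sub_apply] at f3
    linarith
  · have f1 := h₄ H ((s4.trans hs).trans e2) u
    have f2 := norm_qf_sub_le g2 (by positivity) u
    rw [card_fin] at f2
    have f3 := re_le_norm (qf u (T.dh y) u - qf u T.dlt u)
    rw [Complex.sub_re] at f3
    have f4 : K * (C₂ * ε) * nrm u ^ 2 ≤ c / 2 * nrm u ^ 2 := by
      gcongr
      rw [← mul_assoc]
      exact (sK.trans hs).trans e3
    have f5 : e * nrm u ^ 2 ≤ c / 2 * nrm u ^ 2 := by gcongr
    linarith

lemma vv_ofReal (h : T.NetReg C) (k : Fin K) : ∃ r : ℝ, T.vv k = r ∧ low C ≤ r ∧ r ≤ C ^ 2 := by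
  have hθ := thet_posDef (h.reg k) (h.fixed k).nonneg
  have h0 : 0 ≤ (blk (T.Phi 0) k k * T.th k).trace :=
    trace_mul_nonneg ((h.Phi_psd 0).submatrix _) hθ.posSemidef
  have h1 : 0 ≤ T.vv k := mul_nonneg inv_card_nonneg h0
  refine ⟨(T.vv k).re, Complex.ext rfl (Complex.le_def.1 h1).2.symm, ?_, ?_⟩
  · have h2 : ((C⁻¹ : ℝ) : ℂ) • 1 ≤ blk (T.Phi 0) k k :=
      (blk_smul_one _ k).symm.trans_le (blk_le_blk (h.Phi_ge 0) k)
    have h3 := smul_one_le_thet (h.reg k) (h.fixed k).nonneg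
    have h4 := trace_mul_le_trace_mul hθ.posSemidef h2
    have h5 := trace_mul_le_trace_mul (A := (1 : Sq (Fin (T.d k))))
      PosSemidef.one h3
    rw [trace_mul_comm _ (blk _ _ _), Matrix.mul_smul, Matrix.mul_one, trace_smul,
      smul_eq_mul] at h4
    rw [Matrix.mul_smul, Matrix.mul_one, Matrix.one_mul, trace_smul, trace_one, smul_eq_mul] at h5
    have h4' := (Complex.le_def.1 h4).1
    have h5' := (Complex.le_def.1 h5).1
    rw [re_ofReal_mul] at h4' h5'
    have hd := h.dR_pos k
    have : (T.vv k).re = (T.d k : ℝ)⁻¹ * (blk (T.Phi 0) k k * T.th k).trace.re := by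
      rw [vv, card_fin, ← ofReal_natCast, ← Complex.ofReal_inv,
        re_ofReal_mul]
    rw [this, le_inv_mul_iff₀ hd]
    rw [card_fin, Complex.natCast_re] at h5'
    have hCp := h.pos
    calc T.d k * low C = C⁻¹ * ((C + C ^ 2)⁻¹ * T.d k) := by unfold low; ring
      _ ≤ C⁻¹ * (T.th k).trace.re := by gcongr
      _ ≤ _ := h4'
  · refine (re_le_norm _).trans ((norm_inv_card_trace_le _).trans ?_)
    exact (nmul ((norm_blk_le _ _ _).trans (h.norm_Phi 0)) (h.norm_th k)).trans
      (le_of_eq (by ring))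

end Net

section Wiener

variable {n : Type} [Fintype n] [DecidableEq n] {C τ : ℝ} {R : Sq n}

/-- The matrix `R (τ I + R)⁻¹` of an MMSE estimate. -/
abbrev wien (τ : ℝ) (R : Sq n) : Sq n :=
  R * ((τ : ℂ) • (1 : Sq n) + R)⁻¹

/-- Bounds on a covariance matrix and a noise variance. -/
structure CovReg (C τ : ℝ) (R : Sq n) : Prop where
  one_le : 1 ≤ C
  tau_nonneg : 0 ≤ τ
  tau_le : τ ≤ C
  ge : ((C⁻¹ : ℝ) : ℂ) • 1 ≤ R
  le : R ≤ (C : ℂ) • 1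

namespace CovReg

lemma pos (h : CovReg C τ R) : 0 < C := zero_lt_one.trans_le h.one_le

lemma posDef (h : CovReg C τ R) : R.PosDef := posDef_of_smul_one_le (inv_pos.2 h.pos) h.ge

lemma norm_le (h : CovReg C τ R) : ‖R‖ ≤ C :=
  norm_le_of_le_smul_one (nonneg_iff_posSemidef.2 h.posDef.posSemidef) h.le h.pos.le

lemma sum_ge (h : CovReg C τ R) : ((C⁻¹ : ℝ) : ℂ) • 1 ≤ (τ : ℂ) • 1 + R :=
  h.ge.trans (le_add_of_nonneg_left (nonneg_iff_posSemidef.2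
    (PosSemidef.one.smul (ofReal_nonneg h.tau_nonneg))))

lemma sum_posDef (h : CovReg C τ R) : ((τ : ℂ) • 1 + R).PosDef := posDef_of_smul_one_le (inv_pos.2 h.pos) h.sum_ge

lemma norm_sum_le (h : CovReg C τ R) : ‖(τ : ℂ) • 1 + R‖ ≤ 2 * C := by
  refine (norm_add_le _ _).trans ?_
  rw [norm_smul, norm_real, norm_of_nonneg h.tau_nonneg]
  have := norm_one_le (m := n)
  have := h.norm_le
  have := h.tau_le
  nlinarith [h.tau_nonneg]

lemma norm_sum_inv_le (h : CovReg C τ R) : ‖((τ : ℂ) • 1 + R)⁻¹‖ ≤ C := by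
  simpa using norm_inv_le (inv_pos.2 h.pos) h.sum_ge

lemma isUnit_sum (h : CovReg C τ R) : IsUnit ((τ : ℂ) • 1 + R).det := (isUnit_iff_isUnit_det _).1 h.sum_posDef.isUnit

lemma wien_mul (h : CovReg C τ R) : wien τ R * ((τ : ℂ) • 1 + R) = R := by
  rw [wien, Matrix.mul_assoc, nonsing_inv_mul _ h.isUnit_sum, Matrix.mul_one]

lemma wien_eq (h : CovReg C τ R) : wien τ R = ((τ : ℂ) • 1 + R)⁻¹ * R := by
  have h1 : R * ((τ : ℂ) • 1 + R) = ((τ : ℂ) • 1 + R) * R := by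
    rw [Matrix.mul_add, Matrix.add_mul]; simp
  calc wien τ R = ((τ : ℂ) • 1 + R)⁻¹ * (((τ : ℂ) • 1 + R) * R) * ((τ : ℂ) • 1 + R)⁻¹ := by
        rw [← Matrix.mul_assoc, nonsing_inv_mul _ h.isUnit_sum, Matrix.one_mul]
    _ = _ := by
        rw [← h1, ← Matrix.mul_assoc, Matrix.mul_assoc, mul_nonsing_inv _ h.isUnit_sum,
          Matrix.mul_one]

lemma wien_herm (h : CovReg C τ R) : (wien τ R)ᴴ = wien τ R := by
  rw [wien, conjTranspose_mul, h.posDef.isHermitian, h.sum_posDef.inv.isHermitian, ← h.wien_eq]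

lemma mul_wien (h : CovReg C τ R) : ((τ : ℂ) • 1 + R) * wien τ R = R := by
  rw [h.wien_eq, ← Matrix.mul_assoc, mul_nonsing_inv _ h.isUnit_sum, Matrix.one_mul]

lemma wien_psd (h : CovReg C τ R) : (wien τ R).PosSemidef := by
  have h1 : (((τ : ℂ) • 1 + R) * R).PosSemidef := by
    rw [Matrix.add_mul, Matrix.smul_mul, Matrix.one_mul]
    refine (h.posDef.posSemidef.smul (ofReal_nonneg h.tau_nonneg)).add ?_
    have := posSemidef_conjTranspose_mul_self R
    rwa [h.posDef.isHermitian] at this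
  have h2 := h1.mul_mul_conjTranspose_same ((τ : ℂ) • 1 + R)⁻¹
  rw [h.sum_posDef.inv.isHermitian, ← Matrix.mul_assoc, nonsing_inv_mul _ h.isUnit_sum,
    Matrix.one_mul] at h2
  exact h2

lemma norm_wien_le (h : CovReg C τ R) : ‖wien τ R‖ ≤ C * C := nmul h.norm_le h.norm_sum_inv_le

lemma isUnit_wien (h : CovReg C τ R) : IsUnit (wien τ R).det := by
  rw [wien, det_mul]
  exact ((isUnit_iff_isUnit_det _).1 h.posDef.isUnit).mul
    ((isUnit_iff_isUnit_det _).1 h.sum_posDef.inv.isUnit)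

lemma norm_wien_inv_le (h : CovReg C τ R) : ‖(wien τ R)⁻¹‖ ≤ 2 * C * C := by
  have : (wien τ R)⁻¹ = ((τ : ℂ) • 1 + R) * R⁻¹ := by
    rw [wien, Matrix.mul_inv_rev, nonsing_inv_nonsing_inv _ h.isUnit_sum]
  rw [this]
  refine nmul h.norm_sum_le ?_
  simpa using norm_inv_le (inv_pos.2 h.pos) h.ge

/-- The error covariance of an MMSE estimate. -/
lemma sub_mul_wien (h : CovReg C τ R) : R - R * wien τ R = (τ : ℂ) • wien τ R := by
  nth_rewrite 1 [← h.mul_wien]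
  rw [← Matrix.sub_mul, add_sub_cancel_right, Matrix.smul_mul, Matrix.one_mul]

end CovReg

end Wiener

section BlockDiagonal

variable {K : ℕ} {d : Fin K → ℕ} (f : (k : Fin K) → Sq (Fin (d k)))

lemma sel_mul_blockDiagonal' (k : Fin K) :
    sel d k * blockDiagonal' f = f k * sel d k := by
  ext i ⟨l, j⟩
  simp only [mul_apply, sel, of_apply, ite_mul, one_mul, zero_mul, sum_ite_eq,
    mem_univ, if_true, mul_ite, mul_one, mul_zero]
  by_cases h : k = l
  · subst h
    simp [blockDiagonal'_apply_eq]
  · rw [blockDiagonal'_apply_ne _ _ _ h, Finset.sum_eq_zero]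
    intro x _
    rw [if_neg]
    intro hx
    exact h (congrArg Sigma.fst hx)

lemma restr_blockDiagonal'_mulVec (u : Ant d → ℂ) (k : Fin K) :
    restr (blockDiagonal' f *ᵥ u) k = f k *ᵥ restr u k := by
  rw [← sel_mulVec, mulVec_mulVec, sel_mul_blockDiagonal', ← mulVec_mulVec, sel_mulVec]

lemma blk_blockDiagonal'_mul (X : Sq (Ant d)) (k l : Fin K) :
    blk (blockDiagonal' f * X) k l = f k * blk X k l := by
  rw [blk_eq, ← Matrix.mul_assoc, sel_mul_blockDiagonal', blk_eq]
  simp only [Matrix.mul_assoc]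

lemma blk_mul_blockDiagonal' (X : Sq (Ant d)) (k l : Fin K) :
    blk (X * blockDiagonal' f) k l = blk X k l * f l := by
  have h := congrArg conjTranspose (blk_blockDiagonal'_mul (fun k => (f k)ᴴ) Xᴴ l k)
  rw [blk_conjTranspose, conjTranspose_mul, conjTranspose_mul, blk_conjTranspose,
    ← blockDiagonal'_conjTranspose] at h
  simpa using h

lemma blockDiagonal'_smul_one (c : ℂ) :
    blockDiagonal' (fun k => c • (1 : Sq (Fin (d k)))) = c • 1 := by
  rw [← blockDiagonal'_one, ← blockDiagonal'_smul]; rfl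

variable {f}

lemma blockDiagonal'_nonneg (h : ∀ k, 0 ≤ f k) : 0 ≤ blockDiagonal' f := by
  choose g hg using fun k => CStarAlgebra.nonneg_iff_eq_star_mul_self.1 (h k)
  have : f = fun k => (g k)ᴴ * g k := funext hg
  rw [this, blockDiagonal'_mul, ← blockDiagonal'_conjTranspose]
  exact nonneg_iff_posSemidef.2 (posSemidef_conjTranspose_mul_self _)

lemma blockDiagonal'_mono {g : (k : Fin K) → Sq (Fin (d k))}
    (h : ∀ k, f k ≤ g k) : blockDiagonal' f ≤ blockDiagonal' g := by
  rw [← sub_nonneg, ← blockDiagonal'_sub]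
  exact blockDiagonal'_nonneg fun k => sub_nonneg.2 (h k)

lemma blockDiagonal'_inv (h : ∀ k, IsUnit (f k).det) :
    (blockDiagonal' f)⁻¹ = blockDiagonal' fun k => (f k)⁻¹ := by
  refine Matrix.inv_eq_right_inv ?_
  rw [← blockDiagonal'_mul, ← blockDiagonal'_one]
  congr 1
  funext k
  exact mul_nonsing_inv _ (h k)

end BlockDiagonal

section SystemFacts

variable {K : ℕ} {S : System K} {C : ℝ}

/-- Families of vectors, one for each user. -/
abbrev System.Est (S : System K) : Type := Fin (S.M + 1) → Ant S.d → ℂ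

/-- Square matrices indexed by the antennas. -/
abbrev System.Mat (S : System K) : Type := Sq (Ant S.d)

/-- Uniform bounds on the parameters of a system. -/
structure SysReg (C : ℝ) (S : System K) : Prop where
  one_le : 1 ≤ C
  d_pos : ∀ k, 0 < S.d k
  M_le : ∀ k, (S.M : ℝ) ≤ C * S.d k
  le_M : ∀ k, (S.d k : ℝ) ≤ C * S.M
  N_le : ∀ k, (S.N : ℝ) ≤ C * S.d k
  tau_le : S.tauSq ≤ C
  R_ge : ∀ j, ((C⁻¹ : ℝ) : ℂ) • 1 ≤ S.R j
  R_le : ∀ j, S.R j ≤ (C : ℂ) • 1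
  Z_ge : ∀ k, ((C⁻¹ : ℝ) : ℂ) • 1 ≤ regMat S.Z (fun k => -S.rho k) k
  Z_le : ∀ k, regMat S.Z (fun k => -S.rho k) k ≤ (C : ℂ) • 1

namespace SysReg

lemma pos (h : SysReg C S) : 0 < C := zero_lt_one.trans_le h.one_le

lemma cov (h : SysReg C S) (j : Fin (S.M + 1)) : CovReg C S.tauSq (S.R j) :=
  ⟨h.one_le, S.tauSq_nonneg, h.tau_le, h.R_ge j, h.R_le j⟩

lemma covBlk (h : SysReg C S) (j : Fin (S.M + 1)) (k : Fin K) : CovReg C S.tauSq (blk (S.R j) k k) :=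
  ⟨h.one_le, S.tauSq_nonneg, h.tau_le, (blk_smul_one _ k).symm.trans_le (blk_le_blk (h.R_ge j) k),
    (blk_le_blk (h.R_le j) k).trans_eq (blk_smul_one _ k)⟩

lemma covD (h : SysReg C S) (j : Fin (S.M + 1)) : CovReg C S.tauSq (S.DR j) :=
  ⟨h.one_le, S.tauSq_nonneg, h.tau_le, (blockDiagonal'_smul_one _).symm.trans_le
    (blockDiagonal'_mono fun k => (h.covBlk j k).ge),
    (blockDiagonal'_mono fun k => (h.covBlk j k).le).trans_eq (blockDiagonal'_smul_one _)⟩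

lemma DT_eq (h : SysReg C S) (j : Fin (S.M + 1)) :
    S.DT j = blockDiagonal' fun k => wien S.tauSq (blk (S.R j) k k) := by
  have e : (S.tauSq : ℂ) • 1 + S.DR j = blockDiagonal' fun k =>
      (S.tauSq : ℂ) • 1 + blk (S.R j) k k := by
    rw [System.DR, ← blockDiagonal'_smul_one, ← blockDiagonal'_add]; rfl
  rw [System.DT, e, blockDiagonal'_inv fun k => (h.covBlk j k).isUnit_sum, System.DR,
    ← blockDiagonal'_mul]

lemma DT_inv_mul (h : SysReg C S) (j : Fin (S.M + 1)) : (S.DT j)⁻¹ * S.DT j = 1 :=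
  nonsing_inv_mul _ (h.covD j).isUnit_wien

lemma DT_herm (h : SysReg C S) (j : Fin (S.M + 1)) : (S.DT j)ᴴ = S.DT j := (h.covD j).wien_herm

lemma V_mul_DT (h : SysReg C S) (j : Fin (S.M + 1)) : S.V j * S.DT j = S.T j := by
  rw [System.V, Matrix.mul_assoc, h.DT_inv_mul, Matrix.mul_one]

/-- The cross covariance `V_j Φ_j` of channel and estimate. -/
lemma V_mul_Phi (h : SysReg C S) (j : Fin (S.M + 1)) : S.V j * S.Phi j = S.R j * S.DT j := by
  rw [System.Phi, ← Matrix.mul_assoc, ← Matrix.mul_assoc, h.V_mul_DT]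
  congr 1
  exact (h.cov j).wien_mul

lemma V_mul_Phi_mul (h : SysReg C S) (j : Fin (S.M + 1)) : S.V j * S.Phi j * (S.V j)ᴴ = S.R j * S.T j := by
  rw [h.V_mul_Phi, Matrix.mul_assoc]
  congr 1
  rw [← h.DT_herm, ← conjTranspose_mul, h.V_mul_DT]
  exact (h.cov j).wien_herm

lemma Phi_psd (h : SysReg C S) (j : Fin (S.M + 1)) : (S.Phi j).PosSemidef := by
  have := (h.cov j).sum_posDef.posSemidef.conjTranspose_mul_mul_same (S.DT j)
  rwa [h.DT_herm] at this

lemma Phi_ge (h : SysReg C S) (j : Fin (S.M + 1)) : (((4 * C ^ 5)⁻¹ : ℝ) : ℂ) • 1 ≤ S.Phi j := by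
  have hC := h.pos
  refine le_of_forall_re_qf (by simp [IsHermitian]) (h.Phi_psd j).isHermitian fun u => ?_
  have e1 : qf u (S.Phi j) u = qf (S.DT j *ᵥ u) ((S.tauSq : ℂ) • 1 + S.R j) (S.DT j *ᵥ u) := by
    rw [← qf_conjTranspose_mul_mul, h.DT_herm]; rfl
  have e2 := re_qf_le_of_le (h.cov j).sum_ge (S.DT j *ᵥ u)
  have e3 : nrm u ≤ 2 * C * C * nrm (S.DT j *ᵥ u) := by
    have := nrm_mulVec_le (S.DT j)⁻¹ (S.DT j *ᵥ u)
    rw [mulVec_mulVec, h.DT_inv_mul, one_mulVec] at this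
    refine this.trans ?_
    have := nrm_nonneg (S.DT j *ᵥ u)
    gcongr
    exact (h.covD j).norm_wien_inv_le
  rw [e1]
  refine le_trans ?_ e2
  rw [qf_smul_one, qf_smul_one, ← ofReal_mul, ← ofReal_mul, ofReal_re,
    ofReal_re]
  calc _ ≤ (4 * C ^ 5)⁻¹ * (2 * C * C * nrm (S.DT j *ᵥ u)) ^ 2 := by
        have := nrm_nonneg u
        gcongr
    _ = _ := by field_simp; ring

lemma norm_Phi (h : SysReg C S) (j : Fin (S.M + 1)) : ‖S.Phi j‖ ≤ 2 * C ^ 5 :=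
  (nmul (nmul (h.covD j).norm_wien_le (h.cov j).norm_sum_le) (h.covD j).norm_wien_le).trans
    (le_of_eq (by ring))

lemma norm_V (h : SysReg C S) (j : Fin (S.M + 1)) : ‖S.V j‖ ≤ 2 * C ^ 4 :=
  (nmul (h.cov j).norm_wien_le (h.covD j).norm_wien_inv_le).trans (le_of_eq (by ring))

lemma norm_VP (h : SysReg C S) (j : Fin (S.M + 1)) : ‖S.V j * S.Phi j‖ ≤ C ^ 3 := by
  rw [h.V_mul_Phi]
  exact (nmul (h.cov j).norm_le (h.covD j).norm_wien_le).trans (le_of_eq (by ring))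

lemma norm_VPV (h : SysReg C S) (j : Fin (S.M + 1)) : ‖S.V j * S.Phi j * (S.V j)ᴴ‖ ≤ C ^ 3 := by
  rw [h.V_mul_Phi_mul]
  exact (nmul (h.cov j).norm_le (h.cov j).norm_wien_le).trans (le_of_eq (by ring))

lemma blk_VP (h : SysReg C S) (j : Fin (S.M + 1)) (k : Fin K) :
    blk (S.V j * S.Phi j) k k = blk (S.Phi j) k k := by
  rw [h.V_mul_Phi, System.Phi, h.DT_eq, blk_mul_blockDiagonal', blk_mul_blockDiagonal',
    blk_blockDiagonal'_mul]
  congr 1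
  have e : blk ((S.tauSq : ℂ) • 1 + S.R j) k k = (S.tauSq : ℂ) • 1 + blk (S.R j) k k := by
    rw [← blk_smul_one (d := S.d) (S.tauSq : ℂ) k]; rfl
  rw [e]
  exact (h.covBlk j k).wien_mul.symm

lemma W_psd (h : SysReg C S) : S.W.PosSemidef :=
  nonneg_iff_posSemidef.1 (sum_nonneg fun j _ => nonneg_iff_posSemidef.2
    ((h.cov j).wien_psd.smul (ofReal_nonneg S.tauSq_nonneg)))

lemma DW_psd (h : SysReg C S) : S.DW.PosSemidef := by
  refine PosSemidef.smul (nonneg_iff_posSemidef.1 (sum_nonneg fun j _ =>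
    nonneg_iff_posSemidef.2 (h.covD j).wien_psd)) (ofReal_nonneg S.tauSq_nonneg)

lemma norm_W (h : SysReg C S) : ‖S.W‖ ≤ (S.M + 1) * C ^ 3 := by
  refine (norm_sum_le _ _).trans ?_
  calc _ ≤ ∑ _j : Fin (S.M + 1), C ^ 3 := sum_le_sum fun j _ => by
        rw [norm_smul, norm_real, norm_of_nonneg S.tauSq_nonneg]
        have := S.tauSq_nonneg
        calc _ ≤ C * (C * C) := by
              gcongr
              exacts [h.pos.le, h.tau_le, (h.cov j).norm_wien_le]
          _ = _ := by ring
    _ = _ := by simp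

lemma norm_DW (h : SysReg C S) : ‖S.DW‖ ≤ (S.M + 1) * C ^ 3 := by
  rw [System.DW, norm_smul, norm_real, norm_of_nonneg S.tauSq_nonneg]
  have hs : ‖∑ j, S.DT j‖ ≤ (S.M + 1) * (C * C) := by
    refine (norm_sum_le _ _).trans ((sum_le_sum fun j _ =>
      (h.covD j).norm_wien_le).trans (le_of_eq (by simp)))
  have := h.pos
  calc _ ≤ C * ((S.M + 1) * (C * C)) := by
        gcongr
        exact h.tau_le
    _ = _ := by ring

end SysReg

/-- The normalisation `N + σ²`. -/
def System.scale (S : System K) : ℝ := S.N + S.sigSq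

/-- The network with transformations `V` and noise covariance `W + σ² I`. -/
def System.net (S : System K) (V : Fin (S.M + 1) → S.Mat)
    (W : S.Mat) (δ : Fin S.M → Fin K → ℝ) : Net K where
  d := S.d
  M := S.M
  Zr := regMat S.Z fun k => -S.rho k
  Phi := S.Phi
  V := V
  Wn := ((S.scale⁻¹ : ℝ) : ℂ) • (W + S.noiseCov)
  g := S.N / S.scale
  δ := δ

/-- Admissible transformations and noise covariances. -/
structure NetChoice (C : ℝ) (S : System K) (V : Fin (S.M + 1) → S.Mat)
    (W : S.Mat) : Prop where
  norm_V : ∀ j, ‖V j‖ ≤ 2 * C ^ 4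
  norm_VP : ∀ j, ‖V j * S.Phi j‖ ≤ 2 * C ^ 5
  norm_VPV : ∀ j, ‖V j * S.Phi j * (V j)ᴴ‖ ≤ 2 * C ^ 5
  V_blk : ∀ j k, blk (V j * S.Phi j) k k = blk (S.Phi j) k k
  W_psd : W.PosSemidef
  norm_W : ‖W‖ ≤ (S.M + 1) * C ^ 3

lemma SysReg.choice (h : SysReg C S) : NetChoice C S S.V S.W where
  norm_V := h.norm_V
  norm_VP j := (h.norm_VP j).trans (by
    have := pow_le_pow_right₀ h.one_le (show 3 ≤ 5 by norm_num)
    have := pow_pos h.pos 5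
    linarith)
  norm_VPV j := (h.norm_VPV j).trans (by
    have := pow_le_pow_right₀ h.one_le (show 3 ≤ 5 by norm_num)
    have := pow_pos h.pos 5
    linarith)
  V_blk := h.blk_VP
  W_psd := h.W_psd
  norm_W := h.norm_W

lemma SysReg.choiceOne (h : SysReg C S) : NetChoice C S (fun _ => 1) S.DW where
  norm_V _ := norm_one_le.trans (by have := one_le_pow₀ h.one_le (n := 4); linarith)
  norm_VP j := by simpa using h.norm_Phi j
  norm_VPV j := by simpa using h.norm_Phi j
  V_blk j k := by simp
  W_psd := h.DW_psd
  norm_W := h.norm_DW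

lemma System.card_ant (S : System K) : (card (Ant S.d) : ℝ) = S.N := by simp [System.N]

lemma SysReg.Phi_le (h : SysReg C S) (j : Fin (S.M + 1)) :
    S.Phi j ≤ ((2 * C ^ 5 : ℝ) : ℂ) • 1 :=
  (le_norm_smul_one (h.Phi_psd j).isHermitian).trans (real_smul_mono
    (nonneg_iff_posSemidef.2 PosSemidef.one) (h.norm_Phi j))

lemma SysReg.const_bounds (h : SysReg C S) : C ≤ 8 * C ^ 6 ∧ 2 * C ^ 4 ≤ 8 * C ^ 6 ∧
    2 * C ^ 5 ≤ 8 * C ^ 6 ∧ 4 * C ^ 5 ≤ 8 * C ^ 6 ∧ 1 ≤ 8 * C ^ 6 := by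
  have h1 := h.one_le
  have p1 : C ≤ C ^ 6 := le_self_pow₀ h1 (by norm_num)
  have p4 : C ^ 4 ≤ C ^ 6 := pow_le_pow_right₀ h1 (by norm_num)
  have p5 : C ^ 5 ≤ C ^ 6 := pow_le_pow_right₀ h1 (by norm_num)
  have p0 : 1 ≤ C ^ 6 := one_le_pow₀ h1
  refine ⟨?_, ?_, ?_, ?_, ?_⟩ <;> linarith

lemma smul_one_mono {n : Type} [Fintype n] [DecidableEq n] {c c' : ℝ} (h : c ≤ c') :
    (c : ℂ) • (1 : Sq n) ≤ (c' : ℂ) • 1 :=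
  real_smul_mono (nonneg_iff_posSemidef.2 PosSemidef.one) h

lemma SysReg.reg (h : SysReg C S) (k : Fin K) :
    Reg (8 * C ^ 6) (regMat S.Z (fun k => -S.rho k) k) fun j : Fin S.M => blk (S.Phi j.succ) k k := by
  obtain ⟨c1, c2, c3, c4, c5⟩ := h.const_bounds
  have hC := h.pos
  exact {
    one_le := c5
    card_pos := by simpa using h.d_pos k
    card_le := by
      rw [card_fin, card_fin]
      exact (h.M_le k).trans (by gcongr)
    Z_ge := (smul_one_mono (by gcongr)).trans (h.Z_ge k)
    Z_le := (h.Z_le k).trans (smul_one_mono c1)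
    Om_ge := fun i => (smul_one_mono (by gcongr)).trans
      ((blk_smul_one _ k).symm.trans_le (blk_le_blk (h.Phi_ge i.succ) k))
    Om_le := fun i => ((blk_le_blk (h.Phi_le i.succ) k).trans_eq (blk_smul_one _ k)).trans
      (smul_one_mono c3) }

lemma SysReg.Om_Amat (h : SysReg C S) (j : Fin S.M) : Om S.Amat j = S.Phi j.succ :=
  psdSqrt_mul_conjTranspose (h.Phi_psd _)

lemma SysReg.isDelta_iff (h : SysReg C S) (δ : Fin S.M → Fin K → ℝ) : S.IsDelta δ ↔
    ∀ k, IsFixed (regMat S.Z (fun k => -S.rho k) k) (fun j : Fin S.M => blk (S.Phi j.succ) k k)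
      fun j => δ j k := by
  have := isPositiveSolution_iff S.Z (fun k => -S.rho k) S.Amat δ (C := 8 * C ^ 6)
    (by simp only [h.Om_Amat]; exact h.reg)
  simp only [h.Om_Amat] at this
  exact this

lemma SysReg.existsUnique_delta (h : SysReg C S) :
    ∃! δ : Fin S.M → Fin K → ℝ, S.IsDelta δ := by
  choose x hx hxf using fun k => fixed_exists (h.reg k)
  refine ⟨fun j k => x k j, (h.isDelta_iff _).2 fun k => ⟨hx k, hxf k⟩, fun δ hδ => ?_⟩
  have hδ := (h.isDelta_iff _).1 hδ
  funext j k
  exact congrFun (fixed_unique (h.reg k) (hδ k).1 (hx k) (hδ k).2 (hxf k)) j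

lemma SysReg.netReg (h : SysReg C S) {V : Fin (S.M + 1) → S.Mat}
    {W : S.Mat} (hVW : NetChoice C S V W) (k₀ : Fin K)
    {δ : Fin S.M → Fin K → ℝ} (hδ : S.IsDelta δ) : (S.net V W δ).NetReg (8 * C ^ 6) := by
  obtain ⟨c1, c2, c3, c4, c5⟩ := h.const_bounds
  have hC := h.pos
  have hC1 := h.one_le
  have hσ := S.sigSq_pos
  have hd := fun k => (Nat.cast_pos (α := ℝ)).2 (h.d_pos k)
  have hN1 : (1 : ℝ) ≤ S.N := by
    have : S.d k₀ ≤ S.N := single_le_sum (f := S.d) (fun _ _ => Nat.zero_le _)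
      (mem_univ k₀)
    have h2 := h.d_pos k₀
    exact_mod_cast h2.trans_le this
  have hs : 0 < S.scale := by unfold System.scale; linarith
  have hnet : (S.net V W δ).N = S.N := S.card_ant
  have hdN : ∀ k, (S.d k : ℝ) ≤ S.N := fun k => by
    exact_mod_cast single_le_sum (f := S.d) (fun _ _ => Nat.zero_le _) (mem_univ k)
  have hM1 : (S.M + 1 : ℝ) ≤ 2 * C * S.N := by
    have := h.M_le k₀
    have := hdN k₀
    nlinarith
  exact {
    one_le := c5
    d_pos := h.d_pos
    M_le := fun k => (h.reg k).card_le.trans_eq' (by simp [System.net]) |>.trans_eq (by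
      simp [System.net])
    le_M := fun k => (h.le_M k).trans (by
      change C * (S.M : ℝ) ≤ 8 * C ^ 6 * S.M
      gcongr)
    tr_le := fun j k => by
      have e1 : ‖(S.Phi j).trace‖ ≤ S.N * (2 * C ^ 5) := by
        refine (norm_trace_le _).trans ?_
        rw [S.card_ant]
        gcongr
        exact h.norm_Phi j
      change ‖(S.Phi j).trace‖ + (S.net V W δ).N ≤ 8 * C ^ 6 * S.d k
      rw [hnet]
      have e2 := h.N_le k
      calc _ ≤ S.N * (2 * C ^ 5 + 1) := by linarith
        _ ≤ (C * S.d k) * (2 * C ^ 5 + 1 * C ^ 5) := by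
            gcongr
            rw [one_mul]
            exact one_le_pow₀ hC1
        _ ≤ _ := by
            have : 0 < C ^ 6 * S.d k := mul_pos (by positivity) (hd k)
            nlinarith
    Z_ge := fun k => (h.reg k).Z_ge
    Z_le := fun k => (h.reg k).Z_le
    Phi_ge := fun j => (smul_one_mono (by gcongr)).trans (h.Phi_ge j)
    Phi_le := fun j => (h.Phi_le j).trans (smul_one_mono c3)
    norm_V := fun j => (hVW.norm_V j).trans c2
    norm_VP := fun j => (hVW.norm_VP j).trans c3
    norm_PV := fun j => by
      have := (l2_opNorm_conjTranspose (V j * S.Phi j)).trans_le ((hVW.norm_VP j).trans c3)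
      rwa [conjTranspose_mul, (h.Phi_psd j).isHermitian] at this
    norm_VPV := fun j => (hVW.norm_VPV j).trans c3
    V_blk := hVW.V_blk
    g_nonneg := div_nonneg (cast_nonneg _) hs.le
    g_le := by
      change (S.N : ℝ) / S.scale ≤ 1
      rw [div_le_one hs]; unfold System.scale; linarith
    Wn_ge := by
      change ((1 - S.N / S.scale : ℝ) : ℂ) • 1 ≤ ((S.scale⁻¹ : ℝ) : ℂ) • (W + S.noiseCov)
      have e1 : (1 - S.N / S.scale : ℝ) = S.scale⁻¹ * S.sigSq := by
        rw [System.scale] at hs ⊢; field_simp; ring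
      rw [e1, ofReal_mul, ← smul_smul]
      exact real_smul_le (by positivity) (le_add_of_nonneg_left (nonneg_iff_posSemidef.2 hVW.W_psd))
    norm_Wn := by
      change ‖((S.scale⁻¹ : ℝ) : ℂ) • (W + S.noiseCov)‖ ≤ _
      rw [norm_smul, norm_real, norm_of_nonneg (by positivity), inv_mul_le_iff₀ hs]
      refine (norm_add_le _ _).trans ?_
      have e1 : ‖S.noiseCov‖ ≤ S.sigSq := by
        rw [System.noiseCov, norm_smul, norm_real, norm_of_nonneg hσ.le]
        exact mul_le_of_le_one_right hσ.le norm_one_le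
      have e2 : (S.M + 1) * C ^ 3 ≤ 2 * C * S.N * C ^ 3 := by gcongr
      have e3 : C ^ 4 ≤ C ^ 6 := pow_le_pow_right₀ hC1 (by norm_num)
      have e4 : 2 * C * S.N * C ^ 3 ≤ S.N * (8 * C ^ 6) := by
        calc _ = S.N * (2 * C ^ 4) := by ring
          _ ≤ _ := by gcongr
      have e5 := mul_le_mul_of_nonneg_left c5 hσ.le
      have e6 := hVW.norm_W
      unfold System.scale
      linarith
    fixed := (h.isDelta_iff δ).1 hδ }

/-! ### The deterministic approximations in terms of networks -/

lemma SysReg.vv_eq (h : SysReg C S) (V : Fin (S.M + 1) → S.Mat)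
    (W : S.Mat) (δ : Fin S.M → Fin K → ℝ) (k : Fin K) :
    (S.net V W δ).vv k = S.v δ k := by
  rw [System.v, digBar, System.Th, Theta_eq_thet]
  simp only [h.Om_Amat, Net.vv, div_eq_inv_mul, card_fin]
  rfl

lemma ups_smul {m m' ι : Type} [Fintype m] [DecidableEq m] [Fintype m'] [DecidableEq m']
    [Fintype ι] [DecidableEq ι] (Z : Sq m) (Om : ι → Sq m) (Z' : Sq m')
    (Om' : ι → Sq m') (Ox : ι → Matrix m m' ℂ) (δ δ' : ι → ℝ) (a : Matrix m' m ℂ)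
    (b : Matrix m m' ℂ) (c : ℂ) :
    ups Z Om Z' Om' Ox δ δ' a (c • b) = c * ups Z Om Z' Om' Ox δ δ' a b := by
  have : (fun i => ((Ox i)ᴴ * thet Z Om δ * (c • b) * thet Z' Om' δ').trace)
      = c • fun i => ((Ox i)ᴴ * thet Z Om δ * b * thet Z' Om' δ').trace := by funext i; simp
  rw [ups, ups, this, mulVec_smul, dotProduct_smul]
  simp
  ring

lemma SysReg.dlt_eq (h : SysReg C S) {V : Fin (S.M + 1) → S.Mat}
    {W : S.Mat} (hVW : NetChoice C S V W) {δ : Fin S.M → Fin K → ℝ}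
    (hδ : S.IsDelta δ) (k l : Fin K) :
    upsBar (S.Th δ) S.Amat δ k l (blk (S.Phi 0) l k) (blk (W + S.noiseCov) k l)
      / ((S.d k : ℂ) * (S.d l : ℂ))
    + isq S.d k l * piBar (S.Th δ) S.Amat (fun j => V j.succ * psdSqrt (S.Phi j.succ)) δ k l
      (blk (S.Phi 0) l k) = ((S.scale / S.N : ℝ) : ℂ) * (S.net V W δ).dlt k l := by
  have hr := h.netReg hVW k hδ
  have hN : (S.N : ℝ) ≠ 0 := by
    have e : (S.net V W δ).N = S.N := S.card_ant
    rw [← e]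
    exact (hr.N_pos k).ne'
  have hs : S.scale ≠ 0 := by
    have := S.sigSq_pos
    have : (0 : ℝ) ≤ S.N := cast_nonneg _
    unfold System.scale; linarith
  have hu := isUnit_linMat (hr.pairReg k l) (hr.fixed k) (hr.fixed l)
  have hTh : S.Th δ = Theta S.Z (fun k => -S.rho k) S.Amat δ := rfl
  have hA : ∀ j : Fin S.M, (V j.succ * psdSqrt (S.Phi j.succ)) * (S.Amat j)ᴴ
      = V j.succ * S.Phi j.succ := fun j => by
    rw [System.Amat, Matrix.mul_assoc, psdSqrt_mul_conjTranspose (h.Phi_psd _)]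
  have hA' : ∀ j : Fin S.M, S.Amat j * (V j.succ * psdSqrt (S.Phi j.succ))ᴴ
      = S.Phi j.succ * (V j.succ)ᴴ := fun j => by
    rw [System.Amat, conjTranspose_mul, ← Matrix.mul_assoc, psdSqrt_mul_conjTranspose (h.Phi_psd _)]
  have hB : ∀ j : Fin S.M, (V j.succ * psdSqrt (S.Phi j.succ)) *
      (V j.succ * psdSqrt (S.Phi j.succ))ᴴ = V j.succ * S.Phi j.succ * (V j.succ)ᴴ := fun j => by
    rw [conjTranspose_mul, Matrix.mul_assoc, ← Matrix.mul_assoc (psdSqrt _),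
      psdSqrt_mul_conjTranspose (h.Phi_psd _), Matrix.mul_assoc]
  rw [hTh, upsBar_eq, isq_mul_piBar S.Z (fun k => -S.rho k) S.Amat _ δ (by
    simp only [h.Om_Amat]; exact hu)]
  simp only [upsK, thirdK, hA, hA', hB, h.Om_Amat]
  have e1 : (S.net V W δ).N = S.N := S.card_ant
  have e2 := ups_smul (regMat S.Z (fun k => -S.rho k) k) (fun j => blk (S.Phi j.succ) k k)
    (regMat S.Z (fun k => -S.rho k) l) (fun j => blk (S.Phi j.succ) l l)
    (fun j => blk (S.Phi j.succ) k l) (fun j => δ j k) (fun j => δ j l) (blk (S.Phi 0) l k)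
    (blk (W + S.noiseCov) k l) ((S.scale⁻¹ : ℝ) : ℂ)
  rw [Net.dlt, of_apply, e1]
  change _ = ((S.scale / S.N : ℝ) : ℂ) * (((S.N / (S.d k * S.d l) : ℝ) : ℂ) * ups
    (regMat S.Z (fun k => -S.rho k) k) (fun j => blk (S.Phi j.succ) k k)
    (regMat S.Z (fun k => -S.rho k) l) (fun j => blk (S.Phi j.succ) l l)
    (fun j => blk (S.Phi j.succ) k l) (fun j => δ j k) (fun j => δ j l) (blk (S.Phi 0) l k)
    (((S.scale⁻¹ : ℝ) : ℂ) • blk (W + S.noiseCov) k l)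
    + (((S.N / S.scale) / (S.d k * S.d l) : ℝ) : ℂ) * _)
  rw [e2]
  have hNc : (S.N : ℂ) ≠ 0 := by exact_mod_cast hN
  have hsc : (S.scale : ℂ) ≠ 0 := by exact_mod_cast hs
  have hdk : (S.d k : ℂ) ≠ 0 := by exact_mod_cast (h.d_pos k).ne'
  have hdl : (S.d l : ℂ) ≠ 0 := by exact_mod_cast (h.d_pos l).ne'
  push_cast
  field_simp
  rfl

lemma SysReg.Del_eq (h : SysReg C S) {δ : Fin S.M → Fin K → ℝ} (hδ : S.IsDelta δ) :
    S.Del δ = ((S.scale / S.N : ℝ) : ℂ) • (S.net S.V S.W δ).dlt := by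
  ext k l
  exact h.dlt_eq h.choice hδ k l

lemma SysReg.DelI_eq (h : SysReg C S) {δ : Fin S.M → Fin K → ℝ} (hδ : S.IsDelta δ) :
    S.DelI δ = ((S.scale / S.N : ℝ) : ℂ) • (S.net (fun _ => 1) S.DW δ).dlt := by
  ext k l
  have := h.dlt_eq h.choiceOne hδ k l
  simp only [Matrix.one_mul] at this
  exact this

end SystemFacts

section ComplexGaussian

instance (v : ℝ) : IsProbabilityMeasure (complexGaussian v) :=
  Measure.isProbabilityMeasure_map Complex.measurableEquivRealProd.symm.measurable.aemeasurable

lemma integral_complexGaussian_prod (v : ℝ) (f g : ℝ → ℂ) :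
    ∫ z, f z.re * g z.im ∂complexGaussian v
      = (∫ x, f x ∂gaussianReal 0 (v / 2).toNNReal) * ∫ x, g x ∂gaussianReal 0 (v / 2).toNNReal := by
  rw [complexGaussian, integral_map_equiv]
  exact integral_prod_mul f g

lemma integral_exp_complexGaussian {v : ℝ} (hv : 0 ≤ v) (c : ℂ) :
    ∫ z, Complex.exp (((star c * z).re : ℂ) * I) ∂complexGaussian v
      = Complex.exp (-((v * ‖c‖ ^ 2 : ℝ) : ℂ) / 4) := by
  have e : ∀ z : ℂ, Complex.exp (((star c * z).re : ℂ) * I)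
      = Complex.exp (c.re * z.re * I) * Complex.exp (c.im * z.im * I) := fun z => by
    rw [← Complex.exp_add]
    congr 1
    simp [Complex.mul_re]
    ring
  simp_rw [e]
  rw [integral_complexGaussian_prod v (fun x => Complex.exp (c.re * x * I))
    fun x => Complex.exp (c.im * x * I), ← charFun_apply_real, ← charFun_apply_real,
    charFun_gaussianReal, charFun_gaussianReal, ← Complex.exp_add]
  congr 1
  have h1 : (((v / 2).toNNReal : ℝ) : ℂ) = (v / 2 : ℝ) := by rw [Real.coe_toNNReal _ (by linarith)]
  rw [h1, ← Complex.normSq_eq_norm_sq, Complex.normSq_apply]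
  push_cast
  ring

lemma integral_exp_sq_gaussianReal (s : ℝ) :
    ∫ x, exp (s * x ^ 2) ∂gaussianReal 0 ((1 : ℝ) / 2).toNNReal = (sqrt (1 - s))⁻¹ := by
  have h0 : ((1 : ℝ) / 2).toNNReal ≠ 0 := by simp
  rw [integral_gaussianReal_eq_integral_smul h0]
  have h1 : (((1 : ℝ) / 2).toNNReal : ℝ) = 1 / 2 := Real.coe_toNNReal _ (by norm_num)
  have e : ∀ x : ℝ, gaussianPDFReal 0 ((1 : ℝ) / 2).toNNReal x • exp (s * x ^ 2)
      = (sqrt Real.pi)⁻¹ * exp (-(1 - s) * x ^ 2) := fun x => by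
    rw [gaussianPDFReal, h1, smul_eq_mul, mul_assoc, ← Real.exp_add]
    congr 2 <;> ring_nf
  simp_rw [e]
  rw [integral_const_mul, integral_gaussian, Real.sqrt_div Real.pi_pos.le]
  have := Real.sqrt_pos.2 Real.pi_pos
  field_simp

lemma integral_exp_norm_sq_complexGaussian {s : ℝ} (hs : s < 1) :
    ∫ z, exp (s * ‖z‖ ^ 2) ∂complexGaussian 1 = (1 - s)⁻¹ := by
  have e : ∀ z : ℂ, exp (s * ‖z‖ ^ 2) = exp (s * z.re ^ 2) * exp (s * z.im ^ 2) :=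
    fun z => by
      rw [← Real.exp_add, ← Complex.normSq_eq_norm_sq, Complex.normSq_apply]
      ring_nf
  simp_rw [e]
  rw [complexGaussian, integral_map_equiv]
  refine (integral_prod_mul (fun x => exp (s * x ^ 2)) fun x => exp (s * x ^ 2)).trans ?_
  rw [integral_exp_sq_gaussianReal, ← mul_inv, Real.mul_self_sqrt (by linarith)]

/-- Sub-exponential bound for the centred square of a standard complex Gaussian variable. -/
lemma integral_exp_centred_le {s : ℝ} (hs : s ≤ 1 / 2) :
    0 < ∫ z, exp (s * (‖z‖ ^ 2 - 1)) ∂complexGaussian 1 ∧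
    ∫ z, exp (s * (‖z‖ ^ 2 - 1)) ∂complexGaussian 1 ≤ exp (2 * s ^ 2) := by
  have e : ∀ z : ℂ, exp (s * (‖z‖ ^ 2 - 1)) = exp (-s) * exp (s * ‖z‖ ^ 2) :=
    fun z => by
      rw [← Real.exp_add]
      ring_nf
  have hs1 : 0 < 1 - s := by linarith
  simp_rw [e]
  rw [integral_const_mul, integral_exp_norm_sq_complexGaussian (by linarith)]
  refine ⟨by positivity, ?_⟩
  rw [mul_inv_le_iff₀ hs1]
  have h1 := Real.add_one_le_exp (s + 2 * s ^ 2)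
  have h2 : 1 ≤ (1 - s) * exp (s + 2 * s ^ 2) := by
    refine le_trans ?_ (mul_le_mul_of_nonneg_left h1 hs1.le)
    nlinarith [mul_nonneg (sq_nonneg s) (by linarith : 0 ≤ 1 - 2 * s)]
  calc exp (-s) ≤ exp (-s) * ((1 - s) * exp (s + 2 * s ^ 2)) :=
        le_mul_of_one_le_right (Real.exp_pos _).le h2
    _ = (exp (-s) * exp (s + 2 * s ^ 2)) * (1 - s) := by ring
    _ = exp (2 * s ^ 2) * (1 - s) := by
        rw [← Real.exp_add]
        ring_nf

end ComplexGaussian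

section GaussianFamily

variable {Ω : Type*} [MeasurableSpace Ω] {P : Measure Ω} [IsProbabilityMeasure P]
  {ι : Type} [Fintype ι] [DecidableEq ι] {J J' : Type} [Fintype J] [DecidableEq J]
  [Fintype J'] [DecidableEq J'] {ξ : ι → Ω → ℂ} {v : ι → ℝ}

/-- Independent circularly symmetric complex Gaussian variables `ξ i` with variances `v i`. -/
structure GaussFam (P : Measure Ω) (ξ : ι → Ω → ℂ) (v : ι → ℝ) : Prop where
  meas : ∀ i, Measurable (ξ i)
  nonneg : ∀ i, 0 ≤ v i
  law : ∀ i, P.map (ξ i) = complexGaussian (v i)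
  indep : iIndepFun ξ P

/-- The random vector `L ξ`. -/
def lin (L : Matrix J ι ℂ) (ξ : ι → Ω → ℂ) (ω : Ω) : J → ℂ := L *ᵥ fun i => ξ i ω

/-- The cross covariance matrix of `L ξ` and `L' ξ`. -/
def covMat (v : ι → ℝ) (L : Matrix J ι ℂ) (L' : Matrix J' ι ℂ) : Matrix J J' ℂ :=
  L * Matrix.diagonal (fun i => (v i : ℂ)) * L'ᴴ

lemma GaussFam.measurable_lin (h : GaussFam P ξ v) (L : Matrix J ι ℂ) : Measurable (lin L ξ) := by
  refine measurable_pi_lambda _ fun j => ?_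
  simp only [lin, mulVec, dotProduct]
  exact Finset.measurable_sum _ fun i _ => (h.meas i).const_mul _

lemma GaussFam.integral_exp (h : GaussFam P ξ v) (c : ι → ℂ) :
    ∫ ω, Complex.exp (((star c ⬝ᵥ fun i => ξ i ω).re : ℂ) * I) ∂P
      = Complex.exp (-((∑ i, v i * ‖c i‖ ^ 2 : ℝ) : ℂ) / 4) := by
  have e : ∀ ω, Complex.exp (((star c ⬝ᵥ fun i => ξ i ω).re : ℂ) * I)
      = ∏ i, Complex.exp (((star (c i) * ξ i ω).re : ℂ) * I) := fun ω => by
    rw [← Complex.exp_sum, dotProduct, re_sum, Complex.ofReal_sum, Finset.sum_mul]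
    rfl
  simp_rw [e]
  have hm : ∀ i, Measurable fun z : ℂ => Complex.exp (((star (c i) * z).re : ℂ) * I) :=
    fun i => by fun_prop
  rw [h.indep.integral_fun_prod_comp (f := fun i z =>
    Complex.exp (((star (c i) * z).re : ℂ) * I)) (fun i => (h.meas i).aemeasurable)
    fun i => (hm i).aestronglyMeasurable]
  have e2 : ∀ i, ∫ ω, Complex.exp (((star (c i) * ξ i ω).re : ℂ) * I) ∂P
      = Complex.exp (-((v i * ‖c i‖ ^ 2 : ℝ) : ℂ) / 4) := fun i => by
    rw [← integral_exp_complexGaussian (h.nonneg i) (c i), ← h.law i,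
      integral_map (h.meas i).aemeasurable (hm i).aestronglyMeasurable]
  simp_rw [e2]
  rw [← Complex.exp_sum, Complex.ofReal_sum, ← Finset.sum_neg_distrib, Finset.sum_div]

lemma qf_cov (L : Matrix J ι ℂ) (u : J → ℂ) :
    (qf u (covMat v L L) u).re = ∑ i, v i * ‖(Lᴴ *ᵥ u) i‖ ^ 2 := by
  have e : covMat v L L = Lᴴᴴ * Matrix.diagonal (fun i => (v i : ℂ)) * Lᴴ := by
    rw [conjTranspose_conjTranspose]; rfl
  rw [e, qf_conjTranspose_mul_mul, qf, dotProduct, re_sum]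
  refine sum_congr rfl fun i _ => ?_
  rw [mulVec_diagonal, Pi.star_apply, mul_left_comm, re_ofReal_mul, star_def,
    Complex.conj_mul', ← Complex.ofReal_pow, ofReal_re]

lemma GaussFam.integral_exp_lin (h : GaussFam P ξ v) (L : Matrix J ι ℂ) (u : J → ℂ) :
    ∫ ω, Complex.exp (((star u ⬝ᵥ lin L ξ ω).re : ℂ) * I) ∂P
      = Complex.exp (-((qf u (covMat v L L) u).re : ℂ) / 4) := by
  have e : ∀ ω, star u ⬝ᵥ lin L ξ ω = star (Lᴴ *ᵥ u) ⬝ᵥ fun i => ξ i ω := fun ω => by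
    rw [lin, dotProduct_mulVec, star_mulVec, conjTranspose_conjTranspose]
  simp_rw [e]
  rw [h.integral_exp, qf_cov]

lemma exists_dual_repr (ℓ : StrongDual ℝ (J → ℂ)) : ∃ u : J → ℂ, ∀ x, ℓ x = (star u ⬝ᵥ x).re := by
  refine ⟨fun j => ⟨ℓ (Pi.single j 1), ℓ (Pi.single j I)⟩, fun x => ?_⟩
  have e : x = ∑ j, ((x j).re • (Pi.single j 1 : J → ℂ) + (x j).im • (Pi.single j I : J → ℂ)) := by
    funext i
    simp only [Finset.sum_apply, Pi.add_apply, Pi.smul_apply, Pi.single_apply]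
    simp [sum_add_distrib]
  conv_lhs => rw [e]
  simp only [map_sum, map_add, map_smul, dotProduct, re_sum, Pi.star_apply,
    star_def, Complex.mul_re, Complex.conj_re, Complex.conj_im, smul_eq_mul]
  exact sum_congr rfl fun j _ => by ring

lemma qf_add_add (u : J → ℂ) (u' : J' → ℂ) (L : Matrix J ι ℂ) (L' : Matrix J' ι ℂ)
    (h0 : covMat v L L' = 0) : ∑ i, v i * ‖(Lᴴ *ᵥ u + L'ᴴ *ᵥ u') i‖ ^ 2
      = (qf u (covMat v L L) u).re + (qf u' (covMat v L' L') u').re := by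
  have hx : ∑ i, v i * (star (Lᴴ *ᵥ u) i * (L'ᴴ *ᵥ u') i).re = 0 := by
    have e : qf u (covMat v L L') u' = ∑ i, (v i : ℂ) * (star (Lᴴ *ᵥ u) i * (L'ᴴ *ᵥ u') i) := by
      have e : covMat v L L' = Lᴴᴴ * Matrix.diagonal (fun i => (v i : ℂ)) * L'ᴴ := by
        rw [conjTranspose_conjTranspose]; rfl
      rw [e, qf_conjTranspose_mul_mul, qf, dotProduct]
      refine sum_congr rfl fun i _ => ?_
      rw [mulVec_diagonal]; ring
    rw [h0] at e
    have := congrArg Complex.re e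
    simp only [qf, zero_mulVec, dotProduct_zero, Complex.zero_re, re_sum,
      re_ofReal_mul] at this
    exact this.symm
  rw [qf_cov, qf_cov, ← sum_add_distrib]
  have : ∀ i, v i * ‖(Lᴴ *ᵥ u + L'ᴴ *ᵥ u') i‖ ^ 2 = v i * ‖(Lᴴ *ᵥ u) i‖ ^ 2
      + v i * ‖(L'ᴴ *ᵥ u') i‖ ^ 2 + 2 * (v i * (star (Lᴴ *ᵥ u) i * (L'ᴴ *ᵥ u') i).re) := fun i => by
    rw [Pi.add_apply, ← Complex.normSq_eq_norm_sq, ← Complex.normSq_eq_norm_sq,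
      ← Complex.normSq_eq_norm_sq, Complex.normSq_add, Pi.star_apply, star_def, mul_add,
      mul_add]
    congr 1
    rw [← Complex.conj_re]
    simp
    ring
  simp_rw [this]
  rw [sum_add_distrib, ← Finset.mul_sum, hx]
  simp [sum_add_distrib]

/-- Uncorrelated linear images of a Gaussian family are independent. -/
lemma GaussFam.indepFun (h : GaussFam P ξ v) {L : Matrix J ι ℂ} {L' : Matrix J' ι ℂ}
    (h0 : covMat v L L' = 0) : IndepFun (lin L ξ) (lin L' ξ) P := by
  have m1 := h.measurable_lin L
  have m2 := h.measurable_lin L'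
  rw [indepFun_iff_charFunDual_prod m1.aemeasurable m2.aemeasurable]
  intro ℓ
  obtain ⟨u, hu⟩ := exists_dual_repr (ℓ.comp (.inl ℝ (J → ℂ) (J' → ℂ)))
  obtain ⟨u', hu'⟩ := exists_dual_repr (ℓ.comp (.inr ℝ (J → ℂ) (J' → ℂ)))
  have hℓ : ∀ p : (J → ℂ) × (J' → ℂ), ℓ p = (star u ⬝ᵥ p.1 + star u' ⬝ᵥ p.2).re := fun p => by
    have : p = ContinuousLinearMap.inl ℝ (J → ℂ) (J' → ℂ) p.1
        + ContinuousLinearMap.inr ℝ (J → ℂ) (J' → ℂ) p.2 := by simp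
    conv_lhs => rw [this, map_add]
    rw [Complex.add_re, ← hu, ← hu']
    rfl
  have mc : ∀ {E : Type} [NormedAddCommGroup E] [NormedSpace ℝ E] [MeasurableSpace E]
      [OpensMeasurableSpace E] (ℓ : StrongDual ℝ E),
      Measurable fun x => Complex.exp ((ℓ x : ℂ) * I) := fun ℓ =>
    (Complex.continuous_exp.comp ((Complex.continuous_ofReal.comp ℓ.continuous).mul
      continuous_const)).measurable
  rw [charFunDual_apply, charFunDual_apply, charFunDual_apply,
    integral_map (m1.prodMk m2).aemeasurable (mc ℓ).aestronglyMeasurable,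
    integral_map m1.aemeasurable (mc _).aestronglyMeasurable,
    integral_map m2.aemeasurable (mc _).aestronglyMeasurable]
  simp_rw [hu, hu', hℓ]
  rw [h.integral_exp_lin, h.integral_exp_lin]
  have e : ∀ ω, star u ⬝ᵥ lin L ξ ω + star u' ⬝ᵥ lin L' ξ ω
      = star (Lᴴ *ᵥ u + L'ᴴ *ᵥ u') ⬝ᵥ fun i => ξ i ω := fun ω => by
    rw [lin, lin, dotProduct_mulVec, dotProduct_mulVec, star_add, star_mulVec, star_mulVec,
      conjTranspose_conjTranspose, conjTranspose_conjTranspose, add_dotProduct]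
  simp_rw [e]
  rw [h.integral_exp, qf_add_add u u' L L' h0, ← Complex.exp_add]
  congr 1
  push_cast
  ring

/-- A linear image with identity covariance consists of independent standard variables. -/
lemma GaussFam.map_lin (h : GaussFam P ξ v) {L : Matrix J ι ℂ} (h1 : covMat v L L = 1) :
    P.map (lin L ξ) = Measure.pi fun _ : J => complexGaussian 1 := by
  have m1 := h.measurable_lin L
  have : IsProbabilityMeasure (P.map (lin L ξ)) := Measure.isProbabilityMeasure_map m1.aemeasurable
  refine Measure.ext_of_charFunDual (funext fun ℓ => ?_)
  obtain ⟨u, hu⟩ := exists_dual_repr ℓ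
  have hg : GaussFam (Measure.pi fun _ : J => complexGaussian 1) (fun i (x : J → ℂ) => x i)
      (fun _ => 1) :=
    { meas := fun i => measurable_pi_apply i
      nonneg := fun _ => zero_le_one
      law := fun i => by
        have := measurePreserving_eval (fun _ : J => complexGaussian 1) i
        exact this.map_eq
      indep := iIndepFun_pi (X := fun _ => id) fun _ => aemeasurable_id }
  rw [charFunDual_apply, charFunDual_apply, integral_map m1.aemeasurable]
  · simp_rw [hu]
    rw [h.integral_exp_lin, hg.integral_exp, h1, qf, one_mulVec, dot_self, ofReal_re, nrm_sq]
    simp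
  · exact (Complex.continuous_exp.comp ((Complex.continuous_ofReal.comp ℓ.continuous).mul
      continuous_const)).measurable.aestronglyMeasurable

end GaussianFamily

section Tails

variable {J : Type} [Fintype J] [DecidableEq J]

lemma chernoff_pi (a : J → ℝ) {F : ℝ} (hF : 0 < F) (ha : ∑ i, a i ^ 2 ≤ F ^ 2) (η : ℝ) :
    (Measure.pi fun _ : J => complexGaussian 1).real
      {w | η * F ≤ ∑ i, a i * (‖w i‖ ^ 2 - 1)} ≤ 2 * exp (-η / 2) := by
  set μ := Measure.pi fun _ : J => complexGaussian 1
  set f : (J → ℂ) → ℝ := fun w => exp ((2 * F)⁻¹ * ∑ i, a i * (‖w i‖ ^ 2 - 1))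
  have hf : ∫ w, f w ∂μ = ∏ i, ∫ z, exp ((a i / (2 * F)) * (‖z‖ ^ 2 - 1)) ∂complexGaussian 1 := by
    rw [← integral_fintype_prod_eq_prod (μ := fun _ : J => complexGaussian 1)
      (fun i z => exp ((a i / (2 * F)) * (‖z‖ ^ 2 - 1)))]
    refine integral_congr_ae (.of_forall fun w => ?_)
    simp only [f]
    rw [← Real.exp_sum, Finset.mul_sum]
    congr 1
    exact sum_congr rfl fun i _ => by ring
  have hai : ∀ i, a i / (2 * F) ≤ 1 / 2 := fun i => by
    have h1 : a i ^ 2 ≤ F ^ 2 :=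
      (single_le_sum (f := fun i => a i ^ 2) (fun i _ => sq_nonneg _) (mem_univ i)).trans ha
    have h2 := abs_le_of_sq_le_sq' h1 hF.le
    rw [div_le_div_iff₀ (by positivity) (by norm_num)]
    linarith [h2.2]
  have hpos : 0 < ∫ w, f w ∂μ := by
    rw [hf]
    exact Finset.prod_pos fun i _ => (integral_exp_centred_le (hai i)).1
  have hle : ∫ w, f w ∂μ ≤ 2 := by
    rw [hf]
    calc _ ≤ ∏ i, exp (2 * (a i / (2 * F)) ^ 2) :=
          Finset.prod_le_prod (fun i _ => (integral_exp_centred_le (hai i)).1.le)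
            fun i _ => (integral_exp_centred_le (hai i)).2
      _ = exp ((∑ i, a i ^ 2) / (2 * F ^ 2)) := by
          rw [← Real.exp_sum, Finset.sum_div]
          congr 1
          refine sum_congr rfl fun i _ => ?_
          field_simp
      _ ≤ exp (1 / 2) := by
          refine Real.exp_le_exp.2 ?_
          rw [div_le_div_iff₀ (by positivity) (by norm_num)]
          linarith
      _ ≤ 2 := by
          have h1 : exp (1 / 2) ^ 2 = exp 1 := by rw [← Real.exp_nat_mul]; norm_num
          have h2 := Real.exp_one_lt_d9
          nlinarith [Real.exp_pos (1 / 2 : ℝ)]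
  have hint : Integrable f μ := by
    by_contra h
    rw [integral_undef h] at hpos
    exact lt_irrefl _ hpos
  have hm := mul_meas_ge_le_integral_of_nonneg (μ := μ) (.of_forall fun w => (Real.exp_pos _).le)
    hint (exp (η / 2))
  have hs : {w | η * F ≤ ∑ i, a i * (‖w i‖ ^ 2 - 1)} = {w | exp (η / 2) ≤ f w} := by
    ext w
    simp only [Set.mem_ofPred_eq, f, Real.exp_le_exp]
    rw [inv_mul_eq_div, le_div_iff₀ (by positivity)]
    ring_nf
  rw [hs, neg_div, Real.exp_neg, ← div_eq_mul_inv, le_div_iff₀ (Real.exp_pos _), mul_comm]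
  exact hm.trans hle

variable {Ω : Type*} [MeasurableSpace Ω] {P : Measure Ω} [IsProbabilityMeasure P]
  {ι : Type} [Fintype ι] [DecidableEq ι] {ξ : ι → Ω → ℂ} {v : ι → ℝ} {Φ : Sq J} {C : ℝ}

lemma cov_mul (v : ι → ℝ) {J' : Type} [Fintype J'] [DecidableEq J'] (G : Matrix J' J ℂ)
    (L : Matrix J ι ℂ) : covMat v (G * L) (G * L) = G * covMat v L L * Gᴴ := by
  simp only [covMat, conjTranspose_mul, Matrix.mul_assoc]

lemma GaussFam.tail_hermitian (h : GaussFam P ξ v) {L : Matrix J ι ℂ} (hL : covMat v L L = Φ)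
    (hΦ : Φ.PosDef) (hC : ‖Φ‖ ≤ C) {X : Sq J} (hX : X.IsHermitian) {F : ℝ} (hF : 0 < C * F)
    (hXF : fro X ≤ F) (η : ℝ) :
    P.real {ω | η * (C * F) ≤ (qf (lin L ξ ω) X (lin L ξ ω) - (X * Φ).trace).re}
      ≤ 2 * exp (-η / 2) := by
  set B := psdSqrt Φ
  have hBB : B * B = Φ := psdSqrt_mul_self hΦ.posSemidef
  have hBh : Bᴴ = B := psdSqrt_herm Φ
  have hBu : IsUnit B.det := by
    have := (isUnit_iff_isUnit_det _).1 hΦ.isUnit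
    rw [← hBB, det_mul] at this
    exact isUnit_of_mul_isUnit_left this
  have hH : (B * X * B).IsHermitian := by
    rw [IsHermitian, conjTranspose_mul, conjTranspose_mul, hBh, hX, Matrix.mul_assoc]
  set U : Sq J := hH.eigenvectorUnitary.1
  set a := hH.eigenvalues
  have hU : U * Uᴴ = 1 := Unitary.coe_mul_star_self hH.eigenvectorUnitary
  have hU' : Uᴴ * U = 1 := Unitary.coe_star_mul_self hH.eigenvectorUnitary
  have hsp : B * X * B = U * Matrix.diagonal (fun i => (a i : ℂ)) * Uᴴ := hH.spectral_theorem
  set G := Uᴴ * B⁻¹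
  have hG : covMat v (G * L) (G * L) = 1 := by
    rw [cov_mul, hL]
    have e1 : Gᴴ = B⁻¹ * U := by
      rw [conjTranspose_mul, conjTranspose_conjTranspose, conjTranspose_nonsing_inv, hBh]
    rw [e1, ← hBB]
    calc Uᴴ * B⁻¹ * (B * B) * (B⁻¹ * U) = Uᴴ * (B⁻¹ * B) * (B * B⁻¹) * U := by
          simp only [Matrix.mul_assoc]
      _ = 1 := by
          rw [nonsing_inv_mul _ hBu, mul_nonsing_inv _ hBu, Matrix.mul_one, Matrix.mul_one, hU']
  have hy : ∀ ω, lin L ξ ω = (B * U) *ᵥ lin (G * L) ξ ω := fun ω => by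
    rw [lin, lin, mulVec_mulVec]
    congr 1
    calc L = (B * (U * Uᴴ) * B⁻¹) * L := by
          rw [hU, Matrix.mul_one, mul_nonsing_inv _ hBu, Matrix.one_mul]
      _ = _ := by simp only [G, Matrix.mul_assoc]
  have hq : ∀ ω, (qf (lin L ξ ω) X (lin L ξ ω) - (X * Φ).trace).re
      = ∑ i, a i * (‖lin (G * L) ξ ω i‖ ^ 2 - 1) := fun ω => by
    have e1 : (B * U)ᴴ * X * (B * U) = Matrix.diagonal (fun i => (a i : ℂ)) := by
      rw [conjTranspose_mul, hBh]
      calc Uᴴ * B * X * (B * U) = Uᴴ * (B * X * B) * U := by simp only [Matrix.mul_assoc]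
        _ = (Uᴴ * U) * Matrix.diagonal (fun i => (a i : ℂ)) * (Uᴴ * U) := by
            rw [hsp]; simp only [Matrix.mul_assoc]
        _ = _ := by rw [hU', Matrix.one_mul, Matrix.mul_one]
    have e2 : (X * Φ).trace = ∑ i, (a i : ℂ) := by
      rw [← hBB, ← Matrix.mul_assoc, trace_mul_comm, ← Matrix.mul_assoc, hsp, trace_mul_comm,
        ← Matrix.mul_assoc, hU', Matrix.one_mul, trace_diagonal]
    rw [hy, ← qf_conjTranspose_mul_mul, e1, e2, qf, dotProduct, Complex.sub_re, re_sum,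
      re_sum, ← sum_sub_distrib]
    refine sum_congr rfl fun i _ => ?_
    rw [mulVec_diagonal, Pi.star_apply, mul_left_comm, re_ofReal_mul, star_def,
      Complex.conj_mul', ← Complex.ofReal_pow, ofReal_re, ofReal_re]
    ring
  have ha : ∑ i, a i ^ 2 ≤ (C * F) ^ 2 := by
    have e1 : ∑ i, a i ^ 2 = fro (B * X * B) ^ 2 := by
      have e2 : (((fro (B * X * B)) ^ 2 : ℝ) : ℂ) = ((∑ i, a i ^ 2 : ℝ) : ℂ) := by
        rw [← fro_sq_trace, hH]
        have : B * X * B * (B * X * B) = U * (Matrix.diagonal (fun i => (a i : ℂ)) *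
            Matrix.diagonal (fun i => (a i : ℂ))) * Uᴴ := by
          calc _ = U * Matrix.diagonal (fun i => (a i : ℂ)) * (Uᴴ * U) *
                Matrix.diagonal (fun i => (a i : ℂ)) * Uᴴ := by
                rw [hsp]; simp only [Matrix.mul_assoc]
            _ = _ := by rw [hU', Matrix.mul_one]; simp only [Matrix.mul_assoc]
        rw [this, trace_mul_comm, ← Matrix.mul_assoc, hU', Matrix.one_mul, diagonal_mul_diagonal,
          trace_diagonal]
        push_cast
        exact sum_congr rfl fun i _ => by ring
      exact_mod_cast e2.symm
    have e2 : ‖B‖ * ‖B‖ = ‖Φ‖ := by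
      rw [← hBB]
      nth_rewrite 3 [← hBh]
      exact (CStarRing.norm_star_mul_self (x := B)).symm
    have e3 : fro (B * X * B) ≤ C * F := by
      refine (fro_mul_le_right _ _).trans ?_
      calc fro (B * X) * ‖B‖ ≤ (‖B‖ * fro X) * ‖B‖ := by
            gcongr; exact fro_mul_le_left _ _
        _ = ‖Φ‖ * fro X := by rw [← e2]; ring
        _ ≤ _ := mul_le_mul hC hXF (fro_nonneg _) ((norm_nonneg _).trans hC)
    rw [e1]
    exact pow_le_pow_left₀ (fro_nonneg _) e3 2
  have h2 := chernoff_pi a hF ha η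
  rw [← h.map_lin hG, map_measureReal_apply (h.measurable_lin _)] at h2
  · simp_rw [hq]
    exact h2
  · exact measurableSet_le measurable_const (by fun_prop)

/-- The Hermitian part of a matrix. -/
def hpart (X : Sq J) : Sq J := (1 / 2 : ℂ) • (X + Xᴴ)

lemma hpart_herm (X : Sq J) : (hpart X).IsHermitian := by
  rw [IsHermitian, hpart, conjTranspose_smul, conjTranspose_add, conjTranspose_conjTranspose,
    add_comm]
  congr 1
  simp

lemma fro_hpart_le (X : Sq J) : fro (hpart X) ≤ fro X := by
  rw [hpart, fro_smul]
  have := fro_add_le X Xᴴ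
  rw [fro_conjTranspose] at this
  have e : ‖(1 / 2 : ℂ)‖ = 1 / 2 := by norm_num
  rw [e]
  linarith

lemma re_qf_hpart (X : Sq J) (hΦ : Φ.IsHermitian) (u : J → ℂ) :
    (qf u (hpart X) u - (hpart X * Φ).trace).re = (qf u X u - (X * Φ).trace).re := by
  have e1 : (qf u Xᴴ u) = star (qf u X u) := by
    rw [qf, qf, ← star_dotProduct, star_mulVec, ← dotProduct_mulVec]
  have e2 : (Xᴴ * Φ).trace = star (X * Φ).trace := by
    rw [← trace_conjTranspose, conjTranspose_mul, hΦ, trace_mul_comm]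
  have e3 : qf u (hpart X) u = 1 / 2 * (qf u X u + qf u Xᴴ u) := by
    simp [qf, hpart, smul_mulVec, add_mulVec, dotProduct_add]
    ring
  rw [e3, e1, hpart, Matrix.smul_mul, Matrix.add_mul, trace_smul, trace_add, e2]
  simp
  ring

/-- Hanson–Wright inequality for complex Gaussian vectors. -/
lemma GaussFam.tail (h : GaussFam P ξ v) {L : Matrix J ι ℂ} (hL : covMat v L L = Φ)
    (hΦ : Φ.PosDef) (hC0 : 0 < C) (hC : ‖Φ‖ ≤ C) (X : Sq J) (η : ℝ) :
    P.real {ω | 2 * η * C * fro X < ‖qf (lin L ξ ω) X (lin L ξ ω) - (X * Φ).trace‖}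
      ≤ 8 * exp (-η / 2) := by
  rcases (fro_nonneg X).eq_or_lt with h0 | h0
  · have hX : X = 0 := by
      have h1 : ∑ i, ∑ j, ‖X i j‖ ^ 2 = 0 := by rw [← fro_sq, ← h0]; simp
      ext i j
      have h2 := (Finset.sum_eq_zero_iff_of_nonneg fun i _ => sum_nonneg fun j _ =>
        sq_nonneg _).1 h1 i (mem_univ i)
      have h3 := (Finset.sum_eq_zero_iff_of_nonneg fun j _ => sq_nonneg _).1 h2 j (mem_univ j)
      simpa using h3
    have : {ω | 2 * η * C * fro X < ‖qf (lin L ξ ω) X (lin L ξ ω) - (X * Φ).trace‖} = ∅ := by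
      ext ω
      rw [Set.mem_ofPred_eq, ← h0]
      simp [hX, qf]
    rw [this, measureReal_empty]
    positivity
  have key : ∀ c : ℂ, ‖c‖ = 1 → P.real {ω | η * (C * fro X) ≤
      (c * (qf (lin L ξ ω) X (lin L ξ ω) - (X * Φ).trace)).re} ≤ 2 * exp (-η / 2) := fun c hc => by
    have := h.tail_hermitian hL hΦ hC (hpart_herm (c • X)) (mul_pos hC0 h0)
      ((fro_hpart_le _).trans_eq (by rw [fro_smul, hc, one_mul])) η
    have e : ∀ u, qf u (c • X) u = c * qf u X u := fun u => by simp [qf, smul_mulVec]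
    simp_rw [re_qf_hpart _ hΦ.isHermitian, e, Matrix.smul_mul, trace_smul,
      smul_eq_mul, ← mul_sub] at this
    exact this
  set E : ℂ → Set Ω := fun c => {ω | η * (C * fro X) ≤
      (c * (qf (lin L ξ ω) X (lin L ξ ω) - (X * Φ).trace)).re}
  have hsub : {ω | 2 * η * C * fro X < ‖qf (lin L ξ ω) X (lin L ξ ω) - (X * Φ).trace‖}
      ⊆ (E 1 ∪ E (-1)) ∪ (E (-I) ∪ E I) := by
    intro ω hω
    simp only [Set.mem_ofPred_eq] at hω
    by_contra hcon
    simp only [Set.mem_union, Set.mem_ofPred_eq, E, not_or, not_le, one_mul, neg_mul,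
      Complex.neg_re, Complex.I_mul_re, neg_neg] at hcon
    obtain ⟨⟨h1, h2⟩, h3, h4⟩ := hcon
    have h5 := Complex.norm_le_abs_re_add_abs_im (qf (lin L ξ ω) X (lin L ξ ω) - (X * Φ).trace)
    have h6 := abs_lt.2 ⟨by linarith, h1⟩
    have h7 := abs_lt.2 ⟨by linarith, h3⟩
    linarith
  refine (measureReal_mono hsub).trans ?_
  have u1 := measureReal_union_le (μ := P) (E 1 ∪ E (-1)) (E (-I) ∪ E I)
  have u2 := measureReal_union_le (μ := P) (E 1) (E (-1))
  have u3 := measureReal_union_le (μ := P) (E (-I)) (E I)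
  have k1 := key 1 (by simp)
  have k2 := key (-1) (by simp)
  have k3 := key (-I) (by simp)
  have k4 := key I (by simp)
  linarith

/-- The Hanson–Wright inequality with an independent random matrix. -/
lemma GaussFam.tail_indep (h : GaussFam P ξ v) {L : Matrix J ι ℂ} (hL : covMat v L L = Φ)
    (hΦ : Φ.PosDef) (hC0 : 0 < C) (hC : ‖Φ‖ ≤ C) {E : Type} [MeasurableSpace E] {Y : Ω → E}
    (hY : Measurable Y) (hind : IndepFun (lin L ξ) Y P) {X : E → Sq J}
    (hX : ∀ i j, Measurable fun e => X e i j) (η : ℝ) :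
    P {ω | 2 * η * C * fro (X (Y ω)) < ‖qf (lin L ξ ω) (X (Y ω)) (lin L ξ ω) - (X (Y ω) * Φ).trace‖}
      ≤ ENNReal.ofReal (8 * exp (-η / 2)) := by
  set S : Set ((J → ℂ) × E) := {p | 2 * η * C * fro (X p.2) < ‖qf p.1 (X p.2) p.1 - (X p.2 * Φ).trace‖}
  have hm : ∀ i j, Measurable fun p : (J → ℂ) × E => X p.2 i j := fun i j => (hX i j).comp measurable_snd
  have hS : MeasurableSet S := by
    refine measurableSet_lt ?_ ?_
    · unfold fro
      fun_prop
    · refine Measurable.norm (Measurable.sub ?_ ?_)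
      · simp only [qf, dotProduct, mulVec, Pi.star_apply, star_def]
        fun_prop
      · simp only [trace, diag_apply, mul_apply]
        fun_prop
  have m1 := h.measurable_lin L
  have e1 := (indepFun_iff_map_prod_eq_prod_map_map m1.aemeasurable hY.aemeasurable).1 hind
  have e2 : {ω | 2 * η * C * fro (X (Y ω)) < ‖qf (lin L ξ ω) (X (Y ω)) (lin L ξ ω)
      - (X (Y ω) * Φ).trace‖} = (fun ω => (lin L ξ ω, Y ω)) ⁻¹' S := rfl
  have p2 : IsProbabilityMeasure (P.map Y) := Measure.isProbabilityMeasure_map hY.aemeasurable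
  have p1 : IsProbabilityMeasure (P.map (lin L ξ)) := Measure.isProbabilityMeasure_map m1.aemeasurable
  rw [e2, ← Measure.map_apply (m1.prodMk hY) hS, e1, Measure.prod_apply_symm hS]
  calc _ ≤ ∫⁻ _, ENNReal.ofReal (8 * exp (-η / 2)) ∂(P.map Y) := by
        refine lintegral_mono fun e => ?_
        have hs : MeasurableSet ((fun x => (x, e)) ⁻¹' S) := measurable_prodMk_right hS
        rw [Measure.map_apply m1 hs]
        have := h.tail hL hΦ hC0 hC (X e) η
        rw [← ofReal_measureReal]
        exact ENNReal.ofReal_le_ofReal this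
    _ = _ := by simp

end Tails

section EntryMeasurable

variable {E : Type} [MeasurableSpace E] {m n p : Type} [Fintype m] [DecidableEq m] [Fintype n]
  [DecidableEq n] [Fintype p] [DecidableEq p]

/-- A matrix-valued map with measurable entries. -/
def EntryMeas (f : E → Matrix m n ℂ) : Prop := ∀ i j, Measurable fun e => f e i j

lemma EntryMeas.const (A : Matrix m n ℂ) : EntryMeas fun _ : E => A := fun _ _ => measurable_const

lemma EntryMeas.mul {f : E → Matrix m n ℂ} {g : E → Matrix n p ℂ} (hf : EntryMeas f)
    (hg : EntryMeas g) : EntryMeas fun e => f e * g e := fun i j => by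
  simp only [mul_apply]
  exact Finset.measurable_sum _ fun k _ => (hf i k).mul (hg k j)

lemma EntryMeas.add {f g : E → Matrix m n ℂ} (hf : EntryMeas f) (hg : EntryMeas g) :
    EntryMeas fun e => f e + g e := fun i j => (hf i j).add (hg i j)

lemma EntryMeas.smul {f : E → Matrix m n ℂ} {c : E → ℂ} (hc : Measurable c) (hf : EntryMeas f) :
    EntryMeas fun e => c e • f e := fun i j => hc.mul (hf i j)

lemma EntryMeas.sum {ι : Type} [Fintype ι] {f : ι → E → Matrix m n ℂ} (hf : ∀ i, EntryMeas (f i)) :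
    EntryMeas fun e => ∑ i, f i e := fun a b => by
  simp only [Matrix.sum_apply]
  exact Finset.measurable_sum _ fun i _ => hf i a b

lemma EntryMeas.conjTranspose {f : E → Matrix m n ℂ} (hf : EntryMeas f) :
    EntryMeas fun e => (f e)ᴴ := fun i j => by
  simp only [conjTranspose_apply, star_def]
  have := hf j i
  fun_prop

lemma EntryMeas.mulVec {f : E → Matrix m n ℂ} {u : E → n → ℂ} (hf : EntryMeas f)
    (hu : ∀ j, Measurable fun e => u e j) (i : m) : Measurable fun e => (f e *ᵥ u e) i := by
  simp only [Matrix.mulVec, dotProduct]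
  exact Finset.measurable_sum _ fun j _ => (hf i j).mul (hu j)

lemma EntryMeas.vecMulVec {u : E → m → ℂ} {w : E → n → ℂ} (hu : ∀ i, Measurable fun e => u e i)
    (hw : ∀ j, Measurable fun e => w e j) : EntryMeas fun e => vecMulVec (u e) (star (w e)) :=
  fun i j => by
    simp only [vecMulVec_apply, Pi.star_apply, star_def]
    have h1 := hu i
    have h2 := hw j
    fun_prop

lemma EntryMeas.trace {f : E → Sq m} (hf : EntryMeas f) : Measurable fun e => (f e).trace := by
  simp only [Matrix.trace, diag_apply]
  exact Finset.measurable_sum _ fun j _ => hf j j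

lemma EntryMeas.det {f : E → Sq m} (hf : EntryMeas f) : Measurable fun e => (f e).det := by
  simp only [det_apply']
  exact Finset.measurable_sum _ fun σ _ =>
    (Finset.measurable_prod _ fun i _ => hf (σ i) i).const_mul _

lemma EntryMeas.inv {f : E → Sq m} (hf : EntryMeas f) : EntryMeas fun e => (f e)⁻¹ :=
  fun i j => by
    simp only [inv_def, Ring.inverse_eq_inv', Matrix.smul_apply, smul_eq_mul, adjugate_apply]
    refine hf.det.inv.mul (EntryMeas.det fun a b => ?_)
    simp only [updateRow_apply]
    split_ifs
    · exact measurable_const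
    · exact hf a b

end EntryMeasurable

namespace Net

variable {K : ℕ} {T : Net K} {E : Type} [MeasurableSpace E] {y : E → T.Est}

lemma entryMeas_res (hy : ∀ i a, Measurable fun e => y e i a) (k : Fin K) :
    EntryMeas fun e => T.res (y e) k := by
  refine EntryMeas.inv (EntryMeas.add (.const _) (EntryMeas.smul measurable_const
    (EntryMeas.sum fun i => EntryMeas.vecMulVec (fun a => ?_) fun a => ?_))) <;>
  exact hy _ _

lemma entryMeas_thHat (hy : ∀ i a, Measurable fun e => y e i a) (k : Fin K) :
    EntryMeas fun e => T.thHat (y e) k := by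
  have hd : ∀ i, Measurable fun e => dhat (T.Zr k) (T.om k) (T.cl (y e) k) i := fun i =>
    Complex.measurable_re.comp ((((EntryMeas.const _).mul (entryMeas_res hy k)).trace).const_mul _)
  refine EntryMeas.inv (EntryMeas.add (.const _) (EntryMeas.smul measurable_const
    (EntryMeas.sum fun i => EntryMeas.smul ?_ (.const _))))
  exact ((Complex.measurable_ofReal.comp (hd i)).const_add _).inv

lemma entryMeas_letter (hy : ∀ i a, Measurable fun e => y e i a) (c : T.Letter) :
    EntryMeas fun e => T.letter (y e) c := by
  have hem : ∀ {k : Fin K} {f : E → Sq (Fin (T.d k))}, EntryMeas f →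
      EntryMeas fun e => (em k k (f e) : T.Mat) := fun hf =>
    ((EntryMeas.const (sel T.d _)ᴴ).mul hf).mul (.const (sel T.d _))
  obtain ⟨a, k, i⟩ := c
  fin_cases a
  · exact hem (entryMeas_res hy k)
  · exact .const _
  · exact hem (entryMeas_thHat hy k)
  · exact EntryMeas.vecMulVec (hy i) (hy i)
  · exact EntryMeas.sum fun j : Fin T.M => EntryMeas.vecMulVec
      (EntryMeas.mulVec (.const (T.V j.succ)) (hy _)) (EntryMeas.mulVec (.const (T.V j.succ)) (hy _))
  · exact .const _
  · exact .const _
  · exact .const _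
  · exact .const _

lemma entryMeas_word (hy : ∀ i a, Measurable fun e => y e i a) (L : List T.Letter) :
    EntryMeas fun e => T.word (y e) L := by
  induction L with
  | nil => exact .const _
  | cons c L ih =>
    simp only [word_cons]
    exact (entryMeas_letter hy c).mul ih

/-- A union bound for the concentration of all quadratic forms. -/
lemma measure_not_conc_le {Ω : Type*} [MeasurableSpace Ω] (P : Measure Ω)
    (Y : Ω → T.Est) (η : ℝ) {b : ENNReal}
    (hb : ∀ (j : Fin (T.M + 1)) (L : List T.Letter),
      P {ω | η * fro (T.word (update (Y ω) j 0) L) < ‖qf (Y ω j)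
        (T.word (update (Y ω) j 0) L) (Y ω j)
        - (T.word (update (Y ω) j 0) L * T.Phi j).trace‖} ≤ b) :
    P {ω | ¬ T.Conc η (Y ω)} ≤ (T.M + 1 : ℕ) * (∑ m : Fin 13, (9 * (K * (T.M + 1))) ^ (m : ℕ) : ℕ) * b := by
  set bad : Fin (T.M + 1) → List T.Letter → Set Ω := fun j L =>
    {ω | η * fro (T.word (update (Y ω) j 0) L) < ‖qf (Y ω j)
        (T.word (update (Y ω) j 0) L) (Y ω j)
        - (T.word (update (Y ω) j 0) L * T.Phi j).trace‖}
  have hsub : {ω | ¬ T.Conc η (Y ω)} ⊆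
      ⋃ j, ⋃ m : Fin 13, ⋃ f : Fin m → T.Letter, bad j (List.ofFn f) := by
    intro ω hω
    simp only [Set.mem_ofPred_eq, Conc, not_forall, not_le] at hω
    obtain ⟨j, L, hL, h⟩ := hω
    simp only [Set.mem_iUnion]
    refine ⟨j, ⟨L.length, by omega⟩, L.get, ?_⟩
    rw [List.ofFn_get]
    exact h
  refine (measure_mono hsub).trans ((measure_iUnion_fintype_le _ _).trans ?_)
  calc _ ≤ ∑ _j : Fin (T.M + 1), ∑ m : Fin 13, ∑ _f : Fin m → T.Letter, b := by
        refine sum_le_sum fun j _ => (measure_iUnion_fintype_le _ _).trans ?_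
        refine sum_le_sum fun m _ => (measure_iUnion_fintype_le _ _).trans ?_
        exact sum_le_sum fun f _ => hb j _
    _ = _ := by
        simp only [Finset.sum_const, Finset.card_univ, Fintype.card_fun, Fintype.card_prod,
          card_fin, nsmul_eq_mul]
        rw [← Finset.sum_mul]
        push_cast
        ring

end Net

section System

variable {K : ℕ} {S : System K} {Ω : Type*} [MeasurableSpace Ω] {P : Measure Ω}
  [IsProbabilityMeasure P] {C : ℝ}

/-- The index set of all Gaussian variables of a system. -/
abbrev System.Idx (S : System K) : Type :=
  (Fin (S.M + 1) × Ant S.d) ⊕ ((Fin (S.M + 1) × Ant S.d) ⊕ (Fin (S.M + 1) ⊕ Ant S.d))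

/-- The variances of the Gaussian variables of a system. -/
def System.var (S : System K) : S.Idx → ℝ :=
  Sum.elim (fun _ => 1) (Sum.elim (fun _ => S.tauSq) (Sum.elim (fun _ => 1) fun _ => S.sigSq))

/-- The Gaussian variables of a system. -/
def Randomness.fam (X : Randomness S P) : S.Idx → Ω → ℂ :=
  Sum.elim (fun p => X.z p.1 p.2) (Sum.elim (fun p => X.pilotNoise p.1 p.2) (Sum.elim X.x X.noise))

lemma Randomness.gaussFam (X : Randomness S P) : GaussFam P X.fam S.var where
  meas := by
    rintro (p | p | j | a)
    exacts [X.meas_z _ _, X.meas_pilotNoise _ _, X.meas_x _, X.meas_noise _]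
  nonneg := by
    rintro (p | p | j | a)
    exacts [zero_le_one, S.tauSq_nonneg, zero_le_one, S.sigSq_pos.le]
  law := by
    rintro (p | p | j | a)
    exacts [X.law_z _ _, X.law_pilotNoise _ _, X.law_x _, X.law_noise _]
  indep := X.indep

/-- The map `(z, ñ) ↦ (A_j z_j + B_j ñ_j)_j`. -/
def System.userMap (S : System K) (A B : Fin (S.M + 1) → S.Mat) :
    Matrix (Fin (S.M + 1) × Ant S.d) S.Idx ℂ :=
  of fun p => Sum.elim (fun q => if p.1 = q.1 then A p.1 p.2 q.2 else 0)
    (Sum.elim (fun q => if p.1 = q.1 then B p.1 p.2 q.2 else 0) 0)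

lemma cov_apply {ι J J' : Type} [Fintype ι] [DecidableEq ι] [Fintype J] [Fintype J'] [DecidableEq J]
    [DecidableEq J'] (v : ι → ℝ) (L : Matrix J ι ℂ) (L' : Matrix J' ι ℂ) (p : J) (q : J') :
    covMat v L L' p q = ∑ i, L p i * v i * star (L' q i) := by
  simp only [covMat, mul_apply (N := L'ᴴ), Matrix.mul_diagonal, conjTranspose_apply]

lemma cov_userMap (A B A' B' : Fin (S.M + 1) → S.Mat)
    (p q : Fin (S.M + 1) × Ant S.d) :
    covMat S.var (S.userMap A B) (S.userMap A' B') p q = if p.1 = q.1 then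
      (A p.1 * (A' p.1)ᴴ + (S.tauSq : ℂ) • (B p.1 * (B' p.1)ᴴ)) p.2 q.2 else 0 := by
  rw [cov_apply, sum_sum_type, sum_sum_type, sum_prod_type,
    sum_prod_type]
  simp only [System.userMap, System.var, of_apply, Sum.elim_inl, Sum.elim_inr, Pi.zero_apply,
    zero_mul, Finset.sum_const_zero, add_zero]
  obtain ⟨j, a⟩ := p
  obtain ⟨j', a'⟩ := q
  have e : ∀ (A A' : Fin (S.M + 1) → S.Mat) (t : ℝ),
      ∑ x, ∑ y, (if j = x then A j a y else 0) * (t : ℂ) * star (if j' = x then A' j' a' y else 0)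
        = if j = j' then (t : ℂ) * (A j * (A' j)ᴴ) a a' else 0 := fun A A' t => by
    rw [sum_eq_single j]
    · by_cases h : j = j'
      · subst h
        simp only [if_true, mul_apply, Finset.mul_sum, conjTranspose_apply]
        exact sum_congr rfl fun y _ => by ring
      · simp [h, Ne.symm h]
    · intro x _ hx
      simp [Ne.symm hx]
    · simp
  rw [e, e]
  split_ifs <;> simp

lemma lin_userMap (X : Randomness S P) (A B : Fin (S.M + 1) → S.Mat) (ω : Ω)
    (j : Fin (S.M + 1)) : (fun a => lin (S.userMap A B) X.fam ω (j, a))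
      = A j *ᵥ (fun a => X.z j a ω) + B j *ᵥ fun a => X.pilotNoise j a ω := by
  funext a
  rw [lin, mulVec, dotProduct, sum_sum_type, sum_sum_type, sum_prod_type,
    sum_prod_type]
  simp [System.userMap, Randomness.fam, mulVec, dotProduct, Finset.sum_ite_irrel]

lemma SysReg.hHat_eq (h : SysReg C S) (X : Randomness S P) (j : Fin (S.M + 1)) (ω : Ω) :
    X.hHat j ω = S.DT j *ᵥ (X.h j ω + fun a => X.pilotNoise j a ω) := by
  have : ∀ k, restr (X.hHat j ω) k = restr (S.DT j *ᵥ (X.h j ω + fun a => X.pilotNoise j a ω)) k :=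
    fun k => by
      rw [h.DT_eq, restr_blockDiagonal'_mulVec, wien, add_comm ((S.tauSq : ℂ) • _)]
      rfl
  funext ⟨k, i⟩
  exact congrFun (this k) i

/-- The linear map that produces the channel estimates. -/
def System.estMap (S : System K) : Matrix (Fin (S.M + 1) × Ant S.d) S.Idx ℂ :=
  S.userMap (fun j => S.DT j * psdSqrt (S.R j)) S.DT

lemma SysReg.lin_estMap (h : SysReg C S) (X : Randomness S P) (ω : Ω) (j : Fin (S.M + 1)) :
    (fun a => lin S.estMap X.fam ω (j, a)) = X.hHat j ω := by
  rw [System.estMap, lin_userMap, h.hHat_eq, mulVec_add, ← mulVec_mulVec]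
  rfl

lemma SysReg.cov_estMap (h : SysReg C S) (p q : Fin (S.M + 1) × Ant S.d) :
    covMat S.var S.estMap S.estMap p q = if p.1 = q.1 then S.Phi p.1 p.2 q.2 else 0 := by
  rw [System.estMap, cov_userMap]
  congr 2
  rw [conjTranspose_mul, h.DT_herm, Matrix.mul_assoc, ← Matrix.mul_assoc (psdSqrt _),
    psdSqrt_mul_conjTranspose (S.R_psd _), System.Phi, Matrix.mul_add, Matrix.add_mul,
    Matrix.mul_smul, Matrix.smul_mul, Matrix.mul_one, add_comm, Matrix.mul_assoc]

lemma SysReg.Phi_posDef (h : SysReg C S) (j : Fin (S.M + 1)) : (S.Phi j).PosDef :=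
  posDef_of_smul_one_le (by have := h.pos; positivity) (h.Phi_ge j)

lemma SysReg.measure_bad_le (h : SysReg C S) (X : Randomness S P)
    (V : Fin (S.M + 1) → S.Mat) (W : S.Mat)
    (δ : Fin S.M → Fin K → ℝ) (η : ℝ) (j : Fin (S.M + 1)) (L : List (S.net V W δ).Letter) :
    P {ω | η * fro ((S.net V W δ).word (update (fun i => X.hHat i ω) j 0) L) <
        ‖qf (X.hHat j ω) ((S.net V W δ).word (update (fun i => X.hHat i ω) j 0) L)
          (X.hHat j ω) - ((S.net V W δ).word (update (fun i => X.hHat i ω) j 0) L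
            * (S.net V W δ).Phi j).trace‖} ≤ ENNReal.ofReal (8 * exp (-(η / (4 * C ^ 5)) / 2)) := by
  have hC := h.pos
  set Lj : Matrix (Ant S.d) S.Idx ℂ := S.estMap.submatrix (fun a => (j, a)) id
  set Lr : Matrix (Fin (S.M + 1) × Ant S.d) S.Idx ℂ :=
    of fun p i => if p.1 = j then 0 else S.estMap p i
  have c1 : covMat S.var Lj Lj = S.Phi j := by
    ext a b
    have := h.cov_estMap (j, a) (j, b)
    rw [if_pos rfl, cov_apply] at this
    rw [cov_apply]
    exact this
  have c2 : covMat S.var Lj Lr = 0 := by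
    ext a q
    rw [cov_apply]
    by_cases hq : q.1 = j
    · simp [Lr, hq]
    · have := h.cov_estMap (j, a) q
      rw [if_neg (Ne.symm hq), cov_apply] at this
      simp only [Lr, of_apply, if_neg hq]
      exact this
  have e1 : ∀ ω, X.hHat j ω = lin Lj X.fam ω := fun ω => (h.lin_estMap X ω j).symm
  have e2 : ∀ ω, update (fun i => X.hHat i ω) j 0
      = fun i a => lin Lr X.fam ω (i, a) := fun ω => by
    funext i
    by_cases hi : i = j
    · subst hi
      funext a
      simp [lin, Lr, mulVec, dotProduct]
    · rw [Function.update_of_ne hi, ← h.lin_estMap X ω i]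
      funext a
      simp [lin, Lr, mulVec, dotProduct, hi]
  have hX : EntryMeas fun e : Fin (S.M + 1) × Ant S.d → ℂ =>
      (S.net V W δ).word (fun i a => e (i, a)) L :=
    Net.entryMeas_word (fun i a => measurable_pi_apply (i, a)) L
  have := X.gaussFam.tail_indep c1 (h.Phi_posDef j) (C := 2 * C ^ 5) (by positivity) (h.norm_Phi j)
    (X.gaussFam.measurable_lin Lr) (X.gaussFam.indepFun c2) hX (η / (4 * C ^ 5))
  have e3 : 2 * (η / (4 * C ^ 5)) * (2 * C ^ 5) = η := by field_simp; ring
  rw [e3] at this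
  let Q : (Ant S.d → ℂ) → S.Est → Prop := fun u y =>
    η * fro ((S.net V W δ).word y L) < ‖qf u ((S.net V W δ).word y L) u
      - ((S.net V W δ).word y L * (S.net V W δ).Phi j).trace‖
  change P {ω | Q (X.hHat j ω) (update (fun i => X.hHat i ω) j 0)} ≤ _
  simp_rw [e2, e1]
  exact this

lemma exists_exp_neg_le : ∃ Q : ℝ, 0 < Q ∧ ∀ u : ℝ, 0 < u → exp (-u) ≤ Q / u ^ 60 := by
  refine ⟨Nat.factorial 60, Nat.cast_pos.2 (Nat.factorial_pos _), fun u hu => ?_⟩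
  have := Real.pow_div_factorial_le_exp u hu.le 60
  rw [Real.exp_neg, inv_le_comm₀ (Real.exp_pos _)
    (div_pos (Nat.cast_pos.2 (Nat.factorial_pos _)) (pow_pos hu _)), inv_div]
  exact this

lemma natCast_mul_ofReal (a b : ℕ) (r : ℝ) :
    (a : ENNReal) * (b : ENNReal) * ENNReal.ofReal r = ENNReal.ofReal ((a : ℝ) * b * r) := by
  rw [ENNReal.ofReal_mul (mul_nonneg a.cast_nonneg b.cast_nonneg),
    ENNReal.ofReal_mul a.cast_nonneg, ENNReal.ofReal_natCast, ENNReal.ofReal_natCast]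

/-- The failure probability of the concentration event. -/
lemma SysReg.measure_not_conc_le (hC : 1 ≤ C) : ∃ D : ℝ, ∀ {S : System K} (_ : SysReg C S)
    (X : Randomness S P) (V : Fin (S.M + 1) → S.Mat)
    (W : S.Mat) (δ : Fin S.M → Fin K → ℝ) (x : ℝ), 0 < x → x ^ 8 = S.N →
    Fin K → P {ω | ¬ (S.net V W δ).Conc (x ^ 2) fun i => X.hHat i ω} ≤ ENNReal.ofReal (D / S.N ^ 2) := by
  obtain ⟨Q, hQ0, hQ⟩ := exists_exp_neg_le
  refine ⟨13 * (2 * C) ^ 13 * (9 * K) ^ 12 * (8 * (Q * (8 * C ^ 5) ^ 60)), ?_⟩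
  intro S h X V W δ x hx hxN k
  have h1 := Net.measure_not_conc_le P (T := S.net V W δ) (fun ω i => X.hHat i ω) (x ^ 2)
    fun j L => h.measure_bad_le X V W δ (x ^ 2) j L
  refine h1.trans ?_
  have hNpos : (0 : ℝ) < S.N := by rw [← hxN]; positivity
  have hN1 : (1 : ℝ) ≤ S.N := by exact_mod_cast (by exact_mod_cast hNpos : 0 < S.N)
  have hM : ((S.M + 1 : ℕ) : ℝ) ≤ 2 * C * S.N := by
    have e1 := h.M_le k
    have e2 : (S.d k : ℝ) ≤ S.N := by
      exact_mod_cast single_le_sum (f := S.d) (fun _ _ => Nat.zero_le _) (mem_univ k)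
    push_cast
    nlinarith
  have hb : 8 * exp (-(x ^ 2 / (4 * C ^ 5)) / 2)
      ≤ 8 * (Q * (8 * C ^ 5) ^ 60) / S.N ^ 15 := by
    have e0 : (0 : ℝ) < x ^ 2 / (8 * C ^ 5) := by positivity
    have e1 : -(x ^ 2 / (4 * C ^ 5)) / 2 = -(x ^ 2 / (8 * C ^ 5)) := by field_simp; norm_num
    have e2 := hQ _ e0
    have e3 : (x ^ 2 / (8 * C ^ 5)) ^ 60 = (S.N : ℝ) ^ 15 / (8 * C ^ 5) ^ 60 := by
      rw [← hxN, div_pow, ← pow_mul, ← pow_mul]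
    rw [e1, mul_div_assoc]
    refine mul_le_mul_of_nonneg_left (e2.trans_eq ?_) (by norm_num)
    rw [e3, div_div_eq_mul_div]
  have hs : ((∑ m : Fin 13, (9 * (K * (S.M + 1))) ^ (m : ℕ) : ℕ) : ℝ)
      ≤ 13 * ((9 * K) ^ 12 * (2 * C * S.N) ^ 12) := by
    have hl : 1 ≤ 9 * (K * (S.M + 1)) := by
      have : 0 < K := k.pos
      nlinarith [Nat.zero_le S.M, Nat.zero_le (K * S.M)]
    have e1 : (∑ m : Fin 13, (9 * (K * (S.M + 1))) ^ (m : ℕ) : ℕ) ≤ 13 * (9 * (K * (S.M + 1))) ^ 12 := by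
      refine (Finset.sum_le_card_nsmul _ _ ((9 * (K * (S.M + 1))) ^ 12) fun m _ =>
        Nat.pow_le_pow_right hl (by omega)).trans_eq (by simp)
    have e2 : ((13 * (9 * (K * (S.M + 1))) ^ 12 : ℕ) : ℝ)
        = 13 * ((9 * K) ^ 12 * ((S.M + 1 : ℕ) : ℝ) ^ 12) := by push_cast; ring
    refine (Nat.cast_le.2 e1).trans (e2.trans_le ?_)
    gcongr
  refine (natCast_mul_ofReal _ _ _).trans_le ?_
  refine ENNReal.ofReal_le_ofReal ?_
  calc _ ≤ (2 * C * S.N) * (13 * ((9 * K) ^ 12 * (2 * C * S.N) ^ 12)) *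
        (8 * (Q * (8 * C ^ 5) ^ 60) / S.N ^ 15) := by
        refine mul_le_mul (mul_le_mul hM hs (by positivity) (by positivity)) hb (by positivity)
          (by positivity)
    _ = _ := by field_simp

end System

section AlmostSure

variable {K : ℕ} {Ω : Type*} [MeasurableSpace Ω] {P : Measure Ω} [IsProbabilityMeasure P] {C : ℝ}

/-- Almost surely all quadratic forms concentrate for all large systems. -/
lemma ae_eventually_conc (k : Fin K) {S : ℕ → System K} (X : (n : ℕ) → Randomness (S n) P)
    (hN : StrictMono fun n => (S n).N) (hC : 1 ≤ C) (hS : ∀ᶠ n in atTop, SysReg C (S n))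
    (V : (n : ℕ) → Fin ((S n).M + 1) → Sq (Ant (S n).d))
    (W : (n : ℕ) → Sq (Ant (S n).d)) (δ : (n : ℕ) → Fin (S n).M → Fin K → ℝ) :
    ∀ᵐ ω ∂P, ∀ᶠ n in atTop, ((S n).net (V n) (W n) (δ n)).Conc
      ((((S n).N : ℝ) ^ (1 / 8 : ℝ)) ^ 2) fun i => (X n).hHat i ω := by
  obtain ⟨D, hD⟩ := SysReg.measure_not_conc_le (K := K) (P := P) hC
  obtain ⟨n₀, hn₀⟩ := eventually_atTop.1 hS
  set s : ℕ → Set Ω := fun n => if n₀ < n then {ω | ¬ ((S n).net (V n) (W n) (δ n)).Conc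
      ((((S n).N : ℝ) ^ (1 / 8 : ℝ)) ^ 2) fun i => (X n).hHat i ω} else ∅
  have hs : ∀ n, P (s n) ≤ ENNReal.ofReal (|D| * (1 / (n : ℝ) ^ 2)) := fun n => by
    by_cases hn : n₀ < n
    · simp only [s, if_pos hn]
      have hNn : n ≤ (S n).N := hN.le_apply
      have hn1 : 0 < n := by omega
      have hNpos : (0 : ℝ) < (S n).N := by exact_mod_cast hn1.trans_le hNn
      refine (hD (hn₀ n hn.le) (X n) (V n) (W n) (δ n) _ (Real.rpow_pos_of_pos hNpos _) ?_ k).trans ?_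
      · rw [← Real.rpow_natCast, ← Real.rpow_mul hNpos.le]
        norm_num
      · refine ENNReal.ofReal_le_ofReal ?_
        have h1 : (0 : ℝ) < n := by exact_mod_cast hn1
        have h2 : (n : ℝ) ≤ (S n).N := by exact_mod_cast hNn
        rw [mul_one_div]
        calc D / ((S n).N : ℝ) ^ 2 ≤ |D| / ((S n).N : ℝ) ^ 2 := by gcongr; exact le_abs_self D
          _ ≤ _ := by gcongr
    · simp [s, if_neg hn]
  have hsum : ∑' n, P (s n) ≠ ⊤ := by
    have h2 : Summable fun n : ℕ => |D| * (1 / (n : ℝ) ^ 2) :=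
      (Real.summable_one_div_nat_pow.2 (by norm_num)).mul_left _
    exact ne_top_of_le_ne_top h2.tsum_ofReal_ne_top (ENNReal.tsum_le_tsum hs)
  filter_upwards [ae_eventually_notMem hsum] with ω hω
  filter_upwards [hω, eventually_gt_atTop n₀] with n hn hn'
  simpa [s, if_pos hn'] using hn

end AlmostSure

section Moments

lemma measurePreserving_re (v : ℝ) :
    MeasurePreserving Complex.re (complexGaussian v) (gaussianReal 0 (v / 2).toNNReal) :=
  ⟨Complex.measurable_re, by
    rw [complexGaussian, Measure.map_map Complex.measurable_re
      Complex.measurableEquivRealProd.symm.measurable]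
    exact measurePreserving_fst.map_eq⟩

lemma measurePreserving_im (v : ℝ) :
    MeasurePreserving Complex.im (complexGaussian v) (gaussianReal 0 (v / 2).toNNReal) :=
  ⟨Complex.measurable_im, by
    rw [complexGaussian, Measure.map_map Complex.measurable_im
      Complex.measurableEquivRealProd.symm.measurable]
    exact measurePreserving_snd.map_eq⟩

lemma memLp_complexGaussian (v : ℝ) : MemLp (fun z : ℂ => z) 2 (complexGaussian v) :=
  memLp_re_im_iff.1 ⟨(memLp_id_gaussianReal 2).comp_measurePreserving (measurePreserving_re v),
    (memLp_id_gaussianReal 2).comp_measurePreserving (measurePreserving_im v)⟩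

lemma integral_id_complexGaussian (v : ℝ) : ∫ z, z ∂complexGaussian v = 0 := by
  have hi : Integrable (fun z : ℂ => z) (complexGaussian v) :=
    (memLp_complexGaussian v).integrable (by norm_num)
  have h1 : ∫ z : ℂ, z.re ∂complexGaussian v = 0 := by
    have := integral_map (μ := complexGaussian v) Complex.measurable_re.aemeasurable
      (f := fun x : ℝ => x) (by fun_prop)
    rw [(measurePreserving_re v).map_eq, integral_id_gaussianReal] at this
    exact this.symm
  have h2 : ∫ z : ℂ, z.im ∂complexGaussian v = 0 := by
    have := integral_map (μ := complexGaussian v) Complex.measurable_im.aemeasurable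
      (f := fun x : ℝ => x) (by fun_prop)
    rw [(measurePreserving_im v).map_eq, integral_id_gaussianReal] at this
    exact this.symm
  rw [← integral_re_add_im hi]
  simp [h1, h2]

lemma integral_sq_gaussianReal (v : NNReal) : ∫ x, x ^ 2 ∂gaussianReal 0 v = v := by
  have h := variance_of_integral_eq_zero (X := id) (μ := gaussianReal 0 v) aemeasurable_id
    integral_id_gaussianReal
  rw [variance_id_gaussianReal] at h
  exact h.symm

lemma integral_mul_star_complexGaussian {v : ℝ} (hv : 0 ≤ v) :
    ∫ z, z * star z ∂complexGaussian v = v := by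
  have hre : Integrable (fun z : ℂ => z.re ^ 2) (complexGaussian v) :=
    ((memLp_id_gaussianReal 2).comp_measurePreserving (measurePreserving_re v)).integrable_sq
  have him : Integrable (fun z : ℂ => z.im ^ 2) (complexGaussian v) :=
    ((memLp_id_gaussianReal 2).comp_measurePreserving (measurePreserving_im v)).integrable_sq
  have h1 : ∫ z : ℂ, z.re ^ 2 ∂complexGaussian v = v / 2 := by
    have := integral_map (μ := complexGaussian v) Complex.measurable_re.aemeasurable
      (f := fun x : ℝ => x ^ 2) (by fun_prop)
    rw [(measurePreserving_re v).map_eq, integral_sq_gaussianReal,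
      Real.coe_toNNReal _ (by linarith)] at this
    exact this.symm
  have h2 : ∫ z : ℂ, z.im ^ 2 ∂complexGaussian v = v / 2 := by
    have := integral_map (μ := complexGaussian v) Complex.measurable_im.aemeasurable
      (f := fun x : ℝ => x ^ 2) (by fun_prop)
    rw [(measurePreserving_im v).map_eq, integral_sq_gaussianReal,
      Real.coe_toNNReal _ (by linarith)] at this
    exact this.symm
  have e : ∀ z : ℂ, z * star z = ((z.re ^ 2 + z.im ^ 2 : ℝ) : ℂ) := fun z => by
    rw [star_def, Complex.mul_conj, Complex.normSq_apply]
    ring_nf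
  simp_rw [e]
  rw [integral_complex_ofReal, integral_add hre him, h1, h2]
  norm_num

variable {Ω : Type*} [MeasurableSpace Ω] {P : Measure Ω} [IsProbabilityMeasure P]
  {ι : Type} [Fintype ι] [DecidableEq ι] {J J' : Type} [Fintype J] [DecidableEq J]
  [Fintype J'] [DecidableEq J'] {ξ : ι → Ω → ℂ} {v : ι → ℝ}

lemma GaussFam.memLp (h : GaussFam P ξ v) (i : ι) : MemLp (ξ i) 2 P := by
  have := memLp_complexGaussian (v i)
  rw [← h.law i, memLp_map_measure_iff (by fun_prop) (h.meas i).aemeasurable] at this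
  exact this

lemma GaussFam.integral_eq_zero (h : GaussFam P ξ v) (i : ι) : ∫ ω, ξ i ω ∂P = 0 := by
  rw [← integral_id_complexGaussian (v i), ← h.law i,
    integral_map (h.meas i).aemeasurable (by fun_prop)]

lemma GaussFam.integrable_mul_star (h : GaussFam P ξ v) (i j : ι) :
    Integrable (fun ω => ξ i ω * star (ξ j ω)) P :=
  (h.memLp i).integrable_mul (h.memLp j).star

lemma GaussFam.integral_mul_star (h : GaussFam P ξ v) (i j : ι) :
    ∫ ω, ξ i ω * star (ξ j ω) ∂P = if i = j then (v i : ℂ) else 0 := by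
  split_ifs with hij
  · subst hij
    rw [← integral_mul_star_complexGaussian (h.nonneg i), ← h.law i,
      integral_map (h.meas i).aemeasurable (by
        exact (measurable_id.mul Complex.continuous_conj.measurable).aestronglyMeasurable)]
  · have h1 : IndepFun (ξ i) (fun ω => star (ξ j ω)) P :=
      (h.indep.indepFun hij).comp measurable_id Complex.continuous_conj.measurable
    rw [h1.integral_fun_mul_eq_mul_integral (h.memLp i).1 (h.memLp j).star.1, h.integral_eq_zero,
      zero_mul]

lemma GaussFam.memLp_lin (h : GaussFam P ξ v) (L : Matrix J ι ℂ) (p : J) :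
    MemLp (fun ω => lin L ξ ω p) 2 P := by
  simp only [lin, mulVec, dotProduct]
  exact memLp_finsetSum _ fun i _ => (h.memLp i).const_mul _

lemma GaussFam.integral_lin (h : GaussFam P ξ v) (L : Matrix J ι ℂ) (p : J) :
    ∫ ω, lin L ξ ω p ∂P = 0 := by
  simp only [lin, mulVec, dotProduct]
  rw [integral_finsetSum _ fun i _ => ((h.memLp i).integrable (by norm_num)).const_mul _]
  simp [integral_const_mul, h.integral_eq_zero]

lemma GaussFam.integral_lin_mul_star (h : GaussFam P ξ v) (L : Matrix J ι ℂ) (L' : Matrix J' ι ℂ)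
    (p : J) (q : J') : ∫ ω, lin L ξ ω p * star (lin L' ξ ω q) ∂P = covMat v L L' p q := by
  have e : ∀ ω, lin L ξ ω p * star (lin L' ξ ω q)
      = ∑ i, ∑ j, (L p i * star (L' q j)) * (ξ i ω * star (ξ j ω)) := fun ω => by
    simp only [lin, mulVec, dotProduct, star_sum, Finset.sum_mul_sum, star_mul']
    exact sum_congr rfl fun i _ => sum_congr rfl fun j _ => by ring
  simp_rw [e]
  rw [integral_finsetSum _ fun i _ => integrable_finsetSum _ fun j _ =>
    (h.integrable_mul_star i j).const_mul _, cov_apply]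
  refine sum_congr rfl fun i _ => ?_
  rw [integral_finsetSum _ fun j _ => (h.integrable_mul_star i j).const_mul _]
  simp_rw [integral_const_mul, h.integral_mul_star]
  simp
  ring

end Moments

section ConditionalExpectation

variable {Ω E : Type*} {m mΩ : MeasurableSpace Ω} [MeasurableSpace E] {P : Measure Ω}
  [IsProbabilityMeasure P] {Z : Ω → E}

lemma condExp_mul_indep (hm : m ≤ mΩ) (hZ : Measurable Z)
    (hind : Indep (MeasurableSpace.comap Z inferInstance) m P) {f : Ω → ℂ}
    (hf : StronglyMeasurable[m] f) (hfi : Integrable f P) {γ : E → ℂ} (hγ : Measurable γ)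
    (hg : Integrable (fun ω => γ (Z ω)) P) :
    Integrable (fun ω => f ω * γ (Z ω)) P ∧
    P[fun ω => f ω * γ (Z ω) | m] =ᵐ[P] fun ω => f ω * ∫ ω', γ (Z ω') ∂P := by
  have hgm : Measurable[MeasurableSpace.comap Z inferInstance] fun ω => γ (Z ω) :=
    hγ.comp (comap_measurable Z)
  have h1 : IndepFun f (fun ω => γ (Z ω)) P := by
    rw [IndepFun_iff_Indep]
    exact indep_of_indep_of_le_right (indep_of_indep_of_le_left hind.symm hf.measurable.comap_le)
      hgm.comap_le
  have hi : Integrable (fun ω => f ω * γ (Z ω)) P := h1.integrable_mul hfi hg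
  refine ⟨hi, ?_⟩
  have h2 := condExp_bilin_of_stronglyMeasurable_left (ContinuousLinearMap.mul ℝ ℂ) hf hi hg
  have h3 := condExp_indep_eq (μ := P) hZ.comap_le hm hgm.stronglyMeasurable hind
  filter_upwards [h2, h3] with ω h2 h3
  rw [h3] at h2
  exact h2

/-- Conditional second moment of a sum of products of measurable and of independent factors. -/
lemma condExp_norm_sq_sum {T : Type*} [Fintype T] (hm : m ≤ mΩ) (hZ : Measurable Z)
    (hind : Indep (MeasurableSpace.comap Z inferInstance) m P) {f : T → Ω → ℂ}
    (hf : ∀ t, StronglyMeasurable[m] (f t)) (hf2 : ∀ t, MemLp (f t) 2 P) {γ : T → E → ℂ}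
    (hγ : ∀ t, Measurable (γ t))
    (hg : ∀ t t', Integrable (fun ω => γ t (Z ω) * star (γ t' (Z ω))) P) :
    P[fun ω => ‖∑ t, f t ω * γ t (Z ω)‖ ^ 2 | m] =ᵐ[P] fun ω =>
      (∑ t, ∑ t', f t ω * star (f t' ω) * ∫ ω', γ t (Z ω') * star (γ t' (Z ω')) ∂P).re := by
  have key : ∀ p : T × T, _ := fun p => condExp_mul_indep hm hZ hind
    (f := fun ω => f p.1 ω * star (f p.2 ω))
    ((hf p.1).mul (continuous_star.comp_stronglyMeasurable (hf p.2)))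
    ((hf2 p.1).integrable_mul (hf2 p.2).star) (γ := fun e => γ p.1 e * star (γ p.2 e))
    ((hγ p.1).mul (Complex.continuous_conj.measurable.comp (hγ p.2))) (hg p.1 p.2)
  set F : T × T → Ω → ℂ := fun p ω =>
    (f p.1 ω * star (f p.2 ω)) * (γ p.1 (Z ω) * star (γ p.2 (Z ω)))
  have e : (fun ω => ‖∑ t, f t ω * γ t (Z ω)‖ ^ 2) = Complex.reCLM ∘ (∑ p, F p) := by
    funext ω
    have h1 : (∑ p, F p) ω = (∑ t, f t ω * γ t (Z ω)) * star (∑ t, f t ω * γ t (Z ω)) := by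
      rw [star_sum, Finset.sum_mul_sum, Finset.sum_apply, sum_prod_type]
      refine sum_congr rfl fun t _ => sum_congr rfl fun t' _ => ?_
      simp only [F, star_mul']
      ring
    rw [Function.comp_apply, h1, star_def, Complex.mul_conj', ← Complex.ofReal_pow]
    exact (ofReal_re _).symm
  have hint : Integrable (∑ p, F p) P := integrable_finsetSum' _ fun p _ => (key p).1
  rw [e]
  have h1 := Complex.reCLM.comp_condExp_comm (m := m) hint
  have h2 := condExp_finsetSum (s := Finset.univ) (fun p _ => (key p).1) m
  filter_upwards [h1, h2, ae_all_iff.2 fun p => (key p).2] with ω h1 h2 h3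
  rw [← h1, Function.comp_apply]
  have h4 : (P[∑ p, F p | m]) ω = ∑ t, ∑ t', f t ω * star (f t' ω) *
      ∫ ω', γ t (Z ω') * star (γ t' (Z ω')) ∂P := by
    refine h2.trans ?_
    rw [Finset.sum_apply, ← Fintype.sum_prod_type']
    exact sum_congr rfl fun p _ => h3 p
  rw [h4]
  rfl

end ConditionalExpectation

section ErrorModel

variable {K : ℕ} {S : System K} {Ω : Type*} [MeasurableSpace Ω] {P : Measure Ω}
  [IsProbabilityMeasure P] {C : ℝ}

/-- The linear map that produces the estimation errors `h_j - h̃_j`. -/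
def System.errMap (S : System K) : Matrix (Fin (S.M + 1) × Ant S.d) S.Idx ℂ :=
  S.userMap (fun j => (1 - S.T j) * psdSqrt (S.R j)) fun j => -S.T j

/-- The linear map that produces the transmit signal and the receiver noise. -/
def System.sigMap (S : System K) : Matrix (Fin (S.M + 1) ⊕ Ant S.d) S.Idx ℂ :=
  of fun p => Sum.elim 0 (Sum.elim 0 fun q => if p = q then 1 else 0)

lemma SysReg.h_eq (h : SysReg C S) (X : Randomness S P) (ω : Ω) (j : Fin (S.M + 1))
    (a : Ant S.d) : X.h j ω a = X.hTil j ω a + lin S.errMap X.fam ω (j, a) := by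
  have e1 := lin_userMap X (fun j => (1 - S.T j) * psdSqrt (S.R j)) (fun j => -S.T j) ω j
  have e2 : X.hTil j ω = S.T j *ᵥ X.h j ω + S.T j *ᵥ fun a => X.pilotNoise j a ω := by
    rw [Randomness.hTil, h.hHat_eq, mulVec_mulVec, h.V_mul_DT, mulVec_add]
  have e3 := congrFun e1 a
  rw [System.errMap, e3, e2, ← mulVec_mulVec]
  change _ = _ + ((1 - S.T j) *ᵥ X.h j ω + _) a
  rw [sub_mulVec, one_mulVec, neg_mulVec]
  simp only [Pi.add_apply, Pi.sub_apply, Pi.neg_apply]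
  ring

lemma SysReg.cov_errMap (h : SysReg C S) (p q : Fin (S.M + 1) × Ant S.d) :
    covMat S.var S.errMap S.errMap p q = if p.1 = q.1 then ((S.tauSq : ℂ) • S.T p.1) p.2 q.2 else 0 := by
  rw [System.errMap, cov_userMap]
  congr 2
  have hT : (S.T p.1)ᴴ = S.T p.1 := (h.cov p.1).wien_herm
  have h1 : S.R p.1 - S.R p.1 * S.T p.1 = (S.tauSq : ℂ) • S.T p.1 := (h.cov p.1).sub_mul_wien
  rw [conjTranspose_mul, conjTranspose_sub, conjTranspose_one, hT, Matrix.mul_assoc,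
    ← Matrix.mul_assoc (psdSqrt _), psdSqrt_mul_conjTranspose (S.R_psd _), Matrix.mul_sub,
    Matrix.mul_one, h1, conjTranspose_neg, hT, neg_mul_neg, Matrix.sub_mul, Matrix.one_mul,
    Matrix.mul_smul, sub_add_cancel]

lemma SysReg.cov_err_est (h : SysReg C S) : covMat S.var S.errMap S.estMap = 0 := by
  ext p q
  rw [System.errMap, System.estMap, cov_userMap]
  split_ifs with hpq
  · have h1 : S.R p.1 - S.R p.1 * S.T p.1 = (S.tauSq : ℂ) • S.T p.1 := (h.cov p.1).sub_mul_wien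
    have h2 : S.T p.1 * S.R p.1 = S.R p.1 * S.T p.1 := by
      have := congrArg Matrix.conjTranspose (show S.R p.1 * S.T p.1
        = S.R p.1 - (S.tauSq : ℂ) • S.T p.1 by rw [← h1, sub_sub_cancel])
      rw [conjTranspose_mul, conjTranspose_sub, conjTranspose_smul,
        (show (S.T p.1)ᴴ = S.T p.1 from (h.cov p.1).wien_herm), (S.R_psd p.1).isHermitian] at this
      rw [this, star_def, conj_ofReal, ← h1, sub_sub_cancel]
    have : (1 - S.T p.1) * psdSqrt (S.R p.1) * (S.DT p.1 * psdSqrt (S.R p.1))ᴴ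
        + (S.tauSq : ℂ) • (-S.T p.1 * (S.DT p.1)ᴴ) = 0 := by
      rw [conjTranspose_mul, h.DT_herm, Matrix.mul_assoc, ← Matrix.mul_assoc (psdSqrt _),
        psdSqrt_mul_conjTranspose (S.R_psd _), ← Matrix.mul_assoc, Matrix.sub_mul, Matrix.one_mul,
        h2, h1, Matrix.neg_mul, smul_neg, ← Matrix.smul_mul, add_neg_cancel]
    rw [this]
    simp
  · simp

lemma cov_sig_user (A B : Fin (S.M + 1) → S.Mat) :
    covMat S.var S.sigMap (S.userMap A B) = 0 := by
  ext p q
  rw [cov_apply, sum_sum_type, sum_sum_type]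
  simp [System.userMap, System.sigMap]

lemma cov_user_sig (A B : Fin (S.M + 1) → S.Mat) :
    covMat S.var (S.userMap A B) S.sigMap = 0 := by
  ext p q
  rw [cov_apply, sum_sum_type, sum_sum_type]
  simp [System.userMap, System.sigMap]

lemma cov_sig (p q : Fin (S.M + 1) ⊕ Ant S.d) : covMat S.var S.sigMap S.sigMap p q
    = if p = q then ((Sum.elim (fun _ => 1) (fun _ => S.sigSq) p : ℝ) : ℂ) else 0 := by
  rw [cov_apply, sum_sum_type, sum_sum_type]
  simp only [System.sigMap, System.var, of_apply, Sum.elim_inl, Sum.elim_inr, Pi.zero_apply,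
    zero_mul, Finset.sum_const_zero, zero_add]
  rw [sum_eq_single p (fun i _ hi => by rw [if_neg (Ne.symm hi)]; simp) (by simp)]
  by_cases hpq : p = q
  · simp [hpq]
  · simp [hpq, Ne.symm hpq]

/-- Errors, transmit signal and receiver noise. -/
def System.auxMap (S : System K) :
    Matrix ((Fin (S.M + 1) × Ant S.d) ⊕ (Fin (S.M + 1) ⊕ Ant S.d)) S.Idx ℂ :=
  Matrix.fromRows S.errMap S.sigMap

lemma lin_aux_inl (X : Randomness S P) (ω : Ω) (p : Fin (S.M + 1) × Ant S.d) :
    lin S.auxMap X.fam ω (.inl p) = lin S.errMap X.fam ω p := rfl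

lemma lin_aux_inr (X : Randomness S P) (ω : Ω) (p : Fin (S.M + 1) ⊕ Ant S.d) :
    lin S.auxMap X.fam ω (.inr p) = lin S.sigMap X.fam ω p := rfl

lemma lin_sig (X : Randomness S P) (ω : Ω) (p : Fin (S.M + 1) ⊕ Ant S.d) :
    lin S.sigMap X.fam ω p = Sum.elim (fun j => X.x j ω) (fun a => X.noise a ω) p := by
  rw [lin, mulVec, dotProduct, sum_sum_type, sum_sum_type]
  simp only [System.sigMap, of_apply, Sum.elim_inl, Sum.elim_inr, Pi.zero_apply,
    zero_mul, Finset.sum_const_zero, zero_add, ite_mul, one_mul, sum_ite_eq,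
    mem_univ, if_true, Randomness.fam]
  rcases p with p | p <;> rfl

lemma SysReg.cov_aux_est (h : SysReg C S) : covMat S.var S.auxMap S.estMap = 0 := by
  ext p q
  rcases p with p | p
  · exact congrFun (congrFun h.cov_err_est p) q
  · exact congrFun (congrFun (cov_sig_user _ _) p) q

/-- The family of channel estimates. -/
abbrev Randomness.est (X : Randomness S P) (ω : Ω) : S.Est :=
  fun j => X.hHat j ω

lemma SysReg.est_eq (h : SysReg C S) (X : Randomness S P) (ω : Ω) :
    X.est ω = fun j a => lin S.estMap X.fam ω (j, a) :=
  funext fun j => (h.lin_estMap X ω j).symm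

lemma SysReg.measurable_est (h : SysReg C S) (X : Randomness S P) : Measurable X.est := by
  have : X.est = fun ω j a => lin S.estMap X.fam ω (j, a) := funext fun ω => h.est_eq X ω
  rw [this]
  have := X.gaussFam.measurable_lin S.estMap
  exact measurable_pi_lambda _ fun j => measurable_pi_lambda _ fun a =>
    (measurable_pi_apply _).comp this

lemma SysReg.estAlg_le (h : SysReg C S) (X : Randomness S P) : X.estAlg ≤ (inferInstance : MeasurableSpace Ω) :=
  (h.measurable_est X).comap_le

lemma SysReg.indep_aux (h : SysReg C S) (X : Randomness S P) :
    Indep (MeasurableSpace.comap (lin S.auxMap X.fam) inferInstance) X.estAlg P := by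
  have h1 := (X.gaussFam.indepFun h.cov_aux_est).comp measurable_id
    (ψ := fun (u : Fin (S.M + 1) × Ant S.d → ℂ) (j : Fin (S.M + 1)) (a : Ant S.d) => u (j, a))
    (measurable_pi_lambda _ fun j => measurable_pi_lambda _ fun a => measurable_pi_apply _)
  have : (fun (u : Fin (S.M + 1) × Ant S.d → ℂ) (j : Fin (S.M + 1)) (a : Ant S.d) => u (j, a))
      ∘ lin S.estMap X.fam = X.est := funext fun ω => (h.est_eq X ω).symm
  rw [this] at h1
  exact h1

/-- Functions of the estimates are measurable with respect to the estimates. -/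
lemma stronglyMeasurable_comp_est (X : Randomness S P) {f : S.Est → ℂ}
    (hf : Measurable f) : StronglyMeasurable[X.estAlg] fun ω => f (X.est ω) :=
  (hf.comp (comap_measurable X.est)).stronglyMeasurable

lemma measurable_hTil_fun (j : Fin (S.M + 1)) (a : Ant S.d) :
    Measurable fun y : S.Est => (S.V j *ᵥ y j) a :=
  EntryMeas.mulVec (.const (S.V j)) (fun b => (measurable_pi_apply b).comp (measurable_pi_apply j)) a

lemma SysReg.memLp_hTil (h : SysReg C S) (X : Randomness S P) (j : Fin (S.M + 1)) (a : Ant S.d) :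
    MemLp (fun ω => X.hTil j ω a) 2 P := by
  have h1 : ∀ b, MemLp (fun ω => X.hHat j ω b) 2 P := fun b => by
    have := X.gaussFam.memLp_lin S.estMap (j, b)
    have e : (fun ω => lin S.estMap X.fam ω (j, b)) = fun ω => X.hHat j ω b :=
      funext fun ω => congrFun (h.lin_estMap X ω j) b
    rwa [e] at this
  simp only [Randomness.hTil, mulVec, dotProduct]
  exact memLp_finsetSum _ fun b _ => (h1 b).const_mul _

variable {ρ : S.Est → Ant S.d → ℂ} {B : ℝ}

lemma SysReg.condExp_numerator (h : SysReg C S) (X : Randomness S P)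
    (hρ : ∀ a, Measurable fun y => ρ y a) (hB : ∀ y a, ‖ρ y a‖ ≤ B) :
    P[fun ω => star (ρ (X.est ω)) ⬝ᵥ X.h 0 ω | X.estAlg]
      =ᵐ[P] fun ω => star (ρ (X.est ω)) ⬝ᵥ X.hTil 0 ω := by
  have hle := h.estAlg_le X
  have hZ := X.gaussFam.measurable_lin S.auxMap
  have hρs : ∀ a, StronglyMeasurable[X.estAlg] fun ω => star (ρ (X.est ω) a) := fun a =>
    continuous_star.comp_stronglyMeasurable (stronglyMeasurable_comp_est X (hρ a))
  have hb : ∀ a, MemLp (fun ω => star (ρ (X.est ω) a)) ⊤ P := fun a =>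
    memLp_top_of_bound ((hρs a).mono hle).aestronglyMeasurable B
      (.of_forall fun ω => by rw [norm_star]; exact hB _ _)
  set f : Ω → ℂ := fun ω => star (ρ (X.est ω)) ⬝ᵥ X.hTil 0 ω
  have hfm : StronglyMeasurable[X.estAlg] f := by
    refine Finset.stronglyMeasurable_fun_sum _ fun a _ => (hρs a).mul ?_
    exact stronglyMeasurable_comp_est X (measurable_hTil_fun 0 a)
  have hfi : Integrable f P := integrable_finsetSum _ fun a _ =>
    ((h.memLp_hTil X 0 a).integrable (by norm_num)).mul_of_top_right (hb a)
  have key := fun a => condExp_mul_indep hle hZ (h.indep_aux X) (hρs a)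
    ((hb a).integrable le_top) (γ := fun z => z (.inl (0, a))) (measurable_pi_apply _)
    ((X.gaussFam.memLp_lin S.auxMap (.inl (0, a))).integrable (by norm_num))
  set g : Ant S.d → Ω → ℂ := fun a ω =>
    star (ρ (X.est ω) a) * lin S.auxMap X.fam ω (.inl (0, a))
  have e : (fun ω => star (ρ (X.est ω)) ⬝ᵥ X.h 0 ω) = f + ∑ a, g a := by
    funext ω
    rw [Pi.add_apply, Finset.sum_apply]
    simp only [f, g, dotProduct, h.h_eq X, mul_add, sum_add_distrib, lin_aux_inl]
    rfl
  rw [e]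
  have h1 := condExp_add hfi (integrable_finsetSum' Finset.univ fun a _ => (key a).1) X.estAlg
  have h2 := condExp_finsetSum (s := Finset.univ) (fun a _ => (key a).1) X.estAlg
  filter_upwards [h1, h2, ae_all_iff.2 fun a => (key a).2] with ω h1 h2 h3
  rw [h1, Pi.add_apply, condExp_of_stronglyMeasurable hle hfm hfi, h2, Finset.sum_apply]
  simp only [h3, X.gaussFam.integral_lin, mul_zero, Finset.sum_const_zero, add_zero]

/-- The conditional covariance of the interference and noise given the estimates. -/
def Randomness.G0 (X : Randomness S P) (ω : Ω) : S.Mat :=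
  ∑ j : Fin S.M, vecMulVec (X.hTil j.succ ω) (star (X.hTil j.succ ω)) + S.W + S.noiseCov

/-- The error factors of the interference terms. -/
def errFactor (S : System K) :
    Fin (S.M + 1) ⊕ ((Fin (S.M + 1) × Ant S.d) ⊕ Ant S.d) → (Fin (S.M + 1) × Ant S.d → ℂ) → ℂ :=
  Sum.elim (fun _ _ => 1) (Sum.elim (fun p e => e p) fun _ _ => 1)

/-- The signal factors of the interference terms. -/
def sigIndex (S : System K) :
    Fin (S.M + 1) ⊕ ((Fin (S.M + 1) × Ant S.d) ⊕ Ant S.d) → Fin (S.M + 1) ⊕ Ant S.d :=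
  Sum.elim .inl (Sum.elim (fun p => .inl p.1) .inr)

lemma measurable_errFactor (t) : Measurable (errFactor S t) := by
  rcases t with j | p | a
  exacts [measurable_const, measurable_pi_apply _, measurable_const]

lemma memLp_errFactor (X : Randomness S P) (t) :
    MemLp (fun ω => errFactor S t (lin S.errMap X.fam ω)) 2 P := by
  rcases t with j | p | a
  exacts [memLp_const _, X.gaussFam.memLp_lin _ _, memLp_const _]

lemma measurable_mul_star {E : Type*} [MeasurableSpace E] {f g : E → ℂ} (hf : Measurable f)
    (hg : Measurable g) : Measurable fun e => f e * star (g e) :=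
  hf.mul (Complex.continuous_conj.measurable.comp hg)

lemma factor_moments (X : Randomness S P) (t t') :
    Integrable (fun ω => (errFactor S t (lin S.errMap X.fam ω) * lin S.sigMap X.fam ω (sigIndex S t)) *
      star (errFactor S t' (lin S.errMap X.fam ω) * lin S.sigMap X.fam ω (sigIndex S t'))) P ∧
    ∫ ω, (errFactor S t (lin S.errMap X.fam ω) * lin S.sigMap X.fam ω (sigIndex S t)) *
      star (errFactor S t' (lin S.errMap X.fam ω) * lin S.sigMap X.fam ω (sigIndex S t')) ∂P
      = (∫ ω, errFactor S t (lin S.errMap X.fam ω) * star (errFactor S t' (lin S.errMap X.fam ω)) ∂P) *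
        if sigIndex S t = sigIndex S t' then
          ((Sum.elim (fun _ => 1) (fun _ => S.sigSq) (sigIndex S t) : ℝ) : ℂ) else 0 := by
  have e : (fun ω => (errFactor S t (lin S.errMap X.fam ω) * lin S.sigMap X.fam ω (sigIndex S t)) *
      star (errFactor S t' (lin S.errMap X.fam ω) * lin S.sigMap X.fam ω (sigIndex S t')))
      = fun ω => (errFactor S t (lin S.errMap X.fam ω) * star (errFactor S t' (lin S.errMap X.fam ω))) *
        (lin S.sigMap X.fam ω (sigIndex S t) * star (lin S.sigMap X.fam ω (sigIndex S t'))) := by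
    funext ω
    rw [star_mul']
    ring
  have hi := (X.gaussFam.indepFun (L := S.errMap) (cov_user_sig _ _)).comp
    (measurable_mul_star (measurable_errFactor t) (measurable_errFactor (S := S) t'))
    (ψ := fun s => s (sigIndex S t) * star (s (sigIndex S t')))
    (measurable_mul_star (f := fun s : Fin (S.M + 1) ⊕ Ant S.d → ℂ => s (sigIndex S t))
      (g := fun s => s (sigIndex S t')) (measurable_pi_apply _) (measurable_pi_apply _))
  have i1 : Integrable (fun ω => errFactor S t (lin S.errMap X.fam ω)
      * star (errFactor S t' (lin S.errMap X.fam ω))) P :=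
    (memLp_errFactor X t).integrable_mul (memLp_errFactor X t').star
  have i2 : Integrable (fun ω => lin S.sigMap X.fam ω (sigIndex S t)
      * star (lin S.sigMap X.fam ω (sigIndex S t'))) P :=
    (X.gaussFam.memLp_lin _ _).integrable_mul (X.gaussFam.memLp_lin _ _).star
  rw [e]
  refine ⟨hi.integrable_mul i1 i2, ?_⟩
  rw [← cov_sig, ← X.gaussFam.integral_lin_mul_star]
  exact hi.integral_fun_mul_eq_mul_integral i1.1 i2.1

lemma qf_vecMulVec (u w : Ant S.d → ℂ) :
    qf u (vecMulVec w (star w)) u = (star u ⬝ᵥ w) * star (star u ⬝ᵥ w) := by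
  rw [qf, vecMulVec_mulVec, dotProduct_smul, ← star_dotProduct]
  simp

lemma SysReg.condExp_denominator (h : SysReg C S) (X : Randomness S P)
    (hρ : ∀ a, Measurable fun y => ρ y a) (hB : ∀ y a, ‖ρ y a‖ ≤ B) :
    P[fun ω => ‖star (ρ (X.est ω)) ⬝ᵥ (X.Sig ω *ᵥ (fun j => X.x j ω) - X.x 0 ω • X.hTil 0 ω
        + fun a => X.noise a ω)‖ ^ 2 | X.estAlg]
      =ᵐ[P] fun ω => (qf (ρ (X.est ω)) (X.G0 ω) (ρ (X.est ω))).re := by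
  have hle := h.estAlg_le X
  have hZ := X.gaussFam.measurable_lin S.auxMap
  have hρs : ∀ a, StronglyMeasurable[X.estAlg] fun ω => star (ρ (X.est ω) a) := fun a =>
    continuous_star.comp_stronglyMeasurable (stronglyMeasurable_comp_est X (hρ a))
  have hb : ∀ a, MemLp (fun ω => star (ρ (X.est ω) a)) ⊤ P := fun a =>
    memLp_top_of_bound ((hρs a).mono hle).aestronglyMeasurable B
      (.of_forall fun ω => by rw [norm_star]; exact hB _ _)
  set f : Fin (S.M + 1) ⊕ ((Fin (S.M + 1) × Ant S.d) ⊕ Ant S.d) → Ω → ℂ :=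
    Sum.elim (fun j ω => if j = 0 then 0 else star (ρ (X.est ω)) ⬝ᵥ X.hTil j ω)
      (Sum.elim (fun p ω => star (ρ (X.est ω) p.2)) fun a ω => star (ρ (X.est ω) a)) with hf
  have hfm : ∀ t, StronglyMeasurable[X.estAlg] (f t) := by
    rintro (j | p | a)
    · by_cases hj : j = 0
      · simp only [hf, Sum.elim_inl, if_pos hj]
        exact stronglyMeasurable_const
      · simp only [hf, Sum.elim_inl, if_neg hj]
        exact Finset.stronglyMeasurable_fun_sum _ fun a _ =>
          (hρs a).mul (stronglyMeasurable_comp_est X (measurable_hTil_fun j a))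
    exacts [hρs _, hρs _]
  have hf2 : ∀ t, MemLp (f t) 2 P := by
    rintro (j | p | a)
    · by_cases hj : j = 0
      · simp only [hf, Sum.elim_inl, if_pos hj]
        exact memLp_const 0
      · simp only [hf, Sum.elim_inl, if_neg hj, dotProduct]
        exact memLp_finsetSum _ fun a _ => (h.memLp_hTil X j a).mul (hb a)
    exacts [(hb _).mono_exponent le_top, (hb _).mono_exponent le_top]
  set γ : Fin (S.M + 1) ⊕ ((Fin (S.M + 1) × Ant S.d) ⊕ Ant S.d) →
      ((Fin (S.M + 1) × Ant S.d) ⊕ (Fin (S.M + 1) ⊕ Ant S.d) → ℂ) → ℂ :=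
    fun t z => errFactor S t (fun p => z (.inl p)) * z (.inr (sigIndex S t))
  have hγ : ∀ t, Measurable (γ t) := fun t =>
    ((measurable_errFactor t).comp (measurable_pi_lambda _ fun p => measurable_pi_apply _)).mul
      (measurable_pi_apply _)
  have hk := condExp_norm_sq_sum hle hZ (h.indep_aux X) hfm hf2 hγ
    fun t t' => (factor_moments X t t').1
  have e1 : ∀ ω, star (ρ (X.est ω)) ⬝ᵥ (X.Sig ω *ᵥ (fun j => X.x j ω) - X.x 0 ω • X.hTil 0 ω
        + fun a => X.noise a ω) = ∑ t, f t ω * γ t (lin S.auxMap X.fam ω) := fun ω => by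
    have e2 : X.Sig ω *ᵥ (fun j => X.x j ω) = fun a => ∑ j, X.x j ω * (X.hTil j ω a
        + lin S.errMap X.fam ω (j, a)) := by
      funext a
      simp only [mulVec, dotProduct, Randomness.Sig, of_apply, ← h.h_eq X]
      exact sum_congr rfl fun j _ => mul_comm _ _
    have e3 : ∀ p, lin S.auxMap X.fam ω (.inr p) = Sum.elim (fun j => X.x j ω)
      (fun a => X.noise a ω) p := lin_sig X ω
    rw [e2, sum_sum_type, sum_sum_type, sum_prod_type, Fin.sum_univ_succ]
    simp only [hf, γ, errFactor, sigIndex, Sum.elim_inl, Sum.elim_inr, lin_aux_inl, e3, one_mul,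
      if_true, zero_mul, zero_add, Fin.succ_ne_zero, if_false, dotProduct, Pi.add_apply,
      Pi.sub_apply, Pi.smul_apply, smul_eq_mul, Pi.star_apply, mul_add, sum_add_distrib,
      mul_sub, sum_sub_distrib, Finset.mul_sum, Finset.sum_mul]
    have s1 : ∑ a, ∑ j, star (ρ (X.est ω) a) * (X.x j ω * X.hTil j ω a)
        = ∑ a, star (ρ (X.est ω) a) * (X.x 0 ω * X.hTil 0 ω a)
          + ∑ j : Fin S.M, ∑ a, star (ρ (X.est ω) a) * X.hTil j.succ ω a * X.x j.succ ω := by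
      simp_rw [Fin.sum_univ_succ, sum_add_distrib]
      congr 1
      rw [sum_comm]
      exact sum_congr rfl fun j _ => sum_congr rfl fun a _ => by ring
    have s2 : ∑ a, ∑ j, star (ρ (X.est ω) a) * (X.x j ω * lin S.errMap X.fam ω (j, a))
        = ∑ j, ∑ a, star (ρ (X.est ω) a) * (lin S.errMap X.fam ω (j, a) * X.x j ω) := by
      rw [sum_comm]
      exact sum_congr rfl fun j _ => sum_congr rfl fun a _ => by ring
    rw [s1, s2]
    ring
  simp_rw [e1]
  filter_upwards [hk] with ω hω
  rw [hω]
  congr 1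
  simp only [γ, lin_aux_inr]
  change ∑ t, ∑ t', f t ω * star (f t' ω) * ∫ ω', (errFactor S t (lin S.errMap X.fam ω') *
    lin S.sigMap X.fam ω' (sigIndex S t)) * star (errFactor S t' (lin S.errMap X.fam ω') *
    lin S.sigMap X.fam ω' (sigIndex S t')) ∂P = _
  simp_rw [(factor_moments X _ _).2]
  have m1 : ∀ p q, ∫ ω, lin S.errMap X.fam ω p * star (lin S.errMap X.fam ω q) ∂P
      = if p.1 = q.1 then ((S.tauSq : ℂ) • S.T p.1) p.2 q.2 else 0 := fun p q => by
    rw [X.gaussFam.integral_lin_mul_star, h.cov_errMap]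
  have m2 : ∀ p, ∫ ω, star (lin S.errMap X.fam ω p) ∂P = 0 := fun p => by
    have := integral_conj (μ := P) (f := fun ω => lin S.errMap X.fam ω p)
    rw [X.gaussFam.integral_lin, map_zero] at this
    exact this
  have m3 : ∀ p, ∫ ω, lin S.errMap X.fam ω p ∂P = 0 := fun p => X.gaussFam.integral_lin _ p
  simp only [sum_sum_type, errFactor, sigIndex, Sum.elim_inl, Sum.elim_inr, m1, m2, m3, hf,
    one_mul, star_one, mul_one, integral_const, probReal_univ, one_smul, mul_zero, zero_mul,
    Finset.sum_const_zero, add_zero, zero_add, Sum.inl.injEq, Sum.inr.injEq, reduceCtorEq, if_false, star_star]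
  have q1 : ∑ j, ∑ i, (if j = 0 then 0 else star (ρ (X.est ω)) ⬝ᵥ X.hTil j ω) *
      star (if i = 0 then 0 else star (ρ (X.est ω)) ⬝ᵥ X.hTil i ω) * (if j = i then ((1 : ℝ) : ℂ) else 0)
      = ∑ j : Fin S.M, qf (ρ (X.est ω)) (vecMulVec (X.hTil j.succ ω) (star (X.hTil j.succ ω)))
        (ρ (X.est ω)) := by
    simp only [mul_ite, mul_zero, sum_ite_eq, mem_univ, if_true]
    rw [Fin.sum_univ_succ]
    simp [Fin.succ_ne_zero, qf_vecMulVec]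
  have q2 : ∑ p : Fin (S.M + 1) × Ant S.d, ∑ q : Fin (S.M + 1) × Ant S.d,
      star (ρ (X.est ω) p.2) * ρ (X.est ω) q.2 *
        ((if p.1 = q.1 then ((S.tauSq : ℂ) • S.T p.1) p.2 q.2 else 0)
          * (if p.1 = q.1 then ((1 : ℝ) : ℂ) else 0)) = qf (ρ (X.est ω)) S.W (ρ (X.est ω)) := by
    rw [sum_prod_type]
    simp only [sum_prod_type]
    have : ∀ j a, ∑ i, ∑ b, star (ρ (X.est ω) a) * ρ (X.est ω) b *
        ((if j = i then ((S.tauSq : ℂ) • S.T j) a b else 0) * (if j = i then ((1 : ℝ) : ℂ) else 0))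
        = ∑ b, star (ρ (X.est ω) a) * (((S.tauSq : ℂ) • S.T j) a b * ρ (X.est ω) b) := fun j a => by
      rw [sum_eq_single j (fun i _ hi => by simp [Ne.symm hi]) (by simp)]
      refine sum_congr rfl fun b _ => ?_
      simp only [if_true]
      push_cast
      ring
    simp only [this]
    rw [sum_comm, qf, dotProduct]
    refine sum_congr rfl fun a _ => ?_
    rw [mulVec, dotProduct, Finset.mul_sum, sum_comm]
    refine sum_congr rfl fun b _ => ?_
    rw [System.W, Matrix.sum_apply, Finset.sum_mul, Finset.mul_sum]
    rfl
  have q3 : ∑ a, ∑ b, star (ρ (X.est ω) a) * ρ (X.est ω) b * (if a = b then (S.sigSq : ℂ) else 0)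
      = qf (ρ (X.est ω)) S.noiseCov (ρ (X.est ω)) := by
    simp only [mul_ite, mul_zero, sum_ite_eq, mem_univ, if_true]
    rw [qf, System.noiseCov, smul_mulVec, one_mulVec, dotProduct]
    refine sum_congr rfl fun a _ => ?_
    simp only [Pi.star_apply, Pi.smul_apply, smul_eq_mul]
    ring
  rw [q1, q2, q3, Randomness.G0]
  simp only [qf, add_mulVec, sum_mulVec, dotProduct_add, dotProduct_sum]
  ring

end ErrorModel

section Receivers

/-- Receivers of MMSE type are bounded, whatever the estimates are. -/
lemma nrm_mulVec_inv_le {m n : Type} [Fintype m] [DecidableEq m] [Fintype n] [DecidableEq n]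
    {G : Sq m} {D : Matrix m n ℂ} {g : m → ℂ} {s : ℝ}
    (hG : vecMulVec g (star g) + (s : ℂ) • 1 ≤ G) :
    s * nrm (D *ᵥ ((Dᴴ * G * D)⁻¹ *ᵥ (Dᴴ *ᵥ g))) ^ 2 ≤ 1 := by
  by_cases hu : IsUnit (Dᴴ * G * D).det
  · set x := (Dᴴ * G * D)⁻¹ *ᵥ (Dᴴ *ᵥ g) with hx
    have h1 : (Dᴴ * G * D) *ᵥ x = Dᴴ *ᵥ g := by
      rw [hx, mulVec_mulVec, mul_nonsing_inv _ hu, one_mulVec]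
    have h2 : qf (D *ᵥ x) G (D *ᵥ x) = star (D *ᵥ x) ⬝ᵥ g := by
      rw [qf, star_mulVec, ← dotProduct_mulVec, ← dotProduct_mulVec, ← h1]
      simp only [mulVec_mulVec, Matrix.mul_assoc]
    have h3 := re_qf_le_of_le hG (D *ᵥ x)
    rw [qf_add, qf_smul_one, ← norm_qf_sq, h2, Complex.add_re, ofReal_re] at h3
    have h4 := re_le_norm (star (D *ᵥ x) ⬝ᵥ g)
    have h5 : ((s : ℂ) * ((nrm (D *ᵥ x) ^ 2 : ℝ) : ℂ)).re = s * nrm (D *ᵥ x) ^ 2 := by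
      rw [← ofReal_mul, ofReal_re]
    nlinarith [sq_nonneg (‖star (D *ᵥ x) ⬝ᵥ g‖ - 1)]
  · rw [nonsing_inv_apply_not_isUnit _ hu, zero_mulVec, mulVec_zero]
    simp [nrm]

variable {K : ℕ} {S : System K} {Ω : Type*} [MeasurableSpace Ω] {P : Measure Ω}
  [IsProbabilityMeasure P] {C : ℝ}

/-- The local receivers as functions of the estimates. -/
def System.recv (S : System K) (y : S.Est) (k : Fin K) : Fin (S.d k) → ℂ :=
  (∑ j, vecMulVec (restr (y j) k) (star (restr (y j) k)) + (S.d k : ℂ) • S.Z k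
    + ((S.d k : ℂ) * (S.rho k : ℂ)) • 1)⁻¹ *ᵥ restr (y 0) k

/-- The matrix `D_r` as a function of the estimates. -/
def System.drm (S : System K) (y : S.Est) : Matrix (Ant S.d) (Fin K) ℂ :=
  of fun a l => if a.1 = l then S.recv y a.1 a.2 else 0

/-- The covariance `∑_j (V_j y_j) (V_j y_j)ᴴ + W + σ² I`. -/
def System.fullCov (S : System K) (V : Fin (S.M + 1) → S.Mat)
    (W : S.Mat) (y : S.Est) :
    S.Mat :=
  ∑ j, vecMulVec (V j *ᵥ y j) (star (V j *ᵥ y j)) + W + S.noiseCov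

/-- The fusion weights of MMSE type. -/
def System.fus (S : System K) (V : Fin (S.M + 1) → S.Mat)
    (W : S.Mat) (y : S.Est) : Fin K → ℂ :=
  ((S.drm y)ᴴ * S.fullCov V W y * S.drm y)⁻¹ *ᵥ ((S.drm y)ᴴ *ᵥ (V 0 *ᵥ y 0))

lemma Randomness.r_eq (X : Randomness S P) (k : Fin K) (ω : Ω) : X.r k ω = S.recv (X.est ω) k := by
  rw [System.recv, sum_vecMulVec]
  rfl

lemma Randomness.Dr_eq (X : Randomness S P) (ω : Ω) : X.Dr ω = S.drm (X.est ω) := by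
  ext a l
  simp only [Randomness.Dr, System.drm, of_apply, X.r_eq]

lemma Randomness.rAlpha_eq (X : Randomness S P) (β : S.Est → Fin K → ℂ)
    (ω : Ω) : X.rAlpha (fun ω => star (β (X.est ω))) ω
      = S.drm (X.est ω) *ᵥ β (X.est ω) := by
  funext a
  simp only [Randomness.rAlpha, System.drm, mulVec, dotProduct, of_apply, X.r_eq, ite_mul, zero_mul,
    sum_ite_eq, mem_univ, if_true, Pi.star_apply, star_star]
  exact mul_comm _ _

lemma fullCov_herm {V : Fin (S.M + 1) → S.Mat}
    {W : S.Mat} (hW : W.PosSemidef) (y : S.Est) :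
    (S.fullCov V W y)ᴴ = S.fullCov V W y := by
  have h1 : (∑ j, vecMulVec (V j *ᵥ y j) (star (V j *ᵥ y j))).PosSemidef :=
    nonneg_iff_posSemidef.1 (sum_nonneg fun j _ => vecMulVec_nonneg _)
  rw [System.fullCov, System.noiseCov, conjTranspose_add, conjTranspose_add, conjTranspose_smul,
    conjTranspose_one, h1.isHermitian, hW.isHermitian, star_def, conj_ofReal]

lemma le_fullCov {V : Fin (S.M + 1) → S.Mat}
    {W : S.Mat} (hW : W.PosSemidef) (y : S.Est) :
    vecMulVec (V 0 *ᵥ y 0) (star (V 0 *ᵥ y 0)) + (S.sigSq : ℂ) • 1 ≤ S.fullCov V W y := by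
  refine add_le_add_left ?_ _
  refine (single_le_sum (f := fun j => vecMulVec (V j *ᵥ y j) (star (V j *ᵥ y j)))
    (fun j _ => vecMulVec_nonneg _) (mem_univ 0)).trans ?_
  exact le_add_of_nonneg_right (nonneg_iff_posSemidef.2 hW)

lemma star_vecMul_fus {G : S.Mat} (hG : Gᴴ = G)
    (D : Matrix (Ant S.d) (Fin K) ℂ) (g : Ant S.d → ℂ) :
    star (star g ᵥ* (D * (Dᴴ * G * D)⁻¹)) = (Dᴴ * G * D)⁻¹ *ᵥ (Dᴴ *ᵥ g) := by
  rw [star_vecMul, star_star, conjTranspose_mul, conjTranspose_nonsing_inv, conjTranspose_mul,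
    conjTranspose_mul, conjTranspose_conjTranspose, hG, mulVec_mulVec, Matrix.mul_assoc]

lemma SysReg.alphaOpt_eq (h : SysReg C S) (X : Randomness S P) (c : ℂ) :
    X.alphaOpt c = fun ω => star (star c • S.fus S.V S.W (X.est ω)) := by
  funext ω
  have e : X.SigTil ω * (X.SigTil ω)ᴴ + S.W + S.noiseCov = S.fullCov S.V S.W (X.est ω) := by
    rw [System.fullCov, sum_vecMulVec]
    rfl
  rw [Randomness.alphaOpt, e, X.Dr_eq, star_smul, star_star, System.fus,
    ← star_vecMul_fus (fullCov_herm h.W_psd _), star_star]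
  rfl

lemma SysReg.alphaSub_eq (h : SysReg C S) (X : Randomness S P) :
    X.alphaSub = fun ω => star (S.fus (fun _ => 1) S.DW (X.est ω)) := by
  funext ω
  have e : X.SigHat ω * (X.SigHat ω)ᴴ + S.DW + S.noiseCov
      = S.fullCov (fun _ => 1) S.DW (X.est ω) := by
    simp only [System.fullCov, one_mulVec]
    rw [sum_vecMulVec]
    rfl
  rw [Randomness.alphaSub, e, X.Dr_eq, System.fus, ← star_vecMul_fus (fullCov_herm h.DW_psd _),
    star_star, one_mulVec]

lemma nrm_recv_le (y : S.Est) (k : Fin K) :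
    (S.d k * S.rho k) * nrm (S.recv y k) ^ 2 ≤ 1 := by
  have h0 : (0 : ℂ) ≤ (S.d k : ℂ) := by exact_mod_cast Nat.zero_le _
  have := nrm_mulVec_inv_le (D := (1 : Sq (Fin (S.d k))))
    (g := restr (y 0) k) (s := S.d k * S.rho k)
    (G := ∑ j, vecMulVec (restr (y j) k) (star (restr (y j) k)) + (S.d k : ℂ) • S.Z k
      + ((S.d k : ℂ) * (S.rho k : ℂ)) • 1) (by
      push_cast
      refine add_le_add_left ?_ _
      refine (single_le_sum (f := fun j => vecMulVec (restr (y j) k) (star (restr (y j) k)))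
        (fun j _ => vecMulVec_nonneg _) (mem_univ 0)).trans ?_
      exact le_add_of_nonneg_right (nonneg_iff_posSemidef.2 ((S.Z_psd k).smul h0)))
  simpa [System.recv] using this

lemma measurable_drm (S : System K) : EntryMeas fun y => S.drm y := by
  have hy : ∀ j a, Measurable fun y : S.Est => y j a := fun j a => by fun_prop
  intro a l
  simp only [System.drm, of_apply]
  split_ifs
  · exact EntryMeas.mulVec (EntryMeas.inv (((EntryMeas.sum fun j => EntryMeas.vecMulVec
      (fun i => hy j ⟨a.1, i⟩) fun i => hy j ⟨a.1, i⟩).add (.const _)).add (.const _)))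
      (fun i => hy 0 ⟨a.1, i⟩) a.2
  · exact measurable_const

lemma measurable_fus (V : Fin (S.M + 1) → S.Mat)
    (W : S.Mat) (k : Fin K) : Measurable fun y => S.fus V W y k := by
  have hD := measurable_drm S
  have hy : ∀ j a, Measurable fun y : S.Est => (V j *ᵥ y j) a := fun j a =>
    EntryMeas.mulVec (.const (V j)) (fun b => by fun_prop) a
  exact EntryMeas.mulVec (EntryMeas.inv ((hD.conjTranspose.mul
    (((EntryMeas.sum fun j => EntryMeas.vecMulVec (hy j) (hy j)).add (.const _)).add
      (.const _))).mul hD)) (fun l => EntryMeas.mulVec hD.conjTranspose (hy 0) l) k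

/-- The SINR of a fusion rule that is a measurable function of the estimates. -/
lemma SysReg.sinr_eq (h : SysReg C S) (X : Randomness S P)
    {β : S.Est → Fin K → ℂ} (hβ : ∀ k, Measurable fun y => β y k) {B : ℝ}
    (hB : ∀ y a, ‖(S.drm y *ᵥ β y) a‖ ≤ B) : ∀ᵐ ω ∂P,
    X.sinr (fun ω => star (β (X.est ω))) ω =
      ‖star (β (X.est ω)) ⬝ᵥ ((S.drm (X.est ω))ᴴ *ᵥ X.hTil 0 ω)‖ ^ 2 /
        (qf (β (X.est ω)) ((S.drm (X.est ω))ᴴ * X.G0 ω * S.drm (X.est ω)) (β (X.est ω))).re := by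
  have hm : ∀ a, Measurable fun y => (S.drm y *ᵥ β y) a := EntryMeas.mulVec (measurable_drm S) hβ
  filter_upwards [h.condExp_numerator X hm hB, h.condExp_denominator X hm hB] with ω h1 h2
  rw [Randomness.sinr]
  simp only [X.rAlpha_eq]
  rw [h1, h2, star_mulVec, ← dotProduct_mulVec, qf_conjTranspose_mul_mul]

lemma exists_bound_of_sq_le {s r : ℝ} (hs : 0 < s) (h : s * r ^ 2 ≤ 1) : r ≤ 1 + s⁻¹ := by
  have : r ^ 2 ≤ s⁻¹ := by rw [inv_eq_one_div, le_div_iff₀ hs]; linarith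
  nlinarith [sq_nonneg (r - 1), inv_pos.2 hs]

lemma norm_fus_le {V : Fin (S.M + 1) → S.Mat}
    {W : S.Mat} (hW : W.PosSemidef) (c : ℂ)
    (y : S.Est) (a : Ant S.d) :
    ‖(S.drm y *ᵥ (c • S.fus V W y)) a‖ ≤ ‖c‖ * (1 + S.sigSq⁻¹) := by
  rw [mulVec_smul, Pi.smul_apply, norm_smul]
  gcongr
  exact (norm_apply_le_nrm _ a).trans
    (exists_bound_of_sq_le S.sigSq_pos (nrm_mulVec_inv_le (le_fullCov hW y)))

lemma SysReg.norm_const_le (h : SysReg C S) (β : Fin K → ℂ) (y : S.Est)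
    (a : Ant S.d) : ‖(S.drm y *ᵥ β) a‖ ≤ ∑ k, (1 + (S.d k * S.rho k)⁻¹) * ‖β k‖ := by
  have hp : ∀ k, 0 < S.d k * S.rho k := fun k => mul_pos (by exact_mod_cast h.d_pos k) (S.rho_pos k)
  have e : (S.drm y *ᵥ β) a = S.recv y a.1 a.2 * β a.1 := by simp [System.drm, mulVec, dotProduct]
  rw [e, norm_mul]
  refine le_trans ?_ (single_le_sum (f := fun k => (1 + (S.d k * S.rho k)⁻¹) * ‖β k‖)
    (fun k _ => by have := hp k; positivity) (mem_univ a.1))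
  refine mul_le_mul_of_nonneg_right ?_ (norm_nonneg _)
  exact (norm_apply_le_nrm _ _).trans (exists_bound_of_sq_le (hp _) (nrm_recv_le y _))

end Receivers

section FusionAlgebra

variable {m : Type} [Fintype m] [DecidableEq m]

/-- The quotient `|wᴴ p|² / (wᴴ G w)`. -/
def quo (p : m → ℂ) (G : Sq m) (w : m → ℂ) : ℂ :=
  (star w ⬝ᵥ p) * (star p ⬝ᵥ w) / qf w G w

/-- The matrix `(I + diag(t))⁻¹`. -/
def jm (t : m → ℂ) : Sq m := (1 + diagonal t)⁻¹

lemma isUnit_one_add_diagonal {t : m → ℂ} (ht : 0 ≤ t) : IsUnit (1 + diagonal t).det := by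
  rw [← diagonal_one, diagonal_add, det_diagonal, isUnit_iff_ne_zero]
  exact Finset.prod_ne_zero_iff.2 fun k _ => one_add_ne_zero (ht k)

lemma jm_eq {t : m → ℂ} (ht : 0 ≤ t) : jm t = diagonal fun k => (1 + t k)⁻¹ := by
  refine inv_eq_right_inv ?_
  rw [← diagonal_one, diagonal_add, diagonal_mul_diagonal]
  congr 1
  funext k
  exact mul_inv_cancel₀ (one_add_ne_zero (ht k))

lemma jm_herm {t : m → ℂ} (ht : 0 ≤ t) : (jm t)ᴴ = jm t := by
  rw [jm_eq ht, diagonal_conjTranspose]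
  congr 1
  funext k
  rw [Pi.star_apply, star_inv₀, star_add, star_one, star_of_nonneg (ht k)]

lemma star_mulVec_dot {A : Sq m} (hA : Aᴴ = A) (u w : m → ℂ) :
    star (A *ᵥ u) ⬝ᵥ w = star u ⬝ᵥ (A *ᵥ w) := by rw [star_mulVec, hA, dotProduct_mulVec]

lemma qf_mulVec {A : Sq m} (hA : Aᴴ = A) (G : Sq m) (u : m → ℂ) :
    qf (A *ᵥ u) G (A *ᵥ u) = star u ⬝ᵥ ((A * G * A) *ᵥ u) := by
  rw [qf, star_mulVec_dot hA, mulVec_mulVec, mulVec_mulVec, Matrix.mul_assoc]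

lemma quo_mulVec {A : Sq m} (hA : Aᴴ = A) (p : m → ℂ) (G : Sq m) (u : m → ℂ) :
    quo p G (A *ᵥ u) = (star u ⬝ᵥ (A *ᵥ p)) * (star p ⬝ᵥ (A *ᵥ u))
      / (star u ⬝ᵥ ((A * G * A) *ᵥ u)) := by rw [quo, qf_mulVec hA, star_mulVec_dot hA]

lemma quo_smul (p : m → ℂ) (G : Sq m) (w : m → ℂ) {s : ℂ} (hs : s ≠ 0) :
    quo p G (s • w) = quo p G w := by
  have h : star s * s ≠ 0 := mul_ne_zero (star_ne_zero.2 hs) hs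
  simp only [quo, qf, star_smul, smul_dotProduct, mulVec_smul, dotProduct_smul, smul_eq_mul]
  refine Eq.trans ?_ (mul_div_mul_left _ _ h)
  congr 1 <;> ring

lemma quo_inv {G : Sq m} (hG : G.PosDef) (p : m → ℂ) :
    quo p G (G⁻¹ *ᵥ p) = star p ⬝ᵥ (G⁻¹ *ᵥ p) := by
  rw [quo_mulVec hG.inv.isHermitian, Matrix.nonsing_inv_mul _
    ((isUnit_iff_isUnit_det _).1 hG.isUnit), Matrix.one_mul, mul_self_div_self]

lemma ofReal_quo {G : Sq m} (hG : Gᴴ = G) (p w : m → ℂ) :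
    ((‖star w ⬝ᵥ p‖ ^ 2 / (qf w G w).re : ℝ) : ℂ) = quo p G w := by
  have h1 : ((qf w G w).re : ℂ) = qf w G w := by
    refine Complex.conj_eq_iff_re.1 ?_
    have := star_qf w G w
    rwa [hG] at this
  rw [Complex.ofReal_div, h1, norm_qf_sq, qf, vecMulVec_mulVec, quo]
  congr 1
  simp [dotProduct_smul, mul_comm]

lemma inv_add_vecMulVec_mulVec {G : Sq m} (hG : G.PosDef) (p : m → ℂ) :
    (G + vecMulVec p (star p))⁻¹ *ᵥ p = (1 + qf p G⁻¹ p)⁻¹ • (G⁻¹ *ᵥ p) := by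
  have h1 : (0 : ℂ) ≤ qf p G⁻¹ p := hG.inv.posSemidef.dotProduct_mulVec_nonneg p
  have hu := (isUnit_iff_isUnit_det _).1
    (hG.add_posSemidef (posSemidef_vecMulVec_self_star p)).isUnit
  have h2 : (G + vecMulVec p (star p)) *ᵥ (G⁻¹ *ᵥ p) = (1 + qf p G⁻¹ p) • p := by
    rw [add_mulVec, mulVec_mulVec, mul_nonsing_inv _ ((isUnit_iff_isUnit_det _).1 hG.isUnit),
      one_mulVec, vecMulVec_mulVec, add_smul, one_smul]
    congr 1
    ext i
    simp [qf, mul_comm]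
  have h3 := congrArg (fun v => (G + vecMulVec p (star p))⁻¹ *ᵥ v) h2
  simp only [mulVec_mulVec, mulVec_smul] at h3
  rw [← Matrix.mul_assoc, nonsing_inv_mul _ hu, Matrix.one_mul] at h3
  rw [h3, smul_smul, inv_mul_cancel₀ (one_add_ne_zero h1), one_smul]

end FusionAlgebra

section FusionFormulas

variable {K : ℕ} {S : System K} {Ω : Type*} [MeasurableSpace Ω] {P : Measure Ω}
  [IsProbabilityMeasure P] {C : ℝ} {y : S.Est}
  {V : Fin (S.M + 1) → S.Mat} {W : S.Mat}

/-- The resolvent of the interferers in cluster `k`. -/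
def System.rs (S : System K) (y : S.Est) (k : Fin K) :
    Sq (Fin (S.d k)) :=
  resolv (regMat S.Z (fun k => -S.rho k) k) fun j : Fin S.M => restr (y j.succ) k

/-- The forms `N_k⁻¹ y_{0k}ᴴ Q_k [u]_k`. -/
def System.pq (S : System K) (y : S.Est) (u : Ant S.d → ℂ) : Fin K → ℂ :=
  fun k => (S.d k : ℂ)⁻¹ * qf (restr (y 0) k) (S.rs y k) (restr u k)

/-- The covariance of interference and noise. -/
def System.intCov (S : System K) (V : Fin (S.M + 1) → S.Mat)
    (W : S.Mat) (y : S.Est) :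
    S.Mat :=
  ∑ j : Fin S.M, vecMulVec (V j.succ *ᵥ y j.succ) (star (V j.succ *ᵥ y j.succ)) + W + S.noiseCov

/-- The forms `(N_k N_l)⁻¹ y_{0k}ᴴ Q_k X_{kl} Q_l y_{0l}`. -/
def System.gs (S : System K) (y : S.Est) (X : S.Mat) :
    Sq (Fin K) :=
  of fun k l => ((S.d k : ℂ) * (S.d l : ℂ))⁻¹ *
    qf (restr (y 0) k) (S.rs y k * blk X k l * S.rs y l) (restr (y 0) l)

lemma SysReg.rs_posDef (h : SysReg C S) (y : S.Est) (k : Fin K) :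
    (S.rs y k).PosDef := resolv_posDef h.pos (h.Z_ge k) _

lemma SysReg.pq_nonneg (h : SysReg C S) (y : S.Est) : 0 ≤ S.pq y (y 0) :=
  fun k => mul_nonneg (by simp)
    ((h.rs_posDef y k).posSemidef.dotProduct_mulVec_nonneg _)

lemma SysReg.recv_eq (h : SysReg C S) (y : S.Est) (k : Fin K) :
    S.recv y k = ((S.d k : ℂ)⁻¹ * (1 + S.pq y (y 0) k)⁻¹) • (S.rs y k *ᵥ restr (y 0) k) := by
  have hd : (S.d k : ℂ) ≠ 0 := by exact_mod_cast (h.d_pos k).ne'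
  set Y : Fin (S.M + 1) → Fin (S.d k) → ℂ := fun j => restr (y j) k with hY
  set Zr := regMat S.Z (fun k => -S.rho k) k with hZr
  have e1 : ∑ j, vecMulVec (restr (y j) k) (star (restr (y j) k)) + (S.d k : ℂ) • S.Z k
      + ((S.d k : ℂ) * (S.rho k : ℂ)) • 1 = (S.d k : ℂ) • resArg Zr Y := by
    rw [resArg, smul_add, smul_smul, card_fin, mul_inv_cancel₀ hd, one_smul, hZr, regMat]
    push_cast
    rw [neg_neg, smul_add, smul_smul]
    abel
  have e2 : resolv Zr (loo Y 0) = S.rs y k := by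
    rw [System.rs, resolv, resolv, resArg, resArg, Fin.sum_univ_succ]
    have h0 : vecMulVec (loo Y 0 0) (star (loo Y 0 0)) = 0 := by ext; simp [loo, vecMulVec_apply]
    rw [h0, zero_add]
    simp [loo, Function.update_of_ne, Fin.succ_ne_zero, hY]
    rfl
  have e3 := resolv_mulVec h.pos (h.Z_ge k) Y 0
  have e4 : qj Zr Y 0 = S.pq y (y 0) k := by rw [qj, e2, card_fin]; rfl
  have e5 := Matrix.inv_smul' (A := resArg Zr Y) (Units.mk0 _ hd)
    ((isUnit_iff_isUnit_det _).1 (resArg_posDef h.pos (h.Z_ge k) Y).isUnit)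
  rw [System.recv, e1]
  change ((Units.mk0 _ hd) • resArg Zr Y)⁻¹ *ᵥ Y 0 = _
  rw [e5, smul_mulVec, ← resolv, e3, e4, e2, mul_smul]
  rfl

lemma SysReg.drm_apply (h : SysReg C S) (a : Ant S.d) (l : Fin K) :
    S.drm y a l = if a.1 = l then ((S.d a.1 : ℂ)⁻¹ * (1 + S.pq y (y 0) a.1)⁻¹) *
      (S.rs y a.1 *ᵥ restr (y 0) a.1) a.2 else 0 := by
  rw [System.drm, of_apply, h.recv_eq]
  rfl

lemma SysReg.drm_conjTranspose_mulVec (h : SysReg C S) (u : Ant S.d → ℂ) :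
    (S.drm y)ᴴ *ᵥ u = jm (S.pq y (y 0)) *ᵥ S.pq y u := by
  funext k
  have hd : star ((S.d k : ℂ)⁻¹) = (S.d k : ℂ)⁻¹ := by simp
  have hj : star ((1 + S.pq y (y 0) k)⁻¹) = (1 + S.pq y (y 0) k)⁻¹ := by
    rw [star_inv₀, star_add, star_one, star_of_nonneg (h.pq_nonneg y k)]
  rw [jm_eq (h.pq_nonneg y), mulVec_diagonal, mulVec, dotProduct, Fintype.sum_sigma,
    sum_eq_single k (fun i _ hi => Finset.sum_eq_zero fun a _ => by
      rw [conjTranspose_apply, h.drm_apply, if_neg hi, star_zero, zero_mul]) (by simp)]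
  simp only [conjTranspose_apply, h.drm_apply, if_true, star_mul', hd, hj]
  change _ = (1 + S.pq y (y 0) k)⁻¹ * ((S.d k : ℂ)⁻¹ * qf (restr (y 0) k) (S.rs y k) (restr u k))
  rw [qf, ← star_mulVec_dot (h.rs_posDef y k).isHermitian, dotProduct, Finset.mul_sum,
    Finset.mul_sum]
  refine sum_congr rfl fun i _ => ?_
  rw [Pi.star_apply]
  simp only [restr]
  ring

lemma SysReg.drm_conjTranspose_mul (h : SysReg C S) (X : S.Mat) :
    (S.drm y)ᴴ * X * S.drm y = jm (S.pq y (y 0)) * S.gs y X * jm (S.pq y (y 0)) := by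
  ext k l
  have h1 : ((S.drm y)ᴴ * X * S.drm y) k l = ((S.drm y)ᴴ *ᵥ (X *ᵥ fun a => S.drm y a l)) k := by
    rw [mulVec_mulVec, Matrix.mul_apply]
    rfl
  have h2 : restr (X *ᵥ fun a => S.drm y a l) k = ((S.d l : ℂ)⁻¹ * (1 + S.pq y (y 0) l)⁻¹) •
      (blk X k l *ᵥ (S.rs y l *ᵥ restr (y 0) l)) := by
    funext i
    rw [restr, mulVec, dotProduct, Fintype.sum_sigma, sum_eq_single l
      (fun i _ hi => Finset.sum_eq_zero fun a _ => by rw [h.drm_apply, if_neg hi, mul_zero])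
      (by simp)]
    simp only [h.drm_apply, if_true, Pi.smul_apply, smul_eq_mul, mulVec, dotProduct, Finset.mul_sum]
    simp only [blk, submatrix_apply]
    exact sum_congr rfl fun a _ => sum_congr rfl fun b _ => by ring
  have h3 : S.pq y (X *ᵥ fun a => S.drm y a l) k = (S.d k : ℂ)⁻¹ * qf (restr (y 0) k) (S.rs y k)
    (restr (X *ᵥ fun a => S.drm y a l) k) := rfl
  rw [h1, h.drm_conjTranspose_mulVec, jm_eq (h.pq_nonneg y), mulVec_diagonal, mul_diagonal,
    diagonal_mul, h3, h2, System.gs, of_apply]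
  simp only [qf, mulVec_smul, dotProduct_smul, ← mulVec_mulVec, smul_eq_mul, mul_inv, System.pq]
  ring

lemma intCov_herm (hW : W.PosSemidef) : (S.intCov V W y)ᴴ = S.intCov V W y := by
  have h1 : (∑ j : Fin S.M, vecMulVec (V j.succ *ᵥ y j.succ) (star (V j.succ *ᵥ y j.succ))).PosSemidef :=
    nonneg_iff_posSemidef.1 (sum_nonneg fun j _ => vecMulVec_nonneg _)
  rw [System.intCov, System.noiseCov, conjTranspose_add, conjTranspose_add, conjTranspose_smul,
    conjTranspose_one, h1.isHermitian, hW.isHermitian, star_def, conj_ofReal]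

lemma SysReg.gs_herm (h : SysReg C S) {X : S.Mat} (hX : Xᴴ = X) :
    (S.gs y X)ᴴ = S.gs y X := by
  ext k l
  have e : (blk X l k)ᴴ = blk X k l := by rw [blk, conjTranspose_submatrix, hX]; rfl
  simp only [conjTranspose_apply, System.gs, of_apply, star_mul', star_qf, conjTranspose_mul, e,
    (h.rs_posDef y _).isHermitian.eq, star_inv₀, star_natCast, Matrix.mul_assoc]
  rw [mul_comm (S.d l : ℂ)]

lemma SysReg.N_pos (h : SysReg C S) (k₀ : Fin K) : 0 < S.N :=
  (h.d_pos k₀).trans_le (single_le_sum (fun _ _ => Nat.zero_le _) (mem_univ k₀))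

lemma SysReg.scale_div_pos (h : SysReg C S) (k₀ : Fin K) : 0 < S.scale / S.N :=
  div_pos (add_pos_of_nonneg_of_pos (cast_nonneg _) S.sigSq_pos) (by exact_mod_cast h.N_pos k₀)

lemma SysReg.gs_eq (h : SysReg C S) (k₀ : Fin K) (δ : Fin S.M → Fin K → ℝ) :
    S.gs y (S.intCov V W y) = ((S.scale / S.N : ℝ) : ℂ) • (S.net V W δ).gq y := by
  have hN : (S.N : ℝ) ≠ 0 := by exact_mod_cast (h.N_pos k₀).ne'
  have hNet : (S.net V W δ).N = S.N := System.card_ant S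
  have hs : S.scale ≠ 0 := (add_pos_of_nonneg_of_pos (cast_nonneg _) S.sigSq_pos).ne'
  have e : (S.net V W δ).gm y = ((S.scale⁻¹ : ℝ) : ℂ) • S.intCov V W y := by
    change ((S.N / S.scale / (S.net V W δ).N : ℝ) : ℂ) • ∑ j : Fin S.M,
      vecMulVec (V j.succ *ᵥ y j.succ) (star (V j.succ *ᵥ y j.succ))
      + ((S.scale⁻¹ : ℝ) : ℂ) • (W + S.noiseCov) = _
    rw [hNet, show (S.N / S.scale / S.N : ℝ) = S.scale⁻¹ by field_simp, ← smul_add, System.intCov,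
      add_assoc]
  ext k l
  have e2 : (S.net V W δ).gq y k l = (((S.net V W δ).N / (S.d k * S.d l) : ℝ) : ℂ) *
      qf (restr (y 0) k) (S.rs y k * blk (d := S.d) ((S.net V W δ).gm y) k l * S.rs y l)
        (restr (y 0) l) := rfl
  have e3 : blk (((S.scale⁻¹ : ℝ) : ℂ) • S.intCov V W y) k l
      = ((S.scale⁻¹ : ℝ) : ℂ) • blk (S.intCov V W y) k l := rfl
  rw [Matrix.smul_apply, e2, hNet, e, e3, Matrix.mul_smul, Matrix.smul_mul, qf_smul, System.gs, of_apply,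
    smul_eq_mul]
  have hN' : (S.N : ℂ) ≠ 0 := by exact_mod_cast hN
  have hs' : (S.scale : ℂ) ≠ 0 := by exact_mod_cast hs
  push_cast
  field_simp

lemma SysReg.jm_mulVec_fus (h : SysReg C S) (hG : (S.gs y (S.intCov V W y)).PosDef) :
    ∃ s : ℂ, s ≠ 0 ∧ jm (S.pq y (y 0)) *ᵥ S.fus V W y
      = s • ((S.gs y (S.intCov V W y))⁻¹ *ᵥ S.pq y (V 0 *ᵥ y 0)) := by
  set J := jm (S.pq y (y 0)) with hJ
  set p := S.pq y (V 0 *ᵥ y 0)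
  set G := S.gs y (S.intCov V W y) with hGdef
  have h0 : (0 : ℂ) ≤ qf p G⁻¹ p := hG.inv.posSemidef.dotProduct_mulVec_nonneg p
  refine ⟨(1 + qf p G⁻¹ p)⁻¹, inv_ne_zero (one_add_ne_zero h0), ?_⟩
  have hJJ : J * J⁻¹ = 1 := mul_nonsing_inv _ (by
    rw [hJ, jm]
    exact (isUnit_nonsing_inv_det_iff).2 (isUnit_one_add_diagonal (h.pq_nonneg y)))
  have e1 : S.fullCov V W y = S.intCov V W y + vecMulVec (V 0 *ᵥ y 0) (star (V 0 *ᵥ y 0)) := by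
    rw [System.fullCov, System.intCov, Fin.sum_univ_succ]
    abel
  have e2 : (S.drm y)ᴴ * S.fullCov V W y * S.drm y = J * (G + vecMulVec p (star p)) * J := by
    have := mul_vecMulVec_mul_conjTranspose (S.drm y)ᴴ (V 0 *ᵥ y 0)
    have e3 := mul_vecMulVec_mul_conjTranspose J p
    rw [hJ, jm_herm (h.pq_nonneg y)] at e3
    rw [conjTranspose_conjTranspose, h.drm_conjTranspose_mulVec, ← e3] at this
    rw [e1, Matrix.mul_add, Matrix.add_mul, h.drm_conjTranspose_mul, this, Matrix.mul_add,
      Matrix.add_mul]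
  rw [System.fus, e2, h.drm_conjTranspose_mulVec, mulVec_mulVec, mulVec_mulVec,
    Matrix.mul_inv_rev, Matrix.mul_inv_rev, ← inv_add_vecMulVec_mulVec hG]
  congr 1
  rw [← Matrix.mul_assoc, hJJ, Matrix.one_mul, Matrix.mul_assoc, mul_eq_one_comm.1 hJJ,
    Matrix.mul_one]

/-- Every fusion rule has the SINR of its combination of the local forms. -/
lemma SysReg.ofReal_sinr (h : SysReg C S) (X : Randomness S P)
    {β : S.Est → Fin K → ℂ} (hβ : ∀ k, Measurable fun y => β y k) {B : ℝ}
    (hB : ∀ y a, ‖(S.drm y *ᵥ β y) a‖ ≤ B) : ∀ᵐ ω ∂P,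
    (X.sinr (fun ω => star (β (X.est ω))) ω : ℂ) = quo (S.pq (X.est ω) (S.V 0 *ᵥ X.est ω 0))
      (S.gs (X.est ω) (S.intCov S.V S.W (X.est ω)))
      (jm (S.pq (X.est ω) (X.est ω 0)) *ᵥ β (X.est ω)) := by
  filter_upwards [h.sinr_eq X hβ hB] with ω hω
  have hJ := jm_herm (h.pq_nonneg (X.est ω))
  rw [hω, show X.G0 ω = S.intCov S.V S.W (X.est ω) from rfl,
    show X.hTil 0 ω = S.V 0 *ᵥ X.est ω 0 from rfl, h.drm_conjTranspose_mul,
    h.drm_conjTranspose_mulVec, ← star_mulVec_dot hJ, qf, ← qf_mulVec hJ,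
    ofReal_quo (h.gs_herm (intCov_herm h.W_psd))]

end FusionFormulas

end

section Continuity

variable {m : Type} [Fintype m] [DecidableEq m]

/-- The SINR of optimal weights as a function of the local forms. -/
def fOpt (p : m → ℂ) (G : Sq m) : ℂ := star p ⬝ᵥ (G⁻¹ *ᵥ p)

/-- The SINR of suboptimal weights as a function of the local forms. -/
def fSub (p t : m → ℂ) (G I : Sq m) : ℂ :=
  (star t ⬝ᵥ (I⁻¹ *ᵥ p)) * (star p ⬝ᵥ (I⁻¹ *ᵥ t)) / (star t ⬝ᵥ ((I⁻¹ * G * I⁻¹) *ᵥ t))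

lemma inv_smul_of_ne_zero {s : ℂ} (hs : s ≠ 0) (A : Sq m) : (s • A)⁻¹ = s⁻¹ • A⁻¹ := by
  by_cases hA : IsUnit A.det
  · exact Matrix.inv_smul' A (Units.mk0 s hs) hA
  · rw [nonsing_inv_apply_not_isUnit _ hA, smul_zero, nonsing_inv_apply_not_isUnit]
    rw [det_smul]
    exact fun h => hA (isUnit_of_mul_isUnit_right h)

lemma fOpt_smul {s : ℂ} (hs : s ≠ 0) (p : m → ℂ) (G : Sq m) :
    fOpt p (s • G) = s⁻¹ * fOpt p G := by
  rw [fOpt, inv_smul_of_ne_zero hs, smul_mulVec, dotProduct_smul, smul_eq_mul, fOpt]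

lemma fSub_smul {s : ℂ} (hs : s ≠ 0) (p t : m → ℂ) (G I : Sq m) :
    fSub p t (s • G) (s • I) = s⁻¹ * fSub p t G I := by
  simp only [fSub, inv_smul_of_ne_zero hs, smul_mulVec, dotProduct_smul, smul_eq_mul,
    Matrix.smul_mul, Matrix.mul_smul]
  field_simp

lemma quo_smul_left {s : ℂ} (p : m → ℂ) (G : Sq m) (w : m → ℂ) :
    quo p (s • G) w = s⁻¹ * quo p G w := by
  rw [quo, qf_smul, quo, div_eq_mul_inv, mul_inv, div_eq_mul_inv]
  ring

lemma qf_ne_zero {c : ℝ} (hc : 0 < c) {G : Sq m} (hG : ∀ u, c * nrm u ^ 2 ≤ (qf u G u).re)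
    {w : m → ℂ} (hw : w ≠ 0) : qf w G w ≠ 0 := fun h => by
  obtain ⟨i, hi⟩ := Function.ne_iff.1 hw
  have h1 : 0 < nrm w := (norm_pos_iff.2 hi).trans_le (norm_apply_le_nrm w i)
  have h2 := hG w
  rw [h, Complex.zero_re] at h2
  have : 0 < c * nrm w ^ 2 := by positivity
  linarith

lemma isUnit_det_of_coercive {c : ℝ} (hc : 0 < c) {G : Sq m}
    (hG : ∀ u, c * nrm u ^ 2 ≤ (qf u G u).re) : IsUnit G.det := by
  rw [isUnit_iff_ne_zero]
  intro h
  obtain ⟨w, hw, h0⟩ := exists_mulVec_eq_zero_iff.2 h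
  exact qf_ne_zero hc hG hw (by rw [qf, h0, dotProduct_zero])

lemma mulVec_ne_zero {A : Sq m} (hA : IsUnit A.det) {w : m → ℂ} (hw : w ≠ 0) :
    A *ᵥ w ≠ 0 := fun h => hw (by
  have := congrArg (A⁻¹ *ᵥ ·) h
  simpa [mulVec_mulVec, nonsing_inv_mul _ hA] using this)

lemma continuousAt_inv {A : Sq m} (hA : IsUnit A.det) :
    ContinuousAt (fun B : Sq m => B⁻¹) A := by
  simp_rw [Matrix.inv_def, Ring.inverse_eq_inv']
  exact ((Continuous.matrix_det continuous_id).continuousAt.inv₀ hA.ne_zero).smul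
    (Continuous.matrix_adjugate continuous_id).continuousAt

/-- Local forms `p`, `t`, `G`, `I` and weights `a`. -/
abbrev Forms (m : Type) : Type :=
  (m → ℂ) × (m → ℂ) × (m → m → ℂ) × (m → m → ℂ) × (m → ℂ)

/-- A compact set of forms on which the SINRs are continuous. -/
def formSet (m : Type) [Fintype m] (b B c : ℝ) : Set (Forms m) :=
  {x | ‖x‖ ≤ B ∧ (∀ k, b ≤ (x.2.1 k).re ∧ (x.2.1 k).im = 0) ∧
    (∀ u, c * nrm u ^ 2 ≤ (qf u (of x.2.2.1) u).re) ∧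
    (of x.2.2.2.1)ᴴ = of x.2.2.2.1 ∧
    (∀ u, c * nrm u ^ 2 ≤ (qf u (of x.2.2.2.1) u).re) ∧ ‖x.2.2.2.2‖ = 1}

variable {b B c : ℝ}

lemma isCompact_formSet : IsCompact (formSet m b B c) := by
  refine (isCompact_closedBall (0 : Forms m) B).of_isClosed_subset ?_ fun x hx => by
    simpa using hx.1
  refine (isClosed_le continuous_norm continuous_const).inter (IsClosed.inter ?_ (IsClosed.inter ?_
    (IsClosed.inter ?_ (IsClosed.inter ?_ ?_))))
  · have : {x : Forms m | ∀ k, b ≤ (x.2.1 k).re ∧ (x.2.1 k).im = 0}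
        = ⋂ k, {x | b ≤ (x.2.1 k).re} ∩ {x | (x.2.1 k).im = 0} := by ext; simp
    change IsClosed {x : Forms m | ∀ k, b ≤ (x.2.1 k).re ∧ (x.2.1 k).im = 0}
    rw [this]
    exact isClosed_iInter fun k => (isClosed_le (by fun_prop) (by fun_prop)).inter
      (isClosed_eq (by fun_prop) (by fun_prop))
  · change IsClosed {x : Forms m | ∀ u, c * nrm u ^ 2 ≤ (qf u (of x.2.2.1) u).re}
    simp only [Set.ofPred_forall]
    refine isClosed_iInter fun u => isClosed_le (by fun_prop) ?_
    unfold qf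
    fun_prop
  · exact isClosed_eq (by fun_prop) (by fun_prop)
  · change IsClosed {x : Forms m | ∀ u, c * nrm u ^ 2 ≤ (qf u (of x.2.2.2.1) u).re}
    simp only [Set.ofPred_forall]
    refine isClosed_iInter fun u => isClosed_le (by fun_prop) ?_
    unfold qf
    fun_prop
  · exact isClosed_eq (by fun_prop) (by fun_prop)

lemma nonneg_of_mem_formSet (hb : 0 < b) {x : Forms m} (hx : x ∈ formSet m b B c) : 0 ≤ x.2.1 :=
  fun k => Complex.le_def.2 ⟨hb.le.trans (hx.2.1 k).1, (hx.2.1 k).2.symm⟩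

lemma continuousAt_inv_comp {f : Forms m → Sq m} (hf : Continuous f) {x : Forms m}
    (h : IsUnit (f x).det) : ContinuousAt (fun x => (x, (f x)⁻¹)) x :=
  continuousAt_id.prodMk (ContinuousAt.comp (g := fun B : Sq m => B⁻¹) (f := f)
    (continuousAt_inv h) hf.continuousAt)

lemma continuousAt_fOpt (hc : 0 < c) {x : Forms m} (hx : x ∈ formSet m b B c) :
    ContinuousAt (fun x : Forms m => fOpt x.1 (of x.2.2.1)) x := by
  have h1 : ContinuousAt (fun x : Forms m => (x, (of x.2.2.1)⁻¹)) x :=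
    continuousAt_inv_comp (by fun_prop) (isUnit_det_of_coercive hc hx.2.2.1)
  have h2 : Continuous fun z : Forms m × Sq m => star z.1.1 ⬝ᵥ (z.2 *ᵥ z.1.1) := by fun_prop
  exact ContinuousAt.comp (f := fun x : Forms m => (x, (of x.2.2.1)⁻¹)) h2.continuousAt h1

lemma continuousAt_fSub [Nonempty m] (hb : 0 < b) (hc : 0 < c) {x : Forms m}
    (hx : x ∈ formSet m b B c) : ContinuousAt
      (fun x : Forms m => fSub x.1 x.2.1 (of x.2.2.1) (of x.2.2.2.1)) x := by
  have hI := isUnit_det_of_coercive hc hx.2.2.2.2.1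
  have h1 : ContinuousAt (fun x : Forms m => (x, (of x.2.2.2.1)⁻¹)) x :=
    continuousAt_inv_comp (by fun_prop) hI
  have h2 : Continuous fun z : Forms m × Sq m =>
    (star z.1.2.1 ⬝ᵥ (z.2 *ᵥ z.1.1)) * (star z.1.1 ⬝ᵥ (z.2 *ᵥ z.1.2.1)) := by fun_prop
  have h3 : Continuous fun z : Forms m × Sq m =>
    star z.1.2.1 ⬝ᵥ ((z.2 * of z.1.2.2.1 * z.2) *ᵥ z.1.2.1) := by fun_prop
  have ht : x.2.1 ≠ 0 := fun h => by
    have := (hx.2.1 (Classical.arbitrary m)).1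
    rw [h] at this
    exact hb.not_ge this
  refine ContinuousAt.div
    (ContinuousAt.comp (f := fun x : Forms m => (x, (of x.2.2.2.1)⁻¹)) h2.continuousAt h1)
    (ContinuousAt.comp (f := fun x : Forms m => (x, (of x.2.2.2.1)⁻¹)) h3.continuousAt h1) ?_
  rw [← qf_mulVec (by rw [conjTranspose_nonsing_inv, hx.2.2.2.1])]
  exact qf_ne_zero hc hx.2.2.1 (mulVec_ne_zero (isUnit_nonsing_inv_det_iff.2 hI) ht)

lemma continuousAt_quo (hb : 0 < b) (hc : 0 < c) {x : Forms m} (hx : x ∈ formSet m b B c) :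
    ContinuousAt (fun x : Forms m => quo x.1 (of x.2.2.1) (jm x.2.1 *ᵥ x.2.2.2.2)) x := by
  have hJ := isUnit_one_add_diagonal (nonneg_of_mem_formSet hb hx)
  have h1 : ContinuousAt (fun x : Forms m => (x, jm x.2.1)) x :=
    continuousAt_inv_comp (f := fun x : Forms m => 1 + diagonal x.2.1) (by fun_prop) hJ
  have h2 : Continuous fun z : Forms m × Sq m =>
    (star (z.2 *ᵥ z.1.2.2.2.2) ⬝ᵥ z.1.1) * (star z.1.1 ⬝ᵥ (z.2 *ᵥ z.1.2.2.2.2)) := by fun_prop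
  have h3 : Continuous fun z : Forms m × Sq m =>
      qf (z.2 *ᵥ z.1.2.2.2.2) (of z.1.2.2.1) (z.2 *ᵥ z.1.2.2.2.2) := by
    unfold qf
    fun_prop
  refine ContinuousAt.div
    (ContinuousAt.comp (f := fun x : Forms m => (x, jm x.2.1)) h2.continuousAt h1)
    (ContinuousAt.comp (f := fun x : Forms m => (x, jm x.2.1)) h3.continuousAt h1) ?_
  refine qf_ne_zero hc hx.2.2.1 (mulVec_ne_zero (isUnit_nonsing_inv_det_iff.2 hJ) fun h => ?_)
  have := hx.2.2.2.2.2
  rw [h, norm_zero] at this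
  exact zero_ne_one this

/-- A function that is continuous at the points of a compact set has close values at points that
approach each other, one of them in the compact set. -/
lemma tendsto_sub_of_isCompact {E : Type} [NormedAddCommGroup E] {s : Set E} (hs : IsCompact s)
    {f : E → ℂ} (hf : ∀ x ∈ s, ContinuousAt f x) {x z : ℕ → E} (hx : ∀ᶠ n in atTop, x n ∈ s)
    (hxz : Tendsto (fun n => x n - z n) atTop (𝓝 0)) :
    Tendsto (fun n => f (x n) - f (z n)) atTop (𝓝 0) := by
  rw [Metric.tendsto_nhds]
  intro ε hε
  have h1 := hs.uniformContinuousAt_of_continuousAt f hf (Metric.dist_mem_uniformity hε)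
  have h2 : Tendsto (fun n => (x n, z n)) atTop (uniformity E) := by
    rw [tendsto_uniformity_iff_dist_tendsto_zero]
    simpa [dist_eq_norm] using hxz.norm
  filter_upwards [hx, h2 h1] with n h3 h4
  have := h4 h3
  simpa [dist_eq_norm] using this

end Continuity

section

open scoped Matrix.Norms.L2Operator MatrixOrder

section Values

variable {K : ℕ} {S : System K} {Ω : Type*} [MeasurableSpace Ω] {P : Measure Ω}
  [IsProbabilityMeasure P] {C : ℝ}

/-- The forms of the interference covariances. -/
abbrev System.gOpt (S : System K) (y : S.Est) : Sq (Fin K) :=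
  S.gs y (S.intCov S.V S.W y)

/-- The forms of the interference covariances that ignore the correlation between clusters. -/
abbrev System.gSub (S : System K) (y : S.Est) : Sq (Fin K) :=
  S.gs y (S.intCov (fun _ => 1) S.DW y)

lemma SysReg.ae_sinr (h : SysReg C S) (X : Randomness S P) {c : ℂ} (hc : c ≠ 0) (α : Fin K → ℂ) :
    ∀ᵐ ω ∂P, (S.gOpt (X.est ω)).PosDef → (S.gSub (X.est ω)).PosDef →
    (X.sinrLfoc c ω : ℂ) = fOpt (S.pq (X.est ω) (S.V 0 *ᵥ X.est ω 0)) (S.gOpt (X.est ω)) ∧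
    (X.sinrLfsc ω : ℂ) = fSub (S.pq (X.est ω) (S.V 0 *ᵥ X.est ω 0)) (S.pq (X.est ω) (X.est ω 0))
      (S.gOpt (X.est ω)) (S.gSub (X.est ω)) ∧
    (X.sinrLfcc α ω : ℂ) = quo (S.pq (X.est ω) (S.V 0 *ᵥ X.est ω 0)) (S.gOpt (X.est ω))
      (jm (S.pq (X.est ω) (X.est ω 0)) *ᵥ star α) := by
  have h1 := h.ofReal_sinr X (β := fun y => star c • S.fus S.V S.W y)
    (fun k => (measurable_fus S.V S.W k).const_mul _) (norm_fus_le h.W_psd _)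
  have h2 := h.ofReal_sinr X (β := fun y => S.fus (fun _ => 1) S.DW y)
    (fun k => measurable_fus _ _ k) (fun y a => by
      have := norm_fus_le (V := fun _ => 1) h.DW_psd 1 y a
      rwa [one_smul] at this)
  have h3 := h.ofReal_sinr X (β := fun _ => star α) (fun k => measurable_const)
    (h.norm_const_le (star α))
  filter_upwards [h1, h2, h3] with ω h1 h2 h3 hG hI
  refine ⟨?_, ?_, ?_⟩
  · obtain ⟨s, hs, e⟩ := h.jm_mulVec_fus hG
    rw [Randomness.sinrLfoc, h.alphaOpt_eq, h1, mulVec_smul, e, quo_smul _ _ _ (star_ne_zero.2 hc),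
      quo_smul _ _ _ hs, quo_inv hG, fOpt]
  · obtain ⟨s, hs, e⟩ := h.jm_mulVec_fus hI
    rw [Randomness.sinrLfsc, h.alphaSub_eq, h2, e, quo_smul _ _ _ hs,
      quo_mulVec hI.inv.isHermitian, fSub, one_mulVec]
  · rw [star_star] at h3
    exact h3

lemma barLfsc_eq (S : System K) (δ : Fin S.M → Fin K → ℝ) :
    S.barLfsc δ = fSub (S.v δ) (S.v δ) (S.Del δ) (S.DelI δ) := by rw [System.barLfsc, fSub, sq]

lemma barLfcc_eq (S : System K) {δ : Fin S.M → Fin K → ℝ} (hv : 0 ≤ S.v δ) (α : Fin K → ℂ) :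
    S.barLfcc δ α = quo (S.v δ) (S.Del δ) (jm (S.v δ) *ᵥ star α) := by
  have hJ : S.J δ = jm (S.v δ) := rfl
  rw [quo_mulVec (jm_herm hv), star_star, System.barLfcc, hJ]
  congr 1
  have e : star (S.v δ) ⬝ᵥ (jm (S.v δ) *ᵥ star α) = star (α ⬝ᵥ (jm (S.v δ) *ᵥ S.v δ)) := by
    rw [← star_mulVec_dot (jm_herm hv), ← star_dotProduct_star]
  rw [e, star_def, Complex.mul_conj']
  push_cast
  rfl

end Values

end

section

open scoped Matrix.Norms.L2Operator MatrixOrder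

section Regime

lemma algebraMap_eq_smul_one {m : Type} [Fintype m] [DecidableEq m] (c : ℝ) :
    algebraMap ℝ (Sq m) c = (c : ℂ) • 1 := by
  rw [Algebra.algebraMap_eq_smul_one]
  ext i j
  simp

lemma smul_one_le_of_eigenvalues {m : Type} [Fintype m] [DecidableEq m] {A : Sq m}
    (hA : A.IsHermitian) {c : ℝ} (h : ∀ i, c ≤ hA.eigenvalues i) : (c : ℂ) • 1 ≤ A := by
  rw [← algebraMap_eq_smul_one, algebraMap_le_iff_le_spectrum (ha := hA)]
  rw [hA.spectrum_real_eq_range_eigenvalues]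
  rintro _ ⟨i, rfl⟩
  exact h i

lemma le_smul_one_of_eigenvalues {m : Type} [Fintype m] [DecidableEq m] {A : Sq m}
    (hA : A.IsHermitian) {c : ℝ} (h : ∀ i, hA.eigenvalues i ≤ c) : A ≤ (c : ℂ) • 1 := by
  rw [← algebraMap_eq_smul_one, le_algebraMap_iff_spectrum_le (ha := hA)]
  rw [hA.spectrum_real_eq_range_eigenvalues]
  rintro _ ⟨i, rfl⟩
  exact h i

/-- In the asymptotic regime all systems are eventually regular with the same constant. -/
lemma exists_sysReg {K : ℕ} (S : ℕ → System K) (hτ : ∃ C : ℝ, ∀ n, (S n).tauSq ≤ C)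
    (hA1 : AssumptionA1 S) (hA2 : AssumptionA2 S) (hA3 : AssumptionA3 S) :
    ∃ C : ℝ, 1 ≤ C ∧ ∀ᶠ n in atTop, SysReg C (S n) := by
  obtain ⟨Cτ, hτ⟩ := hτ
  obtain ⟨c₁, C₁, hc₁, h1⟩ := hA1
  obtain ⟨c₂, C₂, hc₂, h2⟩ := hA2
  obtain ⟨⟨Cz, hz⟩, ⟨Cr, hr⟩, c₃, hc₃, h3⟩ := hA3
  have i1 := inv_pos.2 hc₁
  have i2 := inv_pos.2 hc₂
  have i3 := inv_pos.2 hc₃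
  have iK : 0 ≤ K * |C₁| * c₁⁻¹ := by positivity
  have a1 := le_abs_self C₁
  have a2 := le_abs_self C₂
  have a3 := le_abs_self Cτ
  have a4 := le_abs_self Cz
  have a5 := le_abs_self Cr
  have b1 := abs_nonneg C₁
  have b2 := abs_nonneg C₂
  have b3 := abs_nonneg Cτ
  have b4 := abs_nonneg Cz
  have b5 := abs_nonneg Cr
  set C := 1 + |C₁| + c₁⁻¹ + |Cτ| + c₂⁻¹ + |C₂| + c₃⁻¹ + |Cz| + |Cr| + K * |C₁| * c₁⁻¹ with hC
  refine ⟨C, by linarith, ?_⟩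
  filter_upwards [h1, h2, hz, hr, h3] with n h1 h2 hz hr h3
  have hC0 : 0 < C := by linarith
  have hinv : ∀ {c : ℝ}, 0 < c → c⁻¹ ≤ C → C⁻¹ ≤ c := fun hc h => by
    have := inv_anti₀ (inv_pos.2 hc) h
    rwa [inv_inv] at this
  have hM : ∀ k : Fin K, 0 < ((S n).M : ℝ) := fun k => by
    rcases Nat.eq_zero_or_pos (S n).M with h | h
    · have := (h1 k).1
      rw [h, Nat.cast_zero, div_zero] at this
      exact absurd this hc₁.not_ge
    · exact_mod_cast h
  have hl : ∀ k, c₁ * (S n).M ≤ (S n).d k := fun k => (le_div_iff₀ (hM k)).1 (h1 k).1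
  have hu : ∀ k, ((S n).d k : ℝ) ≤ |C₁| * (S n).M := fun k =>
    ((div_le_iff₀ (hM k)).1 (h1 k).2).trans (by gcongr)
  have hl' : ∀ k, ((S n).M : ℝ) ≤ c₁⁻¹ * (S n).d k := fun k => by
    rw [inv_mul_eq_div, le_div_iff₀ hc₁, mul_comm]
    exact hl k
  have hZn : ∀ k, (((S n).rho k : ℝ) : ℂ) • 1 + (S n).Z k
      = regMat (S n).Z (fun k => -(S n).rho k) k := fun k => by simp [regMat]
  refine ⟨by linarith, fun k => ?_, fun k => (hl' k).trans (by gcongr; linarith),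
    fun k => (hu k).trans (by gcongr; linarith), fun k => ?_, (hτ n).trans (by linarith),
    fun j => (smul_one_mono (hinv hc₂ (by linarith))).trans
      (smul_one_le_of_eigenvalues _ fun i => (h2 j i).1),
    fun j => (le_smul_one_of_eigenvalues _ fun i => (h2 j i).2).trans (smul_one_mono (by linarith)),
    fun k => ?_, fun k => ?_⟩
  · have : (0 : ℝ) < (S n).d k := (mul_pos hc₁ (hM k)).trans_le (hl k)
    exact_mod_cast this
  · calc ((S n).N : ℝ) = ∑ l, ((S n).d l : ℝ) := by simp [System.N]
      _ ≤ ∑ _l : Fin K, |C₁| * (c₁⁻¹ * (S n).d k) :=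
        sum_le_sum fun l _ => (hu l).trans (by gcongr; exact hl' k)
      _ = K * |C₁| * c₁⁻¹ * (S n).d k := by simp; ring
      _ ≤ C * (S n).d k := by gcongr; linarith
  · have e1 := smul_one_le_of_eigenvalues ((S n).Z_psd k).isHermitian (c := c₃ - (S n).rho k)
      fun i => by linarith [h3 k i]
    have e2 := add_le_add_right e1 ((((S n).rho k : ℝ) : ℂ) • 1)
    rw [hZn, ← add_smul, ← Complex.ofReal_add, add_sub_cancel] at e2
    exact (smul_one_mono (hinv hc₃ (by linarith))).trans e2
  · rw [← hZn]
    have e1 := (le_norm_smul_one ((S n).Z_psd k).isHermitian).trans (smul_one_mono (hz k))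
    refine (add_le_add_right e1 _).trans ?_
    rw [← add_smul, ← Complex.ofReal_add]
    exact smul_one_mono (by linarith [hr k])

end Regime

section Limits

variable {K : ℕ} {S : System K} {C : ℝ}

lemma posDef_of_coercive {m : Type} [Fintype m] [DecidableEq m] {c : ℝ} (hc : 0 < c)
    {G : Sq m} (hG : Gᴴ = G) (h : ∀ u, c * nrm u ^ 2 ≤ (qf u G u).re) : G.PosDef := by
  refine posDef_of_smul_one_le hc (le_of_forall_re_qf (by simp [IsHermitian]) hG fun u => ?_)
  rw [qf_smul_one, ← ofReal_mul, ofReal_re]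
  exact h u

/-- The random forms are close to their deterministic approximations. -/
lemma forms_near (K : ℕ) (hC : 1 ≤ C) : ∃ D c : ℝ, 0 < D ∧ 0 < c ∧ ∀ {S : System K} (_ : SysReg C S)
    (_ : Fin K) {V : Fin (S.M + 1) → S.Mat} {W : S.Mat}
    (_ : NetChoice C S V W) {δ : Fin S.M → Fin K → ℝ} (_ : S.IsDelta δ) {x : ℝ}
    {y : S.Est}, 1 ≤ x → x ^ 8 = S.N → (S.net V W δ).Conc (x ^ 2) y →
    D * x⁻¹ ≤ c → (∀ k, ‖S.pq y (V 0 *ᵥ y 0) k - S.v δ k‖ ≤ D * x⁻¹) ∧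
      (∀ k, ‖S.pq y (y 0) k - S.v δ k‖ ≤ D * x⁻¹) ∧
      (∀ k l, ‖((S.net V W δ).gq y - (S.net V W δ).dlt) k l‖ ≤ D * x⁻¹) ∧
      (∀ k l, ‖(S.net V W δ).dlt k l‖ ≤ D) ∧
      (∀ k, ∃ r : ℝ, S.v δ k = r ∧ Net.low (8 * C ^ 6) ≤ r ∧ r ≤ D) ∧
      ∀ u, c * nrm u ^ 2 ≤ (qf u ((S.net V W δ).gq y) u).re := by
  have hC8 : 1 ≤ 8 * C ^ 6 := by linarith [one_le_pow₀ hC (n := 6)]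
  obtain ⟨D₁, hD₁, h₁⟩ := Net.vv_near K hC8
  obtain ⟨D₂, c, hD₂, hc, h₂⟩ := Net.dlt_near K hC8
  have hKD : 0 ≤ K * D₂ := by positivity
  set D := D₁ + D₂ + K * D₂ + (8 * C ^ 6) ^ 2 with hD
  refine ⟨D, c / 2, by positivity, by positivity,
    fun {S} h k₀ {V W} hVW {δ} hδ {x y} hx hxN hconc hs => ?_⟩
  have hx0 : 0 < x := by linarith
  have hxi : 0 < x⁻¹ := inv_pos.2 hx0
  have hCC : 0 ≤ (8 * C ^ 6) ^ 2 := by positivity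
  have hN : (S.net V W δ).N = S.N := System.card_ant S
  have H : (S.net V W δ).Good (8 * C ^ 6) (x ^ 2) x⁻¹ y :=
    ⟨h.netReg hVW k₀ hδ, hconc, one_le_pow₀ hx, by rw [hN, ← hxN]; field_simp; rfl, hxi,
      inv_le_one_of_one_le₀ hx⟩
  have m1 : D₁ * x⁻¹ ≤ D * x⁻¹ := by gcongr; linarith
  have m2 : D₂ * x⁻¹ ≤ D * x⁻¹ := by gcongr; linarith
  have mK : K * (D₂ * x⁻¹) ≤ D * x⁻¹ := by rw [← mul_assoc]; gcongr; linarith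
  obtain ⟨g1, g2, g3⟩ := h₂ H (by linarith)
  refine ⟨fun k => ?_, fun k => ?_, fun k l => (g1 k l).trans m2,
    fun k l => (g2 k l).trans (by linarith), fun k => ?_, fun u => ?_⟩
  · have := h₁ H k ⟨[(5, k, 0)], le_rfl, fun y => Net.word_V _ y k 0⟩ (H.reg.norm_V 0) (H.reg.V_blk 0 k)
    rw [h.vv_eq] at this
    exact this.trans m1
  · have : ‖(S.d k : ℂ)⁻¹ * qf (restr (y 0) k) (S.rs y k)
        (restr ((1 : S.Mat) *ᵥ y 0) k) - (S.net V W δ).vv k‖ ≤ D₁ * x⁻¹ :=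
      h₁ H k (O := (1 : Sq (Ant (S.net V W δ).d)))
        ⟨[], zero_le_one, fun y => rfl⟩ H.norm_one (congrArg (fun A => blk A k k) (Matrix.one_mul _))
    rw [h.vv_eq, one_mulVec] at this
    exact this.trans m1
  · obtain ⟨r, e1, e2, e3⟩ := Net.vv_ofReal H.reg k
    rw [h.vv_eq] at e1
    exact ⟨r, e1, e2, by linarith⟩
  · have f2 := norm_qf_sub_le g1 (by positivity) u
    rw [card_fin] at f2
    have f3 := re_le_norm (-(qf u ((S.net V W δ).gq y) u - qf u (S.net V W δ).dlt u))
    rw [norm_neg, Complex.neg_re, Complex.sub_re] at f3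
    have f4 : K * (D₂ * x⁻¹) * nrm u ^ 2 ≤ c / 2 * nrm u ^ 2 := by
      gcongr
      linarith
    linarith [g3 u]

lemma SysReg.gq_herm (h : SysReg C S) (k₀ : Fin K)
    {V : Fin (S.M + 1) → S.Mat} {W : S.Mat}
    (hVW : NetChoice C S V W) (δ : Fin S.M → Fin K → ℝ) (y : S.Est) :
    ((S.net V W δ).gq y)ᴴ = (S.net V W δ).gq y := by
  have h1 := h.gs_herm (y := y) (intCov_herm (V := V) (y := y) hVW.W_psd)
  rw [h.gs_eq k₀ δ, conjTranspose_smul, star_def, conj_ofReal] at h1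
  exact smul_right_injective _ (by exact_mod_cast (h.scale_div_pos k₀).ne') h1

end Limits

end

section Convergence

variable {K : ℕ}

lemma norm_forms_le {x : Forms (Fin K)} {r : ℝ} (hr : 0 ≤ r) (h1 : ∀ k, ‖x.1 k‖ ≤ r)
    (h2 : ∀ k, ‖x.2.1 k‖ ≤ r) (h3 : ∀ k l, ‖x.2.2.1 k l‖ ≤ r) (h4 : ∀ k l, ‖x.2.2.2.1 k l‖ ≤ r)
    (h5 : ‖x.2.2.2.2‖ ≤ r) : ‖x‖ ≤ r := by
  refine norm_prod_le_iff.2 ⟨(pi_norm_le_iff_of_nonneg hr).2 h1, norm_prod_le_iff.2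
    ⟨(pi_norm_le_iff_of_nonneg hr).2 h2, norm_prod_le_iff.2 ⟨?_, norm_prod_le_iff.2 ⟨?_, h5⟩⟩⟩⟩
  · exact (pi_norm_le_iff_of_nonneg hr).2 fun k => (pi_norm_le_iff_of_nonneg hr).2 (h3 k)
  · exact (pi_norm_le_iff_of_nonneg hr).2 fun k => (pi_norm_le_iff_of_nonneg hr).2 (h4 k)

/-- Convergence of the SINRs in a uniformly regular regime. -/
lemma ae_tendsto_sinr (hK : 0 < K) {Ω : Type*} [MeasurableSpace Ω] {P : Measure Ω}
    [IsProbabilityMeasure P] {S : ℕ → System K} (X : (n : ℕ) → Randomness (S n) P)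
    (hN : StrictMono fun n => (S n).N) {C : ℝ} (hC : 1 ≤ C) (hS : ∀ᶠ n in atTop, SysReg C (S n))
    {c : ℕ → ℂ} (hc : ∀ n, c n ≠ 0) {α : ℕ → Fin K → ℂ} (hα : ∀ n, α n ≠ 0)
    {δ : (n : ℕ) → Fin (S n).M → Fin K → ℝ} (hδ : ∀ᶠ n in atTop, (S n).IsDelta (δ n)) :
    ∀ᵐ ω ∂P,
      Tendsto (fun n => ((X n).sinrLfoc (c n) ω : ℂ) - (S n).barLfoc (δ n)) atTop (𝓝 0) ∧
      Tendsto (fun n => ((X n).sinrLfsc ω : ℂ) - (S n).barLfsc (δ n)) atTop (𝓝 0) ∧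
      Tendsto (fun n => ((X n).sinrLfcc (α n) ω : ℂ) - (S n).barLfcc (δ n) (α n)) atTop (𝓝 0) := by
  set k₀ : Fin K := ⟨0, hK⟩
  have : Nonempty (Fin K) := ⟨k₀⟩
  obtain ⟨D, e, hD, he, hnear⟩ := forms_near K hC
  have hC8 : 1 ≤ 8 * C ^ 6 := by linarith [one_le_pow₀ hC (n := 6)]
  set b := Net.low (8 * C ^ 6) / 2 with hb
  have hb0 : 0 < b := half_pos (Net.low_pos hC8)
  set q : ℕ → ℝ := fun n => ((S n).N : ℝ) ^ (1 / 8 : ℝ) with hq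
  have hqt : Tendsto q atTop atTop := (tendsto_rpow_atTop (by norm_num)).comp
    (tendsto_natCast_atTop_atTop.comp hN.tendsto_atTop)
  have hqi : Tendsto (fun n => D * (q n)⁻¹) atTop (𝓝 0) := by
    simpa using hqt.inv_tendsto_atTop.const_mul D
  have hval : ∀ᵐ ω ∂P, ∀ n, SysReg C (S n) → _ := ae_all_iff.2 fun n => by
    by_cases h : SysReg C (S n)
    · filter_upwards [h.ae_sinr (X n) (hc n) (α n)] with ω hω _ using hω
    · exact .of_forall fun ω h' => absurd h' h
  filter_upwards [hval, ae_eventually_conc k₀ X hN hC hS (fun n => (S n).V) (fun n => (S n).W) δ,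
    ae_eventually_conc k₀ X hN hC hS (fun n _ => 1) (fun n => (S n).DW) δ] with ω hval hc0 hc1
  set G : ℕ → Sq (Fin K) := fun n => ((S n).net (S n).V (S n).W (δ n)).gq ((X n).est ω)
  set I : ℕ → Sq (Fin K) := fun n =>
    ((S n).net (fun _ => 1) (S n).DW (δ n)).gq ((X n).est ω)
  set G' : ℕ → Sq (Fin K) := fun n => ((S n).net (S n).V (S n).W (δ n)).dlt
  set I' : ℕ → Sq (Fin K) := fun n => ((S n).net (fun _ => 1) (S n).DW (δ n)).dlt
  set p : ℕ → Fin K → ℂ := fun n => (S n).pq ((X n).est ω) ((S n).V 0 *ᵥ (X n).est ω 0)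
  set t : ℕ → Fin K → ℂ := fun n => (S n).pq ((X n).est ω) ((X n).est ω 0)
  set v : ℕ → Fin K → ℂ := fun n => (S n).v (δ n)
  set s : ℕ → ℂ := fun n => ((((S n).scale / (S n).N : ℝ) : ℂ))
  set a : ℕ → Fin K → ℂ := fun n => ((‖α n‖⁻¹ : ℝ) : ℂ) • star (α n)
  set x : ℕ → Forms (Fin K) := fun n => (p n, t n, G n, I n, a n) with hx
  set z : ℕ → Forms (Fin K) := fun n => (v n, v n, G' n, I' n, a n) with hz
  have ha : ∀ n, ((‖α n‖⁻¹ : ℝ) : ℂ) ≠ 0 := fun n => by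
    exact_mod_cast inv_ne_zero (norm_ne_zero_iff.2 (hα n))
  have ha1 : ∀ n, ‖a n‖ = 1 := fun n => by
    rw [norm_smul, norm_real, norm_inv, norm_norm, norm_star,
      inv_mul_cancel₀ (norm_ne_zero_iff.2 (hα n))]
  have main : ∀ᶠ n in atTop, SysReg C (S n) ∧ (S n).IsDelta (δ n) ∧ 0 ≤ v n ∧
      x n ∈ formSet (Fin K) b (2 * D + 1) e ∧ ‖x n - z n‖ ≤ D * (q n)⁻¹ := by
    filter_upwards [hS, hδ, hc0, hc1, hqt.eventually_ge_atTop 1,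
      hqi.eventually_le_const he, hqi.eventually_le_const hb0,
      hqi.eventually_le_const hD] with n h hδ hc0 hc1 hq1 hqe hqb hqD
    have hq8 : q n ^ 8 = (S n).N := by
      rw [hq, ← Real.rpow_natCast, ← Real.rpow_mul (cast_nonneg _)]
      norm_num
    obtain ⟨n1, n2, n3, n4, n5, n6⟩ := hnear h k₀ h.choice hδ hq1 hq8 hc0 hqe
    obtain ⟨-, -, m3, m4, -, m6⟩ := hnear h k₀ h.choiceOne hδ hq1 hq8 hc1 hqe
    have hq0 : 0 ≤ D * (q n)⁻¹ := by positivity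
    have hlow : 0 < Net.low (8 * C ^ 6) := Net.low_pos hC8
    have hv : 0 ≤ v n := fun k => by
      obtain ⟨r, hr, hr1, -⟩ := n5 k
      change 0 ≤ (S n).v (δ n) k
      rw [hr]
      exact_mod_cast hlow.le.trans hr1
    have hxz : ‖x n - z n‖ ≤ D * (q n)⁻¹ := norm_forms_le hq0 n1 n2 n3 m3 (by simpa [hx, hz] using hq0)
    have hzn : ‖z n‖ ≤ D + 1 := by
      have hvD : ∀ k, ‖v n k‖ ≤ D + 1 := fun k => by
        obtain ⟨r, hr, hr1, hr2⟩ := n5 k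
        change ‖(S n).v (δ n) k‖ ≤ _
        rw [hr, norm_real, norm_of_nonneg (hlow.le.trans hr1)]
        linarith
      exact norm_forms_le (by linarith) hvD hvD (fun k l => (n4 k l).trans (by linarith))
        (fun k l => (m4 k l).trans (by linarith)) (by simp only [hz, ha1]; linarith)
    refine ⟨h, hδ, hv, ⟨?_, fun k => ?_, n6, h.gq_herm k₀ h.choiceOne _ _, m6, ha1 n⟩, hxz⟩
    · have := norm_add_le (x n - z n) (z n)
      rw [sub_add_cancel] at this
      change ‖x n‖ ≤ 2 * D + 1
      linarith
    · obtain ⟨r, hr, hr1, -⟩ := n5 k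
      have h1 := n2 k
      rw [hr] at h1
      have h2 := (Complex.abs_re_le_norm _).trans (h1.trans hqb)
      rw [Complex.sub_re, ofReal_re] at h2
      have h3 : -b ≤ ((S n).pq ((X n).est ω) ((X n).est ω 0) k).re - r := neg_le_of_abs_le h2
      have h4 : b ≤ ((S n).pq ((X n).est ω) ((X n).est ω 0) k).re := by linarith
      exact ⟨h4, (Complex.le_def.1 (h.pq_nonneg _ k)).2.symm⟩
  have hmem : ∀ᶠ n in atTop, x n ∈ formSet (Fin K) b (2 * D + 1) e := main.mono fun n h => h.2.2.2.1
  have hdiff : Tendsto (fun n => x n - z n) atTop (𝓝 0) :=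
    squeeze_zero_norm' (main.mono fun n h => h.2.2.2.2) hqi
  have lim : ∀ {F : Forms (Fin K) → ℂ} {f : ℕ → ℂ},
      (∀ x ∈ formSet (Fin K) b (2 * D + 1) e, ContinuousAt F x) →
      (∀ᶠ n in atTop, f n = (s n)⁻¹ * (F (x n) - F (z n))) → Tendsto f atTop (𝓝 0) :=
    fun {F f} hF hf => by
      refine squeeze_zero_norm' ?_ (tendsto_zero_iff_norm_tendsto_zero.1
        (tendsto_sub_of_isCompact isCompact_formSet hF hmem hdiff))
      filter_upwards [hf, hS] with n hf h
      have hNpos : (0 : ℝ) < (S n).N := by exact_mod_cast h.N_pos k₀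
      have h1 : 1 ≤ (S n).scale / (S n).N := by
        rw [le_div_iff₀ hNpos, System.scale]
        linarith [(S n).sigSq_pos]
      rw [hf, norm_mul, norm_inv, norm_real, norm_of_nonneg (by linarith)]
      exact mul_le_of_le_one_left (norm_nonneg _) (inv_le_one_of_one_le₀ h1)
  have values : ∀ᶠ n in atTop, s n ≠ 0 ∧ 0 ≤ v n ∧ (S n).Del (δ n) = s n • G' n ∧
      (S n).DelI (δ n) = s n • I' n ∧
      ((X n).sinrLfoc (c n) ω : ℂ) = fOpt (p n) (s n • G n) ∧
      ((X n).sinrLfsc ω : ℂ) = fSub (p n) (t n) (s n • G n) (s n • I n) ∧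
      ((X n).sinrLfcc (α n) ω : ℂ) = quo (p n) (s n • G n) (jm (t n) *ᵥ star (α n)) := by
    filter_upwards [main] with n ⟨h, hδ, hv, hxm, hxz⟩
    have hs := h.scale_div_pos k₀
    have hs' : ((0 : ℝ) : ℂ) < s n := Complex.real_lt_real.2 hs
    rw [Complex.ofReal_zero] at hs'
    have hG : (S n).gOpt ((X n).est ω) = s n • G n := h.gs_eq k₀ _
    have hI : (S n).gSub ((X n).est ω) = s n • I n := h.gs_eq k₀ _
    have hGp : (G n).PosDef := posDef_of_coercive he (h.gq_herm k₀ h.choice _ _) hxm.2.2.1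
    have hIp : (I n).PosDef := posDef_of_coercive he (h.gq_herm k₀ h.choiceOne _ _) hxm.2.2.2.2.1
    have := hval n h (by rw [hG]; exact hGp.smul hs') (by rw [hI]; exact hIp.smul hs')
    rw [hG, hI] at this
    exact ⟨hs'.ne', hv, h.Del_eq hδ, h.DelI_eq hδ, this⟩
  refine ⟨lim (fun x hx => continuousAt_fOpt he hx) ?_, lim (fun x hx => continuousAt_fSub hb0 he hx) ?_,
    lim (fun x hx => continuousAt_quo hb0 he hx) ?_⟩
  · filter_upwards [values] with n ⟨hs, hv, hD, hI, v1, v2, v3⟩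
    have e1 : (S n).barLfoc (δ n) = fOpt (v n) ((S n).Del (δ n)) := rfl
    rw [v1, e1, hD, fOpt_smul hs, fOpt_smul hs, mul_sub]
    rfl
  · filter_upwards [values] with n ⟨hs, hv, hD, hI, v1, v2, v3⟩
    rw [v2, barLfsc_eq, hD, hI, fSub_smul hs, fSub_smul hs, mul_sub]
    rfl
  · filter_upwards [values] with n ⟨hs, hv, hD, hI, v1, v2, v3⟩
    rw [v3, barLfcc_eq _ hv, hD, quo_smul_left, quo_smul_left, ← mul_sub]
    change _ = (s n)⁻¹ * (quo (p n) (G n) (jm (t n) *ᵥ a n) - quo (v n) (G' n) (jm (v n) *ᵥ a n))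
    simp only [a, mulVec_smul]
    rw [quo_smul _ _ _ (ha n), quo_smul _ _ _ (ha n)]

end Convergence

end DBP

end

theorem theorem1 {K : ℕ} (hK : 0 < K)
    {Ω : Type*} [MeasurableSpace Ω] (P : Measure Ω) [IsProbabilityMeasure P]
    (S : ℕ → DBP.System K)
    (X : (n : ℕ) → DBP.Randomness (S n) P)
    (hN : StrictMono fun n => (S n).N)
    (hτ : ∃ C : ℝ, ∀ n, (S n).tauSq ≤ C)
    (hA1 : DBP.AssumptionA1 S) (hA2 : DBP.AssumptionA2 S) (hA3 : DBP.AssumptionA3 S)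
    (c : ℕ → ℂ) (hc : ∀ n, c n ≠ 0)
    (α : ℕ → Fin K → ℂ) (hα : ∀ n, α n ≠ 0) :
    (∀ᶠ n in atTop, ∃! δ : Fin (S n).M → Fin K → ℝ, (S n).IsDelta δ) ∧
    ∀ δ : (n : ℕ) → Fin (S n).M → Fin K → ℝ, (∀ᶠ n in atTop, (S n).IsDelta (δ n)) →
      (∀ᵐ ω ∂P, Tendsto
        (fun n => ((X n).sinrLfoc (c n) ω : ℂ) - (S n).barLfoc (δ n)) atTop (𝓝 0)) ∧
      (∀ᵐ ω ∂P, Tendsto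
        (fun n => ((X n).sinrLfsc ω : ℂ) - (S n).barLfsc (δ n)) atTop (𝓝 0)) ∧
      (∀ᵐ ω ∂P, Tendsto
        (fun n => ((X n).sinrLfcc (α n) ω : ℂ) - (S n).barLfcc (δ n) (α n)) atTop (𝓝 0)) := by
  obtain ⟨C, hC, hS⟩ := DBP.exists_sysReg S hτ hA1 hA2 hA3
  refine ⟨hS.mono fun n h => h.existsUnique_delta, fun δ hδ => ?_⟩
  have h := DBP.ae_tendsto_sinr hK X hN hC hS hc hα hδ
  exact ⟨h.mono fun ω h => h.1, h.mono fun ω h => h.2.1, h.mono fun ω h => h.2.2⟩
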